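/- Let $\mathbb{C}^*=\mathbb{C}\setminus\{0\}$. For $\lambda\in(0,1)$ put $B_\lambda=\{z\in\mathbb{C} : |z|\le 2(1-\lambda)^{-1}\}$, $B_\lambda^*=B_\lambda\setminus\{0\}$ and $b_\lambda=2(1-\lambda)^{-1}-1-\lambda$. Let $\mathscr{T}_\lambda$ be the space of homeomorphisms $\tau:B_\lambda^*\to\mathbb{R}/\mathbb{Z}\times(1-\lambda,b_\lambda]$ that extend to a $C^1$ diffeomorphism onto its image defined on a neighborhood of $B_\lambda^*$ in $\mathbb{C}^*$, with the weak $C^1$ topology (uniform $C^1$ convergence on compact subsets of $B_\lambda^*$). Let $\mathscr{G}_\lambda$ be the space of maps $g:\mathbb{R}/\mathbb{Z}\times[1-\lambda,b_\lambda]\to B_\lambda$ that extend to a $C^1$ local diffeomorphism on a neighborhood in $\mathbb{R}/\mathbb{Z}\times\mathbb{R}$, with the strong (uniform) $C^1$ topology. Let $\mathscr{F}_\lambda$ be the set of maps $F=g\circ\tau:B_\lambda^*\to B_\lambda$ with $\tau\in\mathscr{T}_\lambda$ and $g\in\mathscr{G}_\lambda$, with the largest topology for which $(\tau,g)\mapsto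 g\circ\tau$ is continuous. It contains $$F_\lambda(z)=(1-\lambda+\lambda|z|)\,(z/|z|)^2+1 .$$ For $F\in\mathscr{F}_\lambda$ and $S\subset B_\lambda$ put $F(S)=F(S\setminus\{0\})$, and let $\Omega_F=\bigcap_{m\ge1}F^m(B_\lambda)$ be the maximal invariant set. The point $p_\lambda=1+(1-\lambda)^{-1}$ is a saddle fixed point of $F_\lambda$; for $F$ close to $F_\lambda$ let $p_F$ be its continuation: the saddle fixed point of $F$ that depends continuously on $F$, equals $p_\lambda$ for $F=F_\lambda$, and is the only fixed point of $F$ in a neighborhood of $p_\lambda$ independent of $F$. Its unstable manifold $W^u(p_F)$ is the set of points having an infinite backward orbit under $F$ that converges to $p_F$; an arc of $W^u(p_F)$, as an immersed curve, is one along which such backward orbits can be chosen continuously. The external (internal) boundary of a bounded set $S\subset\mathbb{C}$ is the boundary of the union of the unbounded (bounded) connected components of $\mathbb{C}\setminus S$. **Proposition.** There is $\lambda_0\in(0,1)$ such that for every $\lambda\in(\lambda_0,1)$ there is an open neighborhood $\mathscr{N}$ of $F_\lambda$ in $\mathscr{F}_\lambda$ on which the continuation $p_F$ is defined and such that for every $F\in\mathscr{N}$: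 1. $\Omega_F$ is a topological annulus (homeomorphic to $S^1\times(0,1]$), and $0$ lies in its interior. 2. The external boundary $\gamma_F^+$ of $\Omega_F$ is a Jordan curve contained in $\Omega_F$ and in $W^u(p_F)$. It is $C^1$ at every point except one point $q$, where $W^u(p_F)$ has a transversal self-intersection. That is, for some $\varepsilon>0$ there is a $C^1$ arc $\Gamma:(-\varepsilon,1+\varepsilon)\to\mathbb{C}$ of $W^u(p_F)$ with nowhere vanishing derivative, with $\Gamma([0,1])=\gamma_F^+$, injective on $[0,1)$, with $\Gamma(0)=\Gamma(1)=q$ and with $\Gamma'(0),\Gamma'(1)$ linearly independent over $\mathbb{R}$. 3. The internal boundary $\gamma_F^-$ of $\Omega_F$ is a Jordan curve disjoint from $\Omega_F$. -/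

import Mathlib

open Set Filter Topology

noncomputable section

namespace WildLorenz

/-! ### The punctured disc, the cylinder and their coordinates -/

/-- The closed disc `B_lam = {z : |z| ≤ 2 (1 - lam)⁻¹}`. -/
def disc (lam : ℝ) : Set ℂ := {z | ‖z‖ ≤ 2 * (1 - lam)⁻¹}

/-- The punctured closed disc `B_lam \ {0}`. -/
def discStar (lam : ℝ) : Set ℂ := disc lam \ {0}

/-- The upper end `2 (1 - lam)⁻¹ - 1 - lam` of the second coordinate on the cylinder. -/
def top (lam : ℝ) : ℝ := 2 * (1 - lam)⁻¹ - 1 - lam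

/-- The cylinder `ℝ/ℤ × ℝ`. -/
abbrev Cyl : Type := AddCircle (1 : ℝ) × ℝ

/-- The standard smooth embedding `(θ, t) ↦ (exp (2πiθ), t)` of `ℝ/ℤ × ℝ` in `ℂ × ℝ`. A map into the
cylinder is `C¹` exactly when its composition with this embedding is, and `C¹` convergence may be
tested after composing with it. -/
def cylEmb (x : Cyl) : ℂ × ℝ := ((AddCircle.toCircle x.1 : ℂ), x.2)

/-- The universal covering `ℝ × ℝ → ℝ/ℤ × ℝ`. -/
def cylProj (x : ℝ × ℝ) : Cyl := ((x.1 : AddCircle (1 : ℝ)), x.2)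

/-! ### The three spaces of maps -/

/-- The homeomorphisms `τ` from `B_lam \ {0}` onto `ℝ/ℤ × (1 - lam, 2 (1 - lam)⁻¹ - 1 - lam]` that extend
to a `C¹` diffeomorphism onto its image, defined on an open neighbourhood of `B_lam \ {0}` in `ℂ \ {0}`.
(An injective `C¹` map between surfaces with injective derivative is a diffeomorphism onto
its open image.) -/
structure SpaceT (lam : ℝ) where
  homeo : discStar lam ≃ₜ AddCircle (1 : ℝ) × Ioc (1 - lam) (top lam)
  extends_diffeo : ∃ (U : Set ℂ) (T : ℂ → Cyl), IsOpen U ∧ discStar lam ⊆ U ∧ (0 : ℂ) ∉ U ∧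
    (∀ z : discStar lam, T z = ((homeo z).1, ((homeo z).2 : ℝ))) ∧
    InjOn T U ∧ ContDiffOn ℝ 1 (cylEmb ∘ T) U ∧
    ∀ z ∈ U, Function.Injective (fderiv ℝ (cylEmb ∘ T) z)

/-- `τ`, read in `ℂ × ℝ`, with the value `0` off `B_lam \ {0}`. -/
def SpaceT.rep {lam : ℝ} (τ : SpaceT lam) (z : ℂ) : ℂ × ℝ :=
  open Classical in
  if h : z ∈ discStar lam then cylEmb ((τ.homeo ⟨z, h⟩).1, ((τ.homeo ⟨z, h⟩).2 : ℝ)) else 0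

/-- The weak `C¹` topology: uniform convergence, on every compact subset of `B_lam \ {0}`, of the maps
and of their derivatives. -/
instance (lam : ℝ) : TopologicalSpace (SpaceT lam) :=
  TopologicalSpace.induced
    (fun τ => UniformOnFun.ofFun {K : Set (discStar lam) | IsCompact K}
      (fun z : discStar lam => (τ.rep z, fderivWithin ℝ τ.rep (discStar lam) z)))
    inferInstance

/-- The maps `g` from `ℝ/ℤ × [1 - lam, 2 (1 - lam)⁻¹ - 1 - lam]` to `B_lam` that extend to a `C¹` local
diffeomorphism of a neighbourhood in `ℝ/ℤ × ℝ`. -/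
structure SpaceG (lam : ℝ) where
  toFun : AddCircle (1 : ℝ) × Icc (1 - lam) (top lam) → ℂ
  mapsTo : ∀ x, toFun x ∈ disc lam
  extends_localDiffeo : ∃ (U : Set Cyl) (G : Cyl → ℂ), IsOpen U ∧
    univ ×ˢ Icc (1 - lam) (top lam) ⊆ U ∧
    (∀ x : AddCircle (1 : ℝ) × Icc (1 - lam) (top lam), G (x.1, (x.2 : ℝ)) = toFun x) ∧
    ContDiffOn ℝ 1 (G ∘ cylProj) (cylProj ⁻¹' U) ∧
    ∀ x ∈ cylProj ⁻¹' U, Function.Bijective (fderiv ℝ (G ∘ cylProj) x)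

/-- The lift of `g` to the strip `ℝ × [1 - lam, 2 (1 - lam)⁻¹ - 1 - lam]`, with the value `0` off it. -/
def SpaceG.lift {lam : ℝ} (g : SpaceG lam) (x : ℝ × ℝ) : ℂ :=
  open Classical in
  if h : x.2 ∈ Icc (1 - lam) (top lam) then g.toFun ((x.1 : AddCircle (1 : ℝ)), ⟨x.2, h⟩) else 0

/-- The strong `C¹` topology: uniform convergence of the maps and of their derivatives on the whole
(compact) domain. -/
instance (lam : ℝ) : TopologicalSpace (SpaceG lam) :=
  TopologicalSpace.induced
    (fun g => UniformFun.ofFun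
      (fun x : (univ ×ˢ Icc (1 - lam) (top lam) : Set (ℝ × ℝ)) =>
        (g.lift x, fderivWithin ℝ g.lift (univ ×ˢ Icc (1 - lam) (top lam)) x)))
    inferInstance

/-- The composition `g ∘ τ`, as a map on `B_lam \ {0}`. -/
def compFun {lam : ℝ} (τ : SpaceT lam) (g : SpaceG lam) (z : discStar lam) : ℂ :=
  g.toFun ((τ.homeo z).1, ⟨(τ.homeo z).2, Ioc_subset_Icc_self (τ.homeo z).2.2⟩)

/-- The maps `F` on `B_lam \ {0}`, with values in `B_lam`, of the form `g ∘ τ`. -/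
structure SpaceF (lam : ℝ) where
  toFun : discStar lam → ℂ
  isComp : ∃ (τ : SpaceT lam) (g : SpaceG lam), ∀ z, toFun z = compFun τ g z

/-- The composition map `(τ, g) ↦ g ∘ τ`. -/
def compMap (lam : ℝ) (x : SpaceT lam × SpaceG lam) : SpaceF lam :=
  ⟨compFun x.1 x.2, x.1, x.2, fun _ => rfl⟩

/-- The largest topology for which the composition map is continuous. -/
instance (lam : ℝ) : TopologicalSpace (SpaceF lam) :=
  TopologicalSpace.coinduced (compMap lam) inferInstance

/-- `F` with the value `0` off `B_lam \ {0}` (used only at points of `B_lam \ {0}`). -/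
def SpaceF.ext {lam : ℝ} (F : SpaceF lam) (z : ℂ) : ℂ :=
  open Classical in if h : z ∈ discStar lam then F.toFun ⟨z, h⟩ else 0

/-! ### The model map belongs to the space -/

lemma inv_pos_of_mem {lam : ℝ} (hl : lam ∈ Ioo (0 : ℝ) 1) : 0 < (1 - lam)⁻¹ :=
  inv_pos.2 (by linarith [hl.2])

/-- The angle `arg z / 2π` in `ℝ/ℤ`. -/
def angle (z : ℂ) : AddCircle (1 : ℝ) := ((Complex.arg z / (2 * Real.pi) : ℝ) : AddCircle (1 : ℝ))

lemma toCircle_angle {z : ℂ} (hz : z ≠ 0) :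
    (AddCircle.toCircle (angle z) : ℂ) = z / (‖z‖ : ℂ) := by
  have h0 : (‖z‖ : ℂ) ≠ 0 := by simpa using hz
  have hpi : (Real.pi : ℂ) ≠ 0 := by exact_mod_cast Real.pi_ne_zero
  rw [angle, AddCircle.toCircle_apply_mk, Circle.coe_exp, eq_div_iff h0]
  have : ((2 * Real.pi / 1 * (Complex.arg z / (2 * Real.pi)) : ℝ) : ℂ) = Complex.arg z := by
    push_cast
    field_simp
  rw [this, mul_comm]
  exact Complex.norm_mul_exp_arg_mul_I z

lemma continuousOn_angle : ContinuousOn angle {z : ℂ | z ≠ 0} := by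
  have hind : IsInducing (fun x : AddCircle (1 : ℝ) => (AddCircle.toCircle x : ℂ)) := by
    have h1 : IsInducing (fun x : AddCircle (1 : ℝ) => AddCircle.toCircle x) := by
      have h2 : (fun x : AddCircle (1 : ℝ) => AddCircle.toCircle x) =
          AddCircle.homeomorphCircle (T := (1 : ℝ)) one_ne_zero :=
        funext fun x => (AddCircle.homeomorphCircle_apply _ x).symm
      rw [h2]
      exact (AddCircle.homeomorphCircle (T := (1 : ℝ)) one_ne_zero).isInducing
    exact IsInducing.subtypeVal.comp h1
  rw [hind.continuousOn_iff]
  have : ContinuousOn (fun z : ℂ => z / (‖z‖ : ℂ)) {z : ℂ | z ≠ 0} := by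
    refine continuousOn_id.div (by fun_prop) ?_
    intro z hz
    simpa using hz
  exact this.congr (fun z hz => toCircle_angle hz)

lemma toCircle_injective : Function.Injective (@AddCircle.toCircle 1) :=
  AddCircle.injective_toCircle one_ne_zero

lemma angle_smul {r : ℝ} (hr : 0 < r) (θ : AddCircle (1 : ℝ)) :
    angle ((r : ℂ) * (AddCircle.toCircle θ : ℂ)) = θ := by
  apply toCircle_injective
  apply Subtype.ext
  have hr' : (r : ℂ) ≠ 0 := by exact_mod_cast hr.ne'
  have hne : (r : ℂ) * (AddCircle.toCircle θ : ℂ) ≠ 0 := mul_ne_zero hr' (Circle.coe_ne_zero _)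
  have := toCircle_angle hne
  rw [this, norm_mul, Circle.norm_coe, Complex.norm_real, Real.norm_of_nonneg hr.le, mul_one]
  field_simp

lemma tauModel_mem {lam : ℝ} (hl : lam ∈ Ioo (0 : ℝ) 1) {z : ℂ} (hz : z ∈ discStar lam) :
    1 - lam + lam * ‖z‖ ∈ Ioc (1 - lam) (top lam) := by
  have h0 : 0 < ‖z‖ := norm_pos_iff.2 (by simpa using hz.2)
  have h1 : ‖z‖ ≤ 2 * (1 - lam)⁻¹ := hz.1
  have h2 : (1 - lam) * (1 - lam)⁻¹ = 1 := mul_inv_cancel₀ (by linarith [hl.2])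
  refine ⟨by nlinarith [hl.1], ?_⟩
  have h3 : lam * ‖z‖ ≤ lam * (2 * (1 - lam)⁻¹) := mul_le_mul_of_nonneg_left h1 hl.1.le
  unfold top
  nlinarith

lemma tauModel_inv_mem {lam : ℝ} (hl : lam ∈ Ioo (0 : ℝ) 1) (θ : AddCircle (1 : ℝ)) {t : ℝ}
    (ht : t ∈ Ioc (1 - lam) (top lam)) :
    (((t - (1 - lam)) / lam : ℝ) : ℂ) * (AddCircle.toCircle θ : ℂ) ∈ discStar lam := by
  have hr : 0 < (t - (1 - lam)) / lam := div_pos (by linarith [ht.1]) hl.1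
  have h2 : (1 - lam) * (1 - lam)⁻¹ = 1 := mul_inv_cancel₀ (by linarith [hl.2])
  refine ⟨?_, ?_⟩
  · change ‖_‖ ≤ _
    rw [norm_mul, Circle.norm_coe, Complex.norm_real, Real.norm_of_nonneg hr.le, mul_one,
      div_le_iff₀ hl.1]
    have := ht.2
    unfold top at this
    nlinarith
  · have hr' : (((t - (1 - lam)) / lam : ℝ) : ℂ) ≠ 0 := by exact_mod_cast hr.ne'
    simpa using mul_ne_zero hr' (Circle.coe_ne_zero (AddCircle.toCircle θ))

/-- The model homeomorphism `z ↦ (arg z / 2π, 1 - lam + lam |z|)`. -/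
def tauHomeo (lam : ℝ) (hl : lam ∈ Ioo (0 : ℝ) 1) :
    discStar lam ≃ₜ AddCircle (1 : ℝ) × Ioc (1 - lam) (top lam) where
  toFun z := (angle z, ⟨1 - lam + lam * ‖(z : ℂ)‖, tauModel_mem hl z.2⟩)
  invFun x := ⟨((((x.2 : ℝ) - (1 - lam)) / lam : ℝ) : ℂ) * (AddCircle.toCircle x.1 : ℂ),
    tauModel_inv_mem hl x.1 x.2.2⟩
  left_inv z := by
    have hz : (z : ℂ) ≠ 0 := by simpa using z.2.2
    have h0 : (‖(z : ℂ)‖ : ℂ) ≠ 0 := by simpa using hz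
    have hl0 : (lam : ℂ) ≠ 0 := by exact_mod_cast hl.1.ne'
    apply Subtype.ext
    simp only [toCircle_angle hz]
    push_cast
    field_simp
    ring
  right_inv x := by
    have hr : 0 < ((x.2 : ℝ) - (1 - lam)) / lam := div_pos (by linarith [x.2.2.1]) hl.1
    have hl0 : lam ≠ 0 := hl.1.ne'
    apply Prod.ext
    · exact angle_smul hr x.1
    · apply Subtype.ext
      simp only [norm_mul, Circle.norm_coe, Complex.norm_real, Real.norm_of_nonneg hr.le, mul_one]
      field_simp
      ring
  continuous_toFun := by
    refine Continuous.prodMk ?_ ?_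
    · exact continuousOn_angle.comp_continuous continuous_subtype_val
        (fun z => by simpa using z.2.2)
    · exact Continuous.subtype_mk (by fun_prop) _
  continuous_invFun := by
    have hc : Continuous (@AddCircle.toCircle 1) := AddCircle.continuous_toCircle
    refine Continuous.subtype_mk ?_ _
    fun_prop

/-- The model map `τ`. -/
def tauModel (lam : ℝ) (hl : lam ∈ Ioo (0 : ℝ) 1) : SpaceT lam where
  homeo := tauHomeo lam hl
  extends_diffeo := by
    set T : ℂ → Cyl := fun z => (angle z, 1 - lam + lam * ‖z‖) with hT
    set L : ℂ × ℝ → ℂ := fun x => x.1 * (((x.2 - (1 - lam)) / lam : ℝ) : ℂ) with hL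
    set U : Set ℂ := {z | z ≠ 0} with hU
    have hUo : IsOpen U := isOpen_ne
    have hl0 : (lam : ℂ) ≠ 0 := by exact_mod_cast hl.1.ne'
    have hLT : ∀ z ∈ U, L (cylEmb (T z)) = z := by
      intro z hz
      have hz' : z ≠ 0 := hz
      have h0 : (‖z‖ : ℂ) ≠ 0 := by simpa using hz'
      simp only [hL, hT, cylEmb, toCircle_angle hz]
      push_cast
      field_simp
      ring
    have hsm : ContDiffOn ℝ 1 (cylEmb ∘ T) U := by
      have h1 : ContDiffOn ℝ 1 (fun z : ℂ => ((z / (‖z‖ : ℂ), 1 - lam + lam * ‖z‖) : ℂ × ℝ)) U := by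
        intro z hz
        have hn : ContDiffAt ℝ 1 (fun z : ℂ => ‖z‖) z := contDiffAt_norm ℝ hz
        have hn' : ContDiffAt ℝ 1 (fun z : ℂ => (‖z‖ : ℂ)) z :=
          Complex.ofRealCLM.contDiff.contDiffAt.comp z hn
        have hz' : z ≠ 0 := hz
        have hne : (‖z‖ : ℂ) ≠ 0 := by simpa using hz'
        have hq : ContDiffAt ℝ 1 (fun z : ℂ => z / (‖z‖ : ℂ)) z := by
          have hi : ContDiffAt ℝ 1 (fun z : ℂ => (‖z‖ : ℂ)⁻¹) z := hn'.inv hne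
          simp only [div_eq_mul_inv]
          exact contDiffAt_id.mul hi
        have hr : ContDiffAt ℝ 1 (fun z : ℂ => 1 - lam + lam * ‖z‖) z :=
          contDiffAt_const.add (contDiffAt_const.mul hn)
        exact (hq.prodMk hr).contDiffWithinAt
      refine h1.congr (fun z hz => ?_)
      simp only [Function.comp, hT, cylEmb, toCircle_angle hz]
    refine ⟨U, T, hUo, fun z hz => by simpa [hU] using hz.2, by simp [hU], fun z => rfl, ?_, hsm, ?_⟩
    · intro z hz w hw h
      rw [← hLT z hz, ← hLT w hw, h]
    · intro z hz
      have hd : DifferentiableAt ℝ (cylEmb ∘ T) z :=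
        (hsm.contDiffAt (hUo.mem_nhds hz)).differentiableAt one_ne_zero
      have hLd : DifferentiableAt ℝ L ((cylEmb ∘ T) z) := by
        have : Differentiable ℝ L := by
          have h1 : Differentiable ℝ (fun x : ℂ × ℝ => (x.2 - (1 - lam)) / lam) := by fun_prop
          exact differentiable_fst.mul (Complex.ofRealCLM.differentiable.comp h1)
        exact this _
      have hc : HasFDerivAt (L ∘ (cylEmb ∘ T))
          ((fderiv ℝ L ((cylEmb ∘ T) z)).comp (fderiv ℝ (cylEmb ∘ T) z)) z :=
        hLd.hasFDerivAt.comp z hd.hasFDerivAt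
      have hid : HasFDerivAt (L ∘ (cylEmb ∘ T)) (ContinuousLinearMap.id ℝ ℂ) z := by
        refine (hasFDerivAt_id z).congr_of_eventuallyEq ?_
        filter_upwards [hUo.mem_nhds hz] with w hw
        exact hLT w hw
      have := hc.unique hid
      intro v w hvw
      have hv := congrArg (fun A : ℂ →L[ℝ] ℂ => A v) this
      have hw := congrArg (fun A : ℂ →L[ℝ] ℂ => A w) this
      simp only [ContinuousLinearMap.comp_apply, ContinuousLinearMap.id_apply] at hv hw
      rw [← hv, ← hw, hvw]

/-- The model map `g (θ, t) = t exp (4πiθ) + 1` on the cylinder. -/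
def gCyl (x : Cyl) : ℂ := (x.2 : ℂ) * (AddCircle.toCircle x.1 : ℂ) ^ 2 + 1

lemma gCyl_cylProj (x : ℝ × ℝ) :
    gCyl (cylProj x) = (x.2 : ℂ) * Complex.exp ((x.1 : ℂ) * (4 * Real.pi * Complex.I)) + 1 := by
  simp only [gCyl, cylProj, AddCircle.toCircle_apply_mk, Circle.coe_exp]
  rw [← Complex.exp_nat_mul]
  congr 3
  push_cast
  ring

/-- The model map `g`. -/
def gModel (lam : ℝ) (hl : lam ∈ Ioo (0 : ℝ) 1) : SpaceG lam where
  toFun x := gCyl (x.1, (x.2 : ℝ))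
  mapsTo x := by
    have h1 := x.2.2.1
    have h2 := x.2.2.2
    have h0 : 0 ≤ (x.2 : ℝ) := by linarith [hl.2]
    unfold top at h2
    change ‖_‖ ≤ _
    refine (norm_add_le _ _).trans ?_
    simp only [norm_mul, norm_pow, Circle.norm_coe, Complex.norm_real, Real.norm_of_nonneg h0,
      one_pow, mul_one, norm_one]
    linarith [hl.1]
  extends_localDiffeo := by
    have hcomp : gCyl ∘ cylProj =
        fun x : ℝ × ℝ => (x.2 : ℂ) * Complex.exp ((x.1 : ℂ) * (4 * Real.pi * Complex.I)) + 1 :=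
      funext gCyl_cylProj
    refine ⟨{x | 0 < x.2}, gCyl, isOpen_lt continuous_const continuous_snd, ?_, fun x => rfl, ?_, ?_⟩
    · rintro x ⟨-, hx⟩
      exact lt_of_lt_of_le (by linarith [hl.2]) hx.1
    · rw [hcomp]
      have h1 : ContDiff ℝ 1 (fun x : ℝ × ℝ => (x.1 : ℂ)) := Complex.ofRealCLM.contDiff.comp contDiff_fst
      have h2 : ContDiff ℝ 1 (fun x : ℝ × ℝ => (x.2 : ℂ)) := Complex.ofRealCLM.contDiff.comp contDiff_snd
      exact ((h2.mul (h1.mul contDiff_const).cexp).add contDiff_const).contDiffOn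
    · intro x hx
      have hx2 : (x.2 : ℂ) ≠ 0 := by exact_mod_cast (show (0 : ℝ) < x.2 from hx).ne'
      set c : ℂ := 4 * Real.pi * Complex.I with hc
      set E : ℂ := Complex.exp ((x.1 : ℂ) * c) with hE
      have hE0 : E ≠ 0 := Complex.exp_ne_zero _
      have h1 : HasFDerivAt (fun x : ℝ × ℝ => (x.1 : ℂ))
          (Complex.ofRealCLM.comp (ContinuousLinearMap.fst ℝ ℝ ℝ)) x :=
        Complex.ofRealCLM.hasFDerivAt.comp x hasFDerivAt_fst
      have h2 : HasFDerivAt (fun x : ℝ × ℝ => (x.2 : ℂ))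
          (Complex.ofRealCLM.comp (ContinuousLinearMap.snd ℝ ℝ ℝ)) x :=
        Complex.ofRealCLM.hasFDerivAt.comp x hasFDerivAt_snd
      have h3 := (h2.mul (h1.mul_const c).cexp).add_const 1
      have hval : ∀ v : ℝ × ℝ, fderiv ℝ (gCyl ∘ cylProj) x v =
          E * ((v.2 : ℂ) + x.2 * (4 * Real.pi * v.1 : ℝ) * Complex.I) := by
        intro v
        have h4 : fderiv ℝ (fun x : ℝ × ℝ => (x.2 : ℂ) * Complex.exp ((x.1 : ℂ) * c) + 1) x = _ :=
          h3.fderiv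
        rw [hcomp, h4]
        simp only [add_apply, smul_apply,
          ContinuousLinearMap.comp_apply, ContinuousLinearMap.coe_fst', ContinuousLinearMap.coe_snd',
          Complex.ofRealCLM_apply, smul_eq_mul, hc]
        simp
        ring
      have hinj : Function.Injective (fderiv ℝ (gCyl ∘ cylProj) x) := by
        rw [injective_iff_map_eq_zero]
        intro v hv
        rw [hval, mul_eq_zero, or_iff_right hE0] at hv
        have hre := congrArg Complex.re hv
        have him := congrArg Complex.im hv
        simp at hre him
        have hx2' : x.2 ≠ 0 := (show (0 : ℝ) < x.2 from hx).ne'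
        have : v.1 = 0 := him.resolve_left hx2'
        exact Prod.ext this hre
      refine ⟨hinj, ?_⟩
      have hfr : Module.finrank ℝ (ℝ × ℝ) = Module.finrank ℝ ℂ := by
        rw [Module.finrank_prod, Complex.finrank_real_complex, Module.finrank_self]
      exact (LinearMap.injective_iff_surjective_of_finrank_eq_finrank
        (f := (fderiv ℝ (gCyl ∘ cylProj) x : ℝ × ℝ →ₗ[ℝ] ℂ)) hfr).1 hinj

/-- The model map `F_lam (z) = (1 - lam + lam |z|) (z / |z|)² + 1`, as a point of the space of maps. -/
def modelF (lam : ℝ) (hl : lam ∈ Ioo (0 : ℝ) 1) : SpaceF lam where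
  toFun z := (1 - lam + lam * ‖(z : ℂ)‖ : ℝ) * ((z : ℂ) / (‖(z : ℂ)‖ : ℂ)) ^ 2 + 1
  isComp := by
    refine ⟨tauModel lam hl, gModel lam hl, fun z => ?_⟩
    have hz : (z : ℂ) ≠ 0 := by simpa using z.2.2
    simp only [compFun, gModel, gCyl, tauModel, tauHomeo, Homeomorph.homeomorph_mk_coe,
      Equiv.coe_fn_mk, toCircle_angle hz]

/-! ### The maximal invariant set, the fixed point and its unstable manifold -/

/-- The action on sets: `F(S)` is the image of `S \ {0}`. -/
def SpaceF.act {lam : ℝ} (F : SpaceF lam) (S : Set ℂ) : Set ℂ :=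
  {w | ∃ z : discStar lam, (z : ℂ) ∈ S ∧ F.toFun z = w}

/-- The maximal invariant set `Ω_F = ⋂_{m ≥ 1} F^m(B_lam)`. -/
def SpaceF.omega {lam : ℝ} (F : SpaceF lam) : Set ℂ :=
  ⋂ m : ℕ, ⋂ _ : 1 ≤ m, F.act^[m] (disc lam)

/-- `p` is a fixed point of `F`. -/
def SpaceF.IsFixed {lam : ℝ} (F : SpaceF lam) (p : ℂ) : Prop :=
  p ∈ discStar lam ∧ F.ext p = p

/-- `p` is a saddle fixed point of `F`: the derivative there has a real eigenvalue of modulus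
less than `1` and a real eigenvalue of modulus greater than `1`. -/
def SpaceF.IsSaddle {lam : ℝ} (F : SpaceF lam) (p : ℂ) : Prop :=
  F.IsFixed p ∧ ∃ a b : ℝ, |a| < 1 ∧ 1 < |b| ∧
    Module.End.HasEigenvalue (fderivWithin ℝ F.ext (discStar lam) p : ℂ →ₗ[ℝ] ℂ) a ∧
    Module.End.HasEigenvalue (fderivWithin ℝ F.ext (discStar lam) p : ℂ →ₗ[ℝ] ℂ) b

/-- The saddle fixed point `1 + (1 - lam)⁻¹` of the model map. -/
def pModel (lam : ℝ) : ℂ := ((1 + (1 - lam)⁻¹ : ℝ) : ℂ)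

/-- On the neighbourhood `N` of the model map, `p` is the continuation of its saddle fixed point:
`p` is continuous, takes the value `1 + (1 - lam)⁻¹` at the model map, and `p F` is a saddle fixed point
of `F`, the only fixed point of `F` in some neighbourhood of `1 + (1 - lam)⁻¹` that does not
depend on `F`. -/
def IsContinuation {lam : ℝ} (hl : lam ∈ Ioo (0 : ℝ) 1) (N : Set (SpaceF lam))
    (p : SpaceF lam → ℂ) : Prop :=
  ContinuousOn p N ∧ p (modelF lam hl) = pModel lam ∧
    ∃ V : Set ℂ, IsOpen V ∧ pModel lam ∈ V ∧
      ∀ F ∈ N, p F ∈ V ∧ F.IsSaddle (p F) ∧ ∀ z ∈ V, F.IsFixed z → z = p F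

/-- The unstable manifold of the fixed point `p`: the points with an infinite backward orbit that
converges to `p`. -/
def SpaceF.unstableManifold {lam : ℝ} (F : SpaceF lam) (p : ℂ) : Set ℂ :=
  {w | ∃ y : ℕ → ℂ, y 0 = w ∧ (∀ n, y (n + 1) ∈ discStar lam ∧ F.ext (y (n + 1)) = y n) ∧
    Tendsto y atTop (𝓝 p)}

/-- `Γ`, on the parameter set `I`, runs along the unstable manifold of `p` regarded as an immersed
curve: its points have backward orbits converging to `p` that vary continuously along `I`. -/
def SpaceF.IsUnstableArc {lam : ℝ} (F : SpaceF lam) (p : ℂ) (Γ : ℝ → ℂ) (I : Set ℝ) : Prop :=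
  ∃ Y : ℕ → ℝ → ℂ, EqOn (Y 0) Γ I ∧ (∀ n, ContinuousOn (Y n) I) ∧
    (∀ n, ∀ s ∈ I, Y (n + 1) s ∈ discStar lam ∧ F.ext (Y (n + 1) s) = Y n s) ∧
    ∀ s ∈ I, Tendsto (fun n => Y n s) atTop (𝓝 p)

/-! ### Plane topology -/

/-- A Jordan curve: the image of the circle under an injective continuous map. -/
def IsJordanCurve (γ : Set ℂ) : Prop :=
  ∃ f : Circle → ℂ, Continuous f ∧ Function.Injective f ∧ range f = γ

/-- The half-open topological annulus: a set homeomorphic to `S¹ × (0, 1]`. -/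
def IsHalfOpenAnnulus (S : Set ℂ) : Prop :=
  Nonempty (S ≃ₜ Circle × Ioc (0 : ℝ) 1)

/-- The external boundary of `S`: the boundary of the union of the unbounded components of the
complement of `S`. -/
def externalBoundary (S : Set ℂ) : Set ℂ :=
  frontier {z | z ∈ Sᶜ ∧ ¬ Bornology.IsBounded (connectedComponentIn Sᶜ z)}

/-- The internal boundary of `S`: the boundary of the union of the bounded components of the
complement of `S`. -/
def internalBoundary (S : Set ℂ) : Set ℂ :=
  frontier {z | z ∈ Sᶜ ∧ Bornology.IsBounded (connectedComponentIn Sᶜ z)}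

/-- `γ` is a closed curve that is regularly `C¹` except at `q`, where the unstable manifold of `p` has a
transversal self-intersection: some regular `C¹` arc `Γ` of the unstable manifold, defined on an open
interval that contains `[0, 1]`, passes through `q` at the times `0` and `1` with linearly independent
velocities, is injective on `[0, 1)`, and traces `γ` on `[0, 1]`. (So `γ` has a corner at `q`,
and is not differentiable there.) -/
def SpaceF.IsUnstableLoop {lam : ℝ} (F : SpaceF lam) (p : ℂ) (γ : Set ℂ) (q : ℂ) : Prop :=
  ∃ (ε : ℝ) (Γ : ℝ → ℂ), 0 < ε ∧
    ContDiffOn ℝ 1 Γ (Ioo (-ε) (1 + ε)) ∧ (∀ s ∈ Ioo (-ε) (1 + ε), deriv Γ s ≠ 0) ∧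
    F.IsUnstableArc p Γ (Ioo (-ε) (1 + ε)) ∧
    InjOn Γ (Ico 0 1) ∧ Γ '' Icc 0 1 = γ ∧ Γ 0 = q ∧ Γ 1 = q ∧
    LinearIndependent ℝ ![deriv Γ 0, deriv Γ 1]

end WildLorenz

end

open Set Filter Topology

noncomputable section

namespace WildLorenz

/-! ### Star-shaped annuli around the point `1` -/

/-! Put `R = (1 - lam)⁻¹`, a large number, and use polar coordinates `(x, y)` around `1`. For `y` of
order `R` the point `1 + y e^{ix}` has modulus about `y + cos x` and argument about `x`, so the
model map lifts to a map whose derivative is close to that of `(x, y) ↦ (2 x, y + cos x)`. Two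
refinements decide everything: the vertical derivative is at most `lam = 1 - 1 / R`, and the angle
depends on `y` only at order `R⁻²`. The weak vertical contraction therefore beats the coupling, and
it still does after a perturbation of order `R⁻⁴`. `StripMap` collects the inequalities that are
used; `ModelClose.stripMap` proves them for every map near the model.

Outer boundary. A graph transform yields an invariant graph `y = h x` over `|x| < 7`, which is more
than two turns. Its inverse dynamics contracts to a fixed point, so the graph lies on the unstable
manifold. A second contraction gives the slopes; `h` is `C¹` (`StripMap.InvGraph.hasDerivAt`) and
its slope is close to the explicit series `-∑ 2⁻ᵏ sin (2⁻ᵏ x)`. Hence `h x - h (x - 2π)` is strictly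
decreasing on a neighbourhood of `[0, 2π]`, and since `h` is almost even it vanishes at a point `q`
near `π` (`exists_corner`). There two consecutive turns cross transversally. The arc over `[q - 2π,
q]` closes up to a loop, the radial graph of a function `H` on the circle, and the adjacent parts of
the graph lie below it.

Inner boundary. The weak topology on the factors `τ` gives no control near the puncture. Control
comes from `g`, which is `C¹` up to the bottom circle of the cylinder: for the model this circle
goes to a small circle around `1`, and the direction away from `1` points into the cylinder. This
property is open in `g` and depends only on `g ∘ τ` (`SpaceG.Outward.of_compMap_eq`), so it defines
an open condition in the quotient topology. It follows that near `1` the image of `F` omits exactly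
a star-shaped region with continuous radial function `m` (`SpaceF.exists_hole`).

The maximal invariant set. The excess of a point over the outer curve is multiplied by at most `c +
2 σ < 1` (`Picture.excess`), and no image lies in the hole; so the set is contained in the annulus
`m < |w - 1| ≤ H`. Conversely every point of that annulus has a preimage in it
(`Picture.starAnnulus_subset`). Equality (`Picture.omega_eq`) reduces the topological claims to
facts about radial graphs. Uniqueness and continuity of the saddle come from one estimate on almost
fixed points (`StripMap.almost_fixed`). -/

/-- The point at distance `ρ` from `1` in the direction `u`. -/
def ray (u : Circle) (ρ : ℝ) : ℂ := 1 + ρ * (u : ℂ)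

/-- The direction from `1` to `w`. -/
def dir (w : ℂ) : Circle := Circle.exp (Complex.arg (w - 1))

lemma continuous_ray : Continuous (fun x : Circle × ℝ => ray x.1 x.2) := by
  unfold ray; fun_prop

lemma norm_ray_sub_one (u : Circle) {ρ : ℝ} (h : 0 ≤ ρ) : ‖ray u ρ - 1‖ = ρ := by
  simp [ray, abs_of_nonneg h, Circle.norm_coe]

lemma ray_dir (w : ℂ) : ray (dir w) ‖w - 1‖ = w := by
  simp [ray, dir, Complex.norm_mul_exp_arg_mul_I]

lemma dir_ray (u : Circle) {ρ : ℝ} (h : 0 < ρ) : dir (ray u ρ) = u := by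
  simp only [dir, ray, add_sub_cancel_left]
  rw [Complex.arg_real_mul _ h, Circle.exp_arg]

/-- `Complex.arg` jumps across the negative axis, but `dir w` is `(w - 1) / ‖w - 1‖`, which does
not. -/
lemma continuousOn_dir : ContinuousOn dir {w | w ≠ 1} := by
  have hind : IsInducing (fun x : Circle => (x : ℂ)) := IsInducing.subtypeVal
  rw [hind.continuousOn_iff]
  have : ContinuousOn (fun w : ℂ => (w - 1) / (‖w - 1‖ : ℂ)) {w | w ≠ 1} := by
    refine ContinuousOn.div (by fun_prop) (by fun_prop) ?_
    intro w hw
    simpa [sub_eq_zero] using hw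
  refine this.congr fun w hw => ?_
  have h0 : (‖w - 1‖ : ℂ) ≠ 0 := by simpa [sub_eq_zero] using hw
  rw [eq_div_iff h0]
  simp [dir, mul_comm _ (‖w - 1‖ : ℂ), Complex.norm_mul_exp_arg_mul_I]

section Level

variable {H : Circle → ℝ} {b : ℝ}

lemma continuousOn_norm_sub_dir (hH : Continuous H) :
    ContinuousOn (fun w : ℂ => ‖w - 1‖ - H (dir w)) {w | w ≠ 1} :=
  ContinuousOn.sub (by fun_prop) (hH.comp_continuousOn continuousOn_dir)

/-- `dir` is not continuous at `1`; the positive lower bound `b` on `H` keeps the curve away from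
that point. -/
lemma isOpen_above (hH : Continuous H) (hb : 0 < b) (hbH : ∀ u, b ≤ H u) :
    IsOpen {w : ℂ | H (dir w) < ‖w - 1‖} := by
  have h := (continuousOn_norm_sub_dir hH).isOpen_inter_preimage (isOpen_ne (x := (1 : ℂ)))
    (isOpen_Ioi (a := (0 : ℝ)))
  convert h using 1
  ext w
  simp only [mem_ofPred_eq, mem_inter_iff, mem_preimage, mem_Ioi, sub_pos]
  refine ⟨fun h => ⟨?_, h⟩, fun h => h.2⟩
  rintro rfl
  have := hbH (dir 1)
  simp at h
  linarith

lemma isOpen_below (hH : Continuous H) (hb : 0 < b) (hbH : ∀ u, b ≤ H u) :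
    IsOpen {w : ℂ | ‖w - 1‖ < H (dir w)} := by
  have h := (continuousOn_norm_sub_dir hH).isOpen_inter_preimage (isOpen_ne (x := (1 : ℂ)))
    (isOpen_Iio (a := (0 : ℝ)))
  -- This ball supplies the neighbourhood of `1`, where continuity of `dir` is not available.
  have h2 : IsOpen {w : ℂ | ‖w - 1‖ < b} := isOpen_lt (by fun_prop) continuous_const
  convert h.union h2 using 1
  ext w
  simp only [mem_ofPred_eq, mem_union, mem_inter_iff, mem_preimage, mem_Iio, sub_neg]
  constructor
  · intro h
    by_cases hw : w = 1
    · right; simpa [hw] using hb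
    · exact Or.inl ⟨hw, h⟩
  · rintro (h | h)
    · exact h.2
    · exact h.trans_le (hbH _)

/-- Every annulus considered below contains the unit circle around `1`, so this circle separates the
components of the complement. -/
lemma isPreconnected_split {S : Set ℂ} (hS : IsPreconnected S)
    (hne : ∀ w ∈ S, ‖w - 1‖ ≠ 1) {z : ℂ} (hz : z ∈ S) (hz1 : ‖z - 1‖ < 1) :
    ∀ w ∈ S, ‖w - 1‖ < 1 := by
  intro w hw
  have h1 : IsOpen {w : ℂ | ‖w - 1‖ < 1} := isOpen_lt (by fun_prop) continuous_const
  have h2 : IsOpen {w : ℂ | 1 < ‖w - 1‖} := isOpen_lt continuous_const (by fun_prop)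
  refine hS.subset_left_of_subset_union h1 h2 ?_ ?_ ⟨z, hz, hz1⟩ hw
  · rw [Set.disjoint_left]
    intro w hw hw'
    simp only [mem_ofPred_eq] at hw hw'
    linarith
  · intro w hw
    rcases lt_or_gt_of_ne (hne w hw) with h | h
    · exact Or.inl h
    · exact Or.inr h

lemma mem_closure_above (hb : 0 < b) (hbH : ∀ u, b ≤ H u) (u : Circle) :
    ray u (H u) ∈ closure {w : ℂ | H (dir w) < ‖w - 1‖} := by
  have ht : Tendsto (fun t : ℝ => ray u t) (𝓝[>] (H u)) (𝓝 (ray u (H u))) :=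
    ((continuous_ray.comp (Continuous.prodMk_right u)).tendsto _).mono_left nhdsWithin_le_nhds
  refine mem_closure_of_tendsto ht ?_
  filter_upwards [self_mem_nhdsWithin] with t ht
  have h0 : 0 < t := by have := hbH u; simp at ht; linarith
  simp only [dir_ray u h0, norm_ray_sub_one u h0.le]
  exact ht

lemma range_ray_eq (hb : 0 < b) (hbH : ∀ u, b ≤ H u) :
    range (fun u => ray u (H u)) = {w : ℂ | ‖w - 1‖ = H (dir w)} := by
  ext w
  constructor
  · rintro ⟨u, rfl⟩
    have h0 : 0 < H u := hb.trans_le (hbH u)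
    simp only [mem_ofPred_eq, dir_ray u h0, norm_ray_sub_one u h0.le]
  · intro h
    refine ⟨dir w, ?_⟩
    simp only [mem_ofPred_eq] at h
    simp only [← h, ray_dir]

lemma frontier_above (hH : Continuous H) (hb : 0 < b) (hbH : ∀ u, b ≤ H u) :
    frontier {w : ℂ | H (dir w) < ‖w - 1‖} = range (fun u => ray u (H u)) := by
  have ho := isOpen_above hH hb hbH
  rw [ho.frontier_eq]
  apply Subset.antisymm
  · rintro w ⟨hw, hw'⟩
    rw [range_ray_eq hb hbH]
    refine le_antisymm (not_lt.1 hw') ?_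
    by_contra! hlt
    obtain ⟨v, hv, hv'⟩ := mem_closure_iff.1 hw _ (isOpen_below hH hb hbH) hlt
    simp only [mem_ofPred_eq] at hv hv'
    linarith
  · rintro w ⟨u, rfl⟩
    refine ⟨mem_closure_above hb hbH u, ?_⟩
    have h0 : 0 < H u := hb.trans_le (hbH u)
    simp only [mem_ofPred_eq, dir_ray u h0, norm_ray_sub_one u h0.le]
    exact lt_irrefl _

lemma frontier_le (hH : Continuous H) (hb : 0 < b) (hbH : ∀ u, b ≤ H u) :
    frontier {w : ℂ | ‖w - 1‖ ≤ H (dir w)} = range (fun u => ray u (H u)) := by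
  rw [← frontier_compl, ← frontier_above hH hb hbH]
  congr 1
  ext w
  simp

lemma isJordanCurve_range_ray (hH : Continuous H) (hb : 0 < b) (hbH : ∀ u, b ≤ H u) :
    IsJordanCurve (range fun u => ray u (H u)) := by
  refine ⟨fun u => ray u (H u), continuous_ray.comp (continuous_id.prodMk hH), ?_, rfl⟩
  intro u v huv
  have := congrArg dir huv
  simpa only [dir_ray _ (hb.trans_le (hbH _))] using this

end Level

/-- The half-open annulus around `1` between the curves with radial functions `m` and `H`. -/
def starAnnulus (m H : Circle → ℝ) : Set ℂ := {w | m (dir w) < ‖w - 1‖ ∧ ‖w - 1‖ ≤ H (dir w)}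

/-! ### Components of the complement of a star-shaped annulus, and its two boundaries. -/

section Annulus

variable {m H : Circle → ℝ} {b : ℝ}

lemma ray_mem_starAnnulus {u : Circle} {ρ : ℝ} (h0 : 0 < ρ) :
    ray u ρ ∈ starAnnulus m H ↔ m u < ρ ∧ ρ ≤ H u := by
  simp only [starAnnulus, mem_ofPred_eq, dir_ray u h0, norm_ray_sub_one u h0.le]

/-- On each ray from `1`, the interval from `m` (excluded) to `H` (included) is rescaled affinely to
`(0, 1]`. -/
lemma isHalfOpenAnnulus_starAnnulus (hm : Continuous m) (hH : Continuous H) (hb : 0 < b)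
    (hbm : ∀ u, b ≤ m u) (hm1 : ∀ u, m u < 1) (hH1 : ∀ u, 1 < H u) :
    IsHalfOpenAnnulus (starAnnulus m H) := by
  have hpos : ∀ u, 0 < H u - m u := fun u => by linarith [hm1 u, hH1 u]
  have hinv : ∀ (u : Circle) (t : ℝ), t ∈ Ioc (0 : ℝ) 1 →
      m u < m u + t * (H u - m u) ∧ m u + t * (H u - m u) ≤ H u := by
    intro u t ht
    have := mul_pos ht.1 (hpos u)
    have := mul_le_mul_of_nonneg_right ht.2 (hpos u).le
    constructor <;> linarith
  have hne : ∀ w : starAnnulus m H, (w : ℂ) ≠ 1 := by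
    intro w hw
    have h1 := w.2.1
    have h2 := hbm (dir w)
    rw [hw] at h1 h2
    simp at h1
    linarith
  have hdir : Continuous fun w : starAnnulus m H => dir w :=
    continuousOn_dir.comp_continuous continuous_subtype_val hne
  refine ⟨⟨⟨fun w => (dir w, ⟨(‖(w : ℂ) - 1‖ - m (dir w)) / (H (dir w) - m (dir w)), ?_⟩),
    fun x => ⟨ray x.1 (m x.1 + x.2 * (H x.1 - m x.1)), ?_⟩, ?_, ?_⟩, ?_, ?_⟩⟩
  · exact ⟨div_pos (sub_pos.2 w.2.1) (hpos _), (div_le_one (hpos _)).2 (by linarith [w.2.2])⟩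
  · have h := hinv x.1 x.2 x.2.2
    have h0 : 0 < m x.1 + x.2 * (H x.1 - m x.1) := by linarith [hbm x.1]
    exact (ray_mem_starAnnulus h0).2 h
  · intro w
    apply Subtype.ext
    simp only
    rw [div_mul_cancel₀ _ (hpos _).ne', add_sub_cancel, ray_dir]
  · intro x
    have h := hinv x.1 x.2 x.2.2
    have h0 : 0 < m x.1 + x.2 * (H x.1 - m x.1) := by linarith [hbm x.1]
    apply Prod.ext
    · exact dir_ray _ h0
    · apply Subtype.ext
      simp only [dir_ray _ h0, norm_ray_sub_one _ h0.le]
      rw [add_sub_cancel_left, mul_div_cancel_right₀ _ (hpos _).ne']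
  · refine Continuous.prodMk hdir (Continuous.subtype_mk ?_ _)
    exact Continuous.div (Continuous.sub (by fun_prop) (hm.comp hdir))
      ((hH.comp hdir).sub (hm.comp hdir)) (fun w => (hpos _).ne')
  · refine Continuous.subtype_mk (continuous_ray.comp (Continuous.prodMk continuous_fst ?_)) _
    fun_prop

lemma compl_starAnnulus (hm1 : ∀ u, m u < 1) (hH1 : ∀ u, 1 < H u) {w : ℂ}
    (hw : w ∈ (starAnnulus m H)ᶜ) : ‖w - 1‖ ≠ 1 := by
  intro h
  exact hw ⟨by rw [h]; exact hm1 _, by rw [h]; exact (hH1 _).le⟩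

/-- From a point beyond the unit circle around `1` the outward ray never meets the annulus, so its
component is unbounded; a component that starts inside that circle cannot cross it. -/
lemma bounded_component_iff (hm1 : ∀ u, m u < 1) (hH1 : ∀ u, 1 < H u) {w : ℂ}
    (hw : w ∈ (starAnnulus m H)ᶜ) :
    Bornology.IsBounded (connectedComponentIn (starAnnulus m H)ᶜ w) ↔ ‖w - 1‖ < 1 := by
  constructor
  · intro hB
    by_contra! hlt
    have hlt' : 1 < ‖w - 1‖ := lt_of_le_of_ne hlt (compl_starAnnulus hm1 hH1 hw).symm
    have habove : H (dir w) < ‖w - 1‖ := by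
      by_contra! hle
      exact hw ⟨(hm1 _).trans hlt', hle⟩
    have hsub : (fun t => ray (dir w) t) '' Ici ‖w - 1‖ ⊆
        connectedComponentIn (starAnnulus m H)ᶜ w := by
      refine IsPreconnected.subset_connectedComponentIn ?_ ⟨_, self_mem_Ici, ray_dir w⟩ ?_
      · exact isPreconnected_Ici.image _
          (continuous_ray.comp (Continuous.prodMk_right (dir w))).continuousOn
      · rintro _ ⟨t, ht, rfl⟩ hmem
        have ht' : ‖w - 1‖ ≤ t := ht
        have := ((ray_mem_starAnnulus (by linarith)).1 hmem).2
        linarith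
    -- If the ray had norm at most `C`, its point at distance at least `C + 2` from `1` would
    -- contradict the triangle inequality.
    obtain ⟨C, hC⟩ := (hB.subset hsub).exists_norm_le
    have h1 := hC _ ⟨max ‖w - 1‖ (C + 2), mem_Ici.2 (le_max_left _ _), rfl⟩
    have h0 : 0 ≤ max ‖w - 1‖ (C + 2) := (norm_nonneg _).trans (le_max_left _ _)
    have h2 := norm_ray_sub_one (dir w) h0
    have h3 := norm_sub_le (ray (dir w) (max ‖w - 1‖ (C + 2))) 1
    rw [norm_one, h2] at h3
    have := le_max_right ‖w - 1‖ (C + 2)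
    linarith
  · intro hlt
    have hsub : connectedComponentIn (starAnnulus m H)ᶜ w ⊆ {v | ‖v - 1‖ < 1} :=
      isPreconnected_split isPreconnected_connectedComponentIn
        (fun v hv => compl_starAnnulus hm1 hH1 (connectedComponentIn_subset _ _ hv))
        (mem_connectedComponentIn hw) hlt
    refine (Metric.isBounded_ball (x := (1 : ℂ)) (r := 1)).subset (hsub.trans ?_)
    intro v hv
    simpa [dist_eq_norm] using hv

lemma externalBoundary_starAnnulus (hH : Continuous H)
    (hm1 : ∀ u, m u < 1) (hH1 : ∀ u, 1 < H u) :
    externalBoundary (starAnnulus m H) = range fun u => ray u (H u) := by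
  rw [externalBoundary, ← frontier_above hH one_pos (fun u => (hH1 u).le)]
  congr 1
  ext w
  simp only [mem_ofPred_eq]
  constructor
  · rintro ⟨hw, hB⟩
    rw [bounded_component_iff hm1 hH1 hw, not_lt] at hB
    by_contra! hle
    exact hw ⟨(hm1 _).trans_le hB, hle⟩
  · intro h
    have hw : w ∈ (starAnnulus m H)ᶜ := fun h' => by linarith [h'.2]
    refine ⟨hw, ?_⟩
    rw [bounded_component_iff hm1 hH1 hw]
    linarith [hH1 (dir w)]

lemma internalBoundary_starAnnulus (hm : Continuous m) (hb : 0 < b) (hbm : ∀ u, b ≤ m u)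
    (hm1 : ∀ u, m u < 1) (hH1 : ∀ u, 1 < H u) :
    internalBoundary (starAnnulus m H) = range fun u => ray u (m u) := by
  rw [internalBoundary, ← frontier_le hm hb hbm]
  congr 1
  ext w
  simp only [mem_ofPred_eq]
  constructor
  · rintro ⟨hw, hB⟩
    rw [bounded_component_iff hm1 hH1 hw] at hB
    by_contra! hle
    exact hw ⟨hle, by linarith [hH1 (dir w)]⟩
  · intro h
    have hw : w ∈ (starAnnulus m H)ᶜ := fun h' => by linarith [h'.1]
    refine ⟨hw, ?_⟩
    rw [bounded_component_iff hm1 hH1 hw]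
    linarith [hm1 (dir w)]

lemma externalBoundary_subset_starAnnulus (hH : Continuous H)
    (hm1 : ∀ u, m u < 1) (hH1 : ∀ u, 1 < H u) :
    externalBoundary (starAnnulus m H) ⊆ starAnnulus m H := by
  rw [externalBoundary_starAnnulus hH hm1 hH1]
  rintro _ ⟨u, rfl⟩
  rw [ray_mem_starAnnulus (by linarith [hH1 u])]
  exact ⟨(hm1 u).trans (hH1 u), le_rfl⟩

lemma disjoint_internalBoundary_starAnnulus (hm : Continuous m) (hb : 0 < b)
    (hbm : ∀ u, b ≤ m u) (hm1 : ∀ u, m u < 1) (hH1 : ∀ u, 1 < H u) :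
    Disjoint (internalBoundary (starAnnulus m H)) (starAnnulus m H) := by
  rw [internalBoundary_starAnnulus hm hb hbm hm1 hH1, Set.disjoint_left]
  rintro _ ⟨u, rfl⟩ h
  rw [ray_mem_starAnnulus (hb.trans_le (hbm u))] at h
  exact lt_irrefl _ h.1

lemma mem_interior_starAnnulus (hm : Continuous m) (hH : Continuous H) (hb : 0 < b)
    (hbm : ∀ u, b ≤ m u) (hH1 : ∀ u, 1 < H u) {w : ℂ}
    (h1 : m (dir w) < ‖w - 1‖) (h2 : ‖w - 1‖ < H (dir w)) :
    w ∈ interior (starAnnulus m H) := by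
  refine mem_interior.2 ⟨_, ?_, (isOpen_above hm hb hbm).inter
    (isOpen_below hH one_pos (fun u => (hH1 u).le)), ⟨h1, h2⟩⟩
  rintro v ⟨hv1, hv2⟩
  exact ⟨hv1, le_of_lt hv2⟩

end Annulus

/-! ### Invariant graphs of maps of a strip -/

/-- A contraction principle for real functions on a set, in the uniform distance. -/
lemma exists_fixed_function {J : Set ℝ} (P : (ℝ → ℝ) → Prop) (Γ : (ℝ → ℝ) → ℝ → ℝ) {c C : ℝ}
    (hc0 : 0 ≤ c) (hc1 : c < 1) {k₀ : ℝ → ℝ} (hk₀ : P k₀) (hP : ∀ k, P k → P (Γ k))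
    (hC : ∀ x ∈ J, |Γ k₀ x - k₀ x| ≤ C)
    (hΓ : ∀ k l D, P k → P l → (∀ x ∈ J, |k x - l x| ≤ D) → ∀ x ∈ J, |Γ k x - Γ l x| ≤ c * D)
    (hlim : ∀ (u : ℕ → ℝ → ℝ) k, (∀ n, P (u n)) → TendstoUniformlyOn u k atTop J → P k) :
    ∃ k, P k ∧ ∀ x ∈ J, Γ k x = k x := by
  -- Picard iteration: consecutive iterates differ by `C c ^ n` uniformly on `J`, so they converge
  -- uniformly there, and `hlim` keeps the limit in the class `P`.
  set u : ℕ → ℝ → ℝ := fun n => Γ^[n] k₀ with hu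
  have hsucc : ∀ n, u (n + 1) = Γ (u n) := fun n => Function.iterate_succ_apply' _ _ _
  have hPu : ∀ n, P (u n) := by
    intro n
    induction n with
    | zero => exact hk₀
    | succ n ih => rw [hsucc]; exact hP _ ih
  have hd : ∀ n, ∀ x ∈ J, |u (n + 1) x - u n x| ≤ C * c ^ n := by
    intro n
    induction n with
    | zero => intro x hx; simpa [hu] using hC x hx
    | succ n ih =>
      intro x hx
      have := hΓ _ _ _ (hPu _) (hPu _) ih x hx
      rw [hsucc (n + 1)]
      nth_rewrite 2 [hsucc n]
      calc _ ≤ c * (C * c ^ n) := this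
        _ = _ := by ring
  have hdist : ∀ x ∈ J, ∀ n, dist (u n x) (u (n + 1) x) ≤ C * c ^ n := by
    intro x hx n
    rw [dist_comm, Real.dist_eq]
    exact hd n x hx
  have hex : ∀ x ∈ J, ∃ l, Tendsto (fun n => u n x) atTop (𝓝 l) := fun x hx =>
    cauchySeq_tendsto_of_complete (cauchySeq_of_le_geometric c C hc1 (hdist x hx))
  choose! k hk using hex
  have hle : ∀ x ∈ J, ∀ n, |u n x - k x| ≤ C * c ^ n / (1 - c) := fun x hx n =>
    dist_le_of_le_geometric_of_tendsto c C hc1 (hdist x hx) (hk x hx) n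
  have h0 : Tendsto (fun n : ℕ => C * c ^ n / (1 - c)) atTop (𝓝 0) := by
    have := ((tendsto_pow_atTop_nhds_zero_of_lt_one hc0 hc1).const_mul C).div_const (1 - c)
    simpa using this
  have hunif : TendstoUniformlyOn u k atTop J := by
    rw [Metric.tendstoUniformlyOn_iff]
    intro e he
    filter_upwards [h0.eventually (gt_mem_nhds he)] with n hn x hx
    rw [dist_comm, Real.dist_eq]
    exact (hle x hx n).trans_lt hn
  have hPk := hlim u k hPu hunif
  refine ⟨k, hPk, fun x hx => ?_⟩
  have h1 : Tendsto (fun n => u (n + 1) x) atTop (𝓝 (k x)) :=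
    (hk x hx).comp (tendsto_add_atTop_nat 1)
  refine tendsto_nhds_unique ?_ h1
  rw [tendsto_iff_dist_tendsto_zero]
  refine squeeze_zero (fun n => dist_nonneg) (fun n => ?_) (by simpa using h0.const_mul c)
  rw [Real.dist_eq, hsucc]
  exact hΓ _ _ _ (hPu n) hPk (fun y hy => hle y hy n) x hx

/-- A mean value inequality with two-sided bounds. -/
lemma sub_mem_of_hasDerivAt {φ φ' : ℝ → ℝ} {a b m M : ℝ} (hab : a ≤ b)
    (hφ : ∀ t ∈ Icc a b, HasDerivAt φ (φ' t) t) (hm : ∀ t ∈ Icc a b, m ≤ φ' t)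
    (hM : ∀ t ∈ Icc a b, φ' t ≤ M) :
    m * (b - a) ≤ φ b - φ a ∧ φ b - φ a ≤ M * (b - a) := by
  rcases hab.eq_or_lt with rfl | hlt
  · simp
  obtain ⟨t, ht, hs⟩ := exists_hasDerivAt_eq_slope φ φ' hlt
    (fun t ht => (hφ t ht).continuousAt.continuousWithinAt)
    (fun t ht => hφ t (Ioo_subset_Icc_self ht))
  have ht' := Ioo_subset_Icc_self ht
  have hpos : 0 < b - a := by linarith
  rw [eq_div_iff hpos.ne'] at hs
  rw [← hs]
  exact ⟨mul_le_mul_of_nonneg_right (hm t ht') hpos.le,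
    mul_le_mul_of_nonneg_right (hM t ht') hpos.le⟩

/-- The strip `R / 2 < y < 2 R - 3 / 2` in the `(x, y)`-plane. -/
def strip (R : ℝ) : Set (ℝ × ℝ) := {p | R / 2 < p.2 ∧ p.2 < 2 * R - 3 / 2}

/-- The linear form with coefficients `a` and `b`. -/
def lin (a b : ℝ) : ℝ × ℝ →L[ℝ] ℝ :=
  a • ContinuousLinearMap.fst ℝ ℝ ℝ + b • ContinuousLinearMap.snd ℝ ℝ ℝ

lemma lin_apply (a b : ℝ) (v : ℝ × ℝ) : lin a b v = a * v.1 + b * v.2 := by simp [lin]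

/-- A `C¹` map `(f, g)` of a strip that roughly doubles the first coordinate, weakly contracts the
second one, and is close to `(x, y) ↦ (2 x, y + cos x)` in the `C¹` sense. -/
structure StripMap (lam R η c σ : ℝ) (f g a11 a12 a21 a22 : ℝ × ℝ → ℝ) : Prop where
  hR : 1000 ≤ R
  hlam : 0 < lam
  hη : 0 ≤ η
  -- One `η` is lost in `g_lower` and four in the bound `4 |x|` through `f_zero`; the gap `1 - lam`
  -- has to absorb all five when the lower bound of the admissible class is propagated.
  hηlam : 5 * η ≤ 1 - lam
  hc : 0 ≤ c
  -- This is the contraction rate of the vertical distance to an invariant graph: `c` along the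
  -- fibre, and `2 σ` because the base point moves by `σ` under a graph of Lipschitz constant `2`.
  hcσ : c + 2 * σ < 1
  hσ : σ ≤ 1 / 100000
  f_deriv : ∀ p ∈ strip R, HasFDerivAt f (lin (a11 p) (a12 p)) p
  g_deriv : ∀ p ∈ strip R, HasFDerivAt g (lin (a21 p) (a22 p)) p
  cont11 : ContinuousOn a11 (strip R)
  cont12 : ContinuousOn a12 (strip R)
  cont21 : ContinuousOn a21 (strip R)
  cont22 : ContinuousOn a22 (strip R)
  b11 : ∀ p ∈ strip R, |a11 p - 2| ≤ 1 / 100000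
  b12 : ∀ p ∈ strip R, |a12 p| ≤ σ
  b21 : ∀ p ∈ strip R, |a21 p + Real.sin p.1| ≤ 1 / 100000
  b22 : ∀ p ∈ strip R, |a22 p - 1| ≤ 1 / 100000
  b22' : ∀ p ∈ strip R, a22 p ≤ c
  f_near : ∀ p ∈ strip R, |f p - 2 * p.1| ≤ 1 / 100000
  f_zero : ∀ y, R / 2 < y → y < 2 * R - 3 / 2 → |f (0, y)| ≤ η
  g_lower : ∀ p ∈ strip R, R + lam * (p.2 - R) + lam * (Real.cos p.1 - 1) - η ≤ g p
  g_upper : ∀ p ∈ strip R, g p ≤ R + lam * (p.2 - R) + η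

/-! ### The graph transform and its invariant Lipschitz graph. -/

namespace StripMap

variable {lam R η c σ : ℝ} {f g a11 a12 a21 a22 : ℝ × ℝ → ℝ}

/-- The graphs on which the graph transform acts. -/
def Adm (R : ℝ) (h : ℝ → ℝ) : Prop :=
  (∀ x ∈ Ioo (-7 : ℝ) 7, R - 1 - 4 * |x| ≤ h x ∧ h x ≤ R + 1) ∧
    ∀ x ∈ Ioo (-7 : ℝ) 7, ∀ y ∈ Ioo (-7 : ℝ) 7, |h x - h y| ≤ 2 * |x - y|

lemma Adm.mem_strip {h : ℝ → ℝ} (hR : 1000 ≤ R) (hh : Adm R h) (x : ℝ) {t : ℝ}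
    (ht : t ∈ Ioo (-7 : ℝ) 7) : (x, h t) ∈ strip R := by
  have h1 := hh.1 t ht
  have h2 : |t| < 7 := abs_lt.2 ht
  constructor <;> simp only <;> linarith

lemma vert_g (M : StripMap lam R η c σ f g a11 a12 a21 a22) {x y₁ y₂ : ℝ} (h1 : (x, y₁) ∈ strip R)
    (h2 : (x, y₂) ∈ strip R) (hy : y₁ ≤ y₂) :
    9 / 10 * (y₂ - y₁) ≤ g (x, y₂) - g (x, y₁) ∧ g (x, y₂) - g (x, y₁) ≤ c * (y₂ - y₁) := by
  have hs : ∀ t ∈ Icc y₁ y₂, (x, t) ∈ strip R := fun t ht =>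
    ⟨h1.1.trans_le ht.1, lt_of_le_of_lt ht.2 h2.2⟩
  refine sub_mem_of_hasDerivAt (φ := fun t => g (x, t)) (φ' := fun t => a22 (x, t)) hy
    (fun t ht => ?_) (fun t ht => ?_) (fun t ht => M.b22' _ (hs t ht))
  · have : HasDerivAt (fun t => g (x, t)) _ t := (M.g_deriv _ (hs t ht)).comp_hasDerivAt t
      ((hasDerivAt_const t x).prodMk (hasDerivAt_id t))
    simpa [lin_apply] using this
  · have := (abs_le.1 (M.b22 _ (hs t ht))).1
    linarith

lemma vert_f (M : StripMap lam R η c σ f g a11 a12 a21 a22) {x y₁ y₂ : ℝ} (h1 : (x, y₁) ∈ strip R)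
    (h2 : (x, y₂) ∈ strip R) : |f (x, y₂) - f (x, y₁)| ≤ σ * |y₂ - y₁| := by
  wlog hy : y₁ ≤ y₂ generalizing y₁ y₂
  · have := this h2 h1 (le_of_not_ge hy)
    rwa [abs_sub_comm, abs_sub_comm y₂]
  have hs : ∀ t ∈ Icc y₁ y₂, (x, t) ∈ strip R := fun t ht =>
    ⟨h1.1.trans_le ht.1, lt_of_le_of_lt ht.2 h2.2⟩
  have := sub_mem_of_hasDerivAt (φ := fun t => f (x, t)) (φ' := fun t => a12 (x, t)) hy
    (fun t ht => ?_) (fun t ht => (abs_le.1 (M.b12 _ (hs t ht))).1)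
    (fun t ht => (abs_le.1 (M.b12 _ (hs t ht))).2)
  · rw [abs_of_nonneg (sub_nonneg.2 hy), abs_le]
    constructor <;> linarith [this.1, this.2]
  · have : HasDerivAt (fun t => f (x, t)) _ t := (M.f_deriv _ (hs t ht)).comp_hasDerivAt t
      ((hasDerivAt_const t x).prodMk (hasDerivAt_id t))
    simpa [lin_apply] using this

lemma horiz_f (M : StripMap lam R η c σ f g a11 a12 a21 a22) {x₁ x₂ y : ℝ} (h1 : (x₁, y) ∈ strip R)
    (hx : x₁ ≤ x₂) :
    (2 - 1 / 100000) * (x₂ - x₁) ≤ f (x₂, y) - f (x₁, y) ∧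
      f (x₂, y) - f (x₁, y) ≤ (2 + 1 / 100000) * (x₂ - x₁) := by
  have hs : ∀ t ∈ Icc x₁ x₂, (t, y) ∈ strip R := fun t ht => h1
  refine sub_mem_of_hasDerivAt (φ := fun t => f (t, y)) (φ' := fun t => a11 (t, y)) hx
    (fun t ht => ?_) (fun t ht => ?_) (fun t ht => ?_)
  · have : HasDerivAt (fun t => f (t, y)) _ t := (M.f_deriv _ (hs t ht)).comp_hasDerivAt t
      ((hasDerivAt_id t).prodMk (hasDerivAt_const t y))
    simpa [lin_apply] using this
  · linarith [(abs_le.1 (M.b11 _ (hs t ht))).1]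
  · linarith [(abs_le.1 (M.b11 _ (hs t ht))).2]

lemma horiz_g (M : StripMap lam R η c σ f g a11 a12 a21 a22) {x₁ x₂ y : ℝ}
    (h1 : (x₁, y) ∈ strip R) : |g (x₂, y) - g (x₁, y)| ≤ (1 + 1 / 100000) * |x₂ - x₁| := by
  wlog hx : x₁ ≤ x₂ generalizing x₁ x₂
  · have := @this x₂ x₁ h1 (le_of_not_ge hx)
    rwa [abs_sub_comm, abs_sub_comm x₂]
  have hs : ∀ t ∈ Icc x₁ x₂, (t, y) ∈ strip R := fun t ht => h1
  have := sub_mem_of_hasDerivAt (φ := fun t => g (t, y)) (φ' := fun t => a21 (t, y))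
    (m := -(1 + 1 / 100000)) (M := 1 + 1 / 100000) hx
    (fun t ht => ?_) (fun t ht => ?_) (fun t ht => ?_)
  · rw [abs_of_nonneg (sub_nonneg.2 hx), abs_le]
    constructor <;> linarith [this.1, this.2]
  · have : HasDerivAt (fun t => g (t, y)) _ t := (M.g_deriv _ (hs t ht)).comp_hasDerivAt t
      ((hasDerivAt_id t).prodMk (hasDerivAt_const t y))
    simpa [lin_apply] using this
  · have := (abs_le.1 (M.b21 _ (hs t ht))).1
    have := Real.sin_le_one t
    simp only at *
    linarith
  · have := (abs_le.1 (M.b21 _ (hs t ht))).2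
    have := Real.neg_one_le_sin t
    simp only at *
    linarith

lemma vert_g_abs (M : StripMap lam R η c σ f g a11 a12 a21 a22) {x y₁ y₂ : ℝ}
    (h1 : (x, y₁) ∈ strip R) (h2 : (x, y₂) ∈ strip R) :
    |g (x, y₂) - g (x, y₁)| ≤ c * |y₂ - y₁| := by
  wlog hy : y₁ ≤ y₂ generalizing y₁ y₂
  · have := this h2 h1 (le_of_not_ge hy)
    rwa [abs_sub_comm, abs_sub_comm y₂]
  have := M.vert_g h1 h2 hy
  rw [abs_of_nonneg (sub_nonneg.2 hy), abs_of_nonneg (by linarith [this.1])]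
  exact this.2

/-- Along a `2`-Lipschitz graph the vertical variation enters `f` only through the factor `σ`, so
the horizontal stretching remains close to `2`. -/
lemma graph_f (M : StripMap lam R η c σ f g a11 a12 a21 a22) {h : ℝ → ℝ} (hh : Adm R h)
    {x₁ x₂ : ℝ} (h1 : x₁ ∈ Ioo (-7 : ℝ) 7) (h2 : x₂ ∈ Ioo (-7 : ℝ) 7) (hx : x₁ ≤ x₂) :
    199 / 100 * (x₂ - x₁) ≤ f (x₂, h x₂) - f (x₁, h x₁) ∧
      f (x₂, h x₂) - f (x₁, h x₁) ≤ 201 / 100 * (x₂ - x₁) := by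
  have e1 := M.horiz_f (hh.mem_strip M.hR x₁ h2) hx
  have e2 := M.vert_f (hh.mem_strip M.hR x₁ h1) (hh.mem_strip M.hR x₁ h2)
  have e3 := hh.2 x₂ h2 x₁ h1
  have hσ0 : 0 ≤ σ := (abs_nonneg _).trans (M.b12 _ (hh.mem_strip M.hR x₁ h1))
  rw [abs_of_nonneg (sub_nonneg.2 hx)] at e3
  have e4 : σ * |h x₂ - h x₁| ≤ 1 / 100000 * (2 * (x₂ - x₁)) :=
    mul_le_mul M.hσ e3 (abs_nonneg _) (by norm_num)
  have e5 := abs_le.1 (e2.trans e4)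
  constructor <;> linarith [e1.1, e1.2, e5.1, e5.2]

lemma graph_f_abs (M : StripMap lam R η c σ f g a11 a12 a21 a22) {h : ℝ → ℝ} (hh : Adm R h)
    {x₁ x₂ : ℝ} (h1 : x₁ ∈ Ioo (-7 : ℝ) 7) (h2 : x₂ ∈ Ioo (-7 : ℝ) 7) :
    199 / 100 * |x₂ - x₁| ≤ |f (x₂, h x₂) - f (x₁, h x₁)| ∧
      |f (x₂, h x₂) - f (x₁, h x₁)| ≤ 201 / 100 * |x₂ - x₁| := by
  wlog hx : x₁ ≤ x₂ generalizing x₁ x₂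
  · have := this h2 h1 (le_of_not_ge hx)
    rwa [abs_sub_comm, abs_sub_comm (f (x₂, h x₂))]
  have := M.graph_f hh h1 h2 hx
  rw [abs_of_nonneg (sub_nonneg.2 hx), abs_of_nonneg (by linarith [this.1])]
  exact this

/-- The slope `-sin` contributes at most about `1` and the graph itself at most `2`. Since `301 /
199 < 2`, the Lipschitz constant `2` is preserved by the transform. -/
lemma graph_g_abs (M : StripMap lam R η c σ f g a11 a12 a21 a22) {h : ℝ → ℝ} (hh : Adm R h)
    {x₁ x₂ : ℝ} (h1 : x₁ ∈ Ioo (-7 : ℝ) 7) (h2 : x₂ ∈ Ioo (-7 : ℝ) 7) :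
    |g (x₂, h x₂) - g (x₁, h x₁)| ≤ 301 / 100 * |x₂ - x₁| := by
  have e1 := M.horiz_g (x₁ := x₁) (x₂ := x₂) (hh.mem_strip M.hR x₁ h2)
  have e2 := M.vert_g_abs (hh.mem_strip M.hR x₁ h1) (hh.mem_strip M.hR x₁ h2)
  have e3 := hh.2 x₂ h2 x₁ h1
  have hσ0 : 0 ≤ σ := (abs_nonneg _).trans (M.b12 _ (hh.mem_strip M.hR x₁ h1))
  have e4 : c * |h x₂ - h x₁| ≤ 1 * (2 * |x₂ - x₁|) :=
    mul_le_mul (by linarith [M.hcσ]) e3 (abs_nonneg _) (by norm_num)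
  have e5 := abs_sub_le (g (x₂, h x₂)) (g (x₁, h x₂)) (g (x₁, h x₁))
  linarith [abs_nonneg (x₂ - x₁)]

lemma sigma_nonneg (M : StripMap lam R η c σ f g a11 a12 a21 a22) : 0 ≤ σ :=
  (abs_nonneg _).trans (M.b12 (0, R) ⟨by simp only; linarith [M.hR], by simp only; linarith [M.hR]⟩)

/-- Over `[-15/4, 15/4]` the angle runs across nearly `[-15/2, 15/2]`, which covers `(-7, 7)`. Thus
a graph over `(-7, 7)` determines its image over the same interval. -/
lemma exists_preimage (M : StripMap lam R η c σ f g a11 a12 a21 a22) {h : ℝ → ℝ} (hh : Adm R h)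
    {φ : ℝ} (hφ : φ ∈ Ioo (-7 : ℝ) 7) : ∃ x ∈ Ioo (-4 : ℝ) 4, f (x, h x) = φ := by
  have hsub : Icc (-15 / 4 : ℝ) (15 / 4) ⊆ Ioo (-7) 7 := fun x hx =>
    ⟨by linarith [hx.1], by linarith [hx.2]⟩
  have hcont : ContinuousOn (fun x => f (x, h x)) (Icc (-15 / 4 : ℝ) (15 / 4)) := by
    have : LipschitzOnWith (201 / 100) (fun x => f (x, h x)) (Icc (-15 / 4 : ℝ) (15 / 4)) := by
      refine LipschitzOnWith.of_dist_le_mul fun x hx y hy => ?_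
      have := (M.graph_f_abs hh (hsub hy) (hsub hx)).2
      simpa [Real.dist_eq] using this
    exact this.continuousOn
  have e1 := abs_le.1 (M.f_near (-15 / 4, h (-15 / 4))
    (hh.mem_strip M.hR _ (hsub ⟨le_rfl, by norm_num⟩)))
  have e2 := abs_le.1 (M.f_near (15 / 4, h (15 / 4))
    (hh.mem_strip M.hR _ (hsub ⟨by norm_num, le_rfl⟩)))
  simp only at e1 e2
  obtain ⟨x, hx, hxφ⟩ := intermediate_value_Icc (by norm_num) hcont
    (show φ ∈ Icc _ _ from ⟨by linarith [e1.2, hφ.1], by linarith [e2.1, hφ.2]⟩)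
  exact ⟨x, ⟨by linarith [hx.1], by linarith [hx.2]⟩, hxφ⟩

lemma four_sub_seven {x : ℝ} (hx : x ∈ Ioo (-4 : ℝ) 4) : x ∈ Ioo (-7 : ℝ) 7 :=
  ⟨by linarith [hx.1], by linarith [hx.2]⟩

open Classical in
/-- The graph transform. -/
def transform (f g : ℝ × ℝ → ℝ) (h : ℝ → ℝ) (φ : ℝ) : ℝ :=
  -- The default `0` never occurs for an admissible graph and an angle in `(-7, 7)`.
  if hx : ∃ x ∈ Ioo (-4 : ℝ) 4, f (x, h x) = φ then g (hx.choose, h hx.choose) else 0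

lemma transform_spec (M : StripMap lam R η c σ f g a11 a12 a21 a22) {h : ℝ → ℝ} (hh : Adm R h)
    {φ : ℝ} (hφ : φ ∈ Ioo (-7 : ℝ) 7) :
    ∃ x ∈ Ioo (-4 : ℝ) 4, f (x, h x) = φ ∧ transform f g h φ = g (x, h x) := by
  have hx := M.exists_preimage hh hφ
  exact ⟨hx.choose, hx.choose_spec.1, hx.choose_spec.2, by rw [transform, dif_pos hx]⟩

/-- For the lower bound, the loss after one step is at most `4 |x|` from the graph plus `2 |x|` from
`1 - cos x`, because `x² ≤ 4 |x|` for `|x| < 4`. The new angle is nearly `2 x`, so the class allows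
almost `8 |x|`. The constant terms are covered by `5 η ≤ 1 - lam`. -/
lemma adm_transform (M : StripMap lam R η c σ f g a11 a12 a21 a22) {h : ℝ → ℝ} (hh : Adm R h) :
    Adm R (transform f g h) := by
  constructor
  · intro φ hφ
    obtain ⟨x, hx, hxφ, he⟩ := M.transform_spec hh hφ
    have hx7 := four_sub_seven hx
    have hs := hh.mem_strip M.hR x hx7
    have h1 := M.g_lower _ hs
    have h2 := M.g_upper _ hs
    have h3 := hh.1 x hx7
    have h4 := Real.one_sub_sq_div_two_le_cos (x := x)
    have hη := M.hηlam
    have hη0 := M.hη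
    have hl := M.hlam
    simp only at h1 h2
    rw [he]
    constructor
    · have h0s := hh.mem_strip M.hR 0 hx7
      have hz := abs_le.1 (M.f_zero (h x) h0s.1 h0s.2)
      have hxabs : |x| < 4 := abs_lt.2 hx
      have hφabs : (2 - 1 / 100000) * |x| - η ≤ |φ| := by
        rw [← hxφ]
        rcases le_total 0 x with h0 | h0
        · have := (M.horiz_f h0s h0).1
          rw [abs_of_nonneg h0]
          refine le_trans ?_ (le_abs_self _)
          linarith [hz.1]
        · have := (M.horiz_f (x₁ := x) (x₂ := 0) hs h0).1
          rw [abs_of_nonpos h0]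
          refine le_trans ?_ (neg_le_abs _)
          linarith [hz.2]
      have hxx : x ^ 2 ≤ 4 * |x| := by
        rw [← sq_abs]; nlinarith [abs_nonneg x]
      have e1 : lam * (h x - R) ≥ lam * (-1 - 4 * |x|) :=
        mul_le_mul_of_nonneg_left (by linarith) hl.le
      have e2 : lam * (Real.cos x - 1) ≥ lam * (-(2 * |x|)) :=
        mul_le_mul_of_nonneg_left (by linarith) hl.le
      have e3 : lam * |x| ≤ |x| := by nlinarith [abs_nonneg x]
      nlinarith [abs_nonneg x]
    · have e1 : lam * (h x - R) ≤ lam * 1 := mul_le_mul_of_nonneg_left (by linarith) hl.le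
      linarith
  · intro φ hφ ψ hψ
    obtain ⟨x, hx, hxφ, he⟩ := M.transform_spec hh hφ
    obtain ⟨y, hy, hyψ, he'⟩ := M.transform_spec hh hψ
    have h1 := M.graph_g_abs hh (four_sub_seven hy) (four_sub_seven hx)
    have h2 := (M.graph_f_abs hh (four_sub_seven hy) (four_sub_seven hx)).1
    rw [hxφ, hyψ] at h2
    rw [he, he']
    linarith [abs_nonneg (x - y)]

/-- The two preimages of the same angle differ by at most `σ D / 1.99`, which moves the height along
the second graph by at most `3.01 σ D / 1.99 < 2 σ D`; the vertical comparison costs `c D`. -/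
lemma transform_contract (M : StripMap lam R η c σ f g a11 a12 a21 a22) {h k : ℝ → ℝ} {D : ℝ}
    (hh : Adm R h) (hk : Adm R k) (hD : ∀ x ∈ Ioo (-7 : ℝ) 7, |h x - k x| ≤ D) :
    ∀ x ∈ Ioo (-7 : ℝ) 7, |transform f g h x - transform f g k x| ≤ (c + 2 * σ) * D := by
  intro φ hφ
  obtain ⟨x, hx, hxφ, he⟩ := M.transform_spec hh hφ
  obtain ⟨y, hy, hyφ, he'⟩ := M.transform_spec hk hφ
  have hx7 := four_sub_seven hx
  have hy7 := four_sub_seven hy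
  have hs1 := hh.mem_strip M.hR x hx7
  have hs2 := hk.mem_strip M.hR x hx7
  have h1 := M.vert_f hs1 hs2
  have h2 := (M.graph_f_abs hk hy7 hx7).1
  have h3 := M.graph_g_abs hk hy7 hx7
  have h4 := M.vert_g_abs hs2 hs1
  have h5 := hD x hx7
  have h6 := M.sigma_nonneg
  rw [hxφ] at h1
  rw [hyφ] at h2
  rw [he, he']
  rw [abs_sub_comm (k x)] at h1
  have h7 : σ * |h x - k x| ≤ σ * D := mul_le_mul_of_nonneg_left h5 h6
  have h8 : c * |h x - k x| ≤ c * D := mul_le_mul_of_nonneg_left h5 M.hc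
  have h9 := abs_sub_le (g (x, h x)) (g (x, k x)) (g (y, k y))
  linarith [abs_nonneg (x - y)]

lemma exists_invariant_graph (M : StripMap lam R η c σ f g a11 a12 a21 a22) :
    ∃ h, Adm R h ∧ ∀ φ ∈ Ioo (-7 : ℝ) 7, transform f g h φ = h φ := by
  have h0 : Adm R (fun _ => R) :=
    ⟨fun x _ => ⟨by linarith [abs_nonneg x], by linarith⟩, fun x _ y _ => by simp⟩
  -- An admissible function differs from the constant `R` by at most `1 + 4 * 7 = 29` on the
  -- interval, so `40` is a safe first step.
  refine exists_fixed_function (Adm R) (transform f g) (c := c + 2 * σ) (C := 40)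
    (by linarith [M.hc, M.sigma_nonneg]) M.hcσ h0 (fun k hk => M.adm_transform hk) ?_
    (fun k l D hk hl hD => M.transform_contract hk hl hD) ?_
  · intro x hx
    have := (M.adm_transform h0).1 x hx
    have h2 : |x| < 7 := abs_lt.2 hx
    rw [abs_le]
    constructor <;> linarith [this.1, this.2]
  · intro u k hu hk
    have ht : ∀ x ∈ Ioo (-7 : ℝ) 7, Tendsto (fun n => u n x) atTop (𝓝 (k x)) := fun x hx =>
      hk.tendsto_at hx
    refine ⟨fun x hx => ⟨?_, ?_⟩, fun x hx y hy => ?_⟩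
    · exact ge_of_tendsto' (ht x hx) fun n => ((hu n).1 x hx).1
    · exact le_of_tendsto' (ht x hx) fun n => ((hu n).1 x hx).2
    · exact le_of_tendsto' ((ht x hx).sub (ht y hy)).abs fun n => (hu n).2 x hx y hy

end StripMap

/-! ### Invariant slopes and differentiability of the invariant graph. -/

namespace StripMap

variable {lam R η c σ : ℝ} {f g a11 a12 a21 a22 : ℝ × ℝ → ℝ}

/-- The action of the derivative on slopes. -/
def slope (a11 a12 a21 a22 : ℝ × ℝ → ℝ) (p : ℝ × ℝ) (t : ℝ) : ℝ :=
  (a21 p + a22 p * t) / (a11 p + a12 p * t)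

lemma abs_a12_mul (M : StripMap lam R η c σ f g a11 a12 a21 a22) {p : ℝ × ℝ} (hp : p ∈ strip R)
    {t : ℝ} (ht : |t| ≤ 2) : |a12 p * t| ≤ 2 / 100000 := by
  rw [abs_mul]
  have := mul_le_mul ((M.b12 p hp).trans M.hσ) ht (abs_nonneg _) (by norm_num)
  linarith

lemma den_bound (M : StripMap lam R η c σ f g a11 a12 a21 a22) {p : ℝ × ℝ} (hp : p ∈ strip R)
    {t : ℝ} (ht : |t| ≤ 2) : |a11 p + a12 p * t - 2| ≤ 3 / 100000 := by
  have h1 := abs_le.1 (M.abs_a12_mul hp ht)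
  have h2 := abs_le.1 (M.b11 p hp)
  rw [abs_le]
  constructor <;> linarith [h1.1, h1.2, h2.1, h2.2]

lemma num_bound (M : StripMap lam R η c σ f g a11 a12 a21 a22) {p : ℝ × ℝ} (hp : p ∈ strip R)
    {t : ℝ} (ht : |t| ≤ 2) :
    |a21 p + a22 p * t - (t - Real.sin p.1)| ≤ 3 / 100000 := by
  have h1 := abs_le.1 (M.b21 p hp)
  have h2 : |(a22 p - 1) * t| ≤ 1 / 100000 * 2 := by
    rw [abs_mul]
    exact mul_le_mul (M.b22 p hp) ht (abs_nonneg _) (by norm_num)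
  have h3 := abs_le.1 h2
  rw [abs_le]
  constructor <;> linarith [h1.1, h1.2, h3.1, h3.2]

/-- For the map `(x, y) ↦ (2 x, y + cos x)` a slope `t` over `x` becomes `(t - sin x) / 2`; this
bounds the deviation from that rule. -/
lemma slope_near (M : StripMap lam R η c σ f g a11 a12 a21 a22) {p : ℝ × ℝ} (hp : p ∈ strip R)
    {t : ℝ} (ht : |t| ≤ 2) :
    |slope a11 a12 a21 a22 p t - (t - Real.sin p.1) / 2| ≤ 6 / 100000 := by
  have hd := abs_le.1 (M.den_bound hp ht)
  have hn := abs_le.1 (M.num_bound hp ht)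
  have h3 : |t - Real.sin p.1| ≤ 3 := by
    have := abs_le.1 ht
    rw [abs_le]
    constructor <;> linarith [Real.neg_one_le_sin p.1, Real.sin_le_one p.1, this.1, this.2]
  have h3' := abs_le.1 h3
  have hpos : 0 < a11 p + a12 p * t := by linarith [hd.1]
  set D := a11 p + a12 p * t
  set u := t - Real.sin p.1
  have key : slope a11 a12 a21 a22 p t - u / 2 = ((a21 p + a22 p * t - u) - u * (D - 2) / 2) / D := by
    change (a21 p + a22 p * t) / D - u / 2 = _
    rw [eq_div_iff hpos.ne', sub_mul, div_mul_cancel₀ _ hpos.ne']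
    ring
  have h4 : |u * (D - 2) / 2| ≤ 3 * (3 / 100000) / 2 := by
    rw [abs_div, abs_mul, abs_two]
    have := mul_le_mul h3 (M.den_bound hp ht) (abs_nonneg _) (by norm_num)
    linarith
  have h5 := abs_le.1 h4
  rw [key, abs_div, abs_of_pos hpos, div_le_iff₀ hpos, abs_le]
  constructor <;> nlinarith [hd.1, hd.2, hn.1, hn.2, h5.1, h5.2]

lemma slope_bound (M : StripMap lam R η c σ f g a11 a12 a21 a22) {p : ℝ × ℝ} (hp : p ∈ strip R)
    {t : ℝ} (ht : |t| ≤ 2) : |slope a11 a12 a21 a22 p t| ≤ 2 := by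
  have h1 := abs_le.1 (M.slope_near hp ht)
  have h2 := abs_le.1 ht
  rw [abs_le]
  constructor <;>
    linarith [Real.neg_one_le_sin p.1, Real.sin_le_one p.1, h1.1, h1.2, h2.1, h2.2]

/-- The action on slopes is a Möbius map: its difference quotient is the determinant, about `2`,
over the product of two denominators, each about `2`. -/
lemma slope_contract (M : StripMap lam R η c σ f g a11 a12 a21 a22) {p : ℝ × ℝ} (hp : p ∈ strip R)
    {t t' : ℝ} (ht : |t| ≤ 2) (ht' : |t'| ≤ 2) :
    |slope a11 a12 a21 a22 p t - slope a11 a12 a21 a22 p t'| ≤ 6 / 10 * |t - t'| := by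
  have hd := abs_le.1 (M.den_bound hp ht)
  have hd' := abs_le.1 (M.den_bound hp ht')
  have hpos : 0 < a11 p + a12 p * t := by linarith [hd.1]
  have hpos' : 0 < a11 p + a12 p * t' := by linarith [hd'.1]
  have key : slope a11 a12 a21 a22 p t - slope a11 a12 a21 a22 p t' =
      (a11 p * a22 p - a12 p * a21 p) * (t - t') /
        ((a11 p + a12 p * t) * (a11 p + a12 p * t')) := by
    rw [slope, slope, div_sub_div _ _ hpos.ne' hpos'.ne']
    congr 1
    ring
  have hdet : |a11 p * a22 p - a12 p * a21 p| ≤ 21 / 10 := by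
    have e1 := abs_le.1 (M.b11 p hp)
    have e2 := abs_le.1 (M.b22 p hp)
    have e3 := abs_le.1 ((M.b12 p hp).trans M.hσ)
    have e4 := abs_le.1 (M.b21 p hp)
    have e5 : |a12 p * a21 p| ≤ 1 / 100000 * 2 := by
      rw [abs_mul]
      refine mul_le_mul ((M.b12 p hp).trans M.hσ) ?_ (abs_nonneg _) (by norm_num)
      rw [abs_le]
      constructor <;>
        linarith [Real.neg_one_le_sin p.1, Real.sin_le_one p.1, e4.1, e4.2]
    have e6 := abs_le.1 e5
    rw [abs_le]
    constructor <;> nlinarith [e1.1, e1.2, e2.1, e2.2, e6.1, e6.2]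
  rw [key, abs_div, abs_mul, abs_of_pos (mul_pos hpos hpos'), div_le_iff₀ (mul_pos hpos hpos')]
  have h1 := mul_le_mul_of_nonneg_right hdet (abs_nonneg (t - t'))
  have h2 : 39 / 10 ≤ (a11 p + a12 p * t) * (a11 p + a12 p * t') := by nlinarith [hd.1, hd'.1]
  have h3 := mul_le_mul_of_nonneg_left h2 (abs_nonneg (t - t'))
  linarith [abs_nonneg (t - t')]

/-- An invariant graph of `h`, with slope function `s` and inverse branch `v`. -/
structure InvGraph (R : ℝ) (f g a11 a12 a21 a22 : ℝ × ℝ → ℝ) (h s v : ℝ → ℝ) : Prop where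
  adm : Adm R h
  v_mem : ∀ φ ∈ Ioo (-7 : ℝ) 7, v φ ∈ Ioo (-4 : ℝ) 4
  f_v : ∀ φ ∈ Ioo (-7 : ℝ) 7, f (v φ, h (v φ)) = φ
  g_v : ∀ φ ∈ Ioo (-7 : ℝ) 7, g (v φ, h (v φ)) = h φ
  s_cont : ContinuousOn s (Ioo (-7 : ℝ) 7)
  s_bound : ∀ φ ∈ Ioo (-7 : ℝ) 7, |s φ| ≤ 2
  s_eq : ∀ φ ∈ Ioo (-7 : ℝ) 7, s φ = slope a11 a12 a21 a22 (v φ, h (v φ)) (s (v φ))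

lemma lipschitz_v (M : StripMap lam R η c σ f g a11 a12 a21 a22) {h v : ℝ → ℝ} (hh : Adm R h)
    (hv : ∀ φ ∈ Ioo (-7 : ℝ) 7, v φ ∈ Ioo (-4 : ℝ) 4)
    (hfv : ∀ φ ∈ Ioo (-7 : ℝ) 7, f (v φ, h (v φ)) = φ) {φ ψ : ℝ} (hφ : φ ∈ Ioo (-7 : ℝ) 7)
    (hψ : ψ ∈ Ioo (-7 : ℝ) 7) : 199 / 100 * |v φ - v ψ| ≤ |φ - ψ| := by
  have := (M.graph_f_abs hh (four_sub_seven (hv ψ hψ)) (four_sub_seven (hv φ hφ))).1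
  rwa [hfv φ hφ, hfv ψ hψ] at this

lemma continuousOn_v (M : StripMap lam R η c σ f g a11 a12 a21 a22) {h v : ℝ → ℝ} (hh : Adm R h)
    (hv : ∀ φ ∈ Ioo (-7 : ℝ) 7, v φ ∈ Ioo (-4 : ℝ) 4)
    (hfv : ∀ φ ∈ Ioo (-7 : ℝ) 7, f (v φ, h (v φ)) = φ) : ContinuousOn v (Ioo (-7) 7) := by
  have : LipschitzOnWith 1 v (Ioo (-7 : ℝ) 7) := by
    refine LipschitzOnWith.of_dist_le_mul fun φ hφ ψ hψ => ?_
    have := M.lipschitz_v hh hv hfv hφ hψ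
    simp only [Real.dist_eq, NNReal.coe_one, one_mul]
    linarith [abs_nonneg (v φ - v ψ)]
  exact this.continuousOn

lemma Adm.continuousOn {h : ℝ → ℝ} (hh : Adm R h) : ContinuousOn h (Ioo (-7) 7) := by
  have : LipschitzOnWith 2 h (Ioo (-7 : ℝ) 7) := by
    refine LipschitzOnWith.of_dist_le_mul fun φ hφ ψ hψ => ?_
    simpa [Real.dist_eq] using hh.2 φ hφ ψ hψ
  exact this.continuousOn

/-- Here `v` inverts the dynamics on the graph found by the graph transform. The slope function is
the fixed point of a second contraction, on continuous functions bounded by `2`. That it is the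
derivative of `h` is not yet known. -/
theorem exists_invGraph (M : StripMap lam R η c σ f g a11 a12 a21 a22) :
    ∃ h s v, InvGraph R f g a11 a12 a21 a22 h s v := by
  obtain ⟨h, hh, hT⟩ := M.exists_invariant_graph
  have hex : ∀ φ ∈ Ioo (-7 : ℝ) 7, ∃ x ∈ Ioo (-4 : ℝ) 4, f (x, h x) = φ ∧ g (x, h x) = h φ := by
    intro φ hφ
    obtain ⟨x, hx, h1, h2⟩ := M.transform_spec hh hφ
    exact ⟨x, hx, h1, by rw [← h2, hT φ hφ]⟩
  choose! v hv4 hvf hvg using hex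
  have hvc := M.continuousOn_v hh hv4 hvf
  have hmaps : MapsTo v (Ioo (-7) 7) (Ioo (-7) 7) := fun φ hφ => four_sub_seven (hv4 φ hφ)
  have hpc : ContinuousOn (fun φ => (v φ, h (v φ))) (Ioo (-7 : ℝ) 7) :=
    hvc.prodMk (hh.continuousOn.comp hvc hmaps)
  have hps : MapsTo (fun φ => (v φ, h (v φ))) (Ioo (-7 : ℝ) 7) (strip R) := fun φ hφ =>
    hh.mem_strip M.hR _ (hmaps hφ)
  suffices hs : ∃ s : ℝ → ℝ, (ContinuousOn s (Ioo (-7) 7) ∧ ∀ φ ∈ Ioo (-7 : ℝ) 7, |s φ| ≤ 2) ∧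
      ∀ φ ∈ Ioo (-7 : ℝ) 7, slope a11 a12 a21 a22 (v φ, h (v φ)) (s (v φ)) = s φ by
    obtain ⟨s, ⟨hsc, hsb⟩, hs⟩ := hs
    exact ⟨h, s, v, hh, hv4, hvf, hvg, hsc, hsb, fun φ hφ => (hs φ hφ).symm⟩
  refine exists_fixed_function (J := Ioo (-7 : ℝ) 7)
    (fun s => ContinuousOn s (Ioo (-7) 7) ∧ ∀ φ ∈ Ioo (-7 : ℝ) 7, |s φ| ≤ 2)
    (fun s φ => slope a11 a12 a21 a22 (v φ, h (v φ)) (s (v φ))) (c := 6 / 10) (C := 2)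
    (k₀ := fun _ => 0) (by norm_num) (by norm_num) ⟨continuousOn_const, by simp⟩ ?_ ?_ ?_ ?_
  · rintro s ⟨hsc, hsb⟩
    refine ⟨?_, fun φ hφ => M.slope_bound (hps hφ) (hsb _ (hmaps hφ))⟩
    have hsv : ContinuousOn (fun φ => s (v φ)) (Ioo (-7 : ℝ) 7) := hsc.comp hvc hmaps
    refine ContinuousOn.div ((M.cont21.comp hpc hps).add ((M.cont22.comp hpc hps).mul hsv))
      ((M.cont11.comp hpc hps).add ((M.cont12.comp hpc hps).mul hsv)) ?_
    intro φ hφ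
    have := (abs_le.1 (M.den_bound (hps hφ) (hsb _ (hmaps hφ)))).1
    simp only at *
    linarith
  · intro φ hφ
    simpa using M.slope_bound (hps hφ) (t := 0) (by simp)
  · intro k l D hk hl hD φ hφ
    refine (M.slope_contract (hps hφ) (hk.2 _ (hmaps hφ)) (hl.2 _ (hmaps hφ))).trans ?_
    have := hD _ (hmaps hφ)
    linarith
  · intro u k hu hk
    refine ⟨hk.continuousOn (Eventually.frequently (.of_forall fun n => (hu n).1)), fun φ hφ => ?_⟩
    exact le_of_tendsto' (hk.tendsto_at hφ).abs fun n => (hu n).2 φ hφ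

namespace InvGraph

variable {h s v : ℝ → ℝ}

lemma mem_strip (G : InvGraph R f g a11 a12 a21 a22 h s v)
    (M : StripMap lam R η c σ f g a11 a12 a21 a22) (x : ℝ) {t : ℝ} (ht : t ∈ Ioo (-7 : ℝ) 7) :
    (x, h t) ∈ strip R := G.adm.mem_strip M.hR x ht

lemma v_mem' (G : InvGraph R f g a11 a12 a21 a22 h s v) {φ : ℝ} (hφ : φ ∈ Ioo (-7 : ℝ) 7) :
    v φ ∈ Ioo (-7 : ℝ) 7 := four_sub_seven (G.v_mem φ hφ)

lemma v_unique (G : InvGraph R f g a11 a12 a21 a22 h s v)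
    (M : StripMap lam R η c σ f g a11 a12 a21 a22) {x : ℝ} (hx : x ∈ Ioo (-7 : ℝ) 7)
    (hf : f (x, h x) ∈ Ioo (-7 : ℝ) 7) : v (f (x, h x)) = x := by
  have h1 := (M.graph_f_abs G.adm hx (G.v_mem' hf)).1
  rw [G.f_v _ hf, sub_self, abs_zero] at h1
  have h2 : |v (f (x, h x)) - x| = 0 := le_antisymm (by linarith) (abs_nonneg _)
  exact sub_eq_zero.1 (abs_eq_zero.1 h2)

lemma g_graph (G : InvGraph R f g a11 a12 a21 a22 h s v)
    (M : StripMap lam R η c σ f g a11 a12 a21 a22) {x : ℝ} (hx : x ∈ Ioo (-7 : ℝ) 7)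
    (hf : f (x, h x) ∈ Ioo (-7 : ℝ) 7) : g (x, h x) = h (f (x, h x)) := by
  have := G.g_v _ hf
  rwa [G.v_unique M hx hf] at this

/-- Invariance transports the linearization error from `v φ` to `φ`. The error is multiplied by
about `1`, whereas the increment of the angle doubles, so the constant improves by nearly one half.
-/
lemma diff_step (G : InvGraph R f g a11 a12 a21 a22 h s v)
    (M : StripMap lam R η c σ f g a11 a12 a21 a22) {C : ℝ} (hC : 0 < C)
    (hP : ∀ φ ∈ Ioo (-7 : ℝ) 7, ∀ᶠ y in 𝓝 φ, |h y - h φ - s φ * (y - φ)| ≤ C * |y - φ|) :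
    ∀ φ ∈ Ioo (-7 : ℝ) 7, ∀ᶠ y in 𝓝 φ,
      |h y - h φ - s φ * (y - φ)| ≤ 6 / 10 * C * |y - φ| := by
  intro φ hφ
  have hJ : Ioo (-7 : ℝ) 7 ∈ 𝓝 φ := Ioo_mem_nhds hφ.1 hφ.2
  set x := v φ with hx
  have hx7 : x ∈ Ioo (-7 : ℝ) 7 := G.v_mem' hφ
  set p : ℝ × ℝ := (x, h x) with hp
  have hps : p ∈ strip R := G.mem_strip M x hx7
  have hvc : ContinuousAt v φ := (M.continuousOn_v G.adm G.v_mem G.f_v).continuousAt hJ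
  have hhc : ContinuousAt h x := G.adm.continuousOn.continuousAt (Ioo_mem_nhds hx7.1 hx7.2)
  have hpc : Tendsto (fun y => (v y, h (v y))) (𝓝 φ) (𝓝 p) :=
    hvc.tendsto.prodMk_nhds (Tendsto.comp (f := v) hhc hvc.tendsto)
  -- Remainders of this size in `f` and `g` are affordable: `1.01 + 0.006`, divided by the
  -- stretching `1.99`, is below `0.6`.
  have hδ : 0 < C / 1000 := by positivity
  have ef := hpc.eventually ((M.f_deriv p hps).isLittleO.bound hδ)
  have eg := hpc.eventually ((M.g_deriv p hps).isLittleO.bound hδ)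
  have eP := hvc.tendsto.eventually (hP x hx7)
  filter_upwards [ef, eg, eP, hJ] with y hf hg hPy hy
  have hy7 := G.v_mem' hy
  have hlip := M.lipschitz_v G.adm G.v_mem G.f_v hy hφ
  have hL := G.adm.2 _ hy7 _ hx7
  rw [G.f_v y hy, hp, G.f_v φ hφ, lin_apply] at hf
  rw [G.g_v y hy, hp, G.g_v φ hφ, lin_apply] at hg
  simp only [Prod.fst_sub, Prod.snd_sub, Real.norm_eq_abs] at hf hg
  rw [← hp] at hf hg
  set k := v y - x with hk
  set Δ := h (v y) - h x with hΔ
  have hnorm : ‖((v y, h (v y)) : ℝ × ℝ) - (x, h x)‖ ≤ 2 * |k| := by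
    rw [Prod.norm_def]
    refine max_le ?_ hL
    simp only [Prod.fst_sub, Real.norm_eq_abs]
    linarith [abs_nonneg k]
  have hf' : |y - φ - (a11 p * k + a12 p * Δ)| ≤ C / 1000 * (2 * |k|) :=
    hf.trans (mul_le_mul_of_nonneg_left hnorm hδ.le)
  have hg' : |h y - h φ - (a21 p * k + a22 p * Δ)| ≤ C / 1000 * (2 * |k|) :=
    hg.trans (mul_le_mul_of_nonneg_left hnorm hδ.le)
  have hsx := G.s_bound x hx7
  have hden := abs_le.1 (M.den_bound hps hsx)
  have hsφ := G.s_bound φ hφ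
  have hseq : s φ * (a11 p + a12 p * s x) = a21 p + a22 p * s x := by
    rw [G.s_eq φ hφ, slope]
    exact div_mul_cancel₀ _ (by linarith [hden.1])
  set e := Δ - s x * k with he
  -- The invariance `hseq` of the slope cancels the terms linear in `k`; only remainders and the
  -- propagated error `e` are left.
  have hident : h y - h φ - s φ * (y - φ) =
      (h y - h φ - (a21 p * k + a22 p * Δ)) - s φ * (y - φ - (a11 p * k + a12 p * Δ)) +
        (a22 p - s φ * a12 p) * e := by
    have h1 : Δ = e + s x * k := by rw [he]; ring
    rw [h1]
    linear_combination (-k) * hseq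
  have h1 : |s φ * (y - φ - (a11 p * k + a12 p * Δ))| ≤ 2 * (C / 1000 * (2 * |k|)) := by
    rw [abs_mul]
    exact mul_le_mul hsφ hf' (abs_nonneg _) (by norm_num)
  have hq : |a22 p - s φ * a12 p| ≤ 101 / 100 := by
    have e1 := abs_le.1 (M.b22 p hps)
    have e2 : |s φ * a12 p| ≤ 2 / 100000 := by rw [mul_comm]; exact M.abs_a12_mul hps hsφ
    have e3 := abs_le.1 e2
    rw [abs_le]
    constructor <;> linarith [e1.1, e1.2, e3.1, e3.2]
  have h2 : |(a22 p - s φ * a12 p) * e| ≤ 101 / 100 * (C * |k|) := by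
    rw [abs_mul]
    exact mul_le_mul hq hPy (abs_nonneg _) (by norm_num)
  have h3 : C * (199 / 100 * |k|) ≤ C * |y - φ| := mul_le_mul_of_nonneg_left hlip hC.le
  rw [hident]
  have t1 := abs_add_le ((h y - h φ - (a21 p * k + a22 p * Δ)) -
    s φ * (y - φ - (a11 p * k + a12 p * Δ))) ((a22 p - s φ * a12 p) * e)
  have t2 := abs_sub (h y - h φ - (a21 p * k + a22 p * Δ))
    (s φ * (y - φ - (a11 p * k + a12 p * Δ)))
  have hCk : 0 ≤ C * |k| := by positivity
  linarith

/-- The Lipschitz bound on `h` and the bound on `s` give the linearization error with constant `2 +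
2 = 4`. Each use of `diff_step` multiplies it by `0.6`, on a smaller neighbourhood, so it becomes
smaller than any `e`. -/
theorem hasDerivAt (G : InvGraph R f g a11 a12 a21 a22 h s v)
    (M : StripMap lam R η c σ f g a11 a12 a21 a22) {φ : ℝ} (hφ : φ ∈ Ioo (-7 : ℝ) 7) :
    HasDerivAt h (s φ) φ := by
  have hP : ∀ n : ℕ, ∀ φ ∈ Ioo (-7 : ℝ) 7, ∀ᶠ y in 𝓝 φ,
      |h y - h φ - s φ * (y - φ)| ≤ 4 * (6 / 10 : ℝ) ^ n * |y - φ| := by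
    intro n
    induction n with
    | zero =>
      intro φ hφ
      filter_upwards [Ioo_mem_nhds hφ.1 hφ.2] with y hy
      have h1 := G.adm.2 y hy φ hφ
      have h2 : |s φ * (y - φ)| ≤ 2 * |y - φ| := by
        rw [abs_mul]
        exact mul_le_mul_of_nonneg_right (G.s_bound φ hφ) (abs_nonneg _)
      have h3 := abs_sub (h y - h φ) (s φ * (y - φ))
      simp only [pow_zero, mul_one]
      linarith
    | succ n ih =>
      have := G.diff_step M (by positivity) ih
      intro φ hφ
      filter_upwards [this φ hφ] with y hy
      calc _ ≤ _ := hy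
        _ = _ := by ring
  rw [hasDerivAt_iff_isLittleO, Asymptotics.isLittleO_iff]
  intro e he
  have h0 : Tendsto (fun n : ℕ => 4 * (6 / 10 : ℝ) ^ n) atTop (𝓝 0) := by
    simpa using (tendsto_pow_atTop_nhds_zero_of_lt_one (by norm_num : (0 : ℝ) ≤ 6 / 10)
      (by norm_num)).const_mul 4
  obtain ⟨n, hn⟩ := (h0.eventually (gt_mem_nhds he)).exists
  filter_upwards [hP n φ hφ] with y hy
  simp only [smul_eq_mul, Real.norm_eq_abs]
  rw [mul_comm (y - φ)]
  exact hy.trans (mul_le_mul_of_nonneg_right (le_of_lt hn) (abs_nonneg _))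

end InvGraph

end StripMap

/-! ### The limit slope function -/

/-- The function `∑ 2⁻ᵏ sin (2⁻ᵏ x)`, summed over `k ≥ 1`. -/
def sinSum (x : ℝ) : ℝ := ∑' k : ℕ, (1 / 2 : ℝ) ^ (k + 1) * Real.sin (x * (1 / 2 : ℝ) ^ (k + 1))

lemma summable_sinSum (x : ℝ) :
    Summable fun k : ℕ => (1 / 2 : ℝ) ^ (k + 1) * Real.sin (x * (1 / 2 : ℝ) ^ (k + 1)) := by
  have hg : Summable fun k : ℕ => (1 / 2 : ℝ) ^ (k + 1) :=
    (summable_nat_add_iff 1).2 (summable_geometric_of_lt_one (by norm_num) (by norm_num))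
  refine Summable.of_norm_bounded hg fun k => ?_
  rw [norm_mul, Real.norm_of_nonneg (by positivity), Real.norm_eq_abs]
  exact mul_le_of_le_one_right (by positivity) (Real.abs_sin_le_one _)

/-- Up to sign this is the invariance of a slope function under the limit rule `t ↦ (t - sin (x /
2)) / 2`. -/
lemma sinSum_eq (x : ℝ) : sinSum x = (sinSum (x / 2) + Real.sin (x / 2)) / 2 := by
  unfold sinSum
  rw [(summable_sinSum x).tsum_eq_zero_add]
  have h : ∀ k : ℕ, (1 / 2 : ℝ) ^ (k + 1 + 1) * Real.sin (x * (1 / 2 : ℝ) ^ (k + 1 + 1)) =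
      1 / 2 * ((1 / 2 : ℝ) ^ (k + 1) * Real.sin (x / 2 * (1 / 2 : ℝ) ^ (k + 1))) := by
    intro k
    rw [pow_succ _ (k + 1)]
    ring_nf
  simp_rw [h]
  rw [tsum_mul_left]
  simp only [zero_add, pow_one]
  rw [show x * (1 / 2) = x / 2 by ring]
  ring

lemma sinSum_neg (x : ℝ) : sinSum (-x) = -sinSum x := by
  unfold sinSum
  rw [← tsum_neg]
  congr 1
  ext k
  rw [neg_mul, Real.sin_neg, mul_neg]

lemma abs_sin_sub_sin_le (x y : ℝ) : |Real.sin x - Real.sin y| ≤ |x - y| := by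
  have h : LipschitzWith 1 Real.sin := by
    refine lipschitzWith_of_nnnorm_deriv_le Real.differentiable_sin fun x => ?_
    rw [Real.deriv_sin, ← NNReal.coe_le_coe, coe_nnnorm, Real.norm_eq_abs]
    exact Real.abs_cos_le_one x
  simpa [Real.dist_eq] using h.dist_le_mul x y

/-- Termwise the Lipschitz constants are `4⁻ᵏ`, with sum `1 / 3`. -/
lemma abs_sinSum_sub_le (x y : ℝ) : |sinSum x - sinSum y| ≤ |x - y| / 3 := by
  have hs := (summable_sinSum x).sub (summable_sinSum y)
  have hg : HasSum (fun k : ℕ => |x - y| / 4 * (1 / 4 : ℝ) ^ k) (|x - y| / 3) := by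
    have := (hasSum_geometric_of_lt_one (r := (1 / 4 : ℝ)) (by norm_num) (by norm_num)).mul_left
      (|x - y| / 4)
    rwa [show |x - y| / 4 * (1 - 1 / 4 : ℝ)⁻¹ = |x - y| / 3 by norm_num; ring] at this
  rw [sinSum, sinSum, ← (summable_sinSum x).tsum_sub (summable_sinSum y), ← Real.norm_eq_abs]
  refine tsum_of_norm_bounded hg fun k => ?_
  rw [← mul_sub, norm_mul, Real.norm_of_nonneg (by positivity), Real.norm_eq_abs]
  have h1 := abs_sin_sub_sin_le (x * (1 / 2 : ℝ) ^ (k + 1)) (y * (1 / 2 : ℝ) ^ (k + 1))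
  rw [← sub_mul, abs_mul, abs_of_nonneg (by positivity : (0 : ℝ) ≤ (1 / 2) ^ (k + 1))] at h1
  calc _ ≤ (1 / 2 : ℝ) ^ (k + 1) * (|x - y| * (1 / 2) ^ (k + 1)) :=
        mul_le_mul_of_nonneg_left h1 (by positivity)
    _ = |x - y| / 4 * ((1 / 2) * (1 / 2)) ^ k := by rw [mul_pow]; ring
    _ = _ := by norm_num

lemma abs_sinSum_le (x : ℝ) : |sinSum x| ≤ 1 := by
  have hg : HasSum (fun k : ℕ => (1 / 2 : ℝ) * (1 / 2 : ℝ) ^ k) 1 := by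
    have := (hasSum_geometric_of_lt_one (r := (1 / 2 : ℝ)) (by norm_num) (by norm_num)).mul_left
      (1 / 2)
    rwa [show (1 / 2 : ℝ) * (1 - 1 / 2)⁻¹ = 1 by norm_num] at this
  rw [sinSum, ← Real.norm_eq_abs]
  refine tsum_of_norm_bounded hg fun k => ?_
  rw [norm_mul, Real.norm_of_nonneg (by positivity), Real.norm_eq_abs, pow_succ']
  exact mul_le_of_le_one_right (by positivity) (Real.abs_sin_le_one _)

/-- All the arguments `2⁻ᵏ x` with `k ≥ 1` lie in `[0, π]`. -/
lemma sinSum_nonneg {x : ℝ} (h0 : 0 ≤ x) (h1 : x ≤ 2 * Real.pi) : 0 ≤ sinSum x := by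
  refine tsum_nonneg fun k => mul_nonneg (by positivity) (Real.sin_nonneg_of_nonneg_of_le_pi
    (by positivity) ?_)
  have : (1 / 2 : ℝ) ^ (k + 1) ≤ 1 / 2 := by
    rw [pow_succ']
    exact mul_le_of_le_one_right (by norm_num) (pow_le_one₀ (by norm_num) (by norm_num))
  nlinarith

/-- The first two terms suffice. The terms `sin (x / 2)` are nonnegative, and reflection turns `sin
(x / 4)` into `cos (x / 4)`; in the first quadrant sine plus cosine is at least `1`, with weight `1
/ 4`. -/
lemma sinSum_add_reflect {x : ℝ} (h0 : 0 ≤ x) (h1 : x ≤ 2 * Real.pi) :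
    1 / 4 ≤ sinSum x + sinSum (2 * Real.pi - x) := by
  have hS : ∀ y, 0 ≤ y → y ≤ 2 * Real.pi →
      Real.sin (y / 2) / 2 + Real.sin (y / 4) / 4 ≤ sinSum y := by
    intro y hy0 hy1
    have e1 := sinSum_eq y
    have e2 := sinSum_eq (y / 2)
    have e3 : 0 ≤ sinSum (y / 2 / 2) := sinSum_nonneg (by linarith) (by linarith)
    rw [show y / 2 / 2 = y / 4 by ring] at e2 e3
    linarith
  have e1 := hS x h0 h1
  have e2 := hS (2 * Real.pi - x) (by linarith) (by linarith)
  have s1 : 0 ≤ Real.sin (x / 2) := Real.sin_nonneg_of_nonneg_of_le_pi (by linarith) (by linarith)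
  have s2 : 0 ≤ Real.sin ((2 * Real.pi - x) / 2) :=
    Real.sin_nonneg_of_nonneg_of_le_pi (by linarith) (by linarith)
  have s3 : Real.sin ((2 * Real.pi - x) / 4) = Real.cos (x / 4) := by
    rw [← Real.sin_pi_div_two_sub]
    ring_nf
  rw [s3] at e2
  have s4 : 0 ≤ Real.sin (x / 4) :=
    Real.sin_nonneg_of_nonneg_of_le_pi (by linarith) (by linarith [Real.pi_pos])
  have s5 : 0 ≤ Real.cos (x / 4) :=
    Real.cos_nonneg_of_neg_pi_div_two_le_of_le (by linarith [Real.pi_pos]) (by linarith)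
  have s6 := Real.sin_sq_add_cos_sq (x / 4)
  have s7 : 1 ≤ Real.sin (x / 4) + Real.cos (x / 4) := by nlinarith
  linarith

/-- Leaving `[0, 2π]` by `1 / 10` costs at most `2 / 30`, by the Lipschitz constant `1 / 3`. -/
lemma sinSum_add_reflect' {x : ℝ} (h0 : -(1 / 10) ≤ x) (h1 : x ≤ 2 * Real.pi + 1 / 10) :
    18 / 100 ≤ sinSum x + sinSum (2 * Real.pi - x) := by
  obtain ⟨y, hy0, hy1, hxy⟩ : ∃ y, 0 ≤ y ∧ y ≤ 2 * Real.pi ∧ |x - y| ≤ 1 / 10 := by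
    rcases lt_or_ge x 0 with hx | hx
    · exact ⟨0, le_rfl, by positivity, by rw [abs_le]; constructor <;> linarith⟩
    rcases lt_or_ge (2 * Real.pi) x with hx' | hx'
    · exact ⟨2 * Real.pi, by positivity, le_rfl, by rw [abs_le]; constructor <;> linarith⟩
    · exact ⟨x, hx, hx', by simp⟩
  have e1 := sinSum_add_reflect hy0 hy1
  have e2 := abs_le.1 (abs_sinSum_sub_le x y)
  have e3 := abs_le.1 (abs_sinSum_sub_le (2 * Real.pi - x) (2 * Real.pi - y))
  rw [sub_sub_sub_cancel_left, abs_sub_comm y] at e3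
  linarith [e2.1, e3.1]

/-! ### The corner, and the dynamics around the invariant graph. -/

namespace StripMap

namespace InvGraph

variable {lam R η c σ : ℝ} {f g a11 a12 a21 a22 : ℝ × ℝ → ℝ} {h s v : ℝ → ℝ}

/-- `s` and `-sinSum` obey nearly the same functional equation, in which the previous value is
halved. The discrepancy per step thus adds up to about twice its size. -/
lemma slope_near_sinSum (G : InvGraph R f g a11 a12 a21 a22 h s v)
    (M : StripMap lam R η c σ f g a11 a12 a21 a22) {φ : ℝ} (hφ : φ ∈ Ioo (-7 : ℝ) 7) :
    |s φ + sinSum φ| ≤ 15 / 100000 := by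
  have key : ∀ n : ℕ, ∀ φ ∈ Ioo (-7 : ℝ) 7,
      |s φ + sinSum φ| ≤ 3 * (1 / 2 : ℝ) ^ n + 15 / 100000 := by
    intro n
    induction n with
    | zero =>
      intro φ hφ
      have h1 := abs_add_le (s φ) (sinSum φ)
      have h2 := G.s_bound φ hφ
      have h3 := abs_sinSum_le φ
      simp only [pow_zero]
      linarith
    | succ n ih =>
      intro φ hφ
      have hx7 := G.v_mem' hφ
      have e1 := M.slope_near (G.mem_strip M (v φ) hx7) (G.s_bound _ hx7)
      have e2 := M.f_near _ (G.mem_strip M (v φ) hx7)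
      rw [G.f_v φ hφ] at e2
      rw [← G.s_eq φ hφ] at e1
      simp only at e1 e2
      have e3 := sinSum_eq φ
      have e4 := abs_sinSum_sub_le (φ / 2) (v φ)
      have e5 := abs_sin_sub_sin_le (φ / 2) (v φ)
      have e6 : |φ / 2 - v φ| ≤ 1 / 100000 / 2 := by
        rw [show φ / 2 - v φ = (φ - 2 * v φ) / 2 by ring, abs_div, abs_two]
        linarith
      have e7 := ih (v φ) hx7
      rw [abs_le] at e1 e4 e5 e7 ⊢
      rw [pow_succ]
      constructor <;> linarith [e1.1, e1.2, e4.1, e4.2, e5.1, e5.2, e7.1, e7.2]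
  have h0 : Tendsto (fun n : ℕ => 3 * (1 / 2 : ℝ) ^ n + 15 / 100000) atTop (𝓝 (15 / 100000)) := by
    simpa using ((tendsto_pow_atTop_nhds_zero_of_lt_one (by norm_num : (0 : ℝ) ≤ 1 / 2)
      (by norm_num)).const_mul 3).add_const (15 / 100000 : ℝ)
  exact ge_of_tendsto' h0 fun n => key n φ hφ

/-- The derivative of `h x - h (x - 2π)` is close to `-(sinSum x + sinSum (2π - x))`, hence bounded
away from `0`. Monotonicity gives the crossing, its transversality, and the order of the two turns
on either side. The margin `1 / 10` is there because doubling the angles of `[q - 2π, q]` may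
slightly overshoot `±2π`. -/
lemma exists_corner (G : InvGraph R f g a11 a12 a21 a22 h s v)
    (M : StripMap lam R η c σ f g a11 a12 a21 a22) :
    ∃ q, |q - Real.pi| ≤ 1 / 100 ∧ h q = h (q - 2 * Real.pi) ∧ s q ≠ s (q - 2 * Real.pi) ∧
      (∀ x ∈ Icc q (2 * Real.pi + 1 / 10), h x ≤ h (x - 2 * Real.pi)) ∧
      ∀ x ∈ Icc (-(2 * Real.pi) - 1 / 10) (q - 2 * Real.pi), h x ≤ h (x + 2 * Real.pi) := by
  have hpi1 := Real.pi_gt_d2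
  have hpi2 := Real.pi_lt_d2
  set π := Real.pi with hπ
  have hmem : ∀ x ∈ Icc (-(1 / 10)) (2 * π + 1 / 10),
      x ∈ Ioo (-7 : ℝ) 7 ∧ x - 2 * π ∈ Ioo (-7 : ℝ) 7 := by
    intro x hx
    exact ⟨⟨by linarith [hx.1], by linarith [hx.2]⟩, ⟨by linarith [hx.1], by linarith [hx.2]⟩⟩
  have hneg : ∀ x ∈ Icc (-(1 / 10)) (2 * π + 1 / 10), s x - s (x - 2 * π) ≤ -(17 / 100) := by
    intro x hx
    have e1 := abs_le.1 (G.slope_near_sinSum M (hmem x hx).1)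
    have e2 := abs_le.1 (G.slope_near_sinSum M (hmem x hx).2)
    have e3 := sinSum_add_reflect' hx.1 hx.2
    have e4 := sinSum_neg (2 * π - x)
    rw [neg_sub] at e4
    linarith [e1.2, e2.1]
  set d : ℝ → ℝ := fun x => h x - h (x - 2 * π) with hd
  have hdd : ∀ x ∈ Icc (-(1 / 10)) (2 * π + 1 / 10),
      HasDerivAt d (s x - s (x - 2 * π)) x := by
    intro x hx
    exact (G.hasDerivAt M (hmem x hx).1).sub
      ((G.hasDerivAt M (hmem x hx).2).comp_sub_const x (2 * π))
  have hdec : ∀ x y, -(1 / 10) ≤ x → x ≤ y → y ≤ 2 * π + 1 / 10 →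
      d y - d x ≤ -(17 / 100) * (y - x) := by
    intro x y hx hxy hy
    refine (sub_mem_of_hasDerivAt (m := -4) hxy (fun t ht => hdd t ⟨hx.trans ht.1, ht.2.trans hy⟩)
      (fun t ht => ?_) (fun t ht => hneg t ⟨hx.trans ht.1, ht.2.trans hy⟩)).2
    have hm := hmem t ⟨hx.trans ht.1, ht.2.trans hy⟩
    have := abs_le.1 (G.s_bound _ hm.1)
    have := abs_le.1 (G.s_bound _ hm.2)
    linarith
  -- `sinSum` is odd, so `h` is almost even: `h x - h (-x)` has derivative at most `3 * 10⁻⁴` in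
  -- modulus, integrated over `[0, π]`.
  have hdpi : |d π| ≤ 1 / 1000 := by
    have he : ∀ t ∈ Icc 0 π, HasDerivAt (fun x => h x - h (-x)) (s t + s (-t)) t := by
      intro t ht
      have h1 : t ∈ Ioo (-7 : ℝ) 7 := ⟨by linarith [ht.1], by linarith [ht.2]⟩
      have h2 : -t ∈ Ioo (-7 : ℝ) 7 := ⟨by linarith [ht.2], by linarith [ht.1]⟩
      have h3 : HasDerivAt (fun x => h (-x)) (-s (-t)) t := by
        have := (G.hasDerivAt M h2).comp t (hasDerivAt_neg t)
        simpa [Function.comp_def] using this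
      have := (G.hasDerivAt M h1).sub h3
      rwa [sub_neg_eq_add] at this
    have hb : ∀ t ∈ Icc 0 π, |s t + s (-t)| ≤ 30 / 100000 := by
      intro t ht
      have e1 := abs_le.1 (G.slope_near_sinSum M (φ := t) ⟨by linarith [ht.1], by linarith [ht.2]⟩)
      have e2 := abs_le.1 (G.slope_near_sinSum M (φ := -t) ⟨by linarith [ht.2], by linarith [ht.1]⟩)
      have e3 := sinSum_neg t
      rw [abs_le]
      constructor <;> linarith [e1.1, e1.2, e2.1, e2.2]
    have := sub_mem_of_hasDerivAt Real.pi_pos.le he (fun t ht => (abs_le.1 (hb t ht)).1)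
      (fun t ht => (abs_le.1 (hb t ht)).2)
    simp only [neg_zero, sub_self, sub_zero] at this
    rw [hd]
    simp only
    rw [show π - 2 * π = -π by ring, abs_le]
    constructor <;> nlinarith [this.1, this.2]
  have hdpi' := abs_le.1 hdpi
  -- A displacement of `1 / 100` changes `d` by at least `0.0017`, more than `|d π| ≤ 0.001`, so the
  -- sign changes within that distance of `π`.
  have h1 := hdec π (π + 1 / 100) (by linarith) (by linarith) (by linarith)
  have h2 := hdec (π - 1 / 100) π (by linarith) (by linarith) (by linarith)
  obtain ⟨q, hq, hdq⟩ := intermediate_value_Icc' (show π - 1 / 100 ≤ π + 1 / 100 by linarith)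
    (f := d) (fun x hx => (hdd x ⟨by linarith [hx.1], by linarith [hx.2]⟩).continuousAt.continuousWithinAt)
    (show (0 : ℝ) ∈ Icc _ _ from ⟨by linarith, by linarith⟩)
  refine ⟨q, ?_, ?_, ?_, ?_, ?_⟩
  · rw [abs_le]; constructor <;> linarith [hq.1, hq.2]
  · exact sub_eq_zero.1 hdq
  · intro he
    have := hneg q ⟨by linarith [hq.1], by linarith [hq.2]⟩
    linarith
  · intro x hx
    have := hdec q x (by linarith [hq.1]) hx.1 hx.2
    rw [hdq] at this
    have h3 : d x ≤ 0 := by linarith [hx.1]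
    exact sub_nonpos.1 h3
  · intro x hx
    have := hdec (x + 2 * π) q (by linarith [hx.1]) (by linarith [hx.2]) (by linarith [hq.2])
    rw [hdq] at this
    have h3 : 0 ≤ d (x + 2 * π) := by linarith [hx.2]
    have h4 := sub_nonneg.1 h3
    rwa [add_sub_cancel_right] at h4

/-- A vertical displacement from the graph changes `g` by a factor between `9 / 10` and `c`. It
moves the base point by a factor at most `σ`, and so the height of the graph there by at most `2 σ`.
-/
lemma above (G : InvGraph R f g a11 a12 a21 a22 h s v)
    (M : StripMap lam R η c σ f g a11 a12 a21 a22) {x y : ℝ} (hx : x ∈ Ioo (-7 : ℝ) 7)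
    (hxy : (x, y) ∈ strip R) (hy : h x ≤ y) (hf : f (x, h x) ∈ Ioo (-7 : ℝ) 7)
    (hf' : f (x, y) ∈ Ioo (-7 : ℝ) 7) :
    1 / 2 * (y - h x) ≤ g (x, y) - h (f (x, y)) ∧
      g (x, y) - h (f (x, y)) ≤ (c + 2 * σ) * (y - h x) := by
  have hs := G.mem_strip M x hx
  have e1 := M.vert_g hs hxy hy
  have e2 := M.vert_f hs hxy
  have e3 := G.adm.2 _ hf' _ hf
  have e4 := G.g_graph M hx hf
  have hnn := sub_nonneg.2 hy
  rw [abs_of_nonneg hnn] at e2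
  have e5 := mul_le_mul_of_nonneg_right M.hσ hnn
  have e6 := abs_le.1 e3
  constructor <;> linarith [e1.1, e1.2, e6.1, e6.2]

lemma below (G : InvGraph R f g a11 a12 a21 a22 h s v)
    (M : StripMap lam R η c σ f g a11 a12 a21 a22) {x y : ℝ} (hx : x ∈ Ioo (-7 : ℝ) 7)
    (hxy : (x, y) ∈ strip R) (hy : y ≤ h x) (hf : f (x, h x) ∈ Ioo (-7 : ℝ) 7)
    (hf' : f (x, y) ∈ Ioo (-7 : ℝ) 7) : g (x, y) ≤ h (f (x, y)) := by
  have hs := G.mem_strip M x hx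
  have e1 := M.vert_g hxy hs hy
  have e2 := M.vert_f hxy hs
  have e3 := G.adm.2 _ hf' _ hf
  have e4 := G.g_graph M hx hf
  have hnn := sub_nonneg.2 hy
  rw [abs_of_nonneg hnn] at e2
  have e5 := mul_le_mul_of_nonneg_right M.hσ hnn
  have e6 := abs_le.1 e3
  rw [abs_sub_comm (f (x, y))] at e6
  linarith [e1.1, e1.2, e6.1, e6.2]

/-- `v` maps into `(-4, 4)`, so it has a fixed point in `[-6, 6]`; as a contraction it draws every
angle to it. Its iterates are the backward orbits that put the graph on the unstable manifold. -/
lemma exists_fixed (G : InvGraph R f g a11 a12 a21 a22 h s v)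
    (M : StripMap lam R η c σ f g a11 a12 a21 a22) :
    ∃ x₀ : ℝ, |x₀| ≤ 1 / 100000 ∧ f (x₀, h x₀) = x₀ ∧ g (x₀, h x₀) = h x₀ ∧
      ∀ φ ∈ Ioo (-7 : ℝ) 7, Tendsto (fun n => v^[n] φ) atTop (𝓝 x₀) := by
  have hsub : Icc (-6 : ℝ) 6 ⊆ Ioo (-7) 7 := fun x hx =>
    ⟨by linarith [hx.1], by linarith [hx.2]⟩
  have hvc := M.continuousOn_v G.adm G.v_mem G.f_v
  have h1 := G.v_mem (-6) (hsub ⟨le_rfl, by norm_num⟩)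
  have h2 := G.v_mem 6 (hsub ⟨by norm_num, le_rfl⟩)
  obtain ⟨x₀, hx₀, he⟩ := intermediate_value_Icc' (show (-6 : ℝ) ≤ 6 by norm_num)
    (f := fun x => v x - x) ((hvc.mono hsub).sub continuousOn_id)
    (show (0 : ℝ) ∈ Icc _ _ from ⟨by linarith [h2.2], by linarith [h1.1]⟩)
  have hvx : v x₀ = x₀ := sub_eq_zero.1 he
  have hx7 := hsub hx₀
  have hf := G.f_v x₀ hx7
  have hg := G.g_v x₀ hx7
  rw [hvx] at hf hg
  refine ⟨x₀, ?_, hf, hg, fun φ hφ => ?_⟩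
  · have := M.f_near _ (G.mem_strip M x₀ hx7)
    rw [hf] at this
    simp only at this
    rwa [show x₀ - 2 * x₀ = -x₀ by ring, abs_neg] at this
  · have hmem : ∀ n, v^[n] φ ∈ Ioo (-7 : ℝ) 7 := by
      intro n
      induction n with
      | zero => exact hφ
      | succ n ih => rw [Function.iterate_succ_apply']; exact G.v_mem' ih
    have hle : ∀ n : ℕ, |v^[n] φ - x₀| ≤ |φ - x₀| * (6 / 10 : ℝ) ^ n := by
      intro n
      induction n with
      | zero => simp
      | succ n ih =>
        rw [Function.iterate_succ_apply', pow_succ]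
        have := M.lipschitz_v G.adm G.v_mem G.f_v (hmem n) hx7
        rw [hvx] at this
        linarith [abs_nonneg (v (v^[n] φ) - x₀)]
    rw [tendsto_iff_dist_tendsto_zero]
    refine squeeze_zero (fun n => dist_nonneg) hle ?_
    simpa using (tendsto_pow_atTop_nhds_zero_of_lt_one (by norm_num : (0 : ℝ) ≤ 6 / 10)
      (by norm_num)).const_mul |φ - x₀|

end InvGraph

end StripMap

/-! ### The model map and its derivative -/

/-- The model map as a map of the plane. -/
def modelMap (lam : ℝ) (z : ℂ) : ℂ := ((1 - lam + lam * ‖z‖ : ℝ) : ℂ) * (z / (‖z‖ : ℂ)) ^ 2 + 1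

lemma hasFDerivAt_norm {z : ℂ} (hz : z ≠ 0) :
    HasFDerivAt (fun z : ℂ => ‖z‖) (‖z‖⁻¹ • innerSL ℝ z) z := by
  have h0 : ‖z‖ ^ 2 ≠ 0 := by positivity
  have h := (hasStrictFDerivAt_norm_sq z).hasFDerivAt.sqrt h0
  have e : (fun y : ℂ => √(‖y‖ ^ 2)) = fun y => ‖y‖ := by
    ext y; exact Real.sqrt_sq (norm_nonneg y)
  rw [e, Real.sqrt_sq (norm_nonneg z)] at h
  have e2 : ‖z‖⁻¹ • innerSL ℝ z = (1 / (2 * ‖z‖)) • 2 • innerSL ℝ z := by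
    ext v
    simp
    field_simp
  rw [e2]
  exact h

lemma modelMap_sub_one (lam : ℝ) (z : ℂ) :
    modelMap lam z - 1 = ((1 - lam + lam * ‖z‖ : ℝ) : ℂ) * (z / (‖z‖ : ℂ)) ^ 2 := by
  simp [modelMap]

lemma norm_modelMap_sub_one {lam : ℝ} (h0 : 0 < lam) (h1 : lam < 1) {z : ℂ} (hz : z ≠ 0) :
    ‖modelMap lam z - 1‖ = 1 - lam + lam * ‖z‖ := by
  have hn : ‖z‖ ≠ 0 := by simpa using hz
  have h2 : 0 ≤ 1 - lam + lam * ‖z‖ := by positivity [sub_pos.2 h1]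
  rw [modelMap_sub_one, norm_mul, norm_pow, norm_div, Complex.norm_real, Complex.norm_real,
    Real.norm_of_nonneg h2, norm_norm, div_self hn]
  simp

lemma contDiffAt_modelMap (lam : ℝ) {z : ℂ} (hz : z ≠ 0) : ContDiffAt ℝ 1 (modelMap lam) z := by
  have hn : ContDiffAt ℝ 1 (fun z : ℂ => ‖z‖) z := contDiffAt_norm ℝ hz
  have hn' : ContDiffAt ℝ 1 (fun z : ℂ => (‖z‖ : ℂ)) z :=
    Complex.ofRealCLM.contDiff.contDiffAt.comp z hn
  have hne : (‖z‖ : ℂ) ≠ 0 := by simpa using hz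
  have hi : ContDiffAt ℝ 1 (fun z : ℂ => (‖z‖ : ℂ)⁻¹) z := hn'.inv hne
  have hr : ContDiffAt ℝ 1 (fun z : ℂ => ((1 - lam + lam * ‖z‖ : ℝ) : ℂ)) z :=
    Complex.ofRealCLM.contDiff.contDiffAt.comp z
      (contDiffAt_const.add (contDiffAt_const.mul hn))
  unfold modelMap
  simp only [div_eq_mul_inv]
  exact (hr.mul ((contDiffAt_id.mul hi).pow 2)).add contDiffAt_const

/-- Multiplication by `conj z` separates a vector into its radial part (real) and its angular part
(imaginary). The modulus changes at rate `lam`, the argument at rate `2`. -/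
lemma fderiv_modelMap (lam : ℝ) {z : ℂ} (hz : z ≠ 0) (v : ℂ) :
    fderiv ℝ (modelMap lam) z v = (z / (‖z‖ : ℂ)) ^ 2 *
      (((lam * ((starRingEnd ℂ) z * v).re / ‖z‖ : ℝ) : ℂ) +
        (((1 - lam + lam * ‖z‖) * (2 * ((starRingEnd ℂ) z * v).im / ‖z‖ ^ 2) : ℝ) : ℂ) *
          Complex.I) := by
  have hne : (‖z‖ : ℂ) ≠ 0 := by simpa using hz
  have hn := hasFDerivAt_norm hz
  have hn0 : ‖z‖ ≠ 0 := by simpa using hz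
  have hn' : HasFDerivAt (fun z : ℂ => ((‖z‖⁻¹ : ℝ) : ℂ)) (Complex.ofRealCLM.comp _) z :=
    Complex.ofRealCLM.hasFDerivAt.comp z ((hasDerivAt_inv hn0).comp_hasFDerivAt z hn)
  have hr : HasFDerivAt (fun z : ℂ => ((1 - lam + lam * ‖z‖ : ℝ) : ℂ)) (Complex.ofRealCLM.comp _) z :=
    Complex.ofRealCLM.hasFDerivAt.comp z ((hn.const_mul lam).const_add (1 - lam))
  have hu := (hasFDerivAt_id (𝕜 := ℝ) z).mul hn'
  have h := (hr.mul (hu.mul hu)).add_const 1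
  have he : modelMap lam = fun z => ((1 - lam + lam * ‖z‖ : ℝ) : ℂ) *
      ((id z * ((‖z‖⁻¹ : ℝ) : ℂ)) * (id z * ((‖z‖⁻¹ : ℝ) : ℂ))) + 1 := by
    ext z
    simp [modelMap, div_eq_mul_inv, sq]
  have h4 := HasFDerivAt.fderiv (f := fun z : ℂ => ((1 - lam + lam * ‖z‖ : ℝ) : ℂ) *
      ((id z * ((‖z‖⁻¹ : ℝ) : ℂ)) * (id z * ((‖z‖⁻¹ : ℝ) : ℂ))) + 1) h
  rw [he, h4]
  have hin : inner ℝ z v = ((starRingEnd ℂ) z * v).re := by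
    rw [Complex.inner, mul_comm]
  -- The vector is recovered from `conj z * v`, so that everything depends on two real numbers.
  have hv : v = z * ((starRingEnd ℂ) z * v) / (‖z‖ : ℂ) ^ 2 := by
    rw [← mul_assoc, Complex.mul_conj, Complex.normSq_eq_norm_sq]
    push_cast
    field_simp
  simp only [add_apply, smul_apply, ContinuousLinearMap.comp_apply,
    Complex.ofRealCLM_apply, smul_eq_mul, innerSL_apply_apply, hin,
    ContinuousLinearMap.id_apply]
  set P := (starRingEnd ℂ) z * v with hP
  have hP' : P = (P.re : ℂ) + P.im * Complex.I := (Complex.re_add_im P).symm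
  rw [hv]
  set a := P.re
  set b := P.im
  rw [hP']
  push_cast
  simp
  field_simp
  ring

/-! ### Maps close to the model map, in polar coordinates around `1` -/

/-- The map `F`, with derivative `F'`, is `η`-close to the model map: in the uniform distance on
`δ ≤ |z| ≤ 2 / (1 - lam)`, and in the `C¹` distance away from the outer circle. -/
structure ModelClose (lam δ η : ℝ) (F : ℂ → ℂ) (F' : ℂ → ℂ →L[ℝ] ℂ) : Prop where
  deriv : ∀ z, 0 < ‖z‖ → ‖z‖ < 2 * (1 - lam)⁻¹ → HasFDerivAt F (F' z) z
  cont : ContinuousOn F' {z | 0 < ‖z‖ ∧ ‖z‖ < 2 * (1 - lam)⁻¹}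
  close : ∀ z, δ ≤ ‖z‖ → ‖z‖ ≤ 2 * (1 - lam)⁻¹ → ‖F z - modelMap lam z‖ ≤ η
  close' : ∀ z, δ ≤ ‖z‖ → ‖z‖ ≤ 2 * (1 - lam)⁻¹ - 1 / 2 →
    ‖F' z - fderiv ℝ (modelMap lam) z‖ ≤ η

/-- Polar coordinates `(angle, radius)` around the point `1`. -/
def pol (p : ℝ × ℝ) : ℂ := 1 + p.2 * Complex.exp (p.1 * Complex.I)

lemma pol_eq_ray (p : ℝ × ℝ) : pol p = ray (Circle.exp p.1) p.2 := by
  simp [pol, ray]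

lemma pol_sub_one (p : ℝ × ℝ) : pol p - 1 = p.2 * Complex.exp (p.1 * Complex.I) := by
  simp [pol]

lemma normSq_pol (p : ℝ × ℝ) : ‖pol p‖ ^ 2 = p.2 ^ 2 + 2 * p.2 * Real.cos p.1 + 1 := by
  rw [← Complex.normSq_eq_norm_sq, pol, Complex.normSq_apply]
  simp [Complex.exp_ofReal_mul_I_re, Complex.exp_ofReal_mul_I_im]
  have := Real.sin_sq_add_cos_sq p.1
  linear_combination p.2 ^ 2 * this

lemma pol_conj_mul_radial (p : ℝ × ℝ) :
    (starRingEnd ℂ) (pol p) * Complex.exp (p.1 * Complex.I) =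
      ((Real.cos p.1 + p.2 : ℝ) : ℂ) + (Real.sin p.1 : ℝ) * Complex.I := by
  have h := Real.sin_sq_add_cos_sq p.1
  rw [pol, Complex.exp_mul_I, ← Complex.ofReal_cos, ← Complex.ofReal_sin]
  apply Complex.ext
  · simp [-Complex.ofReal_cos, -Complex.ofReal_sin]
    linear_combination p.2 * h
  · simp [-Complex.ofReal_cos, -Complex.ofReal_sin]
    ring

lemma abs_norm_pol_sub (p : ℝ × ℝ) (hp : 0 ≤ p.2) : |‖pol p‖ - p.2| ≤ 1 := by
  have h1 : ‖(p.2 : ℂ) * Complex.exp (p.1 * Complex.I)‖ = p.2 := by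
    rw [norm_mul, Complex.norm_exp_ofReal_mul_I, Complex.norm_real, Real.norm_of_nonneg hp, mul_one]
  have h2 := abs_norm_sub_norm_le (pol p) ((p.2 : ℂ) * Complex.exp (p.1 * Complex.I))
  rw [h1] at h2
  refine h2.trans ?_
  simp [pol]

/-- The left side is the component of `pol p` in the radial direction at angle `p.1`. This
projection bound is what keeps the vertical derivative of the model below `lam`. -/
lemma le_norm_pol (p : ℝ × ℝ) : p.2 + Real.cos p.1 ≤ ‖pol p‖ := by
  have h := normSq_pol p
  have h2 := Real.sin_sq_add_cos_sq p.1
  refine le_trans (le_abs_self _) (abs_le_of_sq_le_sq ?_ (norm_nonneg _))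
  nlinarith [sq_nonneg (Real.sin p.1)]

/-- The radial component of the lift. -/
def liftG (F : ℂ → ℂ) (p : ℝ × ℝ) : ℝ := ‖F (pol p) - 1‖

/-- The image, rotated back by twice the angle. -/
def rot (F : ℂ → ℂ) (p : ℝ × ℝ) : ℂ := (F (pol p) - 1) * Complex.exp (-(2 * p.1 : ℝ) * Complex.I)

/-- The angular component of the lift. -/
def liftF (F : ℂ → ℂ) (p : ℝ × ℝ) : ℝ := 2 * p.1 + Complex.arg (rot F p)

/-- The logarithmic derivative of `F - 1` in the angular direction. -/
def logDx (F : ℂ → ℂ) (F' : ℂ → ℂ →L[ℝ] ℂ) (p : ℝ × ℝ) : ℂ :=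
  F' (pol p) (p.2 * Complex.exp (p.1 * Complex.I) * Complex.I) / (F (pol p) - 1)

/-- The logarithmic derivative of `F - 1` in the radial direction. -/
def logDy (F : ℂ → ℂ) (F' : ℂ → ℂ →L[ℝ] ℂ) (p : ℝ × ℝ) : ℂ :=
  F' (pol p) (Complex.exp (p.1 * Complex.I)) / (F (pol p) - 1)

lemma norm_rot (F : ℂ → ℂ) (p : ℝ × ℝ) : ‖rot F p‖ = liftG F p := by
  rw [rot, norm_mul, ← Complex.ofReal_neg, Complex.norm_exp_ofReal_mul_I, mul_one, liftG]

lemma pol_lift (F : ℂ → ℂ) (p : ℝ × ℝ) : pol (liftF F p, liftG F p) = F (pol p) := by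
  have h : (liftG F p : ℂ) * Complex.exp (Complex.arg (rot F p) * Complex.I) = rot F p := by
    rw [← norm_rot]
    exact Complex.norm_mul_exp_arg_mul_I _
  rw [pol]
  simp only [liftF]
  rw [show ((2 * p.1 + Complex.arg (rot F p) : ℝ) : ℂ) * Complex.I =
      (2 * p.1 : ℝ) * Complex.I + Complex.arg (rot F p) * Complex.I by push_cast; ring,
    Complex.exp_add, mul_left_comm, h, rot, mul_left_comm, ← Complex.exp_add]
  simp

lemma hasFDerivAt_pol (p : ℝ × ℝ) :
    HasFDerivAt pol (((ContinuousLinearMap.fst ℝ ℝ ℝ).smulRight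
        ((p.2 : ℂ) * Complex.exp (p.1 * Complex.I) * Complex.I)) +
      (ContinuousLinearMap.snd ℝ ℝ ℝ).smulRight (Complex.exp (p.1 * Complex.I))) p := by
  have h1 : HasFDerivAt (fun x : ℝ × ℝ => (x.1 : ℂ))
      (Complex.ofRealCLM.comp (ContinuousLinearMap.fst ℝ ℝ ℝ)) p :=
    Complex.ofRealCLM.hasFDerivAt.comp p hasFDerivAt_fst
  have h2 : HasFDerivAt (fun x : ℝ × ℝ => (x.2 : ℂ))
      (Complex.ofRealCLM.comp (ContinuousLinearMap.snd ℝ ℝ ℝ)) p :=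
    Complex.ofRealCLM.hasFDerivAt.comp p hasFDerivAt_snd
  have h3 := (h2.mul (h1.mul_const Complex.I).cexp).const_add 1
  refine (show HasFDerivAt pol _ p from h3).congr_fderiv ?_
  ext <;> simp
  ring

/-- The logarithm of the rotated image is differentiable. -/
lemma hasFDerivAt_log_rot {F : ℂ → ℂ} {F' : ℂ → ℂ →L[ℝ] ℂ} {p : ℝ × ℝ}
    (hF : HasFDerivAt F (F' (pol p)) (pol p)) (hs : rot F p ∈ Complex.slitPlane) :
    HasFDerivAt (fun p => Complex.log (rot F p))
      ((ContinuousLinearMap.fst ℝ ℝ ℝ).smulRight (logDx F F' p - 2 * Complex.I) +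
        (ContinuousLinearMap.snd ℝ ℝ ℝ).smulRight (logDy F F' p)) p := by
  have h0 : rot F p ≠ 0 := Complex.slitPlane_ne_zero hs
  have hW : F (pol p) - 1 ≠ 0 := fun h => h0 (by rw [rot, h, zero_mul])
  have h1 : HasFDerivAt (fun x : ℝ × ℝ => (x.1 : ℂ))
      (Complex.ofRealCLM.comp (ContinuousLinearMap.fst ℝ ℝ ℝ)) p :=
    Complex.ofRealCLM.hasFDerivAt.comp p hasFDerivAt_fst
  have h2 : HasFDerivAt (fun p => F (pol p) - 1) _ p := (hF.comp p (hasFDerivAt_pol p)).sub_const 1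
  have h3 := (h1.mul_const (-2 * Complex.I)).cexp
  have h4 := h2.mul h3
  have he : (fun p => F (pol p) - 1) * (fun x : ℝ × ℝ => Complex.exp (x.1 * (-2 * Complex.I))) =
      rot F := by
    ext p
    simp only [Pi.mul_apply, rot]
    congr 2
    push_cast
    ring
  rw [he] at h4
  have h5 := (Complex.hasStrictDerivAt_log hs).hasDerivAt.complexToReal_fderiv.comp p h4
  refine h5.congr_fderiv ?_
  have hr : rot F p = (F (pol p) - 1) * Complex.exp (p.1 * (-2 * Complex.I)) := (congrFun he p).symm
  have hE := Complex.exp_ne_zero (p.1 * (-2 * Complex.I))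
  rw [hr]
  ext <;> simp [logDx, logDy] <;> field_simp <;> ring

/-- Rotating back by `2 x` brings the image near the positive axis, where the principal logarithm is
smooth; its imaginary part corrects the angle `2 x` without any jump. -/
lemma hasFDerivAt_liftF {F : ℂ → ℂ} {F' : ℂ → ℂ →L[ℝ] ℂ} {p : ℝ × ℝ}
    (hF : HasFDerivAt F (F' (pol p)) (pol p)) (hs : rot F p ∈ Complex.slitPlane) :
    HasFDerivAt (liftF F) (lin (logDx F F' p).im (logDy F F' p).im) p := by
  have h := Complex.imCLM.hasFDerivAt.comp p (hasFDerivAt_log_rot hF hs)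
  have h2 := ((hasFDerivAt_fst (𝕜 := ℝ) (p := p)).const_mul 2).add h
  have he : ((fun y : ℝ × ℝ => 2 * y.1) + ⇑Complex.imCLM ∘ fun p => Complex.log (rot F p)) =
      liftF F := by
    ext p
    simp [liftF, Complex.log_im]
  rw [he] at h2
  refine h2.congr_fderiv ?_
  ext <;> simp [lin]

lemma hasFDerivAt_liftG {F : ℂ → ℂ} {F' : ℂ → ℂ →L[ℝ] ℂ} {p : ℝ × ℝ}
    (hF : HasFDerivAt F (F' (pol p)) (pol p)) (hs : rot F p ∈ Complex.slitPlane) :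
    HasFDerivAt (liftG F)
      (lin (liftG F p * (logDx F F' p).re) (liftG F p * (logDy F F' p).re)) p := by
  have h := (Complex.reCLM.hasFDerivAt.comp p (hasFDerivAt_log_rot hF hs)).exp
  have h0 : 0 < liftG F p := by
    rw [← norm_rot]
    exact norm_pos_iff.2 (Complex.slitPlane_ne_zero hs)
  have hpos : ∀ᶠ x in 𝓝 p, liftG F x =
      Real.exp ((Complex.reCLM ∘ fun p => Complex.log (rot F p)) x) := by
    have hc : ContinuousAt (liftG F) p :=
      ((hF.continuousAt.comp (hasFDerivAt_pol p).continuousAt).sub continuousAt_const).norm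
    filter_upwards [hc.eventually (lt_mem_nhds h0)] with x hx
    simp only [Function.comp, Complex.reCLM_apply, Complex.log_re, norm_rot]
    exact (Real.exp_log hx).symm
  have hp := hpos.self_of_nhds
  refine (h.congr_of_eventuallyEq hpos).congr_fderiv ?_
  rw [← hp]
  ext <;> simp [lin]

/-! ### Entries of the Jacobian of the model lift. -/

section Estimates

variable {R y c s r lam : ℝ}

/-- In these estimates `r = ‖pol p‖` and `c`, `s` are cosine and sine of the angle. The bounded
quantities are the partial derivatives of the angle and of the radius under the model lift. -/
lemma model_b11 (hR : 10 ^ 7 ≤ R) (hy : R / 2 < y) (hc : |c| ≤ 1) (hr : |r - y| ≤ 1)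
    (hr2 : r ^ 2 = y ^ 2 + 2 * y * c + 1) : |2 * (y ^ 2 + y * c) / r ^ 2 - 2| ≤ 5 / R := by
  have hr' := abs_le.1 hr
  have hc' := abs_le.1 hc
  have hr0 : 0 < r := by linarith
  have e : 2 * (y ^ 2 + y * c) / r ^ 2 - 2 = (-(2 * y * c) - 2) / r ^ 2 := by
    rw [div_sub' (by positivity)]
    congr 1
    linear_combination (-2) * hr2
  rw [e, abs_div, abs_of_pos (by positivity : 0 < r ^ 2), div_le_div_iff₀ (by positivity) (by linarith)]
  have h1 : |-(2 * y * c) - 2| ≤ 2 * y + 2 := by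
    rw [abs_le]
    constructor <;> nlinarith
  have h2 : (y - 1) ^ 2 ≤ r ^ 2 := pow_le_pow_left₀ (by linarith) (by linarith) 2
  have h3 := mul_le_mul_of_nonneg_right h1 (show 0 ≤ R by linarith)
  nlinarith

lemma model_b12 (hR : 10 ^ 7 ≤ R) (hy : R / 2 < y) (hs : |s| ≤ 1) (hr : |r - y| ≤ 1) :
    |2 * s / r ^ 2| ≤ 9 / R ^ 2 := by
  have hr' := abs_le.1 hr
  have hR0 : 0 < R := by linarith
  have hr0 : 0 < r := by linarith
  rw [abs_div, abs_of_pos (by positivity : 0 < r ^ 2), abs_mul, abs_two,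
    div_le_div_iff₀ (by positivity) (by positivity)]
  have h2 : (R / 2 - 1) ^ 2 ≤ r ^ 2 := pow_le_pow_left₀ (by linarith) (by linarith) 2
  nlinarith [sq_nonneg R]

lemma model_b21 (hR : 10 ^ 7 ≤ R) (hy : R / 2 < y) (hy' : y < 2 * R) (hs : |s| ≤ 1)
    (hr : |r - y| ≤ 1) (hlam : lam = 1 - 1 / R) : |-(lam * y * s / r) + s| ≤ 7 / R := by
  have hr' := abs_le.1 hr
  have hr0 : 0 < r := by linarith
  have hR0 : 0 < R := by linarith
  have e : -(lam * y * s / r) + s = s * (r - lam * y) / r := by field_simp; ring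
  have hy2 : 1 / R * y ≤ 2 := by rw [one_div, inv_mul_le_iff₀ hR0]; linarith
  have hy3 : 0 ≤ 1 / R * y := mul_nonneg (by positivity) (by linarith)
  have h1 : |r - lam * y| ≤ 3 := by
    rw [hlam, abs_le]
    constructor <;> linarith
  rw [e, abs_div, abs_mul, abs_of_pos hr0, div_le_div_iff₀ hr0 hR0]
  have h2 := mul_le_mul hs h1 (abs_nonneg _) zero_le_one
  nlinarith

/-- The upper bound `lam` is exact, by the projection inequality `y + c ≤ r`. An error of order `1 /
R` here would destroy the contraction. -/
lemma model_b22 (hR : 10 ^ 7 ≤ R) (hy : R / 2 < y) (hc : |c| ≤ 1)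
    (hr : |r - y| ≤ 1) (hcr : y + c ≤ r) (hlam : lam = 1 - 1 / R) (hl0 : 0 < lam) :
    |lam * (y + c) / r - 1| ≤ 7 / R ∧ lam * (y + c) / r ≤ lam := by
  have hr' := abs_le.1 hr
  have hc' := abs_le.1 hc
  have hr0 : 0 < r := by linarith
  have hR0 : 0 < R := by linarith
  have h1 : lam * (y + c) / r ≤ lam := by
    rw [div_le_iff₀ hr0]
    exact mul_le_mul_of_nonneg_left hcr hl0.le
  have h2 : lam - 2 * (3 / R) ≤ lam * (y + c) / r := by
    rw [le_div_iff₀ hr0]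
    have e1 : lam * (r - 2) ≤ lam * (y + c) := mul_le_mul_of_nonneg_left (by linarith) hl0.le
    have e2 : 1 ≤ 3 / R * r := by
      rw [div_mul_eq_mul_div, le_div_iff₀ hR0]
      linarith
    have e3 : lam ≤ 1 := by rw [hlam]; have : 0 < 1 / R := by positivity
                            linarith
    nlinarith
  refine ⟨?_, h1⟩
  have e4 : 7 / R = 7 * (1 / R) := by ring
  have e5 : 3 / R = 3 * (1 / R) := by ring
  have e6 : 0 < 1 / R := by positivity
  rw [e4, abs_le]
  rw [e5] at h2
  constructor <;> linarith

end Estimates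

/-- In the right half plane this is Jordan's inequality `(2 / π) |θ| ≤ |sin θ|`, with `π / 2 ≤ 2`.
-/
lemma abs_arg_le {w : ℂ} (hw : 0 < w.re) {b : ℝ} (hb : |w.im| ≤ b * ‖w‖) :
    |Complex.arg w| ≤ 2 * b := by
  have h0 : 0 < ‖w‖ := norm_pos_iff.2 (by rintro rfl; simp at hw)
  have h1 : |Complex.arg w| ≤ Real.pi / 2 := Complex.abs_arg_le_pi_div_two_iff.2 hw.le
  have h2 := Real.mul_abs_le_abs_sin h1
  rw [Complex.sin_arg, abs_div, abs_norm] at h2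
  have h3 : |w.im| / ‖w‖ ≤ b := (div_le_iff₀ h0).2 hb
  have h4 := h2.trans h3
  have hpi := Real.pi_lt_d2
  have hpi0 := Real.pi_pos
  rw [div_mul_eq_mul_div, div_le_iff₀ hpi0] at h4
  nlinarith [abs_nonneg w.im, div_nonneg (abs_nonneg w.im) h0.le]

/-! ### Comparison of the logarithmic derivatives with those of the model. -/

namespace ModelClose

variable {lam δ η : ℝ} {F : ℂ → ℂ} {F' : ℂ → ℂ →L[ℝ] ℂ}

/-- The logarithmic derivative of the model map minus one. -/
lemma fderiv_modelMap_eq (h0 : 0 < lam) (h1 : lam < 1) {z : ℂ} (hz : z ≠ 0) (v : ℂ) :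
    fderiv ℝ (modelMap lam) z v = (modelMap lam z - 1) *
      (((lam * ((starRingEnd ℂ) z * v).re / (‖z‖ * (1 - lam + lam * ‖z‖)) : ℝ) : ℂ) +
        ((2 * ((starRingEnd ℂ) z * v).im / ‖z‖ ^ 2 : ℝ) : ℂ) * Complex.I) := by
  have hn : 0 < ‖z‖ := norm_pos_iff.2 hz
  have hρ : (0 : ℝ) < 1 - lam + lam * ‖z‖ := by have := mul_pos h0 hn; linarith
  have e : lam * ((starRingEnd ℂ) z * v).re / (‖z‖ * (1 - lam + lam * ‖z‖)) *
      (1 - lam + lam * ‖z‖) = lam * ((starRingEnd ℂ) z * v).re / ‖z‖ := by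
    field_simp
  rw [fderiv_modelMap lam hz, modelMap_sub_one, ← e]
  push_cast
  ring

/-- If `W` is close to `W₀` and `a` is close to `W₀ q`, then `a / W` is close to `q`. -/
lemma norm_div_sub_le {a W W₀ q : ℂ} {η A B : ℝ} (hW : 1 ≤ ‖W‖) (h1 : ‖W - W₀‖ ≤ η)
    (h2 : ‖a - W₀ * q‖ ≤ η * A) (hq : ‖q‖ ≤ B) : ‖a / W - q‖ ≤ η * (A + B) := by
  have hW0 : W ≠ 0 := fun h => by rw [h, norm_zero] at hW; linarith
  have e : a / W - q = ((a - W₀ * q) + q * (W₀ - W)) / W := by field_simp; ring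
  have hη : 0 ≤ η := (norm_nonneg _).trans h1
  rw [e, norm_div, div_le_iff₀ (by linarith)]
  have h3 : ‖q * (W₀ - W)‖ ≤ B * η := by
    rw [norm_mul, norm_sub_rev]
    exact mul_le_mul hq h1 (norm_nonneg _) ((norm_nonneg _).trans hq)
  have h4 := norm_add_le (a - W₀ * q) (q * (W₀ - W))
  have h5 : 0 ≤ η * (A + B) := by
    have := (norm_nonneg _).trans h2
    have := (norm_nonneg _).trans h3
    nlinarith
  nlinarith

/-- The pointwise facts used in the proof that the lift is a `StripMap`. -/
lemma point_facts (h : ModelClose lam δ η F F') (h0 : 0 < lam) (h1 : lam < 1)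
    (hR : 10 ^ 7 ≤ (1 - lam)⁻¹) (hδ : δ ≤ 1) {p : ℝ × ℝ}
    (hp : p ∈ strip (1 - lam)⁻¹) :
    |‖pol p‖ - p.2| ≤ 1 ∧ pol p ≠ 0 ∧ HasFDerivAt F (F' (pol p)) (pol p) ∧
      ‖(F (pol p) - 1) - (modelMap lam (pol p) - 1)‖ ≤ η ∧
      ‖modelMap lam (pol p) - 1‖ = 1 - lam + lam * ‖pol p‖ ∧
      |liftG F p - (1 - lam + lam * ‖pol p‖)| ≤ η ∧
      ∀ v, ‖F' (pol p) v - fderiv ℝ (modelMap lam) (pol p) v‖ ≤ η * ‖v‖ := by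
  set R := (1 - lam)⁻¹ with hRdef
  obtain ⟨hp1, hp2⟩ := hp
  have hr := abs_norm_pol_sub p (by linarith)
  have hr' := abs_le.1 hr
  have hz : pol p ≠ 0 := by
    intro h
    rw [h, norm_zero] at hr'
    linarith [hr'.1]
  have hδz : δ ≤ ‖pol p‖ := by linarith [hr'.1]
  have e1 := h.close (pol p) hδz (by linarith [hr'.2])
  have e2 := h.close' (pol p) hδz (by linarith [hr'.2])
  have e1' : ‖(F (pol p) - 1) - (modelMap lam (pol p) - 1)‖ ≤ η := by
    rwa [sub_sub_sub_cancel_right]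
  have e3 := norm_modelMap_sub_one h0 h1 hz
  refine ⟨hr, hz, h.deriv _ (by linarith [hr'.1]) (by linarith [hr'.2]), e1', e3, ?_, ?_⟩
  · rw [← e3]
    exact (abs_norm_sub_norm_le _ _).trans e1'
  · intro v
    have := (F' (pol p) - fderiv ℝ (modelMap lam) (pol p)).le_opNorm v
    exact this.trans (mul_le_mul_of_nonneg_right e2 (norm_nonneg v))

lemma rot_model (p : ℝ × ℝ) :
    (modelMap lam (pol p) - 1) * Complex.exp (-(2 * p.1 : ℝ) * Complex.I) =
      ((1 - lam + lam * ‖pol p‖ : ℝ) : ℂ) *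
        ((((Real.cos p.1 + p.2 : ℝ) : ℂ) - (Real.sin p.1 : ℝ) * Complex.I) / (‖pol p‖ : ℂ)) ^ 2 := by
  have h := congrArg (starRingEnd ℂ) (pol_conj_mul_radial p)
  rw [map_mul, Complex.conj_conj, ← Complex.exp_conj] at h
  simp only [map_mul, map_add, Complex.conj_ofReal, Complex.conj_I] at h
  have h' : ((Real.cos p.1 + p.2 : ℝ) : ℂ) - (Real.sin p.1 : ℝ) * Complex.I =
      pol p * Complex.exp (p.1 * -Complex.I) := by rw [h]; ring
  have he : Complex.exp (-(2 * p.1 : ℝ) * Complex.I) = Complex.exp (p.1 * -Complex.I) ^ 2 := by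
    rw [← Complex.exp_nat_mul]
    congr 1
    push_cast
    ring
  rw [modelMap_sub_one, h', he]
  ring

/-- The logarithmic derivatives are close to those of the model map. -/
lemma logD_close (h : ModelClose lam δ η F F') (h0 : 0 < lam) (h1 : lam < 1)
    (hR : 10 ^ 7 ≤ (1 - lam)⁻¹) (hδ : δ ≤ 1) (hη : η ≤ 1) {p : ℝ × ℝ}
    (hp : p ∈ strip (1 - lam)⁻¹) {v : ℂ} {A B : ℝ} (hA : ‖v‖ ≤ A)
    (hre : |lam * ((starRingEnd ℂ) (pol p) * v).re / (‖pol p‖ * (1 - lam + lam * ‖pol p‖))| ≤ 1)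
    (him : |2 * ((starRingEnd ℂ) (pol p) * v).im / ‖pol p‖ ^ 2| ≤ B) :
    |(F' (pol p) v / (F (pol p) - 1)).im - 2 * ((starRingEnd ℂ) (pol p) * v).im / ‖pol p‖ ^ 2|
        ≤ η * (A + (1 + B)) ∧
      |liftG F p * (F' (pol p) v / (F (pol p) - 1)).re -
        lam * ((starRingEnd ℂ) (pol p) * v).re / ‖pol p‖| ≤
          liftG F p * (η * (A + (1 + B))) + η := by
  obtain ⟨f1, f2, f3, f4, f5, f6, f7⟩ := h.point_facts h0 h1 hR hδ hp
  have f1' := abs_le.1 f1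
  have f6' := abs_le.1 f6
  have hp1 := hp.1
  have hη0 : 0 ≤ η := (norm_nonneg _).trans f4
  have hn : 0 < ‖pol p‖ := norm_pos_iff.2 f2
  have hρ : (3 : ℝ) ≤ 1 - lam + lam * ‖pol p‖ := by
    have : 1 / 2 ≤ lam := by
      have : (1 - lam) ≤ 1 / 10 ^ 7 := by
        rw [le_div_iff₀ (by norm_num), mul_comm]
        have := mul_le_mul_of_nonneg_right hR (sub_pos.2 h1).le
        rwa [inv_mul_cancel₀ (sub_pos.2 h1).ne'] at this
      norm_num at this
      linarith
    nlinarith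
  set re := lam * ((starRingEnd ℂ) (pol p) * v).re / (‖pol p‖ * (1 - lam + lam * ‖pol p‖))
    with hredef
  set im := 2 * ((starRingEnd ℂ) (pol p) * v).im / ‖pol p‖ ^ 2 with himdef
  set q : ℂ := (re : ℂ) + (im : ℂ) * Complex.I with hq
  have hqre : q.re = re := by simp [hq]
  have hqim : q.im = im := by simp [hq]
  have hqn : ‖q‖ ≤ 1 + B := by
    have := Complex.norm_le_abs_re_add_abs_im q
    rw [hqre, hqim] at this
    linarith
  have hd := norm_div_sub_le (a := F' (pol p) v) (W := F (pol p) - 1) (q := q) (A := A)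
    (by change 1 ≤ liftG F p; linarith [f6'.1]) f4
    (by rw [hq, hredef, himdef, ← fderiv_modelMap_eq h0 h1 f2 v]
        exact (f7 v).trans (mul_le_mul_of_nonneg_left hA hη0)) hqn
  have dre := (Complex.abs_re_le_norm _).trans hd
  have dim := (Complex.abs_im_le_norm _).trans hd
  rw [Complex.sub_re, hqre] at dre
  rw [Complex.sub_im, hqim] at dim
  refine ⟨dim, ?_⟩
  have e : lam * ((starRingEnd ℂ) (pol p) * v).re / ‖pol p‖ =
      (1 - lam + lam * ‖pol p‖) * re := by
    rw [hredef]
    field_simp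
  have e2 : liftG F p * (F' (pol p) v / (F (pol p) - 1)).re - (1 - lam + lam * ‖pol p‖) * re =
      liftG F p * ((F' (pol p) v / (F (pol p) - 1)).re - re) +
        (liftG F p - (1 - lam + lam * ‖pol p‖)) * re := by ring
  have hG : 0 ≤ liftG F p := norm_nonneg _
  rw [e, e2]
  refine (abs_add_le _ _).trans (add_le_add ?_ ?_)
  · rw [abs_mul, abs_of_nonneg hG]
    exact mul_le_mul_of_nonneg_left dre hG
  · rw [abs_mul]
    calc _ ≤ η * 1 := mul_le_mul f6 hre (abs_nonneg _) hη0
      _ = η := mul_one _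

end ModelClose

namespace ModelClose

variable {lam δ η : ℝ} {F : ℂ → ℂ} {F' : ℂ → ℂ →L[ℝ] ℂ}

lemma half_le_of_inv (h1 : lam < 1) (hR : 10 ^ 7 ≤ (1 - lam)⁻¹) : 1 / 2 ≤ lam := by
  have h2 : (1 - lam) ≤ 1 / 10 ^ 7 := by
    rw [le_div_iff₀ (by norm_num), mul_comm]
    have := mul_le_mul_of_nonneg_right hR (sub_pos.2 h1).le
    rwa [inv_mul_cancel₀ (sub_pos.2 h1).ne'] at this
  norm_num at h2
  linarith

/-- The rotated model image is `ρ ((c + y - i s) / r)²`: its real part is comparable to `ρ`, its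
imaginary part smaller by a factor of order `1 / R`. -/
lemma rot_real_bounds {R y c s r ρ : ℝ} (hR : 100 ≤ R) (hy : R / 2 < y) (hρ : 0 ≤ ρ)
    (hc : -1 ≤ c ∧ c ≤ 1) (hs : |s| ≤ 1) (hr : -1 ≤ r - y ∧ r - y ≤ 1) (hcs : s ^ 2 + c ^ 2 = 1) :
    1 / 2 * ρ ≤ ρ * ((c + y) ^ 2 - s ^ 2) / r ^ 2 ∧
      |2 * ρ * s * (c + y) / r ^ 2| ≤ 9 / 2 / R * ρ := by
  have hR0 : 0 < R := by linarith
  have hr0 : 0 < r := by linarith [hr.1]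
  have hr2 : (y - 1) ^ 2 ≤ r ^ 2 := pow_le_pow_left₀ (by linarith) (by linarith [hr.1]) 2
  have hr2' : r ^ 2 ≤ (y + 1) ^ 2 := pow_le_pow_left₀ hr0.le (by linarith [hr.2]) 2
  constructor
  · rw [le_div_iff₀ (pow_pos hr0 2)]
    have hm : 1 / 2 * r ^ 2 ≤ (c + y) ^ 2 - s ^ 2 := by nlinarith [hc.1, hc.2]
    have := mul_le_mul_of_nonneg_left hm hρ
    linarith
  · rw [abs_div, abs_of_pos (pow_pos hr0 2), div_le_iff₀ (pow_pos hr0 2), abs_mul, abs_mul, abs_mul,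
      abs_two, abs_of_nonneg hρ, abs_of_nonneg (show 0 ≤ c + y by linarith [hc.1])]
    have e1 : 2 * (y + 1) ≤ 9 / 2 / R * r ^ 2 := by
      rw [div_mul_eq_mul_div, le_div_iff₀ hR0]
      nlinarith
    have e2 : |s| * (c + y) ≤ 1 * (y + 1) :=
      mul_le_mul hs (by linarith [hc.2]) (by linarith [hc.1]) zero_le_one
    have e3 := mul_le_mul_of_nonneg_left (show 2 * (|s| * (c + y)) ≤ 9 / 2 / R * r ^ 2 by linarith)
      hρ
    calc 2 * ρ * |s| * (c + y) = ρ * (2 * (|s| * (c + y))) := by ring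
      _ ≤ ρ * (9 / 2 / R * r ^ 2) := e3
      _ = _ := by ring

/-- The real and imaginary parts of the rotated image. -/
lemma rot_bounds (h : ModelClose lam δ η F F') (h0 : 0 < lam) (h1 : lam < 1)
    (hR : 10 ^ 7 ≤ (1 - lam)⁻¹) (hδ : δ ≤ 1) (hη : η ≤ 1 / 100) {p : ℝ × ℝ}
    (hp : p ∈ strip (1 - lam)⁻¹) :
    0 < (rot F p).re ∧ |(rot F p).im| ≤ 5 / (1 - lam)⁻¹ * liftG F p ∧
      (p.1 = 0 → |(rot F p).im| ≤ η) ∧ 1 ≤ liftG F p := by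
  obtain ⟨f1, f2, f3, f4, f5, f6, f7⟩ := h.point_facts h0 h1 hR hδ hp
  set R := (1 - lam)⁻¹ with hRdef
  have hlam2 := half_le_of_inv h1 hR
  have f1' := abs_le.1 f1
  have f6' := abs_le.1 f6
  obtain ⟨hp1, hp2⟩ := hp
  have hR0 : 0 < R := by linarith
  have hsq := normSq_pol p
  have hcs := Real.sin_sq_add_cos_sq p.1
  have hc := abs_le.1 (Real.abs_cos_le_one p.1)
  have hs := Real.abs_sin_le_one p.1
  set c := Real.cos p.1
  set s := Real.sin p.1
  set y := p.2
  set r := ‖pol p‖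
  have hr0 : 0 < r := by linarith
  set ρ := 1 - lam + lam * r with hρ
  have hρ3 : 3 ≤ ρ := by nlinarith
  have hdiff : ‖rot F p - (ρ : ℂ) * ((((c + y : ℝ) : ℂ) - (s : ℝ) * Complex.I) / (r : ℂ)) ^ 2‖ ≤ η := by
    rw [← rot_model p, rot, ← sub_mul, norm_mul, ← Complex.ofReal_neg,
      Complex.norm_exp_ofReal_mul_I, mul_one]
    exact f4
  have hr0' : (r : ℂ) ≠ 0 := by exact_mod_cast hr0.ne'
  have hval : (ρ : ℂ) * ((((c + y : ℝ) : ℂ) - (s : ℝ) * Complex.I) / (r : ℂ)) ^ 2 =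
      ((ρ * ((c + y) ^ 2 - s ^ 2) / r ^ 2 : ℝ) : ℂ) +
        ((-(2 * ρ * s * (c + y) / r ^ 2) : ℝ) : ℂ) * Complex.I := by
    push_cast
    field_simp
    ring_nf
    rw [Complex.I_sq]
    ring
  rw [hval] at hdiff
  have dre := (Complex.abs_re_le_norm _).trans hdiff
  have dim := (Complex.abs_im_le_norm _).trans hdiff
  simp only [Complex.sub_re, Complex.sub_im, Complex.add_re, Complex.add_im, Complex.ofReal_re,
    Complex.ofReal_im, Complex.re_ofReal_mul, Complex.im_ofReal_mul, Complex.I_re, Complex.I_im,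
    mul_zero, mul_one, add_zero, zero_add] at dre dim
  have dre' := abs_le.1 dre
  obtain ⟨hre, him⟩ := rot_real_bounds (by linarith) hp1 (by linarith : 0 ≤ ρ) hc hs f1' hcs
  have hG1 : 1 ≤ liftG F p := by linarith
  refine ⟨by linarith, ?_, ?_, hG1⟩
  · have e1 := abs_le.1 dim
    have e2 := abs_le.1 him
    have hρR : R / 5 ≤ ρ := by nlinarith
    have hsmall : 9 / 2 / R * ρ + η ≤ 5 / R * liftG F p := by
      rw [show 9 / 2 / R * ρ + η = (9 / 2 * ρ + η * R) / R by field_simp,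
        show 5 / R * liftG F p = 5 * liftG F p / R by ring, div_le_div_iff_of_pos_right hR0]
      have : η * R ≤ 1 / 100 * R := mul_le_mul_of_nonneg_right hη hR0.le
      linarith [f6'.1]
    rw [abs_le]
    constructor <;> linarith
  · intro hx
    have hs0 : s = 0 := by simp [s, hx]
    rw [hs0] at dim
    simpa using dim

end ModelClose

/-! ### The lift of a nearby map is a strip map. -/

namespace ModelClose

variable {lam δ η : ℝ} {F : ℂ → ℂ} {F' : ℂ → ℂ →L[ℝ] ℂ}

/-- The scale `e = R⁻²` lies between the perturbation and the gap `1 / R`; these inequalities record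
by how much. -/
lemma sq_bounds {R e η : ℝ} (hR : 10 ^ 7 ≤ R) (he : e = 1 / R ^ 2) (hη0 : 0 ≤ η)
    (hη : 10 * R ^ 2 * η ≤ e) :
    e * R ≤ 1 / 10 ^ 7 ∧ 0 < e ∧ e ≤ 1 / 10 ^ 7 ∧ 10 * η ≤ e ∧ R * η ≤ e / 10 ∧
      7 / R ≤ 7 / 10 ^ 7 := by
  have hR0 : 0 < R := by linarith
  have h1 : e * R = 1 / R := by rw [he]; field_simp
  have h2 : 1 / R ≤ 1 / 10 ^ 7 := one_div_le_one_div_of_le (by norm_num) hR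
  have h3 : 0 < e := by rw [he]; positivity
  have h4 : e ≤ e * R := by nlinarith
  have h5 : η ≤ R * η := by nlinarith
  have h6 : R * η ≤ R ^ 2 * η := by nlinarith [mul_nonneg hR0.le hη0]
  refine ⟨by rw [h1]; exact h2, h3, by linarith, by linarith, by linarith, ?_⟩
  rw [show 7 / R = 7 * (1 / R) by ring]
  linarith

set_option maxHeartbeats 400000 in
/-- Estimates for the derivative of the lift. -/
lemma lift_deriv_bounds (h : ModelClose lam δ η F F') (h0 : 0 < lam) (h1 : lam < 1)
    (hR : 10 ^ 7 ≤ (1 - lam)⁻¹) (hδ : δ ≤ 1)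
    (hη : 10 * (1 - lam)⁻¹ ^ 2 * η ≤ 1 / (1 - lam)⁻¹ ^ 2) {p : ℝ × ℝ}
    (hp : p ∈ strip (1 - lam)⁻¹) :
    |(logDx F F' p).im - 2| ≤ 1 / 100000 ∧ |(logDy F F' p).im| ≤ 10 / (1 - lam)⁻¹ ^ 2 ∧
      |liftG F p * (logDx F F' p).re + Real.sin p.1| ≤ 1 / 100000 ∧
      |liftG F p * (logDy F F' p).re - 1| ≤ 1 / 100000 ∧
      liftG F p * (logDy F F' p).re ≤ lam + 1 / (1 - lam)⁻¹ ^ 2 := by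
  obtain ⟨f1, f2, f3, f4, f5, f6, f7⟩ := h.point_facts h0 h1 hR hδ hp
  have hη0 : 0 ≤ η := (norm_nonneg _).trans f4
  have hlamR : lam = 1 - 1 / (1 - lam)⁻¹ := by simp
  have hηe := sq_bounds hR rfl hη0 hη
  have hdy := fun A B v => h.logD_close h0 h1 hR hδ (by linarith [hηe.1, hηe.2.1, hηe.2.2.1]) hp
    (A := A) (B := B) (v := v)
  have hcr := le_norm_pol p
  have hn : 0 < ‖pol p‖ := norm_pos_iff.2 f2
  have hconj := pol_conj_mul_radial p
  have hnsq := normSq_pol p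
  have hρ : 1 ≤ 1 - lam + lam * ‖pol p‖ := by
    have := (abs_le.1 f1).1
    have := hp.1
    nlinarith
  have f6' := abs_le.1 f6
  have f1' := abs_le.1 f1
  have hGR : liftG F p ≤ 2 * (1 - lam)⁻¹ := by
    have := hp.2
    nlinarith
  have hp1 := hp.1
  have hp2 := hp.2
  have hE : ‖Complex.exp (p.1 * Complex.I)‖ = 1 := Complex.norm_exp_ofReal_mul_I _
  have hsl := Real.abs_sin_le_one p.1
  have hcl := Real.abs_cos_le_one p.1
  have hG0 : 0 ≤ liftG F p := norm_nonneg _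
  have hR2η : (1 - lam)⁻¹ ^ 2 * η ≤ 1 / (1 - lam)⁻¹ ^ 2 / 10 := by linarith
  have hx := hdy (2 * (1 - lam)⁻¹) 3 (p.2 * Complex.exp (p.1 * Complex.I) * Complex.I)
  have hy := hdy 1 1 (Complex.exp (p.1 * Complex.I))
  have hcx : (starRingEnd ℂ) (pol p) * (p.2 * Complex.exp (p.1 * Complex.I) * Complex.I) =
      ((-(Real.sin p.1 * p.2) : ℝ) : ℂ) + ((p.2 ^ 2 + p.2 * Real.cos p.1 : ℝ) : ℂ) * Complex.I := by
    rw [show (starRingEnd ℂ) (pol p) * (p.2 * Complex.exp (p.1 * Complex.I) * Complex.I) =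
      (starRingEnd ℂ) (pol p) * Complex.exp (p.1 * Complex.I) * (p.2 * Complex.I) by ring, hconj]
    push_cast
    ring_nf
    rw [Complex.I_sq]
    ring
  have hre : ∀ a b : ℝ, ((a : ℂ) + (b : ℂ) * Complex.I).re = a := fun a b => by simp
  have him : ∀ a b : ℝ, ((a : ℂ) + (b : ℂ) * Complex.I).im = b := fun a b => by simp
  rw [hcx, hre, him] at hx
  rw [hconj, hre, him] at hy
  clear hdy
  have hlam2 := half_le_of_inv h1 hR
  simp only [logDx, logDy]
  generalize (F' (pol p) (p.2 * Complex.exp (p.1 * Complex.I) * Complex.I) / (F (pol p) - 1)) = Q₁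
    at *
  generalize (F' (pol p) (Complex.exp (p.1 * Complex.I)) / (F (pol p) - 1)) = Q₂ at *
  have hvx : ‖(p.2 : ℂ) * Complex.exp (p.1 * Complex.I) * Complex.I‖ ≤ 2 * (1 - lam)⁻¹ := by
    rw [norm_mul, norm_mul, hE, Complex.norm_I, Complex.norm_real, Real.norm_of_nonneg] <;> linarith
  replace hx := hx hvx
  replace hy := hy hE.le
  -- From here on only the inequalities already collected matter, and with free variables they
  -- become real arithmetic.
  generalize liftG F p = G at *
  generalize Real.sin p.1 = s at *
  generalize Real.cos p.1 = c at *
  generalize ‖pol p‖ = r at *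
  generalize p.2 = y at *
  generalize (1 - lam)⁻¹ = R at *
  obtain ⟨g1, g2, g3, g4, g5, g6⟩ := hηe
  clear f2 f3 f4 f5 f7 hE hre him hconj hcx hvx h hp
  have m11 := model_b11 hR hp1 hcl f1 hnsq
  have m12 := model_b12 hR hp1 hsl f1
  have m21 := model_b21 hR hp1 (by linarith) hsl f1 hlamR
  have m22 := model_b22 hR hp1 hcl f1 (by linarith) hlamR h0
  rw [show 9 / R ^ 2 = 9 * (1 / R ^ 2) by ring] at m12
  rw [show 10 / R ^ 2 = 10 * (1 / R ^ 2) by ring]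
  rw [show 5 / R = 5 / 7 * (7 / R) by ring] at m11
  generalize 1 / R ^ 2 = e at *
  generalize 7 / R = k at *
  have hρ2 : 2 ≤ 1 - lam + lam * r := by
    have e1 : lam * 4 ≤ lam * r := mul_le_mul_of_nonneg_left (by linarith) h0.le
    linarith
  have hxx := hx (by
    have e1 : lam * -(s * y) / (r * (1 - lam + lam * r)) =
        -(lam * y * s / r) / (1 - lam + lam * r) := by field_simp
    rw [e1, abs_div, abs_of_pos (show 0 < 1 - lam + lam * r by linarith),
      div_le_one (by linarith)]
    have := abs_le.1 m21
    have := abs_le.1 hsl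
    rw [abs_le]
    constructor <;> linarith) (by
    have := abs_le.1 m11
    rw [abs_le]
    constructor <;> linarith)
  have hyy := hy (by
    have hc := abs_le.1 hcl
    have e0 : lam * (c + y) / (r * (1 - lam + lam * r)) =
        lam * (y + c) / r / (1 - lam + lam * r) := by rw [div_div, add_comm]
    rw [e0, abs_div, abs_of_pos (show 0 < 1 - lam + lam * r by linarith),
      div_le_one (by linarith)]
    have := abs_le.1 m22.1
    rw [abs_le]
    constructor <;> linarith) (by linarith)
  have n1 := abs_le.1 m11
  have n2 := abs_le.1 m12
  have n3 := abs_le.1 m21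
  have n4 := abs_le.1 m22.1
  have x1 := abs_le.1 hxx.1
  have x2 := abs_le.1 hxx.2
  have y1 := abs_le.1 hyy.1
  have y2 := abs_le.1 hyy.2
  have hGη : G * η ≤ 2 * R * η := mul_le_mul_of_nonneg_right hGR hη0
  have hGη2 : G * (R * η) ≤ 2 * R * (R * η) := mul_le_mul_of_nonneg_right hGR (by nlinarith)
  -- The factor `G ≤ 2 R` and the length `2 R` of the angular vector together cost `R²`. To leave an
  -- error of order `R⁻²`, `η` must be of order `R⁻⁴`.
  have ex : G * (η * (2 * R + (1 + 3))) + η ≤ 2 * e := by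
    have : G * (η * (2 * R + (1 + 3))) = 2 * (G * (R * η)) + 4 * (G * η) := by ring
    have : 2 * R * (R * η) = 2 * (R ^ 2 * η) := by ring
    linarith
  have ey : G * (η * (1 + (1 + 1))) + η ≤ e := by linarith
  have ex' : η * (2 * R + (1 + 3)) ≤ e := by linarith
  rw [show lam * -(s * y) / r = -(lam * y * s / r) by ring] at x2
  rw [show lam * (c + y) / r = lam * (y + c) / r by rw [add_comm]] at y2
  refine ⟨?_, ?_, ?_, ?_, ?_⟩
  · rw [abs_le]; constructor <;> linarith
  · rw [abs_le]; constructor <;> linarith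
  · rw [abs_le]; constructor <;> linarith
  · rw [abs_le]; constructor <;> linarith
  · linarith [m22.2]

/-- With `e = R⁻²` the constants are `c = lam + e` and `σ = 10 e`, so that `c + 2 σ = 1 - R⁻¹ + 21
R⁻² < 1`: both the perturbation and the coupling are of lower order than the gap `1 - lam = R⁻¹`. -/
theorem stripMap (h : ModelClose lam δ η F F') (h0 : 0 < lam) (h1 : lam < 1)
    (hR : 10 ^ 7 ≤ (1 - lam)⁻¹) (hδ : δ ≤ 1)
    (hη : 10 * (1 - lam)⁻¹ ^ 2 * η ≤ 1 / (1 - lam)⁻¹ ^ 2) :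
    StripMap lam (1 - lam)⁻¹ (1 / (1 - lam)⁻¹ ^ 2) (lam + 1 / (1 - lam)⁻¹ ^ 2)
      (10 / (1 - lam)⁻¹ ^ 2) (liftF F) (liftG F) (fun p => (logDx F F' p).im)
      (fun p => (logDy F F' p).im) (fun p => liftG F p * (logDx F F' p).re)
      (fun p => liftG F p * (logDy F F' p).re) := by
  have hlamR : lam = 1 - 1 / (1 - lam)⁻¹ := by simp
  have hη0 : 0 ≤ η := by
    have hp : ((0, (1 - lam)⁻¹) : ℝ × ℝ) ∈ strip (1 - lam)⁻¹ := by
      constructor <;> simp only <;> linarith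
    exact (norm_nonneg _).trans (h.point_facts h0 h1 hR hδ hp).2.2.2.1
  obtain ⟨g1, g2, g3, g4, g5, g6⟩ := sq_bounds hR rfl hη0 hη
  set R := (1 - lam)⁻¹ with hRdef
  have hη1 : η ≤ 1 / 100 := by linarith
  have hR0 : 0 < R := by linarith
  have hRinv : (1 - lam) * R = 1 := mul_inv_cancel₀ (sub_pos.2 h1).ne'
  have hσe : 10 / R ^ 2 = 10 * (1 / R ^ 2) := by ring
  have he1 : 1 / R ^ 2 * 10 ^ 7 ≤ 1 - lam := by
    have : 1 / R ^ 2 * R = 1 / R := by field_simp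
    have h2 : 1 - lam = 1 / R := by linarith
    have := mul_le_mul_of_nonneg_left hR g2.le
    linarith
  have hslit : ∀ p ∈ strip R, rot F p ∈ Complex.slitPlane := fun p hp =>
    Or.inl (h.rot_bounds h0 h1 hR hδ hη1 hp).1
  have hder := fun p (hp : p ∈ strip R) => (h.point_facts h0 h1 hR hδ hp).2.2.1
  have hmaps : MapsTo pol (strip R) {z | 0 < ‖z‖ ∧ ‖z‖ < 2 * R} := by
    intro p hp
    obtain ⟨f1, f2, -⟩ := h.point_facts h0 h1 hR hδ hp
    exact ⟨norm_pos_iff.2 f2, by linarith [(abs_le.1 f1).2, hp.2]⟩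
  have hpolc : Continuous pol := by unfold pol; fun_prop
  have hF'c : ContinuousOn (fun p => F' (pol p)) (strip R) :=
    h.cont.comp hpolc.continuousOn hmaps
  have hFc : ContinuousOn (fun p => F (pol p) - 1) (strip R) := fun p hp =>
    (((hder p hp).continuousAt.comp hpolc.continuousAt).sub continuousAt_const).continuousWithinAt
  have hne : ∀ p ∈ strip R, F (pol p) - 1 ≠ 0 := fun p hp hz =>
    Complex.slitPlane_ne_zero (hslit p hp) (by rw [rot, hz, zero_mul])
  have hGc : ContinuousOn (liftG F) (strip R) := hFc.norm
  have hXc : ContinuousOn (logDx F F') (strip R) :=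
    (hF'c.clm_apply (by fun_prop)).div hFc hne
  have hYc : ContinuousOn (logDy F F') (strip R) :=
    (hF'c.clm_apply (by fun_prop)).div hFc hne
  have hb := fun p (hp : p ∈ strip R) => h.lift_deriv_bounds h0 h1 hR hδ hη hp
  refine
    { hR := by linarith
      hlam := h0
      hη := g2.le
      hηlam := by linarith
      hc := by linarith
      hcσ := by linarith
      hσ := by linarith
      f_deriv := fun p hp => hasFDerivAt_liftF (hder p hp) (hslit p hp)
      g_deriv := fun p hp => hasFDerivAt_liftG (hder p hp) (hslit p hp)
      cont11 := Complex.continuous_im.comp_continuousOn hXc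
      cont12 := Complex.continuous_im.comp_continuousOn hYc
      cont21 := hGc.mul (Complex.continuous_re.comp_continuousOn hXc)
      cont22 := hGc.mul (Complex.continuous_re.comp_continuousOn hYc)
      b11 := fun p hp => (hb p hp).1
      b12 := fun p hp => (hb p hp).2.1
      b21 := fun p hp => (hb p hp).2.2.1
      b22 := fun p hp => (hb p hp).2.2.2.1
      b22' := fun p hp => (hb p hp).2.2.2.2
      f_near := fun p hp => ?_
      f_zero := fun y hy1 hy2 => ?_
      g_lower := fun p hp => ?_
      g_upper := fun p hp => ?_ }
  · obtain ⟨r1, r2, r3, r4⟩ := h.rot_bounds h0 h1 hR hδ hη1 hp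
    rw [liftF, add_sub_cancel_left]
    rw [← norm_rot] at r2
    refine (abs_arg_le r1 r2).trans ?_
    rw [← hRdef, show 5 / R = 5 / 7 * (7 / R) by ring]
    linarith
  · obtain ⟨r1, r2, r3, r4⟩ := h.rot_bounds h0 h1 hR hδ hη1 (p := (0, y)) ⟨hy1, hy2⟩
    have e1 := r3 rfl
    rw [liftF]
    simp only [mul_zero, zero_add]
    rw [← norm_rot] at r4
    have := abs_arg_le r1 (b := η) (by nlinarith)
    linarith
  · obtain ⟨f1, f2, f3, f4, f5, f6, f7⟩ := h.point_facts h0 h1 hR hδ hp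
    have e1 := mul_le_mul_of_nonneg_left (le_norm_pol p) h0.le
    have e2 := (abs_le.1 f6).1
    linarith
  · obtain ⟨f1, f2, f3, f4, f5, f6, f7⟩ := h.point_facts h0 h1 hR hδ hp
    have e1 := mul_le_mul_of_nonneg_left (show ‖pol p‖ ≤ p.2 + 1 by linarith [(abs_le.1 f1).2]) h0.le
    have e2 := (abs_le.1 f6).2
    linarith

end ModelClose

/-! ### The topologies on the spaces of maps -/

/-- Evaluation is jointly continuous for locally uniform convergence. -/
lemma continuous_eval_of_uniformOnFun {T X Y : Type*} [TopologicalSpace T] [TopologicalSpace X]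
    [WeaklyLocallyCompactSpace X] [PseudoMetricSpace Y] {φ : T → X → Y}
    (hcont : ∀ τ, Continuous (φ τ))
    (hφ : Continuous fun τ => UniformOnFun.ofFun {K : Set X | IsCompact K} (φ τ)) :
    Continuous fun p : T × X => φ p.1 p.2 := by
  rw [continuous_iff_continuousAt]
  rintro ⟨τ₀, z₀⟩
  obtain ⟨K, hK, hKz⟩ := exists_compact_mem_nhds z₀
  have h1 := UniformOnFun.tendsto_iff_tendstoUniformlyOn.1 (hφ.tendsto τ₀) K hK
  rw [Metric.tendstoUniformlyOn_iff] at h1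
  rw [ContinuousAt, Metric.tendsto_nhds]
  intro ε hε
  have h2 := (Metric.tendsto_nhds.1 ((hcont τ₀).tendsto z₀)) (ε / 2) (half_pos hε)
  rw [nhds_prod_eq]
  filter_upwards [(h1 (ε / 2) (half_pos hε)).prod_mk (h2.and hKz)] with p hp
  have e1 := hp.1 p.2 hp.2.2
  simp only [UniformOnFun.ofFun, Function.comp] at e1
  have e2 := hp.2.1
  have e3 := dist_triangle_left (φ p.1 p.2) (φ τ₀ z₀) (φ τ₀ p.2)
  rw [dist_comm] at e1
  have e4 : dist (φ τ₀ p.2) (φ p.1 p.2) < ε / 2 := by rw [dist_comm]; exact e1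
  linarith

/-- Evaluation is jointly continuous for uniform convergence. -/
lemma continuous_eval_of_uniformFun {T X Y : Type*} [TopologicalSpace T] [TopologicalSpace X]
    [PseudoMetricSpace Y] {φ : T → X → Y} (hcont : ∀ τ, Continuous (φ τ))
    (hφ : Continuous fun τ => UniformFun.ofFun (φ τ)) :
    Continuous fun p : T × X => φ p.1 p.2 := by
  rw [continuous_iff_continuousAt]
  rintro ⟨τ₀, z₀⟩
  have h1 := UniformFun.tendsto_iff_tendstoUniformly.1 (hφ.tendsto τ₀)
  rw [Metric.tendstoUniformly_iff] at h1
  rw [ContinuousAt, Metric.tendsto_nhds]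
  intro ε hε
  have h2 := (Metric.tendsto_nhds.1 ((hcont τ₀).tendsto z₀)) (ε / 2) (half_pos hε)
  rw [nhds_prod_eq]
  filter_upwards [(h1 (ε / 2) (half_pos hε)).prod_mk h2] with p hp
  have e1 := hp.1 p.2
  simp only [UniformFun.ofFun, Function.comp] at e1
  have e2 := hp.2
  have e3 := dist_triangle_left (φ p.1 p.2) (φ τ₀ z₀) (φ τ₀ p.2)
  have e4 : dist (φ τ₀ p.2) (φ p.1 p.2) < ε / 2 := e1
  linarith

section Spaces

variable {lam : ℝ}

lemma isClosed_disc (lam : ℝ) : IsClosed (disc lam) := isClosed_le continuous_norm continuous_const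

lemma uniqueDiffOn_discStar (hl : lam ∈ Ioo (0 : ℝ) 1) : UniqueDiffOn ℝ (discStar lam) := by
  have h1 : disc lam = Metric.closedBall 0 (2 * (1 - lam)⁻¹) := by
    ext z
    simp [disc]
  have h2 : 0 < 2 * (1 - lam)⁻¹ := by linarith [inv_pos_of_mem hl]
  have h3 : UniqueDiffOn ℝ (disc lam) := by
    rw [h1]
    refine uniqueDiffOn_convex (convex_closedBall _ _) ?_
    rw [interior_closedBall _ h2.ne']
    exact ⟨0, Metric.mem_ball_self h2⟩
  exact h3.inter isOpen_compl_singleton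

instance (lam : ℝ) : LocallyCompactSpace (discStar lam) :=
  ((isClosed_disc lam).isLocallyClosed.inter
    isOpen_compl_singleton.isLocallyClosed).locallyCompactSpace

/-- The closed strip covering the closed cylinder. -/
def closedStrip (lam : ℝ) : Set (ℝ × ℝ) := univ ×ˢ Icc (1 - lam) (top lam)

lemma lt_top_of_mem (hl : lam ∈ Ioo (0 : ℝ) 1) : 1 - lam < top lam := by
  have h1 : (1 - lam) * (1 - lam)⁻¹ = 1 := mul_inv_cancel₀ (by linarith [hl.2])
  have h2 := inv_pos_of_mem hl
  have h3 : 1 < (1 - lam)⁻¹ := by nlinarith [hl.1]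
  unfold top
  linarith

lemma uniqueDiffOn_closedStrip (hl : lam ∈ Ioo (0 : ℝ) 1) : UniqueDiffOn ℝ (closedStrip lam) :=
  uniqueDiffOn_univ.prod (uniqueDiffOn_Icc (lt_top_of_mem hl))

lemma continuous_cylProj : Continuous cylProj :=
  (continuous_quotient_mk'.comp continuous_fst).prodMk continuous_snd

/-- The derivative of `τ`, read in `ℂ × ℝ`. -/
def SpaceT.drep (τ : SpaceT lam) (z : ℂ) : ℂ →L[ℝ] ℂ × ℝ := fderivWithin ℝ τ.rep (discStar lam) z

/-- The derivative of the lift of `g`. -/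
def SpaceG.dlift (g : SpaceG lam) (x : ℝ × ℝ) : ℝ × ℝ →L[ℝ] ℂ :=
  fderivWithin ℝ g.lift (closedStrip lam) x

/-- The derivative of `F`. -/
def SpaceF.dext (F : SpaceF lam) (z : ℂ) : ℂ →L[ℝ] ℂ := fderivWithin ℝ F.ext (discStar lam) z

lemma SpaceT.rep_of_mem (τ : SpaceT lam) {z : ℂ} (hz : z ∈ discStar lam) :
    τ.rep z = cylEmb ((τ.homeo ⟨z, hz⟩).1, ((τ.homeo ⟨z, hz⟩).2 : ℝ)) := by
  rw [SpaceT.rep, dif_pos hz]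

lemma SpaceT.exists_ext (τ : SpaceT lam) : ∃ (U : Set ℂ) (E : ℂ → ℂ × ℝ), IsOpen U ∧
    discStar lam ⊆ U ∧ ContDiffOn ℝ 1 E U ∧ EqOn τ.rep E (discStar lam) := by
  obtain ⟨U, T, hU, hsub, -, heq, -, hC, -⟩ := τ.extends_diffeo
  refine ⟨U, cylEmb ∘ T, hU, hsub, hC, fun z hz => ?_⟩
  rw [τ.rep_of_mem hz, Function.comp, heq ⟨z, hz⟩]

lemma SpaceT.hasFDerivWithinAt (τ : SpaceT lam) {z : ℂ} (hz : z ∈ discStar lam) :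
    HasFDerivWithinAt τ.rep (τ.drep z) (discStar lam) z := by
  obtain ⟨U, E, hU, hsub, hC, heq⟩ := τ.exists_ext
  have h := ((hC.differentiableOn one_ne_zero).mono hsub z hz).congr (fun w hw => heq hw) (heq hz)
  exact h.hasFDerivWithinAt

lemma SpaceT.continuousOn (hl : lam ∈ Ioo (0 : ℝ) 1) (τ : SpaceT lam) :
    ContinuousOn (fun z => (τ.rep z, τ.drep z)) (discStar lam) := by
  obtain ⟨U, E, hU, hsub, hC, heq⟩ := τ.exists_ext
  have h1 : ContinuousOn E (discStar lam) := hC.continuousOn.mono hsub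
  have h2 : ContinuousOn (fderiv ℝ E) (discStar lam) :=
    (hC.continuousOn_fderiv_of_isOpen hU le_rfl).mono hsub
  refine (h1.congr heq).prodMk (h2.congr fun z hz => ?_)
  rw [SpaceT.drep, fderivWithin_congr heq (heq hz)]
  exact ((hC.differentiableOn one_ne_zero).differentiableAt (hU.mem_nhds (hsub hz))).fderivWithin
    (uniqueDiffOn_discStar hl z hz)

/-- Local compactness of the punctured disc turns convergence on compact sets into joint continuity.
-/
lemma SpaceT.continuous_eval (hl : lam ∈ Ioo (0 : ℝ) 1) :
    Continuous fun p : SpaceT lam × discStar lam => (p.1.rep p.2, p.1.drep p.2) :=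
  continuous_eval_of_uniformOnFun (φ := fun (τ : SpaceT lam) (z : discStar lam) => (τ.rep z, τ.drep z))
    (fun τ => continuousOn_iff_continuous_domRestrict.1 (τ.continuousOn hl)) continuous_induced_dom

lemma SpaceG.lift_of_mem (g : SpaceG lam) {x : ℝ × ℝ} (hx : x ∈ closedStrip lam) :
    g.lift x = g.toFun ((x.1 : AddCircle (1 : ℝ)), ⟨x.2, hx.2⟩) := by
  rw [SpaceG.lift, dif_pos hx.2]

lemma SpaceG.exists_ext (g : SpaceG lam) : ∃ (U : Set (ℝ × ℝ)) (E : ℝ × ℝ → ℂ), IsOpen U ∧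
    closedStrip lam ⊆ U ∧ ContDiffOn ℝ 1 E U ∧ EqOn g.lift E (closedStrip lam) ∧
    ∀ x ∈ U, Function.Bijective (fderiv ℝ E x) := by
  obtain ⟨U, G, hU, hsub, heq, hC, hb⟩ := g.extends_localDiffeo
  refine ⟨cylProj ⁻¹' U, G ∘ cylProj, hU.preimage continuous_cylProj, fun x hx => hsub ⟨trivial, hx.2⟩,
    hC, fun x hx => ?_, hb⟩
  rw [g.lift_of_mem hx, ← heq]
  rfl

lemma SpaceG.hasFDerivWithinAt (g : SpaceG lam) {x : ℝ × ℝ} (hx : x ∈ closedStrip lam) :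
    HasFDerivWithinAt g.lift (g.dlift x) (closedStrip lam) x := by
  obtain ⟨U, E, hU, hsub, hC, heq, -⟩ := g.exists_ext
  have h := ((hC.differentiableOn one_ne_zero).mono hsub x hx).congr (fun w hw => heq hw) (heq hx)
  exact h.hasFDerivWithinAt

lemma SpaceG.dlift_eq (hl : lam ∈ Ioo (0 : ℝ) 1) (g : SpaceG lam) {U : Set (ℝ × ℝ)}
    {E : ℝ × ℝ → ℂ} (hU : IsOpen U) (hsub : closedStrip lam ⊆ U) (hC : ContDiffOn ℝ 1 E U)
    (heq : EqOn g.lift E (closedStrip lam)) {x : ℝ × ℝ} (hx : x ∈ closedStrip lam) :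
    g.dlift x = fderiv ℝ E x := by
  rw [SpaceG.dlift, fderivWithin_congr heq (heq hx)]
  exact ((hC.differentiableOn one_ne_zero).differentiableAt (hU.mem_nhds (hsub hx))).fderivWithin
    (uniqueDiffOn_closedStrip hl x hx)

lemma SpaceG.continuousOn (hl : lam ∈ Ioo (0 : ℝ) 1) (g : SpaceG lam) :
    ContinuousOn (fun x => (g.lift x, g.dlift x)) (closedStrip lam) := by
  obtain ⟨U, E, hU, hsub, hC, heq, -⟩ := g.exists_ext
  have h1 : ContinuousOn E (closedStrip lam) := hC.continuousOn.mono hsub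
  have h2 : ContinuousOn (fderiv ℝ E) (closedStrip lam) :=
    (hC.continuousOn_fderiv_of_isOpen hU le_rfl).mono hsub
  exact (h1.congr heq).prodMk (h2.congr fun x hx => g.dlift_eq hl hU hsub hC heq hx)

lemma SpaceG.continuous_eval (hl : lam ∈ Ioo (0 : ℝ) 1) :
    Continuous fun p : SpaceG lam × closedStrip lam => (p.1.lift p.2, p.1.dlift p.2) :=
  continuous_eval_of_uniformFun (φ := fun (g : SpaceG lam) (x : closedStrip lam) => (g.lift x, g.dlift x))
    (fun g => continuousOn_iff_continuous_domRestrict.1 (g.continuousOn hl)) continuous_induced_dom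

end Spaces

/-! ### The derivative of a composition -/

/-- The lift of the angle of `e` that is equal to `x₀` at `e₀`. -/
def localAngle (x₀ : ℝ) (e₀ e : ℂ) : ℝ := x₀ + (Complex.log (e / e₀)).im / (2 * Real.pi)

lemma coe_toCircle (x : ℝ) :
    (AddCircle.toCircle ((x : ℝ) : AddCircle (1 : ℝ)) : ℂ) = Complex.exp (2 * Real.pi * x * Complex.I) := by
  rw [AddCircle.toCircle_apply_mk, Circle.coe_exp]
  push_cast
  ring_nf

lemma coe_toCircle_localAngle {x₀ : ℝ} {e₀ e : ℂ} (he₀ : ‖e₀‖ = 1) (he : ‖e‖ = 1)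
    (h : (AddCircle.toCircle ((x₀ : ℝ) : AddCircle (1 : ℝ)) : ℂ) = e₀) :
    (AddCircle.toCircle ((localAngle x₀ e₀ e : ℝ) : AddCircle (1 : ℝ)) : ℂ) = e := by
  rw [coe_toCircle] at h ⊢
  have h0 : e₀ ≠ 0 := fun h => by simp [h] at he₀
  have hpi : (Real.pi : ℂ) ≠ 0 := by exact_mod_cast Real.pi_ne_zero
  have h1 : Complex.exp (Complex.arg (e / e₀) * Complex.I) = e / e₀ := by
    have := Complex.norm_mul_exp_arg_mul_I (e / e₀)
    rwa [norm_div, he, he₀, div_one, Complex.ofReal_one, one_mul] at this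
  have h2 : (2 * Real.pi * (localAngle x₀ e₀ e : ℝ) * Complex.I : ℂ) =
      2 * Real.pi * x₀ * Complex.I + Complex.arg (e / e₀) * Complex.I := by
    rw [localAngle, Complex.log_im]
    push_cast
    field_simp
  rw [h2, Complex.exp_add, h, h1, mul_div_cancel₀ _ h0]

lemma localAngle_self {x₀ : ℝ} {e₀ : ℂ} (he₀ : ‖e₀‖ = 1) : localAngle x₀ e₀ e₀ = x₀ := by
  have h0 : e₀ ≠ 0 := fun h => by simp [h] at he₀
  simp [localAngle, div_self h0]

/-- The derivative of `(e, t) ↦ (angle of e, t)`. -/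
def angleCLM (e₀ : ℂ) : ℂ × ℝ →L[ℝ] ℝ × ℝ :=
  ((2 * Real.pi)⁻¹ • Complex.imCLM.comp
    ((ContinuousLinearMap.mul ℝ ℂ e₀⁻¹).comp (ContinuousLinearMap.fst ℝ ℂ ℝ))).prod
    (ContinuousLinearMap.snd ℝ ℂ ℝ)

lemma hasFDerivAt_localAngle {x₀ t₀ : ℝ} {e₀ : ℂ} (he₀ : e₀ ≠ 0) :
    HasFDerivAt (fun p : ℂ × ℝ => (localAngle x₀ e₀ p.1, p.2)) (angleCLM e₀) (e₀, t₀) := by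
  have h1 : HasFDerivAt (fun p : ℂ × ℝ => e₀⁻¹ * p.1)
      ((ContinuousLinearMap.mul ℝ ℂ e₀⁻¹).comp (ContinuousLinearMap.fst ℝ ℂ ℝ)) (e₀, t₀) :=
    (ContinuousLinearMap.mul ℝ ℂ e₀⁻¹).hasFDerivAt.comp (e₀, t₀) hasFDerivAt_fst
  have hlog : HasFDerivAt Complex.log _ (e₀⁻¹ * e₀) :=
    (Complex.hasStrictDerivAt_log (x := e₀⁻¹ * e₀)
      (by rw [inv_mul_cancel₀ he₀]; exact Complex.one_mem_slitPlane)).hasDerivAt.complexToReal_fderiv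
  have h2 := HasFDerivAt.comp (g := Complex.log) (f := fun p : ℂ × ℝ => e₀⁻¹ * p.1) (e₀, t₀) hlog h1
  have h3 := ((Complex.imCLM.hasFDerivAt.comp (e₀, t₀) h2).const_mul (2 * Real.pi)⁻¹).const_add x₀
  have h4 := h3.prodMk (hasFDerivAt_snd (𝕜 := ℝ) (p := (e₀, t₀)))
  refine (h4.congr_of_eventuallyEq (.of_forall fun p => ?_)).congr_fderiv ?_
  · simp only [localAngle, Function.comp, Complex.imCLM_apply]
    rw [div_eq_inv_mul, div_eq_inv_mul]
  · rw [inv_mul_cancel₀ he₀]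
    ext <;> simp [angleCLM]

lemma continuous_angleCLM : ContinuousOn angleCLM {e | e ≠ 0} := by
  have h : ContinuousOn (fun e : ℂ => e⁻¹) {e | e ≠ 0} := continuousOn_inv₀
  have h2 : ContinuousOn (fun e : ℂ => ContinuousLinearMap.mul ℝ ℂ e⁻¹) {e | e ≠ 0} :=
    (ContinuousLinearMap.mul ℝ ℂ).continuous.comp_continuousOn h
  have h3 : ContinuousOn (fun e : ℂ => (2 * Real.pi)⁻¹ • Complex.imCLM.comp
      ((ContinuousLinearMap.mul ℝ ℂ e⁻¹).comp (ContinuousLinearMap.fst ℝ ℂ ℝ))) {e | e ≠ 0} := by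
    fun_prop
  exact (ContinuousLinearMap.prodₗᵢ ℝ).continuous.comp_continuousOn
    (h3.prodMk continuousOn_const)

section Compose

variable {lam : ℝ}

lemma SpaceT.norm_rep_fst (τ : SpaceT lam) {z : ℂ} (hz : z ∈ discStar lam) :
    ‖(τ.rep z).1‖ = 1 := by
  rw [τ.rep_of_mem hz, cylEmb, Circle.norm_coe]

lemma SpaceT.rep_snd_mem (τ : SpaceT lam) {z : ℂ} (hz : z ∈ discStar lam) :
    (τ.rep z).2 ∈ Ioc (1 - lam) (top lam) := by
  rw [τ.rep_of_mem hz]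
  exact (τ.homeo ⟨z, hz⟩).2.2

lemma SpaceF.ext_of_mem (F : SpaceF lam) {z : ℂ} (hz : z ∈ discStar lam) :
    F.ext z = F.toFun ⟨z, hz⟩ := by
  rw [SpaceF.ext, dif_pos hz]

/-- The composition in coordinates. -/
lemma compMap_ext_eq (τ : SpaceT lam) (g : SpaceG lam) {z : ℂ} (hz : z ∈ discStar lam) {x : ℝ}
    (hx : (AddCircle.toCircle ((x : ℝ) : AddCircle (1 : ℝ)) : ℂ) = (τ.rep z).1) :
    (compMap lam (τ, g)).ext z = g.lift (x, (τ.rep z).2) := by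
  have hm : (x, (τ.rep z).2) ∈ closedStrip lam := ⟨trivial, Ioc_subset_Icc_self (τ.rep_snd_mem hz)⟩
  rw [SpaceF.ext_of_mem _ hz, g.lift_of_mem hm]
  have h1 : ((x : ℝ) : AddCircle (1 : ℝ)) = (τ.homeo ⟨z, hz⟩).1 := by
    apply toCircle_injective
    apply Subtype.ext
    rw [hx, τ.rep_of_mem hz, cylEmb]
  have h2 : (τ.rep z).2 = (τ.homeo ⟨z, hz⟩).2 := by rw [τ.rep_of_mem hz, cylEmb]
  simp only [compMap, compFun]
  congr 1
  exact Prod.ext h1.symm (Subtype.ext h2.symm)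

/-- The angle of `τ` is lifted near `z` to a real function; the chain rule then goes through the
strip, where `g` has an ordinary derivative. -/
lemma compMap_hasFDerivWithinAt (τ : SpaceT lam) (g : SpaceG lam) {z : ℂ} (hz : z ∈ discStar lam)
    {x : ℝ} (hx : (AddCircle.toCircle ((x : ℝ) : AddCircle (1 : ℝ)) : ℂ) = (τ.rep z).1) :
    HasFDerivWithinAt (compMap lam (τ, g)).ext
      (((g.dlift (x, (τ.rep z).2)).comp (angleCLM (τ.rep z).1)).comp (τ.drep z))
      (discStar lam) z := by
  set e₀ := (τ.rep z).1 with he₀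
  have hn := τ.norm_rep_fst hz
  have he0 : e₀ ≠ 0 := fun h => by rw [← he₀, h] at hn; simp at hn
  have h1 := (hasFDerivAt_localAngle (x₀ := x) (t₀ := (τ.rep z).2) he0).comp_hasFDerivWithinAt z
    (τ.hasFDerivWithinAt hz)
  have hloc : ∀ w ∈ discStar lam, (AddCircle.toCircle ((localAngle x e₀ (τ.rep w).1 : ℝ) :
      AddCircle (1 : ℝ)) : ℂ) = (τ.rep w).1 := fun w hw =>
    coe_toCircle_localAngle hn (τ.norm_rep_fst hw) hx
  have hm : (x, (τ.rep z).2) ∈ closedStrip lam := ⟨trivial, Ioc_subset_Icc_self (τ.rep_snd_mem hz)⟩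
  have h2 := g.hasFDerivWithinAt hm
  have hself : localAngle x e₀ (τ.rep z).1 = x := localAngle_self hn
  have h3 := HasFDerivWithinAt.comp z (t := closedStrip lam)
    (f := (fun p : ℂ × ℝ => (localAngle x e₀ p.1, p.2)) ∘ τ.rep) (g := g.lift)
    (g' := g.dlift (x, (τ.rep z).2)) (by simpa [hself] using h2) h1
    (fun w hw => ⟨trivial, Ioc_subset_Icc_self (τ.rep_snd_mem hw)⟩)
  rw [ContinuousLinearMap.comp_assoc]
  exact h3.congr (fun w hw => compMap_ext_eq τ g hw (hloc w hw))
    (compMap_ext_eq τ g hz (hloc z hz))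

lemma compMap_dext (hl : lam ∈ Ioo (0 : ℝ) 1) (τ : SpaceT lam) (g : SpaceG lam) {z : ℂ}
    (hz : z ∈ discStar lam) {x : ℝ}
    (hx : (AddCircle.toCircle ((x : ℝ) : AddCircle (1 : ℝ)) : ℂ) = (τ.rep z).1) :
    (compMap lam (τ, g)).dext z =
      ((g.dlift (x, (τ.rep z).2)).comp (angleCLM (τ.rep z).1)).comp (τ.drep z) :=
  (compMap_hasFDerivWithinAt τ g hz hx).fderivWithin (uniqueDiffOn_discStar hl z hz)

lemma exists_toCircle_eq {e : ℂ} (he : ‖e‖ = 1) :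
    ∃ x : ℝ, (AddCircle.toCircle ((x : ℝ) : AddCircle (1 : ℝ)) : ℂ) = e := by
  refine ⟨Complex.arg e / (2 * Real.pi), ?_⟩
  have hpi : (Real.pi : ℂ) ≠ 0 := by exact_mod_cast Real.pi_ne_zero
  rw [coe_toCircle]
  have := Complex.norm_mul_exp_arg_mul_I e
  rw [he, Complex.ofReal_one, one_mul] at this
  rw [← this]
  congr 1
  push_cast
  rw [this]
  field_simp

/-- One branch of the angle, continuous near the base point, is used for all triples. The values do
not depend on the branch, since the lift of `g` is periodic. -/
theorem continuous_compMap_eval (hl : lam ∈ Ioo (0 : ℝ) 1) :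
    Continuous fun p : (SpaceT lam × SpaceG lam) × discStar lam =>
      ((compMap lam p.1).ext p.2, (compMap lam p.1).dext p.2) := by
  rw [continuous_iff_continuousAt]
  rintro ⟨⟨τ₀, g₀⟩, z₀⟩
  have hn := τ₀.norm_rep_fst z₀.2
  obtain ⟨x₀, hx₀⟩ := exists_toCircle_eq hn
  set e₀ := (τ₀.rep z₀).1 with he₀
  have he0 : e₀ ≠ 0 := fun h => by rw [h] at hn; simp at hn
  have hT : Continuous fun p : (SpaceT lam × SpaceG lam) × discStar lam =>
      (p.1.1.rep p.2, p.1.1.drep p.2) :=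
    (SpaceT.continuous_eval hl).comp (by fun_prop :
      Continuous fun p : (SpaceT lam × SpaceG lam) × discStar lam => (p.1.1, p.2))
  have hrep : Continuous fun p : (SpaceT lam × SpaceG lam) × discStar lam => p.1.1.rep p.2 :=
    hT.fst
  set P : (SpaceT lam × SpaceG lam) × discStar lam := ((τ₀, g₀), z₀) with hP
  have hx : ContinuousAt (fun p : (SpaceT lam × SpaceG lam) × discStar lam =>
      localAngle x₀ e₀ (p.1.1.rep p.2).1) P := by
    have h1 := (hasFDerivAt_localAngle (x₀ := x₀) (t₀ := (τ₀.rep z₀).2) he0).continuousAt.fst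
    exact ContinuousAt.comp (f := fun p : (SpaceT lam × SpaceG lam) × discStar lam => p.1.1.rep p.2)
      (x := P) h1 hrep.continuousAt
  set X : (SpaceT lam × SpaceG lam) × discStar lam → closedStrip lam := fun p =>
    ⟨(localAngle x₀ e₀ (p.1.1.rep p.2).1, (p.1.1.rep p.2).2),
      trivial, Ioc_subset_Icc_self (p.1.1.rep_snd_mem p.2.2)⟩ with hX
  have hXc : ContinuousAt X P := by
    rw [IsInducing.subtypeVal.continuousAt_iff]
    exact hx.prodMk hrep.snd.continuousAt
  have hGc : ContinuousAt (fun p : (SpaceT lam × SpaceG lam) × discStar lam =>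
      (p.1.2.lift (X p), p.1.2.dlift (X p))) P := by
    have h1 : ContinuousAt (fun p : (SpaceT lam × SpaceG lam) × discStar lam => (p.1.2, X p)) P :=
      (by fun_prop : Continuous fun p : (SpaceT lam × SpaceG lam) × discStar lam =>
        p.1.2).continuousAt.prodMk hXc
    exact ContinuousAt.comp (x := P) (SpaceG.continuous_eval hl).continuousAt h1
  have hA : ContinuousAt (fun p : (SpaceT lam × SpaceG lam) × discStar lam =>
      angleCLM (p.1.1.rep p.2).1) P :=
    ContinuousAt.comp (x := P) (continuous_angleCLM.continuousAt (isOpen_ne.mem_nhds he0))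
      hrep.fst.continuousAt
  have hfin : ContinuousAt (fun p : (SpaceT lam × SpaceG lam) × discStar lam =>
      (p.1.2.lift (X p), ((p.1.2.dlift (X p)).comp (angleCLM (p.1.1.rep p.2).1)).comp
        (p.1.1.drep p.2))) P :=
    hGc.fst.prodMk ((hGc.snd.clm_comp hA).clm_comp hT.snd.continuousAt)
  refine hfin.congr (.of_forall fun p => ?_)
  have hloc := coe_toCircle_localAngle hn (p.1.1.norm_rep_fst p.2.2) hx₀
  exact Prod.ext (compMap_ext_eq p.1.1 p.1.2 p.2.2 hloc).symm
    (compMap_dext hl p.1.1 p.1.2 p.2.2 hloc).symm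

/-- Conditions on the values and derivatives on a compact set are open. -/
theorem isOpen_forall_mem (hl : lam ∈ Ioo (0 : ℝ) 1) {K : Set (discStar lam)} (hK : IsCompact K)
    {W : Set (discStar lam × ℂ × (ℂ →L[ℝ] ℂ))} (hW : IsOpen W) :
    IsOpen {F : SpaceF lam | ∀ z ∈ K, (z, F.ext z, F.dext z) ∈ W} := by
  rw [isOpen_coinduced]
  rw [isOpen_iff_eventually]
  intro p hp
  refine hK.eventually_forall_of_forall_eventually fun z hz => ?_
  have hc : Continuous fun p : (SpaceT lam × SpaceG lam) × discStar lam =>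
      (p.2, (compMap lam p.1).ext p.2, (compMap lam p.1).dext p.2) :=
    continuous_snd.prodMk (continuous_compMap_eval hl)
  exact hc.continuousAt.eventually (hW.mem_nhds (hp z hz))

lemma continuous_ext_apply (hl : lam ∈ Ioo (0 : ℝ) 1) {z : ℂ} (hz : z ∈ discStar lam) :
    Continuous fun F : SpaceF lam => F.ext z := by
  rw [continuous_coinduced_dom]
  exact ((continuous_compMap_eval hl).comp (Continuous.prodMk_left ⟨z, hz⟩)).fst

/-- A map in the space is differentiable on the punctured disc, with continuous derivative. -/
lemma SpaceF.exists_compMap (F : SpaceF lam) : ∃ τ g, F = compMap lam (τ, g) := by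
  obtain ⟨τ, g, h⟩ := F.isComp
  refine ⟨τ, g, ?_⟩
  cases F
  simp only [compMap, SpaceF.mk.injEq]
  exact funext h

lemma SpaceF.hasFDerivWithinAt (hl : lam ∈ Ioo (0 : ℝ) 1) (F : SpaceF lam) {z : ℂ}
    (hz : z ∈ discStar lam) : HasFDerivWithinAt F.ext (F.dext z) (discStar lam) z := by
  obtain ⟨τ, g, rfl⟩ := F.exists_compMap
  obtain ⟨x, hx⟩ := exists_toCircle_eq (τ.norm_rep_fst hz)
  rw [compMap_dext hl τ g hz hx]
  exact compMap_hasFDerivWithinAt τ g hz hx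

lemma SpaceF.continuousOn_dext (hl : lam ∈ Ioo (0 : ℝ) 1) (F : SpaceF lam) :
    ContinuousOn F.dext (discStar lam) := by
  obtain ⟨τ, g, rfl⟩ := F.exists_compMap
  rw [continuousOn_iff_continuous_domRestrict]
  exact ((continuous_compMap_eval hl).comp (Continuous.prodMk_right (τ, g))).snd

lemma SpaceF.hasFDerivAt (hl : lam ∈ Ioo (0 : ℝ) 1) (F : SpaceF lam) {z : ℂ}
    (h0 : 0 < ‖z‖) (h1 : ‖z‖ < 2 * (1 - lam)⁻¹) : HasFDerivAt F.ext (F.dext z) z := by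
  refine (F.hasFDerivWithinAt hl ⟨h1.le, norm_pos_iff.1 h0⟩).hasFDerivAt ?_
  filter_upwards [(isOpen_lt continuous_const continuous_norm).mem_nhds h0,
    (isOpen_lt continuous_norm continuous_const).mem_nhds h1] with w hw0 hw1
  exact ⟨le_of_lt hw1, norm_pos_iff.1 hw0⟩

end Compose

/-! ### Local inverses -/

/-- Strictly differentiable functions increase along the directions of positive derivative. -/
lemma eventually_add_le_of_hasStrictFDerivAt {f : ℂ → ℝ} {f' : ℂ →L[ℝ] ℝ} {w₀ v : ℂ}
    (hf : HasStrictFDerivAt f f' w₀) (hv : 0 < f' v) :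
    ∀ᶠ p : ℂ × ℝ in 𝓝 (w₀, 0), 0 ≤ p.2 → f p.1 + p.2 * (f' v / 2) ≤ f (p.1 + p.2 • v) := by
  have hv0 : 0 < ‖v‖ := norm_pos_iff.2 fun h => by simp [h] at hv
  have hc : 0 < f' v / 2 / ‖v‖ := by positivity
  have h1 := hf.isLittleO.def hc
  have h2 : Tendsto (fun p : ℂ × ℝ => (p.1 + p.2 • v, p.1)) (𝓝 (w₀, 0)) (𝓝 (w₀, w₀)) := by
    have : Continuous fun p : ℂ × ℝ => (p.1 + p.2 • v, p.1) := by fun_prop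
    have h := this.tendsto (w₀, 0)
    simpa using h
  filter_upwards [h2.eventually h1] with p hp hs
  simp only [add_sub_cancel_left, map_smul, norm_smul, smul_eq_mul, Real.norm_of_nonneg hs] at hp
  have h3 : f' v / 2 / ‖v‖ * (p.2 * ‖v‖) = p.2 * (f' v / 2) := by field_simp
  rw [h3, Real.norm_eq_abs] at hp
  linarith [(abs_le.1 hp).1]

/-- The sign of this form is the sign of the second coordinate of `A⁻¹ v`. -/
def outForm (A : ℝ × ℝ →L[ℝ] ℂ) (v : ℂ) : ℝ :=
  (starRingEnd ℂ (A (1, 0)) * v).im * (starRingEnd ℂ (A (1, 0)) * A (0, 1)).im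

lemma apply_eq_add (A : ℝ × ℝ →L[ℝ] ℂ) (y : ℝ × ℝ) :
    A y = y.1 * A (1, 0) + y.2 * A (0, 1) := by
  have h : y = y.1 • ((1 : ℝ), (0 : ℝ)) + y.2 • ((0 : ℝ), (1 : ℝ)) := by ext <;> simp
  conv_lhs => rw [h, map_add, map_smul, map_smul]
  simp

lemma outForm_apply (A : ℝ × ℝ →L[ℝ] ℂ) (y : ℝ × ℝ) :
    outForm A (A y) = y.2 * (starRingEnd ℂ (A (1, 0)) * A (0, 1)).im ^ 2 := by
  rw [outForm, apply_eq_add A y]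
  have h : (starRingEnd ℂ (A (1, 0)) * (y.1 * A (1, 0) + y.2 * A (0, 1))).im =
      y.2 * (starRingEnd ℂ (A (1, 0)) * A (0, 1)).im := by
    simp [Complex.mul_im]
    ring
  rw [h]
  ring

/-- The imaginary part of `conj (A (1, 0)) * A (0, 1)` is the determinant of `A`; if it vanished,
the two columns would be dependent. -/
lemma im_conj_mul_ne_zero {A : ℝ × ℝ →L[ℝ] ℂ} (hA : Function.Injective A) :
    (starRingEnd ℂ (A (1, 0)) * A (0, 1)).im ≠ 0 := by
  intro h
  have h0 : A (1, 0) ≠ 0 := fun h0 => by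
    have := hA (h0.trans (map_zero A).symm)
    simp at this
  have h1 : A (((A (1, 0)).re * (A (0, 1)).re + (A (1, 0)).im * (A (0, 1)).im),
      -((A (1, 0)).re * (A (1, 0)).re + (A (1, 0)).im * (A (1, 0)).im)) = 0 := by
    rw [apply_eq_add]
    simp [Complex.mul_im] at h
    apply Complex.ext
    · simp
      linear_combination (A (1, 0)).im * h
    · simp
      linear_combination (-(A (1, 0)).re) * h
  have h2 := hA (h1.trans (map_zero A).symm)
  simp only [Prod.mk_eq_zero, neg_eq_zero] at h2
  apply h0
  apply Complex.ext
  · exact pow_eq_zero_iff two_ne_zero |>.1 (le_antisymm (by nlinarith [h2.2, sq_nonneg (A (1, 0)).im]) (sq_nonneg _))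
  · exact pow_eq_zero_iff two_ne_zero |>.1 (le_antisymm (by nlinarith [h2.2, sq_nonneg (A (1, 0)).re]) (sq_nonneg _))

lemma continuous_outForm : Continuous fun p : (ℝ × ℝ →L[ℝ] ℂ) × ℂ => outForm p.1 p.2 := by
  unfold outForm
  have h1 : Continuous fun p : (ℝ × ℝ →L[ℝ] ℂ) × ℂ => p.1 (1, 0) := by fun_prop
  have h2 : Continuous fun p : (ℝ × ℝ →L[ℝ] ℂ) × ℂ => p.1 (0, 1) := by fun_prop
  exact (Complex.continuous_im.comp ((Complex.continuous_conj.comp h1).mul continuous_snd)).mul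
    (Complex.continuous_im.comp ((Complex.continuous_conj.comp h1).mul h2))

/-- A local inverse, with the growth of its second coordinate. -/
lemma exists_localInverse {E : ℝ × ℝ → ℂ} {x : ℝ × ℝ} {A : ℝ × ℝ →L[ℝ] ℂ}
    (hE : HasStrictFDerivAt E A x) (hA : Function.Bijective A) :
    ∃ I : ℂ → ℝ × ℝ, ContinuousAt I (E x) ∧ I (E x) = x ∧ (∀ᶠ y in 𝓝 x, I (E y) = y) ∧
      (∀ᶠ w in 𝓝 (E x), E (I w) = w ∧ ContinuousAt I w) ∧
      (∀ v, 0 < outForm A v → ∃ c > 0, ∀ᶠ p : ℂ × ℝ in 𝓝 (E x, 0), 0 ≤ p.2 →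
        (I p.1).2 + p.2 * c ≤ (I (p.1 + p.2 • v)).2) ∧
      (∀ v, outForm A v < 0 → ∃ c > 0, ∀ᶠ p : ℂ × ℝ in 𝓝 (E x, 0), 0 ≤ p.2 →
        (I (p.1 + p.2 • v)).2 ≤ (I p.1).2 - p.2 * c) := by
  set B : (ℝ × ℝ) ≃L[ℝ] ℂ := (LinearEquiv.ofBijective (A : ℝ × ℝ →ₗ[ℝ] ℂ) hA).toContinuousLinearEquiv
    with hB
  have hBA : (B : ℝ × ℝ →L[ℝ] ℂ) = A := by ext <;> rfl
  rw [← hBA] at hE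
  have hinv := hE.to_localInverse
  have hsnd : HasStrictFDerivAt (fun w => (hE.localInverse E B x w).2)
      ((ContinuousLinearMap.snd ℝ ℝ ℝ).comp (B.symm : ℂ →L[ℝ] ℝ × ℝ)) (E x) :=
    (ContinuousLinearMap.snd ℝ ℝ ℝ).hasStrictFDerivAt.comp (E x) hinv
  have hD := im_conj_mul_ne_zero hA.1
  have hform : ∀ v, outForm A v = (B.symm v).2 * (starRingEnd ℂ (A (1, 0)) * A (0, 1)).im ^ 2 := by
    intro v
    have : A (B.symm v) = v := by rw [← hBA]; exact B.apply_symm_apply v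
    rw [← outForm_apply, this]
  have hD2 : 0 < (starRingEnd ℂ (A (1, 0)) * A (0, 1)).im ^ 2 := by positivity
  refine ⟨hE.localInverse E B x, hinv.continuousAt, hE.localInverse_apply_image,
    hE.eventually_left_inverse, hE.eventually_right_inverse.and ?_, fun v hv => ?_, fun v hv => ?_⟩
  · have := (hE.toOpenPartialHomeomorph E).open_target.mem_nhds hE.image_mem_toOpenPartialHomeomorph_target
    filter_upwards [this] with w hw
    exact (hE.toOpenPartialHomeomorph E).symm.continuousAt hw
  · rw [hform] at hv
    have h0 : 0 < (B.symm v).2 := pos_of_mul_pos_left hv hD2.le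
    exact ⟨(B.symm v).2 / 2, half_pos h0, eventually_add_le_of_hasStrictFDerivAt hsnd h0⟩
  · rw [hform] at hv
    have h0 : 0 < -(B.symm v).2 := by
      by_contra! h
      nlinarith
    refine ⟨-(B.symm v).2 / 2, half_pos h0, ?_⟩
    filter_upwards [eventually_add_le_of_hasStrictFDerivAt hsnd.neg (v := v) h0] with p hp hs
    have := hp hs
    simp only [neg_apply, Pi.neg_apply, ContinuousLinearMap.comp_apply, ContinuousLinearMap.coe_snd',
      ContinuousLinearEquiv.coe_coe] at this
    linarith

/-! ### The factor `g` at the bottom circle of the cylinder. -/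

section Bottom

variable {lam : ℝ}

/-- A fundamental domain of the closed cylinder. -/
def cell (lam : ℝ) : Set (ℝ × ℝ) := Icc 0 1 ×ˢ Icc (1 - lam) (top lam)

lemma isCompact_cell (lam : ℝ) : IsCompact (cell lam) := isCompact_Icc.prod isCompact_Icc

lemma cell_subset (lam : ℝ) : cell lam ⊆ closedStrip lam := fun _ hx => ⟨trivial, hx.2⟩

/-- Along the bottom circle, the direction away from `1` points into the cylinder. -/
def SpaceG.Outward (g : SpaceG lam) : Prop :=
  ∀ x ∈ cell lam, x.2 = 1 - lam → 0 < outForm (g.dlift x) (g.lift x - 1)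

lemma SpaceG.hasStrictFDerivAt (hl : lam ∈ Ioo (0 : ℝ) 1) (g : SpaceG lam) {U : Set (ℝ × ℝ)}
    {E : ℝ × ℝ → ℂ} (hU : IsOpen U) (hsub : closedStrip lam ⊆ U) (hC : ContDiffOn ℝ 1 E U)
    (heq : EqOn g.lift E (closedStrip lam)) {x : ℝ × ℝ} (hx : x ∈ closedStrip lam) :
    HasStrictFDerivAt E (g.dlift x) x := by
  rw [g.dlift_eq hl hU hsub hC heq hx]
  exact (hC.contDiffAt (hU.mem_nhds (hsub hx))).hasStrictFDerivAt one_ne_zero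

lemma SpaceG.bijective_dlift (hl : lam ∈ Ioo (0 : ℝ) 1) (g : SpaceG lam) {x : ℝ × ℝ}
    (hx : x ∈ closedStrip lam) : Function.Bijective (g.dlift x) := by
  obtain ⟨U, E, hU, hsub, hC, heq, hb⟩ := g.exists_ext
  rw [g.dlift_eq hl hU hsub hC heq hx]
  exact hb x (hsub hx)

/-- Points beyond the image of a bottom point are images of nearby points of the cylinder. -/
lemma SpaceG.eventually_exists_of_outForm_pos (hl : lam ∈ Ioo (0 : ℝ) 1) (g : SpaceG lam) {x : ℝ × ℝ}
    (hx : x ∈ closedStrip lam) (hx2 : x.2 = 1 - lam) {v : ℂ} (hv : 0 < outForm (g.dlift x) v)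
    {W : Set (ℝ × ℝ)} (hW : W ∈ 𝓝 x) :
    ∀ᶠ s : ℝ in 𝓝[>] 0, ∃ y ∈ W, 1 - lam < y.2 ∧ y.2 < top lam ∧ g.lift y = g.lift x + s • v := by
  obtain ⟨U, E, hU, hsub, hC, heq, -⟩ := g.exists_ext
  obtain ⟨I, hIc, hIx, -, hr, hpos, -⟩ :=
    exists_localInverse (g.hasStrictFDerivAt hl hU hsub hC heq hx) (g.bijective_dlift hl hx)
  obtain ⟨c, hc, hcv⟩ := hpos v hv
  have h1 : Tendsto (fun s : ℝ => E x + s • v) (𝓝[>] 0) (𝓝 (E x)) := by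
    have : Continuous fun s : ℝ => E x + s • v := by fun_prop
    simpa using (this.tendsto 0).mono_left nhdsWithin_le_nhds
  have h2 : Tendsto (fun s : ℝ => (E x, s)) (𝓝[>] 0) (𝓝 (E x, 0)) :=
    ((Continuous.prodMk_right (E x)).tendsto 0).mono_left nhdsWithin_le_nhds
  have hI : Tendsto I (𝓝 (E x)) (𝓝 x) := by simpa [ContinuousAt, hIx] using hIc
  have htop : {y : ℝ × ℝ | y.2 < top lam} ∈ 𝓝 x :=
    (isOpen_lt continuous_snd continuous_const).mem_nhds (by
      change x.2 < _
      rw [hx2]; exact lt_top_of_mem hl)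
  filter_upwards [h1.eventually hr, h2.eventually hcv, (hI.comp h1) hW, (hI.comp h1) htop,
    self_mem_nhdsWithin] with s e1 e2 e3 e4 hs
  have hs0 : (0 : ℝ) < s := hs
  have e5 := e2 hs0.le
  simp only [hIx, hx2] at e5
  have e6 : 1 - lam < (I (E x + s • v)).2 := by nlinarith
  refine ⟨I (E x + s • v), e3, e6, e4, ?_⟩
  rw [heq ⟨trivial, e6.le, le_of_lt e4⟩, e1.1, heq hx]

/-- Points before the image of a bottom point are not images of nearby points of the cylinder. -/
lemma SpaceG.eventually_ne_of_outForm_pos (hl : lam ∈ Ioo (0 : ℝ) 1) (g : SpaceG lam) {x : ℝ × ℝ}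
    (hx : x ∈ closedStrip lam) (hx2 : x.2 = 1 - lam) {v : ℂ} (hv : 0 < outForm (g.dlift x) v) :
    ∀ᶠ p : ℝ × (ℝ × ℝ) in 𝓝 (0, x), 0 < p.1 → p.2 ∈ closedStrip lam → g.lift p.2 ≠ g.lift x - p.1 • v := by
  obtain ⟨U, E, hU, hsub, hC, heq, -⟩ := g.exists_ext
  obtain ⟨I, -, hIx, hleft, -, hpos, -⟩ :=
    exists_localInverse (g.hasStrictFDerivAt hl hU hsub hC heq hx) (g.bijective_dlift hl hx)
  obtain ⟨c, hc, hcv⟩ := hpos v hv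
  have h1 : Tendsto (fun p : ℝ × (ℝ × ℝ) => (E x - p.1 • v, p.1)) (𝓝 (0, x)) (𝓝 (E x, 0)) := by
    have : Continuous fun p : ℝ × (ℝ × ℝ) => (E x - p.1 • v, p.1) := by fun_prop
    simpa using this.tendsto (0, x)
  have h2 : Tendsto (fun p : ℝ × (ℝ × ℝ) => p.2) (𝓝 (0, x)) (𝓝 x) := continuous_snd.tendsto _
  filter_upwards [h1.eventually hcv, h2.eventually hleft] with p e1 e2 hs hp hne
  rw [heq hp, heq hx] at hne
  rw [hne] at e2
  have := e1 hs.le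
  simp only [sub_add_cancel, hIx, hx2, e2] at this
  nlinarith [hp.2.1]

end Bottom

/-! ### Independence of the factorization `F = g ∘ τ`. -/

section Intrinsic

variable {lam : ℝ}

lemma exists_mem_Icc_toCircle_eq {e : ℂ} (he : ‖e‖ = 1) :
    ∃ x ∈ Icc (0 : ℝ) 1, (AddCircle.toCircle ((x : ℝ) : AddCircle (1 : ℝ)) : ℂ) = e := by
  have hpi := Real.pi_pos
  refine ⟨Complex.arg (-e) / (2 * Real.pi) + 1 / 2, ⟨?_, ?_⟩, ?_⟩
  · have h : -(1 / 2) ≤ Complex.arg (-e) / (2 * Real.pi) := by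
      rw [le_div_iff₀ (by positivity)]
      linarith [Complex.neg_pi_lt_arg (-e)]
    linarith
  · have h : Complex.arg (-e) / (2 * Real.pi) ≤ 1 / 2 := by
      rw [div_le_iff₀ (by positivity)]
      linarith [Complex.arg_le_pi (-e)]
    linarith
  · have hpi' : (Real.pi : ℂ) ≠ 0 := by exact_mod_cast Real.pi_ne_zero
    have h1 := Complex.norm_mul_exp_arg_mul_I (-e)
    rw [norm_neg, he, Complex.ofReal_one, one_mul] at h1
    rw [coe_toCircle]
    have h2 : (2 * Real.pi * ((Complex.arg (-e) / (2 * Real.pi) + 1 / 2 : ℝ) : ℂ) * Complex.I : ℂ) =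
        Complex.arg (-e) * Complex.I + Real.pi * Complex.I := by
      push_cast
      field_simp
    rw [h2, Complex.exp_add, h1, Complex.exp_pi_mul_I]
    ring

/-- The inverse of `τ`, read on the strip, with the value `0` elsewhere. -/
def SpaceT.inv (τ : SpaceT lam) (y : ℝ × ℝ) : ℂ :=
  open Classical in
  if h : y.2 ∈ Ioc (1 - lam) (top lam) then τ.homeo.symm ((y.1 : AddCircle (1 : ℝ)), ⟨y.2, h⟩) else 0

lemma SpaceT.inv_of_mem (τ : SpaceT lam) {y : ℝ × ℝ} (h : y.2 ∈ Ioc (1 - lam) (top lam)) :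
    τ.inv y = τ.homeo.symm ((y.1 : AddCircle (1 : ℝ)), ⟨y.2, h⟩) := by
  rw [SpaceT.inv, dif_pos h]

lemma SpaceT.inv_mem (τ : SpaceT lam) {y : ℝ × ℝ} (h : y.2 ∈ Ioc (1 - lam) (top lam)) :
    τ.inv y ∈ discStar lam := by
  rw [τ.inv_of_mem h]
  exact (τ.homeo.symm _).2

lemma SpaceT.rep_inv (τ : SpaceT lam) {y : ℝ × ℝ} (h : y.2 ∈ Ioc (1 - lam) (top lam)) :
    τ.rep (τ.inv y) = cylEmb (cylProj y) := by
  rw [τ.rep_of_mem (τ.inv_mem h)]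
  have : (⟨τ.inv y, τ.inv_mem h⟩ : discStar lam) =
      τ.homeo.symm ((y.1 : AddCircle (1 : ℝ)), ⟨y.2, h⟩) := Subtype.ext (τ.inv_of_mem h)
  rw [this, τ.homeo.apply_symm_apply]
  rfl

lemma SpaceT.inv_eq (τ : SpaceT lam) {y : ℝ × ℝ} {z : ℂ} (hz : z ∈ discStar lam)
    (h1 : (AddCircle.toCircle ((y.1 : ℝ) : AddCircle (1 : ℝ)) : ℂ) = (τ.rep z).1)
    (h2 : y.2 = (τ.rep z).2) : τ.inv y = z := by
  have h : y.2 ∈ Ioc (1 - lam) (top lam) := h2 ▸ τ.rep_snd_mem hz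
  rw [τ.inv_of_mem h]
  have e1 : ((y.1 : AddCircle (1 : ℝ)), (⟨y.2, h⟩ : Ioc (1 - lam) (top lam))) = τ.homeo ⟨z, hz⟩ := by
    refine Prod.ext (toCircle_injective (Subtype.ext ?_)) (Subtype.ext ?_)
    · rw [h1, τ.rep_of_mem hz, cylEmb]
    · exact h2.trans (by rw [τ.rep_of_mem hz, cylEmb])
  rw [e1, τ.homeo.symm_apply_apply]

lemma SpaceT.continuousOn_inv (τ : SpaceT lam) :
    ContinuousOn τ.inv {y | y.2 ∈ Ioc (1 - lam) (top lam)} := by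
  rw [continuousOn_iff_continuous_domRestrict]
  have h1 : Continuous fun y : {y : ℝ × ℝ | y.2 ∈ Ioc (1 - lam) (top lam)} =>
      (((y : ℝ × ℝ).1 : AddCircle (1 : ℝ)), (⟨(y : ℝ × ℝ).2, y.2⟩ : Ioc (1 - lam) (top lam))) := by
    refine Continuous.prodMk ?_ (Continuous.subtype_mk (by fun_prop) _)
    exact continuous_quotient_mk'.comp (by fun_prop)
  refine (continuous_subtype_val.comp (τ.homeo.symm.continuous.comp h1)).congr fun y => ?_
  exact (τ.inv_of_mem y.2).symm

lemma SpaceT.exists_cell (τ : SpaceT lam) {z : ℂ} (hz : z ∈ discStar lam) :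
    ∃ y ∈ cell lam, y.2 ∈ Ioc (1 - lam) (top lam) ∧ τ.rep z = cylEmb (cylProj y) ∧ τ.inv y = z := by
  obtain ⟨x, hx, he⟩ := exists_mem_Icc_toCircle_eq (τ.norm_rep_fst hz)
  refine ⟨(x, (τ.rep z).2), ⟨hx, Ioc_subset_Icc_self (τ.rep_snd_mem hz)⟩, τ.rep_snd_mem hz,
    Prod.ext he.symm rfl, τ.inv_eq hz he rfl⟩

lemma compMap_ext_inv (τ : SpaceT lam) (g : SpaceG lam) {y : ℝ × ℝ}
    (h : y.2 ∈ Ioc (1 - lam) (top lam)) : (compMap lam (τ, g)).ext (τ.inv y) = g.lift y := by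
  have h1 := τ.rep_inv h
  rw [compMap_ext_eq τ g (τ.inv_mem h) (x := y.1) (by rw [h1]; rfl), h1]
  rfl

lemma outForm_sub_smul (A : ℝ × ℝ →L[ℝ] ℂ) (v : ℂ) (κ : ℝ) :
    outForm A (v - κ • A (0, 1)) =
      outForm A v - κ * (starRingEnd ℂ (A (1, 0)) * A (0, 1)).im ^ 2 := by
  simp only [outForm, Complex.mul_im, Complex.sub_re, Complex.sub_im, Complex.smul_re, Complex.smul_im,
    smul_eq_mul]
  ring

/-- Lifts of a short segment through two factorizations of the same map agree. -/
lemma rep_eq_of_segment {τ τ' : SpaceT lam} {g g' : SpaceG lam}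
    (h : compMap lam (τ, g) = compMap lam (τ', g')) {P q : ℝ → ℝ × ℝ} {I' : ℂ → ℝ × ℝ}
    {O : Set (ℝ × ℝ)} (hO : IsOpen O) {s₁ : ℝ}
    (hP : ContinuousOn P (Icc 0 s₁)) (hq : ContinuousOn q (Icc 0 s₁))
    (hPm : ∀ s ∈ Icc 0 s₁, (P s).2 ∈ Ioc (1 - lam) (top lam)) (hqO : ∀ s ∈ Icc 0 s₁, q s ∈ O)
    (hI : ∀ y ∈ O, y ∈ closedStrip lam → I' (g'.lift y) = y)
    (hqI : ∀ s ∈ Icc 0 s₁, q s = I' (g.lift (P s)))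
    (h0 : τ'.rep (τ.inv (P 0)) = cylEmb (cylProj (q 0))) :
    ∀ s ∈ Icc 0 s₁, τ'.rep (τ.inv (P s)) = cylEmb (cylProj (q s)) := by
  have hζm : ∀ s ∈ Icc 0 s₁, τ.inv (P s) ∈ discStar lam := fun s hs => τ.inv_mem (hPm s hs)
  have hζ : ContinuousOn (fun s => τ.inv (P s)) (Icc 0 s₁) :=
    τ.continuousOn_inv.comp hP hPm
  obtain ⟨U, E, -, hsub, hC, heq⟩ := τ'.exists_ext
  have hrepc : ContinuousOn τ'.rep (discStar lam) := (hC.continuousOn.mono hsub).congr heq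
  have hrep : ContinuousOn (fun s => τ'.rep (τ.inv (P s))) (Icc 0 s₁) := hrepc.comp hζ hζm
  have hemb : Continuous fun x : ℝ × ℝ => cylEmb (cylProj x) := by
    have hc : Continuous (@AddCircle.toCircle 1) := AddCircle.continuous_toCircle
    exact ((continuous_subtype_val.comp hc).comp (continuous_fst.comp continuous_cylProj)).prodMk
      (continuous_snd.comp continuous_cylProj)
  have hclosed : IsClosed ({s | τ'.rep (τ.inv (P s)) = cylEmb (cylProj (q s))} ∩ Icc 0 s₁) := by
    have := (hrep.prodMk (hemb.comp_continuousOn hq)).preimage_isClosed_of_isClosed isClosed_Icc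
      (isClosed_diagonal (X := ℂ × ℝ))
    rwa [inter_comm] at this
  have hsubset : Icc 0 s₁ ⊆ {s | τ'.rep (τ.inv (P s)) = cylEmb (cylProj (q s))} := by
    -- Continuation in `s`: the set of agreement is closed, and it extends to the right of each of
    -- its points because a continuous lift stays in `O`, where `I'` inverts `g'`.
    refine hclosed.Icc_subset_of_forall_mem_nhdsWithin h0 fun s₀ hs₀ => ?_
    have hs₀' : s₀ ∈ Icc 0 s₁ := Ico_subset_Icc_self hs₀.2
    have e0 : τ'.rep (τ.inv (P s₀)) = cylEmb (cylProj (q s₀)) := hs₀.1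
    have hn := τ'.norm_rep_fst (hζm s₀ hs₀')
    have hx₀ : (AddCircle.toCircle (((q s₀).1 : ℝ) : AddCircle (1 : ℝ)) : ℂ) =
        (τ'.rep (τ.inv (P s₀))).1 := by rw [e0]; rfl
    have hne : (τ'.rep (τ.inv (P s₀))).1 ≠ 0 := fun h => by rw [h] at hn; simp at hn
    set L : ℝ → ℝ × ℝ := fun s =>
      (localAngle (q s₀).1 (τ'.rep (τ.inv (P s₀))).1 (τ'.rep (τ.inv (P s))).1,
        (τ'.rep (τ.inv (P s))).2) with hL
    have hL0 : L s₀ = q s₀ := Prod.ext (localAngle_self hn) (by simp only [hL]; rw [e0]; rfl)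
    have hLc : ContinuousWithinAt L (Icc 0 s₁) s₀ :=
      ContinuousAt.comp_continuousWithinAt (f := fun s => τ'.rep (τ.inv (P s)))
        (hasFDerivAt_localAngle (x₀ := (q s₀).1) (t₀ := (τ'.rep (τ.inv (P s₀))).2) hne).continuousAt
        (hrep s₀ hs₀')
    have hLO : ∀ᶠ s in 𝓝[Icc 0 s₁] s₀, L s ∈ O :=
      hLc (hO.mem_nhds (by rw [hL0]; exact hqO s₀ hs₀'))
    have hle : 𝓝[>] s₀ ≤ 𝓝[Icc 0 s₁] s₀ :=
      nhdsWithin_le_of_mem (mem_of_superset (Ioc_mem_nhdsGT hs₀.2.2)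
        fun s hs => ⟨hs₀.2.1.trans hs.1.le, hs.2⟩)
    filter_upwards [hle hLO, hle self_mem_nhdsWithin] with s hs hsI
    have hang := coe_toCircle_localAngle hn (τ'.norm_rep_fst (hζm s hsI)) hx₀
    have hLm : L s ∈ closedStrip lam := ⟨trivial, Ioc_subset_Icc_self (τ'.rep_snd_mem (hζm s hsI))⟩
    have e1 := compMap_ext_eq τ' g' (hζm s hsI) hang
    rw [← h, compMap_ext_inv τ g (hPm s hsI)] at e1
    have e2 : q s = L s := by rw [hqI s hsI, e1, hI (L s) hs hLm]
    change _ = cylEmb (cylProj (q s))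
    rw [e2]
    exact Prod.ext hang.symm rfl
  exact hsubset

/-- The behaviour of `g` at the bottom circle depends only on the composition `g ∘ τ`. -/
theorem SpaceG.Outward.of_compMap_eq (hl : lam ∈ Ioo (0 : ℝ) 1) {τ τ' : SpaceT lam}
    {g g' : SpaceG lam} (h : compMap lam (τ, g) = compMap lam (τ', g')) (hg : g.Outward) :
    g'.Outward := by
  intro x' hx' hx'2
  by_contra! hneg
  have hx's := cell_subset lam hx'
  have hlt := lt_top_of_mem hl
  -- These points of the second cylinder descend to the bottom point `x'` where `g'` is supposed to
  -- fail. Their preimages under `τ'` are then read in the first cylinder.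
  set t : ℕ → ℝ × ℝ := fun n => (x'.1, 1 - lam + (top lam - (1 - lam)) * (1 / ((n : ℝ) + 1))) with ht
  have hfrac : ∀ n : ℕ, 0 < 1 / ((n : ℝ) + 1) ∧ 1 / ((n : ℝ) + 1) ≤ 1 := fun n =>
    ⟨by positivity, by rw [div_le_one (by positivity)]; linarith [(Nat.cast_nonneg n : (0 : ℝ) ≤ n)]⟩
  have htm : ∀ n, (t n).2 ∈ Ioc (1 - lam) (top lam) := fun n => by
    obtain ⟨h1, h2⟩ := hfrac n
    constructor <;> simp only [ht] <;> nlinarith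
  have htlim : Tendsto t atTop (𝓝 x') := by
    have h1 := ((tendsto_one_div_add_atTop_nhds_zero_nat (𝕜 := ℝ)).const_mul
      (top lam - (1 - lam))).const_add (1 - lam)
    rw [show 1 - lam + (top lam - (1 - lam)) * 0 = x'.2 by rw [hx'2]; ring] at h1
    have h2 := (tendsto_const_nhds (x := x'.1) (f := atTop (α := ℕ))).prodMk_nhds h1
    exact h2
  set z : ℕ → ℂ := fun n => τ'.inv (t n) with hz
  have hzm : ∀ n, z n ∈ discStar lam := fun n => τ'.inv_mem (htm n)
  choose y hyc hym hyrep hyinv using fun n => τ.exists_cell (hzm n)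
  have hval : ∀ n, g.lift (y n) = g'.lift (t n) := fun n => by
    rw [← compMap_ext_inv τ g (hym n), ← compMap_ext_inv τ' g' (htm n), hyinv n, h]
  obtain ⟨y₀, hy₀, φ, hφ, hlim⟩ := (isCompact_cell lam).tendsto_subseq hyc
  have hy₀s := cell_subset lam hy₀
  have hglift : ContinuousOn g.lift (closedStrip lam) := (g.continuousOn hl).fst
  have hglift' : ContinuousOn g'.lift (closedStrip lam) := (g'.continuousOn hl).fst
  have hw1 : Tendsto (fun n => g.lift (y (φ n))) atTop (𝓝 (g.lift y₀)) :=
    (hglift y₀ hy₀s).tendsto.comp (tendsto_nhdsWithin_iff.2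
      ⟨hlim, .of_forall fun n => cell_subset lam (hyc _)⟩)
  have hw2 : Tendsto (fun n => g'.lift (t (φ n))) atTop (𝓝 (g'.lift x')) :=
    (hglift' x' hx's).tendsto.comp (tendsto_nhdsWithin_iff.2
      ⟨htlim.comp hφ.tendsto_atTop, .of_forall fun n => ⟨trivial, Ioc_subset_Icc_self (htm _)⟩⟩)
  have hw : g.lift y₀ = g'.lift x' :=
    tendsto_nhds_unique hw1 (hw2.congr fun n => (hval _).symm)
  -- If the limit were above the bottom, the points `z n` would converge inside the punctured disc,
  -- and their heights under `τ'` could not tend to `1 - lam`.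
  have hy₀2 : y₀.2 = 1 - lam := by
    by_contra hne
    have hy₀m : y₀.2 ∈ Ioc (1 - lam) (top lam) := ⟨lt_of_le_of_ne hy₀.2.1 (Ne.symm hne), hy₀.2.2⟩
    have h1 : Tendsto (fun n => z (φ n)) atTop (𝓝[discStar lam] (τ.inv y₀)) := by
      refine tendsto_nhdsWithin_iff.2 ⟨?_, .of_forall fun n => hzm _⟩
      refine ((τ.continuousOn_inv y₀ hy₀m).tendsto.comp (tendsto_nhdsWithin_iff.2
        ⟨hlim, .of_forall fun n => hym _⟩)).congr fun n => hyinv _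
    obtain ⟨U, E, -, hsub, hC, heq⟩ := τ'.exists_ext
    have hrepc : ContinuousOn τ'.rep (discStar lam) := (hC.continuousOn.mono hsub).congr heq
    have h2 := (continuous_snd.tendsto _).comp ((hrepc _ (τ.inv_mem hy₀m)).tendsto.comp h1)
    have h3 : Tendsto (fun n => (t (φ n)).2) atTop (𝓝 x'.2) :=
      (continuous_snd.tendsto _).comp (htlim.comp hφ.tendsto_atTop)
    have h4 := tendsto_nhds_unique h2 (h3.congr fun n => by
      simp only [Function.comp, hz]
      rw [τ'.rep_inv (htm _)]
      rfl)
    have h5 := (τ'.rep_snd_mem (τ.inv_mem hy₀m)).1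
    rw [h4, hx'2] at h5
    exact lt_irrefl _ h5
  -- a direction that points into the first cylinder and out of the second
  have hD' := im_conj_mul_ne_zero (g'.bijective_dlift hl hx's).1
  obtain ⟨v, hv1, hv2⟩ : ∃ v, 0 < outForm (g.dlift y₀) v ∧ outForm (g'.dlift x') v < 0 := by
    have h1 := hg y₀ hy₀ hy₀2
    -- `hneg` gives only a weak inequality. Subtracting a small multiple of `g'.dlift x' (0, 1)`,
    -- which points into the second cylinder, makes it strict and preserves the strict inequality
    -- for `g`.
    have hc : Continuous fun κ : ℝ =>
        outForm (g.dlift y₀) (g.lift y₀ - 1 - κ • g'.dlift x' (0, 1)) :=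
      continuous_outForm.comp (by fun_prop : Continuous fun κ : ℝ =>
        (g.dlift y₀, g.lift y₀ - 1 - κ • g'.dlift x' (0, 1)))
    have h2 : ∀ᶠ κ in 𝓝 (0 : ℝ), 0 < outForm (g.dlift y₀) (g.lift y₀ - 1 - κ • g'.dlift x' (0, 1)) :=
      hc.continuousAt.eventually (lt_mem_nhds (by simpa using h1))
    obtain ⟨κ, hκ, hκ0⟩ := ((h2.filter_mono nhdsWithin_le_nhds).and
      (self_mem_nhdsWithin (s := Ioi (0 : ℝ)))).exists
    refine ⟨_, hκ, ?_⟩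
    rw [outForm_sub_smul, hw]
    have : 0 < κ * (starRingEnd ℂ (g'.dlift x' (1, 0)) * g'.dlift x' (0, 1)).im ^ 2 :=
      mul_pos hκ0 (by positivity)
    linarith
  obtain ⟨U, E, hU, hsub, hC, heq, -⟩ := g.exists_ext
  obtain ⟨U', E', hU', hsub', hC', heq', -⟩ := g'.exists_ext
  obtain ⟨I, hIc, hIx, hleft, hright, hpos, -⟩ :=
    exists_localInverse (g.hasStrictFDerivAt hl hU hsub hC heq hy₀s) (g.bijective_dlift hl hy₀s)
  obtain ⟨I', hIc', hIx', hleft', hright', -, hneg'⟩ :=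
    exists_localInverse (g'.hasStrictFDerivAt hl hU' hsub' hC' heq' hx's) (g'.bijective_dlift hl hx's)
  obtain ⟨c, hc, hcv⟩ := hpos v hv1
  obtain ⟨c', hc', hcv'⟩ := hneg' v hv2
  have hEE : E' x' = E y₀ := by rw [← heq hy₀s, ← heq' hx's, hw]
  rw [hEE] at hIc' hIx' hright' hcv'
  set w₀ := E y₀ with hw₀
  obtain ⟨O, hOsub, hO, hx'O⟩ := mem_nhds_iff.1 hleft'
  have hadd : Tendsto (fun p : ℂ × ℝ => p.1 + p.2 • v) (𝓝 (w₀, 0)) (𝓝 w₀) := by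
    have : Continuous fun p : ℂ × ℝ => p.1 + p.2 • v := by fun_prop
    simpa using this.tendsto (w₀, 0)
  have hI2 : Tendsto I (𝓝 w₀) (𝓝 y₀) := by simpa [ContinuousAt, hIx] using hIc
  have hI2' : Tendsto I' (𝓝 w₀) (𝓝 x') := by simpa [ContinuousAt, hIx'] using hIc'
  have htop : {y : ℝ × ℝ | y.2 < top lam} ∈ 𝓝 y₀ :=
    (isOpen_lt continuous_snd continuous_const).mem_nhds (by change y₀.2 < _; rw [hy₀2]; exact hlt)
  have hall := hcv.and (hcv'.and ((hadd.eventually hright).and ((hadd.eventually hright').and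
    ((hadd.eventually (hI2 htop)).and (hadd.eventually (hI2' (hO.mem_nhds hx'O)))))))
  rw [Metric.eventually_nhds_iff] at hall
  obtain ⟨ε, hε, hall⟩ := hall
  have hall' : ∀ w : ℂ, dist w w₀ < ε → ∀ s ∈ Icc (0 : ℝ) (ε / 2), _ := fun w hwε s hs =>
    hall (y := (w, s)) (by
      rw [Prod.dist_eq, max_lt_iff, Real.dist_eq, sub_zero, abs_of_nonneg hs.1]
      exact ⟨hwε, by linarith [hs.2]⟩)
  have hev : ∀ᶠ n in atTop, dist (g.lift (y (φ n))) w₀ < ε ∧ I (E (y (φ n))) = y (φ n) ∧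
      I' (E' (t (φ n))) = t (φ n) ∧ (t (φ n)).2 < 1 - lam + ε / 2 * c' := by
    have h1 : Tendsto (fun n => t (φ n)) atTop (𝓝 x') := htlim.comp hφ.tendsto_atTop
    refine ((tendsto_nhds_unique hw1 hw1 ▸ hw1).eventually (Metric.ball_mem_nhds _ hε)).and ?_ |>.mono
      fun n hn => ⟨by rw [hw₀, ← heq hy₀s]; exact hn.1, hn.2⟩
    refine (hlim.eventually hleft).and ((h1.eventually hleft').and ?_)
    refine h1.eventually ((isOpen_lt continuous_snd continuous_const).mem_nhds ?_)
    change x'.2 < _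
    rw [hx'2]
    have : 0 < ε / 2 * c' := by positivity
    linarith
  obtain ⟨n, hn1, hn2, hn3, hn4⟩ := hev.exists
  have hys := cell_subset lam (hyc (φ n))
  have hts : t (φ n) ∈ closedStrip lam := ⟨trivial, Ioc_subset_Icc_self (htm _)⟩
  set w := g.lift (y (φ n)) with hwdef
  have hIw : I w = y (φ n) := by rw [hwdef, heq hys, hn2]
  have hIw' : I' w = t (φ n) := by rw [hwdef, hval, heq' hts, hn3]
  have hPm : ∀ s ∈ Icc (0 : ℝ) (ε / 2), (I (w + s • v)).2 ∈ Ioc (1 - lam) (top lam) := by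
    intro s hs
    obtain ⟨e1, -, -, -, e5, -⟩ := hall' w hn1 s hs
    have e1 := e1 hs.1
    simp only [hIw] at e1
    refine ⟨?_, le_of_lt e5⟩
    have := (hym (φ n)).1
    have h3 : 0 ≤ s * c := mul_nonneg hs.1 hc.le
    linarith
  have hseg : ∀ s : ℝ, ContinuousAt (fun s : ℝ => w + s • v) s := fun s => by fun_prop
  -- A short segment in the direction `v` rises in the first cylinder, so it consists of images of
  -- `F`. The matching lift in the second cylinder descends at rate `c'`; it starts so low that it
  -- is below the bottom circle at time `ε / 2`, where no height of `τ'` can be.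
  have hfinal := rep_eq_of_segment h (P := fun s => I (w + s • v)) (q := fun s => I' (w + s • v))
    (I' := I') hO
    (fun s hs => (ContinuousAt.comp (f := fun s : ℝ => w + s • v)
      (hall' w hn1 s hs).2.2.1.2 (hseg s)).continuousWithinAt)
    (fun s hs => (ContinuousAt.comp (f := fun s : ℝ => w + s • v)
      (hall' w hn1 s hs).2.2.2.1.2 (hseg s)).continuousWithinAt)
    hPm (fun s hs => (hall' w hn1 s hs).2.2.2.2.2)
    (fun y hy hys => by rw [heq' hys]; exact hOsub hy)
    (fun s hs => by
      rw [heq ⟨trivial, Ioc_subset_Icc_self (hPm s hs)⟩, (hall' w hn1 s hs).2.2.1.1])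
    (by
      simp only [zero_smul, add_zero, hIw, hIw', hyinv]
      exact τ'.rep_inv (htm _))
    (ε / 2) (right_mem_Icc.2 (half_pos hε).le)
  have hmem := τ'.rep_snd_mem (τ.inv_mem (hPm (ε / 2) (right_mem_Icc.2 (half_pos hε).le)))
  rw [hfinal] at hmem
  have h1 : 1 - lam < (I' (w + (ε / 2) • v)).2 := hmem.1
  have h2 := (hall' w hn1 (ε / 2) (right_mem_Icc.2 (half_pos hε).le)).2.1 (half_pos hε).le
  simp only [hIw'] at h2
  linarith

end Intrinsic

/-! ### The hole around `1` -/

/-- A closed set that is left only towards `1` is, near `1`, bounded by a star-shaped curve. -/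
theorem exists_hole {S C : Set ℂ} {ρ₁ : ℝ} (hρ : 0 < ρ₁) (hC : IsClosed C) (hSC : S ⊆ C)
    (h1 : (1 : ℂ) ∉ C) (hopen : ∀ w ∈ S, ‖w - 1‖ ≤ ρ₁ → S ∈ 𝓝 w)
    (hout : ∀ w ∈ C, ‖w - 1‖ < ρ₁ → ∀ᶠ s : ℝ in 𝓝[>] 0, w + s • (w - 1) ∈ S)
    (hin : ∀ w ∈ C, w ∉ S → ∀ᶠ s : ℝ in 𝓝[>] 0, w - s • (w - 1) ∉ C)
    (htop : ∀ u, ray u ρ₁ ∈ S) :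
    ∃ (m : Circle → ℝ) (b : ℝ), Continuous m ∧ 0 < b ∧ (∀ u, b ≤ m u) ∧ (∀ u, m u < ρ₁) ∧
      ∀ u ρ, 0 ≤ ρ → ρ ≤ ρ₁ → (ray u ρ ∈ S ↔ m u < ρ) := by
  have hray : ∀ u, Continuous (ray u) := fun u => by unfold ray; fun_prop
  have hray' : ∀ ρ, Continuous fun u => ray u ρ := fun ρ => by unfold ray; fun_prop
  have hray0 : ∀ u, ray u 0 = 1 := fun u => by simp [ray]
  have hadd : ∀ u (ρ s : ℝ), ray u ρ + s • (ray u ρ - 1) = ray u (ρ * (1 + s)) := fun u ρ s => by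
    simp [ray]
    ring
  have hsub : ∀ u (ρ s : ℝ), ray u ρ - s • (ray u ρ - 1) = ray u (ρ * (1 - s)) := fun u ρ s => by
    simp [ray]
    ring
  set T : Circle → Set ℝ := fun u => {ρ | ray u ρ ∈ C} ∩ Icc 0 ρ₁ with hT
  have hTc : ∀ u, IsClosed (T u) := fun u => (hC.preimage (hray u)).inter isClosed_Icc
  have hTne : ∀ u, (T u).Nonempty := fun u => ⟨ρ₁, hSC (htop u), hρ.le, le_rfl⟩
  have hTb : ∀ u, BddBelow (T u) := fun u => ⟨0, fun ρ hρ => hρ.2.1⟩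
  -- The radius at which the ray first meets `C`; it is positive because `1` is not in `C`.
  set m : Circle → ℝ := fun u => sInf (T u) with hm
  have hmT : ∀ u, m u ∈ T u := fun u => (hTc u).csInf_mem (hTne u) (hTb u)
  have hmle : ∀ u ρ, ρ ∈ T u → m u ≤ ρ := fun u ρ h => csInf_le (hTb u) h
  have hm0 : ∀ u, 0 < m u := fun u => by
    refine lt_of_le_of_ne (hmT u).2.1 fun h => h1 ?_
    have := (hmT u).1
    rw [← h] at this
    rwa [mem_ofPred_eq, hray0] at this
  -- Once in `C`, a ray stays there up to `ρ₁`: membership is closed, and `hout` extends it to the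
  -- right.
  have hup : ∀ u, Icc (m u) ρ₁ ⊆ {ρ | ray u ρ ∈ C} := fun u => by
    refine ((hC.preimage (hray u)).inter isClosed_Icc).Icc_subset_of_forall_mem_nhdsWithin
      (hmT u).1 fun ρ hρ' => ?_
    have hρ0 : 0 < ρ := (hm0 u).trans_le hρ'.2.1
    have h2 := hout (ray u ρ) hρ'.1 (by rw [norm_ray_sub_one u hρ0.le]; exact hρ'.2.2)
    have h3 : Tendsto (fun ρ' => ρ' / ρ - 1) (𝓝[>] ρ) (𝓝[>] 0) := by
      refine tendsto_nhdsWithin_iff.2 ⟨?_, ?_⟩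
      · have : Continuous fun ρ' : ℝ => ρ' / ρ - 1 := by fun_prop
        have h4 := (this.tendsto ρ).mono_left (nhdsWithin_le_nhds (s := Ioi ρ))
        rwa [div_self hρ0.ne', sub_self] at h4
      · filter_upwards [self_mem_nhdsWithin] with ρ' h
        have : 1 < ρ' / ρ := by rw [lt_div_iff₀ hρ0, one_mul]; exact h
        exact sub_pos.2 this
    filter_upwards [h3.eventually h2] with ρ' h
    rw [hadd, show ρ * (1 + (ρ' / ρ - 1)) = ρ' by field_simp; ring] at h
    exact hSC h
  -- `S` is a neighbourhood of each of its points near `1`, so it cannot contain the first point of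
  -- `C` on a ray.
  have hlt : ∀ u ρ, ρ ≤ ρ₁ → ray u ρ ∈ S → 0 ≤ ρ → m u < ρ := fun u ρ h2 h3 h4 => by
    refine lt_of_le_of_ne (hmle u ρ ⟨hSC h3, h4, h2⟩) fun h5 => ?_
    have h6 := hopen _ h3 (by rw [norm_ray_sub_one u h4]; exact h2)
    have h7 : ∀ᶠ ρ' in 𝓝[<] ρ, ray u ρ' ∈ S :=
      (((hray u).tendsto ρ).eventually h6).filter_mono nhdsWithin_le_nhds
    have h8 : ∀ᶠ ρ' in 𝓝[<] ρ, ρ' ∈ Ioo 0 ρ := Ioo_mem_nhdsLT (h5 ▸ hm0 u)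
    obtain ⟨ρ', h9, h10⟩ := (h7.and h8).exists
    have := hmle u ρ' ⟨hSC h9, h10.1.le, h10.2.le.trans h2⟩
    linarith [h10.2]
  -- By `hin`, just below a point of `C` outside `S` the ray leaves `C`; above `m u` this
  -- contradicts `hup`.
  have hgt : ∀ u ρ, ρ ≤ ρ₁ → m u < ρ → ray u ρ ∈ S := fun u ρ h2 h3 => by
    by_contra h4
    have hρ0 := (hm0 u).trans h3
    have h5 := hin _ (hup u ⟨h3.le, h2⟩) h4
    have h6 : ∀ᶠ s : ℝ in 𝓝[>] 0, m u < ρ * (1 - s) ∧ 0 < s := by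
      refine Filter.Eventually.and ?_ self_mem_nhdsWithin
      have : Continuous fun s : ℝ => ρ * (1 - s) := by fun_prop
      exact (this.continuousAt.eventually (lt_mem_nhds (by simpa using h3))).filter_mono
        nhdsWithin_le_nhds
    obtain ⟨s, h7, h8, h9⟩ := (h5.and h6).exists
    rw [hsub] at h7
    exact h7 (hup u ⟨h8.le, by nlinarith⟩)
  have hmρ : ∀ u, m u < ρ₁ := fun u => hlt u ρ₁ le_rfl (htop u) hρ.le
  -- Lower semicontinuity comes from the closedness of `C`, upper semicontinuity from the openness
  -- of `S`.
  have hmc : Continuous m := by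
    rw [continuous_iff_continuousAt]
    intro u
    refine tendsto_order.2 ⟨fun a ha => ?_, fun a ha => ?_⟩
    · rcases lt_or_ge a 0 with ha0 | ha0
      · exact .of_forall fun u' => ha0.trans (hm0 u')
      · have h2 : ray u a ∈ Cᶜ := fun h => absurd (hmle u a ⟨h, ha0, (ha.trans (hmρ u)).le⟩) (not_le.2 ha)
        filter_upwards [(hray' a).continuousAt.eventually (hC.isOpen_compl.mem_nhds h2)] with u' h3
        by_contra! h4
        exact h3 (hup u' ⟨h4, (ha.trans (hmρ u)).le⟩)
    · have h2 : m u < min a ρ₁ := lt_min ha (hmρ u)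
      have h3 := hgt u _ (min_le_right _ _) h2
      have h4 := hopen _ h3 (by
        rw [norm_ray_sub_one u ((hm0 u).trans h2).le]; exact min_le_right _ _)
      filter_upwards [(hray' (min a ρ₁)).continuousAt.eventually h4] with u' h5
      exact (hlt u' _ (min_le_right _ _) h5 ((hm0 u).trans h2).le).trans_le (min_le_left _ _)
  obtain ⟨u₀, -, hu₀⟩ := isCompact_univ.exists_isMinOn (⟨1, trivial⟩ : (univ : Set Circle).Nonempty)
    hmc.continuousOn
  exact ⟨m, m u₀, hmc, hm0 u₀, fun u => hu₀ (mem_univ u), hmρ, fun u ρ h0 hρ' =>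
    ⟨fun h => hlt u ρ hρ' h h0, hgt u ρ hρ'⟩⟩

/-! ### The open, intrinsic condition on the factor `g`. -/

section Good

variable {lam : ℝ}

/-- The bottom circle adds only limit points of the image of `F`. Hence whether `g` avoids `1` on
the closed cylinder depends on `F` alone. -/
lemma image_cell_eq (hl : lam ∈ Ioo (0 : ℝ) 1) (τ : SpaceT lam) (g : SpaceG lam) :
    g.lift '' cell lam = closure (range (compMap lam (τ, g)).toFun) := by
  have hlt := lt_top_of_mem hl
  have hc : ContinuousOn g.lift (closedStrip lam) := (g.continuousOn hl).fst
  apply Subset.antisymm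
  · rintro _ ⟨x, hx, rfl⟩
    have hx' : x ∈ closure {y : ℝ × ℝ | y.2 ∈ Ioc (1 - lam) (top lam)} := by
      have h1 : {y : ℝ × ℝ | y.2 ∈ Ioc (1 - lam) (top lam)} = univ ×ˢ Ioc (1 - lam) (top lam) := by
        ext y; simp
      rw [h1, closure_prod_eq, closure_Ioc hlt.ne]
      exact ⟨by simp, hx.2⟩
    refine closure_mono ?_ (((hc x (cell_subset lam hx)).mono ?_).mem_closure_image hx')
    · rintro _ ⟨y, hy, rfl⟩
      rw [← compMap_ext_inv τ g hy, SpaceF.ext_of_mem _ (τ.inv_mem hy)]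
      exact mem_range_self _
    · exact fun y hy => ⟨trivial, Ioc_subset_Icc_self hy⟩
  · refine closure_minimal ?_ (((isCompact_cell lam).image_of_continuousOn
      (hc.mono (cell_subset lam))).isClosed)
    rintro _ ⟨z, rfl⟩
    obtain ⟨y, hy, hym, -, hinv⟩ := τ.exists_cell z.2
    refine ⟨y, hy, ?_⟩
    rw [← compMap_ext_inv τ g hym, hinv, SpaceF.ext_of_mem _ z.2]

/-- The maps `g` that avoid `1` and behave near the bottom circle as the model map does. -/
def SpaceG.Good (g : SpaceG lam) : Prop := g.Outward ∧ ∀ x ∈ cell lam, g.lift x ≠ 1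

lemma SpaceG.Good.of_compMap_eq (hl : lam ∈ Ioo (0 : ℝ) 1) {τ τ' : SpaceT lam}
    {g g' : SpaceG lam} (h : compMap lam (τ, g) = compMap lam (τ', g')) (hg : g.Good) : g'.Good := by
  refine ⟨hg.1.of_compMap_eq hl h, fun x hx h1 => ?_⟩
  have h2 : (1 : ℂ) ∈ g.lift '' cell lam := by
    rw [image_cell_eq hl τ g, h, ← image_cell_eq hl τ' g']
    exact ⟨x, hx, h1⟩
  obtain ⟨y, hy, hy1⟩ := h2
  exact hg.2 y hy hy1

lemma isOpen_forall_mem_cell (hl : lam ∈ Ioo (0 : ℝ) 1) {K : Set (ℝ × ℝ)} (hK : IsCompact K)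
    (hKs : K ⊆ closedStrip lam) {W : Set (ℂ × (ℝ × ℝ →L[ℝ] ℂ))} (hW : IsOpen W) :
    IsOpen {g : SpaceG lam | ∀ x ∈ K, (g.lift x, g.dlift x) ∈ W} := by
  have hK' : IsCompact ((↑) ⁻¹' K : Set (closedStrip lam)) := by
    rw [IsInducing.subtypeVal.isCompact_iff, Subtype.image_preimage_coe, inter_eq_self_of_subset_right hKs]
    exact hK
  rw [isOpen_iff_eventually]
  intro g hg
  have : ∀ᶠ g' in 𝓝 g, ∀ x ∈ ((↑) ⁻¹' K : Set (closedStrip lam)), (g'.lift x, g'.dlift x) ∈ W :=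
    hK'.eventually_forall_of_forall_eventually fun x hx =>
      (SpaceG.continuous_eval hl).continuousAt.eventually (hW.mem_nhds (hg x hx))
  exact this.mono fun g' h x hx => h ⟨x, hKs hx⟩ hx

lemma isOpen_good (hl : lam ∈ Ioo (0 : ℝ) 1) : IsOpen {g : SpaceG lam | g.Good} := by
  have h1 : IsOpen {p : ℂ × (ℝ × ℝ →L[ℝ] ℂ) | 0 < outForm p.2 (p.1 - 1)} :=
    isOpen_lt continuous_const (continuous_outForm.comp (by fun_prop :
      Continuous fun p : ℂ × (ℝ × ℝ →L[ℝ] ℂ) => (p.2, p.1 - 1)))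
  have h2 : IsOpen {p : ℂ × (ℝ × ℝ →L[ℝ] ℂ) | p.1 ≠ 1} := isOpen_ne.preimage continuous_fst
  have hb : IsCompact (cell lam ∩ {x | x.2 = 1 - lam}) :=
    (isCompact_cell lam).inter_right (isClosed_eq continuous_snd continuous_const)
  convert (isOpen_forall_mem_cell hl hb (inter_subset_left.trans (cell_subset lam)) h1).inter
    (isOpen_forall_mem_cell hl (isCompact_cell lam) (cell_subset lam) h2) using 1
  ext g
  constructor
  · exact fun h => ⟨fun x hx => h.1 x hx.1 hx.2, h.2⟩
  · exact fun h => ⟨fun x hx hx2 => h.1 x ⟨hx, hx2⟩, h.2⟩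

/-- For the model, `g - 1` is a positive multiple of the derivative of `g` in the second coordinate.
-/
lemma good_gModel (hl : lam ∈ Ioo (0 : ℝ) 1) : (gModel lam hl).Good := by
  set E : ℝ × ℝ → ℂ := fun x => (x.2 : ℂ) * Complex.exp ((x.1 : ℂ) * (4 * Real.pi * Complex.I)) + 1
    with hE
  have heq : EqOn (gModel lam hl).lift E (closedStrip lam) := fun x hx => by
    rw [SpaceG.lift_of_mem _ hx, hE]
    exact gCyl_cylProj x
  have h1 : ContDiff ℝ 1 (fun x : ℝ × ℝ => (x.1 : ℂ)) := Complex.ofRealCLM.contDiff.comp contDiff_fst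
  have h2 : ContDiff ℝ 1 (fun x : ℝ × ℝ => (x.2 : ℂ)) := Complex.ofRealCLM.contDiff.comp contDiff_snd
  have hC : ContDiff ℝ 1 E := (h2.mul (h1.mul contDiff_const).cexp).add contDiff_const
  have hsub1 : ∀ x : ℝ × ℝ, E x - 1 = x.2 * Complex.exp ((x.1 : ℂ) * (4 * Real.pi * Complex.I)) :=
    fun x => by simp [hE]
  have hexp : ∀ x : ℝ, ‖Complex.exp ((x : ℂ) * (4 * Real.pi * Complex.I))‖ = 1 := fun x => by
    rw [show (x : ℂ) * (4 * Real.pi * Complex.I) = ((x * (4 * Real.pi) : ℝ) : ℂ) * Complex.I by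
      push_cast; ring]
    exact Complex.norm_exp_ofReal_mul_I _
  have hpos : ∀ x ∈ cell lam, 0 < x.2 := fun x hx => by linarith [hx.2.1, hl.2]
  refine ⟨fun x hx hx2 => ?_, fun x hx h => ?_⟩
  · have hx' := cell_subset lam hx
    rw [SpaceG.dlift_eq hl _ isOpen_univ (subset_univ _) hC.contDiffOn heq hx', heq hx', hsub1]
    set e := Complex.exp ((x.1 : ℂ) * (4 * Real.pi * Complex.I)) with he
    have hd : HasFDerivAt E (fderiv ℝ E x) x := (hC.differentiable one_ne_zero x).hasFDerivAt
    have hd1 : fderiv ℝ E x (1, 0) = x.2 * e * (4 * Real.pi * Complex.I) := by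
      have hp : HasDerivAt (fun s : ℝ => (s, x.2)) ((1 : ℝ), (0 : ℝ)) x.1 :=
        (hasDerivAt_id x.1).prodMk (hasDerivAt_const x.1 x.2)
      have h3 : HasDerivAt (fun s : ℝ => E (s, x.2)) (fderiv ℝ E x (1, 0)) x.1 :=
        HasFDerivAt.comp_hasDerivAt (l := E) (f := fun s : ℝ => (s, x.2)) x.1 hd hp
      have h4 := ((((hasDerivAt_id x.1).ofReal_comp.mul_const (4 * Real.pi * Complex.I)).cexp).const_mul
        (x.2 : ℂ)).add_const 1
      rw [h3.unique h4, Complex.ofReal_one, id, he]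
      ring
    have hd2 : fderiv ℝ E x (0, 1) = e := by
      have hp : HasDerivAt (fun s : ℝ => (x.1, s)) ((0 : ℝ), (1 : ℝ)) x.2 :=
        (hasDerivAt_const x.2 x.1).prodMk (hasDerivAt_id x.2)
      have h3 : HasDerivAt (fun s : ℝ => E (x.1, s)) (fderiv ℝ E x (0, 1)) x.2 :=
        HasFDerivAt.comp_hasDerivAt (l := E) (f := fun s : ℝ => (x.1, s)) x.2 hd hp
      have h4 := ((hasDerivAt_id x.2).ofReal_comp.mul_const e).add_const 1
      rw [h3.unique h4, Complex.ofReal_one, one_mul]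
    have hcc : starRingEnd ℂ e * e = 1 := by
      rw [← Complex.normSq_eq_conj_mul_self, Complex.normSq_eq_norm_sq, he, hexp]
      simp
    rw [outForm, hd1, hd2]
    have e1 : starRingEnd ℂ (x.2 * e * (4 * Real.pi * Complex.I)) * (x.2 * e) =
        ((-(4 * Real.pi * x.2 ^ 2) : ℝ) : ℂ) * Complex.I := by
      simp only [map_mul, Complex.conj_ofReal, Complex.conj_I, map_ofNat]
      push_cast
      linear_combination (-(4 * Real.pi * x.2 ^ 2) * Complex.I : ℂ) * hcc
    have e2 : starRingEnd ℂ (x.2 * e * (4 * Real.pi * Complex.I)) * e =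
        ((-(4 * Real.pi * x.2) : ℝ) : ℂ) * Complex.I := by
      simp only [map_mul, Complex.conj_ofReal, Complex.conj_I, map_ofNat]
      push_cast
      linear_combination (-(4 * Real.pi * x.2) * Complex.I : ℂ) * hcc
    have e4 : ∀ r : ℝ, ((r : ℂ) * Complex.I).im = r := fun r => by simp
    rw [e1, e2, e4, e4]
    have := hpos x hx
    have := Real.pi_pos
    have e3 : -(4 * Real.pi * x.2 ^ 2) * -(4 * Real.pi * x.2) = 16 * Real.pi ^ 2 * x.2 ^ 3 := by ring
    rw [e3]
    positivity
  · rw [heq (cell_subset lam hx), ← sub_eq_zero, hsub1] at h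
    have := congrArg norm h
    rw [norm_mul, hexp, mul_one, norm_zero, Complex.norm_real, norm_eq_zero] at this
    exact (hpos x hx).ne' this

end Good

lemma eventually_norm_mem {z : ℂ} {a b : ℝ} (ha : a < ‖z‖) (hb : ‖z‖ < b) :
    ∀ᶠ w : ℂ in 𝓝 z, a < ‖w‖ ∧ ‖w‖ < b := by
  filter_upwards [(isOpen_lt continuous_const continuous_norm).mem_nhds ha,
    (isOpen_lt continuous_norm continuous_const).mem_nhds hb] with w h1 h2
  exact ⟨h1, h2⟩

/-! ### Openness of the maps, and their behaviour near the puncture. -/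

section Near

variable {lam : ℝ}

/-- The first component of `τ` stays on the unit circle, so its derivative is tangential, and
`angleCLM`, which keeps only the tangential part, loses nothing. -/
lemma SpaceT.injective_drep (hl : lam ∈ Ioo (0 : ℝ) 1) (τ : SpaceT lam) {z : ℂ} (hz : z ∈ discStar lam) :
    Function.Injective ((angleCLM (τ.rep z).1).comp (τ.drep z)) := by
  obtain ⟨U, T, hU, hsub, -, heq, -, hC, hinj⟩ := τ.extends_diffeo
  have heq' : EqOn τ.rep (cylEmb ∘ T) (discStar lam) := fun w hw => by
    rw [τ.rep_of_mem hw, Function.comp, heq ⟨w, hw⟩]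
  have hd : HasFDerivAt (cylEmb ∘ T) (fderiv ℝ (cylEmb ∘ T) z) z :=
    ((hC.differentiableOn one_ne_zero).differentiableAt (hU.mem_nhds (hsub hz))).hasFDerivAt
  have hdrep : τ.drep z = fderiv ℝ (cylEmb ∘ T) z := by
    rw [SpaceT.drep, fderivWithin_congr heq' (heq' hz)]
    exact hd.differentiableAt.fderivWithin (uniqueDiffOn_discStar hl z hz)
  set D := fderiv ℝ (cylEmb ∘ T) z with hD
  have h1 : HasFDerivAt (fun w => ((cylEmb ∘ T) w).1)
      ((ContinuousLinearMap.fst ℝ ℂ ℝ).comp D) z := hasFDerivAt_fst.comp z hd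
  have h2 := h1.norm_sq
  have h3 : HasFDerivAt (fun w => ‖((cylEmb ∘ T) w).1‖ ^ 2) (0 : ℂ →L[ℝ] ℝ) z := by
    refine (hasFDerivAt_const (1 : ℝ) z).congr_of_eventuallyEq (.of_forall fun w => ?_)
    simp [cylEmb, Circle.norm_coe]
  have h4 := h2.unique h3
  rw [hdrep, heq' hz]
  have hn : ‖((cylEmb ∘ T) z).1‖ = 1 := by simp [cylEmb, Circle.norm_coe]
  set e := ((cylEmb ∘ T) z).1 with he
  have he0 : e ≠ 0 := fun h => by rw [h] at hn; simp at hn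
  rw [injective_iff_map_eq_zero]
  intro v hv
  have h5 : (starRingEnd ℂ e * (D v).1).re = 0 := by
    have := congrArg (fun A : ℂ →L[ℝ] ℝ => A v) h4
    have h6 : 2 * (starRingEnd ℂ e * (D v).1).re = 0 := by
      simpa [Complex.inner, mul_comm, mul_add] using this
    linarith
  have hv1 : (2 * Real.pi)⁻¹ * (e⁻¹ * (D v).1).im = 0 := by
    simpa [angleCLM] using congrArg Prod.fst hv
  have hv2 : (D v).2 = 0 := by simpa [angleCLM] using congrArg Prod.snd hv
  have h6 : e⁻¹ = starRingEnd ℂ e := by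
    rw [Complex.inv_def, Complex.normSq_eq_norm_sq, hn]
    simp
  have h7 : starRingEnd ℂ e * (D v).1 = 0 := by
    apply Complex.ext
    · simpa using h5
    · rw [h6] at hv1
      have : (2 * Real.pi)⁻¹ ≠ 0 := by positivity
      simpa using (mul_eq_zero.1 hv1).resolve_left this
  have h8 : (D v).1 = 0 := (mul_eq_zero.1 h7).resolve_left (by simpa using he0)
  exact hinj z (hsub hz) ((Prod.ext h8 hv2 : D v = 0).trans (map_zero D).symm)

lemma SpaceF.hasStrictFDerivAt (hl : lam ∈ Ioo (0 : ℝ) 1) (F : SpaceF lam) {z : ℂ}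
    (h0 : 0 < ‖z‖) (h1 : ‖z‖ < 2 * (1 - lam)⁻¹) : HasStrictFDerivAt F.ext (F.dext z) z := by
  have hev : ∀ᶠ w : ℂ in 𝓝 z, 0 < ‖w‖ ∧ ‖w‖ < 2 * (1 - lam)⁻¹ :=
    eventually_norm_mem h0 h1
  refine hasStrictFDerivAt_of_hasFDerivAt_of_continuousAt
    (hev.mono fun w hw => F.hasFDerivAt hl hw.1 hw.2) ?_
  exact (F.continuousOn_dext hl).continuousAt
    (hev.mono fun w hw => ⟨hw.2.le, norm_pos_iff.1 hw.1⟩)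

/-- The maps in the space are open at the interior points of the punctured disc. -/
lemma SpaceF.nhds_le_map (hl : lam ∈ Ioo (0 : ℝ) 1) (F : SpaceF lam) {z : ℂ}
    (h0 : 0 < ‖z‖) (h1 : ‖z‖ < 2 * (1 - lam)⁻¹) : 𝓝 (F.ext z) ≤ map F.ext (𝓝 z) := by
  have hstrict := F.hasStrictFDerivAt hl h0 h1
  have hz : z ∈ discStar lam := ⟨h1.le, norm_pos_iff.1 h0⟩
  have hinj : Function.Injective (F.dext z) := by
    obtain ⟨τ, g, rfl⟩ := F.exists_compMap
    obtain ⟨x, hx⟩ := exists_toCircle_eq (τ.norm_rep_fst hz)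
    rw [compMap_dext hl τ g hz hx, ContinuousLinearMap.comp_assoc]
    exact (g.bijective_dlift hl (x := (x, (τ.rep z).2))
      ⟨trivial, Ioc_subset_Icc_self (τ.rep_snd_mem hz)⟩).1.comp (τ.injective_drep hl hz)
  have hsurj : Function.Surjective (F.dext z : ℂ →ₗ[ℝ] ℂ) :=
    LinearMap.injective_iff_surjective.1 hinj
  exact (hstrict.map_nhds_eq_of_surj (LinearMap.range_eq_top.2 hsurj)).ge

/-- The values near `0` are not farther from `1` than those on a small circle. -/
theorem norm_sub_one_le_of_good (hl : lam ∈ Ioo (0 : ℝ) 1) {τ : SpaceT lam} {g : SpaceG lam}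
    (hg : g.Good) {δ M : ℝ} (hδ : δ < 2 * (1 - lam)⁻¹)
    (hM : ∀ z, 0 < ‖z‖ → ‖z‖ = δ → ‖(compMap lam (τ, g)).ext z - 1‖ ≤ M) {z : ℂ} (hz0 : 0 < ‖z‖)
    (hzδ : ‖z‖ ≤ δ) : ‖(compMap lam (τ, g)).ext z - 1‖ ≤ M := by
  have hglift : ContinuousOn g.lift (closedStrip lam) := (g.continuousOn hl).fst
  -- The default value `0` of `SpaceT.inv` is the correct limit on the bottom circle.
  have hinv0 : ∀ y : ℝ × ℝ, y.2 = 1 - lam → τ.inv y = 0 := fun y hy => by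
    rw [SpaceT.inv, dif_neg (by rw [hy]; simp)]
  -- On the compact part `ε ≤ ‖z‖` of the disc the heights of `τ` are bounded away from `1 - lam`,
  -- so low points come from near `0`.
  have hsmall : ∀ ε : ℝ, 0 < ε → ∃ κ > 1 - lam, ∀ y : ℝ × ℝ, y.2 ≤ top lam → y.2 < κ → ‖τ.inv y‖ < ε := by
    intro ε hε
    obtain ⟨U, E, -, hsub, hC, heq⟩ := τ.exists_ext
    have hrepc : ContinuousOn τ.rep (discStar lam) := (hC.continuousOn.mono hsub).congr heq
    have hKs : disc lam ∩ {z | ε ≤ ‖z‖} ⊆ discStar lam := fun w hw =>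
      ⟨hw.1, fun h => by
        have h1 : w = 0 := h
        have h2 : ε ≤ ‖w‖ := hw.2
        rw [h1, norm_zero] at h2
        linarith⟩
    have hK : IsCompact (disc lam ∩ {z | ε ≤ ‖z‖}) := by
      refine Metric.isCompact_of_isClosed_isBounded
        ((isClosed_disc lam).inter (isClosed_le continuous_const continuous_norm)) ?_
      refine (Metric.isBounded_closedBall (x := (0 : ℂ)) (r := 2 * (1 - lam)⁻¹)).subset fun w hw => ?_
      simpa [disc] using hw.1
    have main : ∃ κ > 1 - lam, ∀ w ∈ disc lam ∩ {z | ε ≤ ‖z‖}, κ ≤ (τ.rep w).2 := by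
      rcases (disc lam ∩ {z | ε ≤ ‖z‖}).eq_empty_or_nonempty with hE | hE
      · exact ⟨top lam, lt_top_of_mem hl, fun w hw => by rw [hE] at hw; exact hw.elim⟩
      · obtain ⟨w₀, hw₀, hmin⟩ := hK.exists_isMinOn hE (hrepc.mono hKs).snd
        exact ⟨(τ.rep w₀).2, (τ.rep_snd_mem (hKs hw₀)).1, fun w hw => hmin hw⟩
    obtain ⟨κ, hκ, hκ'⟩ := main
    refine ⟨κ, hκ, fun y hy hyκ => ?_⟩
    by_contra! hle
    by_cases hym : y.2 ∈ Ioc (1 - lam) (top lam)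
    · have h1 := hκ' _ ⟨(τ.inv_mem hym).1, hle⟩
      rw [τ.rep_inv hym] at h1
      exact absurd hyκ (not_lt.2 h1)
    · rw [SpaceT.inv, dif_neg hym, norm_zero] at hle
      linarith
  have hinvc : ContinuousOn τ.inv (closedStrip lam) := by
    intro y hy
    rcases eq_or_lt_of_le hy.2.1 with h1 | h1
    · rw [Metric.continuousWithinAt_iff']
      intro ε hε
      obtain ⟨κ, hκ, hκ'⟩ := hsmall ε hε
      have : {y : ℝ × ℝ | y.2 < κ} ∈ 𝓝 y :=
        (isOpen_lt continuous_snd continuous_const).mem_nhds (by change y.2 < κ; rw [← h1]; exact hκ)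
      filter_upwards [mem_nhdsWithin_of_mem_nhds this, self_mem_nhdsWithin] with w hw hws
      rw [hinv0 y h1.symm, dist_zero_right]
      exact hκ' w hws.2.2 hw
    · have h2 : {w : ℝ × ℝ | 1 - lam < w.2} ∈ 𝓝 y :=
        (isOpen_lt continuous_const continuous_snd).mem_nhds h1
      refine (τ.continuousOn_inv y ⟨h1, hy.2.2⟩).mono_of_mem_nhdsWithin ?_
      filter_upwards [mem_nhdsWithin_of_mem_nhds h2, self_mem_nhdsWithin] with w hw hws
      exact ⟨hw, hws.2.2⟩
  set Q : Set (ℝ × ℝ) := cell lam ∩ {x | ‖τ.inv x‖ ≤ δ} with hQ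
  have hQc : IsCompact Q := by
    refine (isCompact_cell lam).of_isClosed_subset ?_ inter_subset_left
    exact ((hinvc.mono (cell_subset lam)).norm).preimage_isClosed_of_isClosed
      (isCompact_cell lam).isClosed isClosed_Iic
  have hzR : ∀ w : ℂ, 0 < ‖w‖ → ‖w‖ ≤ δ → w ∈ discStar lam := fun w h1 h2 =>
    ⟨(h2.trans hδ.le : ‖w‖ ≤ _), norm_pos_iff.1 h1⟩
  have hfind : ∀ w : ℂ, 0 < ‖w‖ → ‖w‖ ≤ δ → ∃ y ∈ Q, g.lift y = (compMap lam (τ, g)).ext w := by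
    intro w h1 h2
    obtain ⟨y, hy, hym, -, hyinv⟩ := τ.exists_cell (hzR w h1 h2)
    exact ⟨y, ⟨hy, by rw [mem_ofPred_eq, hyinv]; exact h2⟩, by rw [← compMap_ext_inv τ g hym, hyinv]⟩
  obtain ⟨y, hyQ, hyz⟩ := hfind z hz0 hzδ
  obtain ⟨x, hxQ, hmax⟩ := hQc.exists_isMaxOn ⟨y, hyQ⟩
    ((hglift.mono (inter_subset_left.trans (cell_subset lam))).sub continuousOn_const).norm
  have hle : ‖(compMap lam (τ, g)).ext z - 1‖ ≤ ‖g.lift x - 1‖ := by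
    rw [← hyz]
    exact hmax hyQ
  have hbound : ∀ w : ℂ, 0 < ‖w‖ → ‖w‖ ≤ δ →
      ‖(compMap lam (τ, g)).ext w - 1‖ ≤ ‖g.lift x - 1‖ := by
    intro w h1 h2
    obtain ⟨y, hyQ, hyw⟩ := hfind w h1 h2
    rw [← hyw]
    exact hmax hyQ
  have hxs := cell_subset lam hxQ.1
  have hx1 : 0 < ‖g.lift x - 1‖ := norm_pos_iff.2 (sub_ne_zero.2 (hg.2 x hxQ.1))
  have hscale : ∀ s : ℝ, 0 < s → ‖g.lift x - 1‖ < ‖g.lift x + s • (g.lift x - 1) - 1‖ := by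
    intro s hs
    have : g.lift x + s • (g.lift x - 1) - 1 = (1 + s) • (g.lift x - 1) := by
      rw [add_smul, one_smul]; ring
    rw [this, norm_smul, Real.norm_of_nonneg (by linarith)]
    nlinarith
  -- A maximum principle: the point where `‖g - 1‖` is largest on `Q` cannot lie on the bottom
  -- circle, since `g` is outward there, nor strictly inside the small disc, since the map is open.
  -- It lies on the circle of radius `δ`.
  refine hle.trans ?_
  rcases eq_or_lt_of_le hxs.2.1 with h1 | h1
  · exfalso
    obtain ⟨κ, hκ, hκ'⟩ := hsmall δ (hz0.trans_le hzδ)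
    have hW : {w : ℝ × ℝ | w.2 < κ} ∈ 𝓝 x :=
      (isOpen_lt continuous_snd continuous_const).mem_nhds (by change x.2 < κ; rw [← h1]; exact hκ)
    obtain ⟨s, ⟨w, hw, hw1, hw2, hws⟩, hs⟩ := ((g.eventually_exists_of_outForm_pos hl hxs h1.symm
      (hg.1 x hxQ.1 h1.symm) hW).and self_mem_nhdsWithin).exists
    have hwm : w.2 ∈ Ioc (1 - lam) (top lam) := ⟨hw1, hw2.le⟩
    have h2 := hbound (τ.inv w) (norm_pos_iff.2 (τ.inv_mem hwm).2) (hκ' w hw2.le hw).le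
    rw [compMap_ext_inv τ g hwm, hws] at h2
    exact absurd (hscale s hs) (not_lt.2 h2)
  · have hxm : x.2 ∈ Ioc (1 - lam) (top lam) := ⟨h1, hxs.2.2⟩
    have hpos : 0 < ‖τ.inv x‖ := norm_pos_iff.2 (τ.inv_mem hxm).2
    have hxδ : ‖τ.inv x‖ ≤ δ := hxQ.2
    rw [← compMap_ext_inv τ g hxm]
    rcases eq_or_lt_of_le hxδ with h2 | h2
    · exact hM _ hpos h2
    · exfalso
      have h3 : ∀ᶠ w : ℂ in 𝓝 (τ.inv x), 0 < ‖w‖ ∧ ‖w‖ < δ :=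
        eventually_norm_mem hpos h2
      have h4 := SpaceF.nhds_le_map hl (compMap lam (τ, g)) hpos (h2.trans hδ) (image_mem_map h3)
      rw [compMap_ext_inv τ g hxm] at h4
      have h5 : Tendsto (fun s : ℝ => g.lift x + s • (g.lift x - 1)) (𝓝[>] 0) (𝓝 (g.lift x)) := by
        have : Continuous fun s : ℝ => g.lift x + s • (g.lift x - 1) := by fun_prop
        simpa using (this.tendsto 0).mono_left nhdsWithin_le_nhds
      obtain ⟨s, ⟨w, hw, hws⟩, hs⟩ := ((h5.eventually h4).and self_mem_nhdsWithin).exists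
      have h6 := hbound w hw.1 hw.2.le
      rw [hws] at h6
      exact absurd (hscale s hs) (not_lt.2 h6)

/-- Near `1`, the image of the punctured disc is the complement of a star-shaped hole. -/
theorem SpaceF.exists_hole (hl : lam ∈ Ioo (0 : ℝ) 1) {τ : SpaceT lam} {g : SpaceG lam}
    {F : SpaceF lam} (hF : F = compMap lam (τ, g)) (hg : g.Good) {ρ₁ : ℝ} (hρ : 0 < ρ₁)
    (hsmall : ∀ z ∈ discStar lam, ‖F.ext z - 1‖ ≤ ρ₁ → ‖z‖ < 2 * (1 - lam)⁻¹)
    (htop : ∀ u, ∃ z ∈ discStar lam, F.ext z = ray u ρ₁) :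
    ∃ (m : Circle → ℝ) (b : ℝ), Continuous m ∧ 0 < b ∧ (∀ u, b ≤ m u) ∧ (∀ u, m u < ρ₁) ∧
      ∀ u ρ, 0 ≤ ρ → ρ ≤ ρ₁ → ((∃ z ∈ discStar lam, F.ext z = ray u ρ) ↔ m u < ρ) := by
  subst hF
  have hglift : ContinuousOn g.lift (closedStrip lam) := (g.continuousOn hl).fst
  set S : Set ℂ := (compMap lam (τ, g)).ext '' discStar lam with hS
  have hSy : ∀ y : ℝ × ℝ, y.2 ∈ Ioc (1 - lam) (top lam) → g.lift y ∈ S := fun y hy =>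
    ⟨τ.inv y, τ.inv_mem hy, compMap_ext_inv τ g hy⟩
  have hopen : ∀ w ∈ S, ‖w - 1‖ ≤ ρ₁ → S ∈ 𝓝 w := by
    rintro _ ⟨z, hz, rfl⟩ hw
    have h0 : 0 < ‖z‖ := norm_pos_iff.2 hz.2
    have h1 := hsmall z hz hw
    refine SpaceF.nhds_le_map hl _ h0 h1 ?_
    have : ∀ᶠ w : ℂ in 𝓝 z, 0 < ‖w‖ ∧ ‖w‖ < 2 * (1 - lam)⁻¹ :=
      eventually_norm_mem h0 h1
    exact this.mono fun w hw => ⟨w, ⟨hw.2.le, norm_pos_iff.1 hw.1⟩, rfl⟩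
  refine WildLorenz.exists_hole (S := S) (C := g.lift '' cell lam) hρ
    ((isCompact_cell lam).image_of_continuousOn (hglift.mono (cell_subset lam))).isClosed ?_ ?_ hopen
    ?_ ?_ htop
  · rintro _ ⟨z, hz, rfl⟩
    obtain ⟨y, hy, hym, -, hyinv⟩ := τ.exists_cell hz
    exact ⟨y, hy, by rw [← compMap_ext_inv τ g hym, hyinv]⟩
  · rintro ⟨x, hx, hx1⟩
    exact hg.2 x hx hx1
  · rintro _ ⟨x, hx, rfl⟩ hw
    rcases eq_or_lt_of_le hx.2.1 with h1 | h1
    · refine (g.eventually_exists_of_outForm_pos hl (cell_subset lam hx) h1.symm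
        (hg.1 x hx h1.symm) univ_mem).mono ?_
      rintro s ⟨y, -, hy1, hy2, hys⟩
      rw [← hys]
      exact hSy y ⟨hy1, hy2.le⟩
    · have h5 : Tendsto (fun s : ℝ => g.lift x + s • (g.lift x - 1)) (𝓝[>] 0) (𝓝 (g.lift x)) := by
        have : Continuous fun s : ℝ => g.lift x + s • (g.lift x - 1) := by fun_prop
        simpa using (this.tendsto 0).mono_left nhdsWithin_le_nhds
      exact h5 (hopen _ (hSy x ⟨h1, hx.2.2⟩) hw.le)
  · intro w hwC hwS
    -- The statement is local in `y`; compactness of the cell then provides one range of `s` for all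
    -- `y`.
    have hP : ∀ y ∈ cell lam, ∀ᶠ p : ℝ × (ℝ × ℝ) in 𝓝 (0, y),
        0 < p.1 → p.2 ∈ closedStrip lam → g.lift p.2 ≠ w - p.1 • (w - 1) := by
      intro y hy
      have hys := cell_subset lam hy
      by_cases h : g.lift y = w
      · have hy2 : y.2 = 1 - lam := by
          by_contra hne
          exact hwS (h ▸ hSy y ⟨lt_of_le_of_ne hy.2.1 (Ne.symm hne), hy.2.2⟩)
        have := g.eventually_ne_of_outForm_pos hl hys hy2 (hg.1 y hy hy2)
        rwa [h] at this
      · have h1 : Tendsto (fun p : ℝ × (ℝ × ℝ) => g.lift p.2 - (w - p.1 • (w - 1)))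
            (𝓝[univ ×ˢ closedStrip lam] (0, y)) (𝓝 (g.lift y - w)) := by
          have e1 : ContinuousWithinAt (fun p : ℝ × (ℝ × ℝ) => g.lift p.2) (univ ×ˢ closedStrip lam)
              (0, y) :=
            ContinuousWithinAt.comp (x := ((0 : ℝ), y)) (f := Prod.snd) (g := g.lift)
              (t := closedStrip lam) (hglift y hys)
              continuous_snd.continuousWithinAt (fun p hp => hp.2)
          have e2 : ContinuousWithinAt (fun p : ℝ × (ℝ × ℝ) => w - p.1 • (w - 1))
              (univ ×ˢ closedStrip lam) (0, y) :=
            (by fun_prop : Continuous fun p : ℝ × (ℝ × ℝ) => w - p.1 • (w - 1)).continuousWithinAt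
          have e3 := (e1.sub e2).tendsto
          simp only [Pi.sub_apply, zero_smul, sub_zero] at e3
          exact e3
        have h2 := h1.eventually (isOpen_ne.mem_nhds (sub_ne_zero.2 h))
        rw [eventually_nhdsWithin_iff] at h2
        filter_upwards [h2] with p hp _ hps
        exact sub_ne_zero.1 (hp ⟨trivial, hps⟩)
    have := (isCompact_cell lam).eventually_forall_of_forall_eventually
      (P := fun s y => 0 < s → y ∈ closedStrip lam → g.lift y ≠ w - s • (w - 1)) hP
    filter_upwards [this.filter_mono nhdsWithin_le_nhds, self_mem_nhdsWithin] with s hs hs0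
    rintro ⟨y, hy, hys⟩
    exact hs y hy hs0 (cell_subset lam hy) hys

end Near

/-! ### Neighbourhoods of the model map -/

section Neighbourhood

variable {lam : ℝ}

/-- The maps that are `η`-close to the model map and whose factors `g` are good. -/
def modelNhd (lam η : ℝ) : Set (SpaceF lam) :=
  {F | (∀ z ∈ discStar lam, 1 / 10 ≤ ‖z‖ → ‖F.ext z - modelMap lam z‖ < η) ∧
    (∀ z ∈ discStar lam, 1 / 10 ≤ ‖z‖ → ‖z‖ ≤ 2 * (1 - lam)⁻¹ - 1 / 2 →
      ‖F.dext z - fderiv ℝ (modelMap lam) z‖ < η) ∧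
    ∀ τ g, F = compMap lam (τ, g) → g.Good}

lemma isCompact_annulus (a b : ℝ) : IsCompact {z : ℂ | a ≤ ‖z‖ ∧ ‖z‖ ≤ b} := by
  refine Metric.isCompact_of_isClosed_isBounded
    ((isClosed_le continuous_const continuous_norm).inter
      (isClosed_le continuous_norm continuous_const)) ?_
  refine (Metric.isBounded_closedBall (x := (0 : ℂ)) (r := b)).subset fun w hw => ?_
  simpa using hw.2

lemma isCompact_preimage_annulus {a b : ℝ} (ha : 0 < a) (hb : b ≤ 2 * (1 - lam)⁻¹) :
    IsCompact {z : discStar lam | a ≤ ‖(z : ℂ)‖ ∧ ‖(z : ℂ)‖ ≤ b} := by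
  have hsub : {z : ℂ | a ≤ ‖z‖ ∧ ‖z‖ ≤ b} ⊆ discStar lam := fun z hz =>
    ⟨(hz.2.trans hb : ‖z‖ ≤ _), norm_pos_iff.1 (ha.trans_le hz.1)⟩
  have := isCompact_annulus a b
  have h2 : IsCompact ((↑) ⁻¹' {z : ℂ | a ≤ ‖z‖ ∧ ‖z‖ ≤ b} : Set (discStar lam)) := by
    rw [IsInducing.subtypeVal.isCompact_iff, Subtype.image_preimage_coe,
      inter_eq_self_of_subset_right hsub]
    exact this
  exact h2

lemma continuous_modelMap_discStar :
    Continuous fun z : discStar lam => (modelMap lam z, fderiv ℝ (modelMap lam) z) := by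
  have h : ContDiffOn ℝ 1 (modelMap lam) {z | z ≠ 0} := fun z hz =>
    (contDiffAt_modelMap lam hz).contDiffWithinAt
  have h1 := h.continuousOn_fderiv_of_isOpen isOpen_ne le_rfl
  exact (h.continuousOn.prodMk h1).comp_continuous continuous_subtype_val fun z => z.2.2

lemma isOpen_modelNhd (hl : lam ∈ Ioo (0 : ℝ) 1) (η : ℝ) : IsOpen (modelNhd lam η) := by
  have h1 : IsOpen {F : SpaceF lam | ∀ z ∈ {z : discStar lam | 1 / 10 ≤ ‖(z : ℂ)‖ ∧
      ‖(z : ℂ)‖ ≤ 2 * (1 - lam)⁻¹}, (z, F.ext z, F.dext z) ∈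
      {p : discStar lam × ℂ × (ℂ →L[ℝ] ℂ) | ‖p.2.1 - modelMap lam p.1‖ < η}} :=
    isOpen_forall_mem hl (isCompact_preimage_annulus (by norm_num) le_rfl)
      (isOpen_lt ((by fun_prop : Continuous fun p : discStar lam × ℂ × (ℂ →L[ℝ] ℂ) => p.2.1).sub
        (continuous_modelMap_discStar.fst.comp continuous_fst)).norm continuous_const)
  have h2 : IsOpen {F : SpaceF lam | ∀ z ∈ {z : discStar lam | 1 / 10 ≤ ‖(z : ℂ)‖ ∧
      ‖(z : ℂ)‖ ≤ 2 * (1 - lam)⁻¹ - 1 / 2}, (z, F.ext z, F.dext z) ∈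
      {p : discStar lam × ℂ × (ℂ →L[ℝ] ℂ) | ‖p.2.2 - fderiv ℝ (modelMap lam) p.1‖ < η}} :=
    isOpen_forall_mem hl (isCompact_preimage_annulus (by norm_num) (by linarith))
      (isOpen_lt ((by fun_prop : Continuous fun p : discStar lam × ℂ × (ℂ →L[ℝ] ℂ) => p.2.2).sub
        (continuous_modelMap_discStar.snd.comp continuous_fst)).norm continuous_const)
  -- In the coinduced topology openness is tested on pairs `(τ, g)`. As goodness does not depend on
  -- the factorization, the quantifier reduces to a condition on the given `g`.
  have h3 : IsOpen {F : SpaceF lam | ∀ τ g, F = compMap lam (τ, g) → g.Good} := by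
    rw [isOpen_coinduced]
    convert (isOpen_good hl).preimage (continuous_snd (X := SpaceT lam)) using 1
    ext p
    constructor
    · exact fun h => h p.1 p.2 rfl
    · exact fun h τ g hp => SpaceG.Good.of_compMap_eq hl hp h
  convert h1.inter (h2.inter h3) using 1
  ext F
  constructor
  · exact fun h => ⟨fun z hz => h.1 z z.2 hz.1, fun z hz => h.2.1 z z.2 hz.1 hz.2, h.2.2⟩
  · exact fun h => ⟨fun z hz h1 => h.1 ⟨z, hz⟩ ⟨h1, hz.1⟩,
      fun z hz h1 h2 => h.2.1 ⟨z, hz⟩ ⟨h1, h2⟩, h.2.2⟩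

lemma modelF_ext (hl : lam ∈ Ioo (0 : ℝ) 1) {z : ℂ} (hz : z ∈ discStar lam) :
    (modelF lam hl).ext z = modelMap lam z := by
  rw [SpaceF.ext_of_mem _ hz]
  rfl

lemma modelF_mem_modelNhd (hl : lam ∈ Ioo (0 : ℝ) 1) {η : ℝ} (hη : 0 < η) :
    modelF lam hl ∈ modelNhd lam η := by
  refine ⟨fun z hz _ => ?_, fun z hz _ _ => ?_, fun τ g h => ?_⟩
  · rw [modelF_ext hl hz, sub_self, norm_zero]
    exact hη
  · have h1 : (modelF lam hl).dext z = fderiv ℝ (modelMap lam) z := by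
      rw [SpaceF.dext, fderivWithin_congr (fun w hw => modelF_ext hl hw) (modelF_ext hl hz)]
      exact ((contDiffAt_modelMap lam hz.2).differentiableAt one_ne_zero).fderivWithin
        (uniqueDiffOn_discStar hl z hz)
    rw [h1, sub_self, norm_zero]
    exact hη
  · have h1 : modelF lam hl = compMap lam (tauModel lam hl, gModel lam hl) := by
      simp only [compMap, modelF, SpaceF.mk.injEq]
      funext z
      have hz : (z : ℂ) ≠ 0 := by simpa using z.2.2
      simp only [compFun, gModel, gCyl, tauModel, tauHomeo, Homeomorph.homeomorph_mk_coe,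
        Equiv.coe_fn_mk, toCircle_angle hz]
    rw [h1] at h
    exact SpaceG.Good.of_compMap_eq hl h (good_gModel hl)

lemma modelClose_of_mem (hl : lam ∈ Ioo (0 : ℝ) 1) {η : ℝ} {F : SpaceF lam}
    (hF : F ∈ modelNhd lam η) : ModelClose lam (1 / 10) η F.ext F.dext where
  deriv z h0 h1 := F.hasFDerivAt hl h0 h1
  cont := (F.continuousOn_dext hl).mono fun z hz => ⟨hz.2.le, norm_pos_iff.1 hz.1⟩
  close z h0 h1 := (hF.1 z ⟨h1, norm_pos_iff.1 (by linarith)⟩ h0).le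
  close' z h0 h1 := (hF.2.1 z ⟨(by linarith : ‖z‖ ≤ 2 * (1 - lam)⁻¹), norm_pos_iff.1 (by linarith)⟩
    h0 h1).le

/-- The model map identifies only antipodal points, and these are at distance at least `2 / 10`. -/
lemma modelMap_ne_of_norm_sub {z w : ℂ} (h0 : 0 < lam) (h1 : lam < 1) (hz : 1 / 10 ≤ ‖z‖)
    (hw : 1 / 10 ≤ ‖w‖) (hzw : ‖z - w‖ = 1 / 100) : modelMap lam z ≠ modelMap lam w := by
  intro h
  have hz0 : z ≠ 0 := norm_pos_iff.1 (by linarith)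
  have hw0 : w ≠ 0 := norm_pos_iff.1 (by linarith)
  have hn : ‖z‖ = ‖w‖ := by
    have e1 := norm_modelMap_sub_one h0 h1 hz0
    rw [h, norm_modelMap_sub_one h0 h1 hw0] at e1
    exact mul_left_cancel₀ h0.ne' (by linarith)
  have e2 : (z / (‖z‖ : ℂ)) ^ 2 = (w / (‖w‖ : ℂ)) ^ 2 := by
    have e3 := congrArg (· - 1) h
    simp only [modelMap_sub_one, hn] at e3
    have e4 : ((1 - lam + lam * ‖w‖ : ℝ) : ℂ) ≠ 0 := by
      have : 0 < 1 - lam + lam * ‖w‖ := by nlinarith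
      exact_mod_cast this.ne'
    rw [hn]
    exact mul_left_cancel₀ e4 e3
  have e5 : z ^ 2 = w ^ 2 := by
    rw [hn, div_pow, div_pow] at e2
    have e6 : (‖w‖ : ℂ) ^ 2 ≠ 0 := by simpa using hw0
    exact (div_left_inj' e6).1 e2
  rcases sq_eq_sq_iff_eq_or_eq_neg.1 e5 with e7 | e7
  · rw [e7, sub_self, norm_zero] at hzw
    norm_num at hzw
  · rw [e7, ← neg_add', norm_neg, ← two_mul, norm_mul] at hzw
    norm_num at hzw
    linarith

/-- Every map close to the model map attains the values of the model map nearby. -/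
theorem exists_forall_exists_eq_modelMap (hl : lam ∈ Ioo (0 : ℝ) 1) : ∃ η₀ > 0, ∀ F ∈ modelNhd lam η₀,
    ∀ z₀ : ℂ, 14 / 100 ≤ ‖z₀‖ → ‖z₀‖ ≤ 2 * (1 - lam)⁻¹ - 1 / 2 →
      ∃ z, ‖z - z₀‖ ≤ 1 / 100 ∧ F.ext z = modelMap lam z₀ := by
  set R := (1 - lam)⁻¹ with hR
  set K : Set (ℂ × ℂ) := ({z : ℂ | 1 / 10 ≤ ‖z‖ ∧ ‖z‖ ≤ 2 * R} ×ˢ {z : ℂ | 1 / 10 ≤ ‖z‖ ∧ ‖z‖ ≤ 2 * R}) ∩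
    {p | ‖p.1 - p.2‖ = 1 / 100} with hK
  have hKc : IsCompact K := ((isCompact_annulus _ _).prod (isCompact_annulus _ _)).inter_right
    (isClosed_eq (by fun_prop) continuous_const)
  have hcont : ContinuousOn (fun p : ℂ × ℂ => ‖modelMap lam p.1 - modelMap lam p.2‖) K := by
    have h : ContinuousOn (modelMap lam) {z | z ≠ 0} := fun z hz =>
      (contDiffAt_modelMap lam hz).continuousAt.continuousWithinAt
    have hne : ∀ z : ℂ, 1 / 10 ≤ ‖z‖ → z ≠ 0 := fun z hz => norm_pos_iff.1 (by linarith)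
    exact ((h.comp continuousOn_fst fun p hp => hne _ hp.1.1.1).sub
      (h.comp continuousOn_snd fun p hp => hne _ hp.1.2.1)).norm
  -- The least separation of model values at distance `1 / 100`, over a compact set of pairs;
  -- perturbations below `κ / 2` cannot bridge it.
  obtain ⟨κ, hκ, hκK⟩ : ∃ κ > 0, ∀ p ∈ K, κ ≤ ‖modelMap lam p.1 - modelMap lam p.2‖ := by
    rcases K.eq_empty_or_nonempty with hE | hE
    · exact ⟨1, one_pos, fun p hp => by rw [hE] at hp; exact hp.elim⟩
    · obtain ⟨p₀, hp₀, hmin⟩ := hKc.exists_isMinOn hE hcont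
      exact ⟨_, norm_pos_iff.2 (sub_ne_zero.2 (modelMap_ne_of_norm_sub hl.1 hl.2 hp₀.1.1.1
        hp₀.1.2.1 hp₀.2)), fun p hp => hmin hp⟩
  refine ⟨κ / 2, half_pos hκ, fun F hF z₀ h1 h2 => ?_⟩
  have hball : ∀ z ∈ Metric.closedBall z₀ (1 / 100), 1 / 10 ≤ ‖z‖ ∧ ‖z‖ < 2 * R := by
    intro z hz
    rw [mem_closedBall_iff_norm] at hz
    have e1 := abs_norm_sub_norm_le z z₀
    have e2 := abs_le.1 (e1.trans hz)
    constructor <;> linarith [e2.1, e2.2]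
  have hmem : ∀ z ∈ Metric.closedBall z₀ (1 / 100), z ∈ discStar lam := fun z hz =>
    ⟨(hball z hz).2.le, norm_pos_iff.1 (by linarith [(hball z hz).1])⟩
  have hFc : ContinuousOn F.ext (discStar lam) := fun z hz =>
    (F.hasFDerivWithinAt hl hz).continuousWithinAt
  obtain ⟨z, hz, hmin⟩ := (isCompact_closedBall z₀ (1 / 100)).exists_isMinOn
    ⟨z₀, Metric.mem_closedBall_self (by norm_num)⟩
    (((hFc.mono hmem).sub continuousOn_const).norm (f := fun z => F.ext z - modelMap lam z₀))
  have hz₀ : z₀ ∈ Metric.closedBall z₀ (1 / 100) := Metric.mem_closedBall_self (by norm_num)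
  have hclose : ∀ z ∈ Metric.closedBall z₀ (1 / 100), ‖F.ext z - modelMap lam z‖ < κ / 2 :=
    fun z hz => hF.1 z (hmem z hz) (hball z hz).1
  have hval : ‖F.ext z - modelMap lam z₀‖ < κ / 2 := lt_of_le_of_lt (hmin hz₀) (hclose z₀ hz₀)
  -- On the boundary of the ball `F` is more than `κ / 2` from the target, but it is closer at the
  -- centre, so the minimum is interior.
  have hzint : ‖z - z₀‖ < 1 / 100 := by
    refine lt_of_le_of_ne (mem_closedBall_iff_norm.1 hz) fun hEq => ?_
    have e1 := hκK (z, z₀) ⟨⟨⟨(hball z hz).1, (hball z hz).2.le⟩, (hball z₀ hz₀).1,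
      (hball z₀ hz₀).2.le⟩, hEq⟩
    have e2 := hclose z hz
    have e3 := norm_sub_le_norm_sub_add_norm_sub (modelMap lam z) (F.ext z) (modelMap lam z₀)
    rw [norm_sub_rev (modelMap lam z) (F.ext z)] at e3
    simp only at e1
    linarith
  refine ⟨z, hzint.le, ?_⟩
  by_contra hne
  have hd : 0 < ‖F.ext z - modelMap lam z₀‖ := norm_pos_iff.2 (sub_ne_zero.2 hne)
  -- By openness, an interior minimum of the distance to the target must be zero.
  have hnhds := F.nhds_le_map hl (z := z) (by linarith [(hball z hz).1]) (hball z hz).2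
    (image_mem_map (Metric.isOpen_ball.mem_nhds (mem_ball_iff_norm.2 hzint)))
  have ht : Tendsto (fun s : ℝ => F.ext z - s • (F.ext z - modelMap lam z₀)) (𝓝[>] 0)
      (𝓝 (F.ext z)) := by
    have : Continuous fun s : ℝ => F.ext z - s • (F.ext z - modelMap lam z₀) := by fun_prop
    simpa using (this.tendsto 0).mono_left nhdsWithin_le_nhds
  obtain ⟨s, ⟨w, hw, hws⟩, hs⟩ := ((ht.eventually hnhds).and
    (Ioo_mem_nhdsGT (zero_lt_one' ℝ))).exists
  have e1 : ‖F.ext z - modelMap lam z₀‖ ≤ ‖F.ext w - modelMap lam z₀‖ :=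
    hmin (Metric.ball_subset_closedBall hw)
  have e2 : F.ext w - modelMap lam z₀ = (1 - s) • (F.ext z - modelMap lam z₀) := by
    rw [hws, sub_smul, one_smul]
    ring
  rw [e2, norm_smul, Real.norm_of_nonneg (by linarith [hs.2])] at e1
  nlinarith [hs.1]

end Neighbourhood

/-! ### The maximal invariant set -/

lemma circle_exp_eq_exp_iff {x y : ℝ} (h : Circle.exp x = Circle.exp y) (hxy : |x - y| < 2 * Real.pi) :
    x = y := by
  obtain ⟨n, hn⟩ := Circle.exp_eq_exp.1 h
  have hpi := Real.pi_pos
  rw [show x - y = n * (2 * Real.pi) by rw [hn]; ring, abs_mul, abs_of_pos (by positivity : 0 < 2 * Real.pi)] at hxy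
  have h1 : |(n : ℝ)| < 1 := by
    by_contra! h2
    nlinarith
  have h2 : n = 0 := by
    rw [← Int.abs_lt_one_iff]
    exact_mod_cast h1
  rw [hn, h2]
  simp

/-- A function on an interval of length `2π` with equal values at the ends lives on the circle. -/
lemma exists_circle_function {h : ℝ → ℝ} {q : ℝ} (hc : ContinuousOn h (Icc (q - 2 * Real.pi) q))
    (hq : h q = h (q - 2 * Real.pi)) :
    ∃ H : Circle → ℝ, Continuous H ∧ ∀ x ∈ Icc (q - 2 * Real.pi) q, H (Circle.exp x) = h x := by
  have hpi := Real.pi_pos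
  have : Fact (0 < 2 * Real.pi) := ⟨by positivity⟩
  set L : AddCircle (2 * Real.pi) → ℝ := AddCircle.liftIco (2 * Real.pi) (q - 2 * Real.pi) h with hL
  have hLc : Continuous L := AddCircle.liftIco_continuous (by rw [sub_add_cancel]; exact hq.symm)
    (by rw [sub_add_cancel]; exact hc)
  have hLx : ∀ x ∈ Icc (q - 2 * Real.pi) q, L (x : AddCircle (2 * Real.pi)) = h x := by
    intro x hx
    rcases eq_or_lt_of_le hx.2 with rfl | hlt
    · have h1 : ((x : ℝ) : AddCircle (2 * Real.pi)) =
          ((x - 2 * Real.pi : ℝ) : AddCircle (2 * Real.pi)) := by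
        rw [AddCircle.coe_sub, AddCircle.coe_period, sub_zero]
      rw [h1, hL, AddCircle.liftIco_coe_apply ⟨le_rfl, by linarith⟩, hq]
    · exact AddCircle.liftIco_coe_apply ⟨hx.1, by linarith⟩
  refine ⟨fun u => L (AddCircle.homeomorphCircle'.symm u),
    hLc.comp AddCircle.homeomorphCircle'.symm.continuous, fun x hx => ?_⟩
  have h1 : AddCircle.homeomorphCircle'.symm (Circle.exp x) = (x : AddCircle (2 * Real.pi)) := by
    rw [Homeomorph.symm_apply_eq]
    rfl
  simp only [h1]
  exact hLx x hx

lemma exists_pol_eq (q : ℝ) (w : ℂ) : ∃ x ∈ Icc (q - 2 * Real.pi) q,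
    pol (x, ‖w - 1‖) = w ∧ dir w = Circle.exp x := by
  have hpi := Real.pi_pos
  have hp : (0 : ℝ) < 2 * Real.pi := by positivity
  set x := toIcoMod hp (q - 2 * Real.pi) (Complex.arg (w - 1)) with hx
  have h1 := toIcoMod_mem_Ico hp (q - 2 * Real.pi) (Complex.arg (w - 1))
  have h2 : Circle.exp x = dir w := by
    rw [dir, Circle.exp_eq_exp]
    refine ⟨-toIcoDiv hp (q - 2 * Real.pi) (Complex.arg (w - 1)), ?_⟩
    rw [hx, toIcoMod]
    push_cast
    simp only [zsmul_eq_mul]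
    ring
  refine ⟨x, ⟨h1.1, by linarith [h1.2]⟩, ?_, h2.symm⟩
  rw [pol_eq_ray, h2, ray_dir]

lemma pol_norm_sub_one {p : ℝ × ℝ} (hp : 0 ≤ p.2) : ‖pol p - 1‖ = p.2 := by
  rw [pol_eq_ray, norm_ray_sub_one _ hp]

lemma dir_pol {p : ℝ × ℝ} (hp : 0 < p.2) : dir (pol p) = Circle.exp p.1 := by
  rw [pol_eq_ray, dir_ray _ hp]

/-- The data describing a map close to the model map: its lift to the strip, with the invariant graph
`h`, the corner at `q`, and the curve `m` that bounds the hole. -/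
structure Picture (lam R η c σ : ℝ) (F : SpaceF lam) (a11 a12 a21 a22 : ℝ × ℝ → ℝ)
    (h s v : ℝ → ℝ) (q b : ℝ) (m H : Circle → ℝ) : Prop where
  hl : lam ∈ Ioo (0 : ℝ) 1
  hR : R = (1 - lam)⁻¹
  M : StripMap lam R η c σ (liftF F.ext) (liftG F.ext) a11 a12 a21 a22
  G : StripMap.InvGraph R (liftF F.ext) (liftG F.ext) a11 a12 a21 a22 h s v
  hq : |q - Real.pi| ≤ 1 / 100
  h_q : h q = h (q - 2 * Real.pi)
  s_q : s q ≠ s (q - 2 * Real.pi)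
  right : ∀ x ∈ Icc q (2 * Real.pi + 1 / 10), h x ≤ h (x - 2 * Real.pi)
  left : ∀ x ∈ Icc (-(2 * Real.pi) - 1 / 10) (q - 2 * Real.pi), h x ≤ h (x + 2 * Real.pi)
  surj : ∀ z₀ : ℂ, 14 / 100 ≤ ‖z₀‖ → ‖z₀‖ ≤ 2 * R - 1 / 2 →
    ∃ z, ‖z - z₀‖ ≤ 1 / 100 ∧ F.ext z = modelMap lam z₀
  outer : ∀ z ∈ discStar lam, 1 / 10 ≤ ‖z‖ → |‖F.ext z - 1‖ - (1 - lam + lam * ‖z‖)| ≤ 1 / 100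
  inner : ∀ z ∈ discStar lam, ‖z‖ ≤ 1 / 10 → ‖F.ext z - 1‖ ≤ 15 / 100
  hm : Continuous m
  hb : 0 < b
  hbm : ∀ u, b ≤ m u
  hm1 : ∀ u, m u < 15 / 100
  hole : ∀ u ρ, 0 ≤ ρ → ρ ≤ 15 / 100 → ((∃ z ∈ discStar lam, F.ext z = ray u ρ) ↔ m u < ρ)
  hH : Continuous H
  hHh : ∀ x ∈ Icc (q - 2 * Real.pi) q, H (Circle.exp x) = h x

/-! ### Contraction towards the outer curve. -/

namespace Picture

variable {lam R η c σ : ℝ} {F : SpaceF lam} {a11 a12 a21 a22 : ℝ × ℝ → ℝ} {h s v : ℝ → ℝ} {q b : ℝ}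
  {m H : Circle → ℝ}

lemma q_bounds (P : Picture lam R η c σ F a11 a12 a21 a22 h s v q b m H) :
    313 / 100 ≤ q ∧ q ≤ 316 / 100 ∧ -(316 / 100) ≤ q - 2 * Real.pi ∧ q - 2 * Real.pi ≤ -(312 / 100) := by
  have h1 := abs_le.1 P.hq
  have h2 := Real.pi_gt_d4
  have h3 := Real.pi_lt_d4
  refine ⟨?_, ?_, ?_, ?_⟩ <;> linarith [h1.1, h1.2]

lemma lam_mul (P : Picture lam R η c σ F a11 a12 a21 a22 h s v q b m H) : lam * R = R - 1 := by
  have h1 : (1 - lam) * R = 1 := by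
    rw [P.hR]
    exact mul_inv_cancel₀ (by linarith [P.hl.2])
  linarith

lemma lam_gt (P : Picture lam R η c σ F a11 a12 a21 a22 h s v q b m H) :
    999 / 1000 ≤ lam ∧ lam < 1 := by
  have h1 := P.lam_mul
  have h2 := P.M.hR
  exact ⟨by nlinarith, P.hl.2⟩

lemma mem_disc_iff (P : Picture lam R η c σ F a11 a12 a21 a22 h s v q b m H) {z : ℂ} :
    z ∈ discStar lam ↔ ‖z‖ ≤ 2 * R ∧ z ≠ 0 := by
  rw [P.hR]
  exact Iff.rfl

lemma mem_Ioo (P : Picture lam R η c σ F a11 a12 a21 a22 h s v q b m H) {x : ℝ}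
    (hx : x ∈ Icc (q - 2 * Real.pi) q) : x ∈ Ioo (-7 : ℝ) 7 := by
  obtain ⟨h1, h2, h3, h4⟩ := P.q_bounds
  exact ⟨by linarith [hx.1], by linarith [hx.2]⟩

lemma h_bounds (P : Picture lam R η c σ F a11 a12 a21 a22 h s v q b m H) {x : ℝ}
    (hx : x ∈ Ioo (-7 : ℝ) 7) : R - 29 ≤ h x ∧ h x ≤ R + 1 := by
  have h1 := P.G.adm.1 x hx
  have h2 : |x| < 7 := abs_lt.2 hx
  exact ⟨by linarith, h1.2⟩

lemma H_bounds (P : Picture lam R η c σ F a11 a12 a21 a22 h s v q b m H) (u : Circle) :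
    R - 29 ≤ H u ∧ H u ≤ R + 1 := by
  obtain ⟨x, hx, -, h2⟩ := exists_pol_eq q (ray u 1)
  rw [dir_ray u one_pos] at h2
  rw [h2, P.hHh x hx]
  exact P.h_bounds (P.mem_Ioo hx)

/-- Over the overlaps, the loop follows the higher of the two turns; this is the order at the corner
obtained from `exists_corner`. -/
lemma h_le_H (P : Picture lam R η c σ F a11 a12 a21 a22 h s v q b m H) {x : ℝ}
    (hx : x ∈ Icc (-(2 * Real.pi) - 1 / 10) (2 * Real.pi + 1 / 10)) : h x ≤ H (Circle.exp x) := by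
  obtain ⟨h1, h2, h3, h4⟩ := P.q_bounds
  rcases le_or_gt x q with hq | hq
  · rcases le_or_gt (q - 2 * Real.pi) x with hq' | hq'
    · rw [P.hHh x ⟨hq', hq⟩]
    · have e1 := P.left x ⟨hx.1, hq'.le⟩
      have e2 := P.hHh (x + 2 * Real.pi) ⟨by linarith [hx.1], by linarith⟩
      rw [show Circle.exp (x + 2 * Real.pi) = Circle.exp x from Circle.periodic_exp x] at e2
      rwa [e2]
  · have e1 := P.right x ⟨hq.le, hx.2⟩
    have e2 := P.hHh (x - 2 * Real.pi) ⟨by linarith, by linarith [hx.2]⟩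
    rw [show Circle.exp (x - 2 * Real.pi) = Circle.exp x from Circle.periodic_exp.sub_eq x] at e2
    rwa [e2]

/-- The image is outside the hole. -/
lemma lt_of_image (P : Picture lam R η c σ F a11 a12 a21 a22 h s v q b m H) {z : ℂ}
    (hz : z ∈ discStar lam) : m (dir (F.ext z)) < ‖F.ext z - 1‖ := by
  rcases le_or_gt ‖F.ext z - 1‖ (15 / 100) with h1 | h1
  · exact (P.hole _ _ (norm_nonneg _) h1).1 ⟨z, hz, (ray_dir _).symm⟩
  · exact (P.hm1 _).trans h1

lemma image_ne_one (P : Picture lam R η c σ F a11 a12 a21 a22 h s v q b m H) {z : ℂ}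
    (hz : z ∈ discStar lam) : F.ext z ≠ 1 := by
  have h1 := P.lt_of_image hz
  have h2 := P.hb.trans_le (P.hbm (dir (F.ext z)))
  exact fun h0 => by rw [h0, sub_self, norm_zero] at h1; rw [h0] at h2; linarith

/-- The bound is below `2 R - 3 / 2`, so after one step the upper edge of the strip is no longer an
obstacle. -/
lemma norm_image_le (P : Picture lam R η c σ F a11 a12 a21 a22 h s v q b m H) {z : ℂ}
    (hz : z ∈ discStar lam) : ‖F.ext z - 1‖ ≤ 2 * R - 19 / 10 := by
  have hR := P.M.hR
  have hlR := P.lam_mul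
  have hlam := P.lam_gt
  rcases le_or_gt ‖z‖ (1 / 10) with h1 | h1
  · linarith [P.inner z hz h1]
  · have h2 := (abs_le.1 (P.outer z hz h1.le)).2
    have h3 : ‖z‖ ≤ 2 * R := (P.mem_disc_iff.1 hz).1
    have h4 : lam * ‖z‖ ≤ lam * (2 * R) := mul_le_mul_of_nonneg_left h3 (by linarith)
    linarith

/-- The excess over the outer curve contracts. -/
lemma excess (P : Picture lam R η c σ F a11 a12 a21 a22 h s v q b m H) {z : ℂ} {e : ℝ}
    (hz : z ∈ discStar lam) (hz1 : ‖z - 1‖ ≤ 2 * R - 19 / 10) (he : 0 ≤ e)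
    (hze : ‖z - 1‖ ≤ H (dir z) + e) : ‖F.ext z - 1‖ ≤ H (dir (F.ext z)) + (c + 2 * σ) * e := by
  have hR := P.M.hR
  have hlam := P.lam_gt
  have hθ : 0 ≤ c + 2 * σ := by linarith [P.M.hc, P.M.sigma_nonneg]
  have hθe := mul_nonneg hθ he
  have hH := (P.H_bounds (dir (F.ext z))).1
  -- Below the strip one step raises the radius by a bounded amount only, and the image is far below
  -- the outer curve. Only the strip requires the graph.
  rcases le_or_gt ‖z - 1‖ (R / 2) with h1 | h1
  · rcases le_or_gt ‖z‖ (1 / 10) with h2 | h2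
    · linarith [P.inner z hz h2]
    · have h3 := (abs_le.1 (P.outer z hz h2.le)).2
      have h4 : ‖z‖ ≤ R / 2 + 1 := by
        have := norm_add_le (z - 1) 1
        rw [sub_add_cancel, norm_one] at this
        linarith
      have h5 : lam * ‖z‖ ≤ 1 * ‖z‖ := mul_le_mul_of_nonneg_right hlam.2.le (norm_nonneg _)
      linarith
  · obtain ⟨x, hx, hxz, hxd⟩ := exists_pol_eq q z
    set y := ‖z - 1‖ with hy
    have hs : (x, y) ∈ strip R := ⟨h1, by simp only; linarith⟩
    have hx7 := P.mem_Ioo hx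
    rw [hxd, P.hHh x hx] at hze
    have hfn := abs_le.1 (P.M.f_near _ hs)
    have hfn' := abs_le.1 (P.M.f_near _ (P.G.mem_strip P.M x hx7))
    obtain ⟨q1, q2, q3, q4⟩ := P.q_bounds
    simp only at hfn hfn'
    have hf7 : liftF F.ext (x, h x) ∈ Ioo (-7 : ℝ) 7 :=
      ⟨by linarith [hx.1], by linarith [hx.2]⟩
    have hf7' : liftF F.ext (x, y) ∈ Ioo (-7 : ℝ) 7 :=
      ⟨by linarith [hx.1], by linarith [hx.2]⟩
    -- The doubled angle leaves `[q - 2π, q]` but stays where the graph is known to lie below `H`.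
    have hfe : liftF F.ext (x, y) ∈ Icc (-(2 * Real.pi) - 1 / 10) (2 * Real.pi + 1 / 10) := by
      have h2 := abs_le.1 P.hq
      exact ⟨by linarith [hx.1, h2.1], by linarith [hx.2, h2.2]⟩
    have hle := P.h_le_H hfe
    have hw : pol (liftF F.ext (x, y), liftG F.ext (x, y)) = F.ext z := by rw [pol_lift, hxz]
    have hg : liftG F.ext (x, y) = ‖F.ext z - 1‖ := by rw [liftG, hxz]
    have hg0 : 0 < liftG F.ext (x, y) := by
      rw [hg]
      exact norm_pos_iff.2 (sub_ne_zero.2 (P.image_ne_one hz))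
    have hd : dir (F.ext z) = Circle.exp (liftF F.ext (x, y)) := by rw [← hw, dir_pol hg0]
    rw [hd, ← hg]
    rcases le_or_gt y (h x) with h2 | h2
    · have := P.G.below P.M hx7 hs h2 hf7 hf7'
      linarith
    · have h3 := (P.G.above P.M hx7 hs h2.le hf7 hf7').2
      have h4 : (c + 2 * σ) * (y - h x) ≤ (c + 2 * σ) * e :=
        mul_le_mul_of_nonneg_left (by linarith) hθ
      linarith

end Picture

/-- A point whose image under the model map is prescribed. -/
lemma modelMap_polar {lam r θ : ℝ} (hr : 0 < r) :
    ‖(r : ℂ) * Complex.exp (θ * Complex.I)‖ = r ∧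
    modelMap lam (r * Complex.exp (θ * Complex.I)) = pol (2 * θ, 1 - lam + lam * r) := by
  have h1 : ‖(r : ℂ) * Complex.exp (θ * Complex.I)‖ = r := by
    rw [norm_mul, Complex.norm_exp_ofReal_mul_I, Complex.norm_real, Real.norm_of_nonneg hr.le, mul_one]
  refine ⟨h1, ?_⟩
  have h2 : (r : ℂ) ≠ 0 := by exact_mod_cast hr.ne'
  rw [modelMap, h1, mul_div_cancel_left₀ _ h2, ← Complex.exp_nat_mul, pol]
  push_cast
  ring_nf

/-! ### The annulus is covered by its image. -/

namespace Picture

variable {lam R η c σ : ℝ} {F : SpaceF lam} {a11 a12 a21 a22 : ℝ × ℝ → ℝ} {h s v : ℝ → ℝ} {q b : ℝ}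
  {m H : Circle → ℝ}

lemma mem_starAnnulus_of (P : Picture lam R η c σ F a11 a12 a21 a22 h s v q b m H) {z : ℂ}
    (h1 : 15 / 100 ≤ ‖z - 1‖) (h2 : ‖z - 1‖ ≤ H (dir z)) : z ∈ starAnnulus m H :=
  ⟨(P.hm1 _).trans_le h1, h2⟩

/-- A point not far from the half-angle preimage lies below the outer curve. -/
lemma mem_starAnnulus_of_halfAngle (P : Picture lam R η c σ F a11 a12 a21 a22 h s v q b m H)
    {φ y r : ℝ} {z : ℂ} (hφ : φ ∈ Icc (q - 2 * Real.pi) q) (hy : R / 2 + 10 ≤ y) (hyh : y ≤ h φ)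
    (hr : y = 1 - lam + lam * r) (hz : ‖z - r * Complex.exp ((φ / 2 : ℝ) * Complex.I)‖ ≤ 1 / 100)
    (hF : F.ext z = pol (φ, y)) : z ∈ starAnnulus m H := by
  have hR := P.M.hR
  have hlam := P.lam_gt
  have hlR := P.lam_mul
  obtain ⟨q1, q2, q3, q4⟩ := P.q_bounds
  have hφ7 := P.mem_Ioo hφ
  have hyR : y ≤ R + 1 := hyh.trans (P.h_bounds hφ7).2
  have hr1 : r ≤ R + 3 := by
    by_contra! h0
    nlinarith
  have hr2 : R / 2 + 9 ≤ r := by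
    by_contra! h0
    nlinarith
  set e := Complex.exp ((φ / 2 : ℝ) * Complex.I) with he
  have hen : ‖e‖ = 1 := Complex.norm_exp_ofReal_mul_I _
  -- The offset of `z - 1` from the model preimage, in the rotating frame of `e`: at most `1 / 100`
  -- from `surj` and `1` from the shift of centre.
  set d : ℂ := (z - r * e - 1) * starRingEnd ℂ e with hd
  have hee : starRingEnd ℂ e * e = 1 := by
    rw [← Complex.normSq_eq_conj_mul_self, Complex.normSq_eq_norm_sq, hen]
    simp
  have hdn : ‖d‖ ≤ 101 / 100 := by
    rw [hd, norm_mul, Complex.norm_conj, hen, mul_one]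
    refine (norm_sub_le _ _).trans ?_
    rw [norm_one]
    linarith
  have hz1 : z - 1 = (r + d) * e := by
    rw [hd]
    linear_combination (-(z - r * e - 1)) * hee
  set y' := ‖(r : ℂ) + d‖ with hy'
  have hyz : ‖z - 1‖ = y' := by rw [hz1, norm_mul, hen, mul_one]
  have hr0 : 0 ≤ r := by linarith
  have hyr : |y' - r| ≤ 101 / 100 := by
    have h1 := abs_norm_sub_norm_le ((r : ℂ) + d) r
    rw [add_sub_cancel_left, Complex.norm_real, Real.norm_of_nonneg hr0] at h1
    exact h1.trans hdn
  have hyr' := abs_le.1 hyr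
  set x' := φ / 2 + Complex.arg (r + d) with hx'
  have harg : |Complex.arg ((r : ℂ) + d)| ≤ 1 / 10 := by
    have hre := abs_le.1 ((Complex.abs_re_le_norm d).trans hdn)
    have him := (Complex.abs_im_le_norm d).trans hdn
    have h1 := abs_arg_le (w := (r : ℂ) + d) (b := 1 / 20) (by simp; linarith) (by
      simp only [Complex.add_im, Complex.ofReal_im, zero_add]
      linarith)
    linarith
  have harg' := abs_le.1 harg
  have hpolz : pol (x', y') = z := by
    have h1 : (y' : ℂ) * Complex.exp (Complex.arg (r + d) * Complex.I) = r + d :=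
      Complex.norm_mul_exp_arg_mul_I _
    rw [pol, hx']
    push_cast
    rw [add_mul, Complex.exp_add]
    have h2 : e = Complex.exp (φ / 2 * Complex.I) := by rw [he]; push_cast; rfl
    rw [← h2]
    linear_combination e * h1 - hz1
  have hy0 : 0 < y' := by linarith
  -- Half of an angle of the fundamental interval is far from its ends, so an error `1 / 10` does
  -- not change the branch.
  have hxI : x' ∈ Icc (q - 2 * Real.pi) q := ⟨by linarith [hφ.1], by linarith [hφ.2]⟩
  have hdz : dir z = Circle.exp x' := by rw [← hpolz, dir_pol hy0]
  refine P.mem_starAnnulus_of (by rw [hyz]; linarith) ?_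
  rw [hdz, P.hHh x' hxI, hyz]
  -- A point strictly above the graph has its image strictly above it, whereas the image is at
  -- height `y ≤ h φ`.
  by_contra! hlt
  have hx7 := P.mem_Ioo hxI
  have hs : (x', y') ∈ strip R := ⟨by simp only; linarith, by simp only; linarith⟩
  have hfn := abs_le.1 (P.M.f_near _ hs)
  have hfn' := abs_le.1 (P.M.f_near _ (P.G.mem_strip P.M x' hx7))
  simp only at hfn hfn'
  have hlift := pol_lift F.ext (x', y')
  rw [hpolz, hF] at hlift
  have hg0 : 0 ≤ liftG F.ext (x', y') := norm_nonneg _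
  have hg : liftG F.ext (x', y') = y := by
    have h1 := pol_norm_sub_one (p := (liftF F.ext (x', y'), liftG F.ext (x', y'))) hg0
    rw [hlift, pol_norm_sub_one (by simp only; linarith)] at h1
    exact h1.symm
  have hf : liftF F.ext (x', y') = φ := by
    have h1 := dir_pol (p := (liftF F.ext (x', y'), liftG F.ext (x', y'))) (by simp only; linarith)
    rw [hlift, dir_pol (by simp only; linarith)] at h1
    refine (circle_exp_eq_exp_iff h1 ?_).symm
    have := Real.pi_gt_three
    rw [abs_lt]
    constructor <;> linarith
  have := (P.G.above P.M hx7 hs hlt.le ⟨by linarith [hφ.1], by linarith [hφ.2]⟩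
    (by rw [hf]; exact hφ7)).1
  rw [hf, hg] at this
  linarith

/-- The annulus is covered by its image. -/
lemma starAnnulus_subset (P : Picture lam R η c σ F a11 a12 a21 a22 h s v q b m H) {w : ℂ}
    (hw : w ∈ starAnnulus m H) : ∃ z ∈ discStar lam, z ∈ starAnnulus m H ∧ F.ext z = w := by
  have hR := P.M.hR
  have hlam := P.lam_gt
  have hlR := P.lam_mul
  rcases le_or_gt ‖w - 1‖ (15 / 100) with h1 | h1
  · obtain ⟨z, hz, hzw⟩ := (P.hole (dir w) ‖w - 1‖ (norm_nonneg _) h1).2 hw.1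
    rw [ray_dir] at hzw
    refine ⟨z, hz, ?_, hzw⟩
    -- Only points near `0` are sent close to `1`; their distance from `1` is about `1`, well inside
    -- the annulus.
    have hz2 : ‖z‖ ≤ 2 / 10 := by
      by_contra! h2
      have h3 := (abs_le.1 (P.outer z hz (by linarith))).1
      rw [hzw] at h3
      nlinarith
    have h4 := abs_norm_sub_norm_le (1 : ℂ) z
    have h5 := norm_sub_le z 1
    rw [norm_one] at h5
    have h6 : ‖(1 : ℂ)‖ - ‖z‖ ≤ ‖1 - z‖ := norm_sub_norm_le _ _
    rw [norm_one, norm_sub_rev] at h6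
    exact P.mem_starAnnulus_of (by linarith) (by linarith [(P.H_bounds (dir z)).1])
  · obtain ⟨φ, hφ, hφw, hφd⟩ := exists_pol_eq q w
    set y := ‖w - 1‖ with hy
    have hyH : y ≤ H (dir w) := hw.2
    have hyh : y ≤ h φ := by rwa [hφd, P.hHh φ hφ] at hyH
    have hyR : y ≤ R + 1 := hyh.trans (P.h_bounds (P.mem_Ioo hφ)).2
    set r := (y - (1 - lam)) / lam with hr
    have hl0 : 0 < lam := by linarith
    have hyr : y = 1 - lam + lam * r := by rw [hr]; field_simp; ring
    have hr1 : 14 / 100 ≤ r := by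
      by_contra! h0
      nlinarith
    have hr2 : r ≤ R + 3 := by
      by_contra! h0
      nlinarith
    have hr0 : 0 < r := by linarith
    have hdisc : ∀ z z₀ : ℂ, ‖z₀‖ = r → ‖z - z₀‖ ≤ 1 / 100 → z ∈ discStar lam := by
      intro z z₀ hz₀ hz
      have h3 := abs_le.1 ((abs_norm_sub_norm_le z z₀).trans hz)
      rw [P.mem_disc_iff]
      exact ⟨by linarith [h3.2], norm_pos_iff.1 (by linarith [h3.1])⟩
    -- For a high target the preimage near angle `φ / 2` is taken, because its lift returns to `φ`
    -- exactly and can be compared with the graph. A low target leaves ample room under `H`, and it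
    -- only matters to stay away from `1`.
    rcases le_or_gt (R / 2 + 10) y with h2 | h2
    · obtain ⟨hn, hmod⟩ := modelMap_polar (lam := lam) (θ := φ / 2) hr0
      obtain ⟨z, hz, hzw⟩ := P.surj _ (by rw [hn]; exact hr1) (by rw [hn]; linarith)
      rw [hmod, ← hyr, show 2 * (φ / 2) = φ by ring] at hzw
      exact ⟨z, hdisc z _ hn hz, P.mem_starAnnulus_of_halfAngle hφ h2 hyh hyr hz hzw, hzw.trans hφw⟩
    · -- a preimage in the left half plane
      obtain ⟨θ, hθ, hcos⟩ : ∃ θ : ℝ, Circle.exp (2 * θ) = Circle.exp φ ∧ Real.cos θ ≤ 0 := by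
        rcases le_or_gt (Real.cos (φ / 2)) 0 with h3 | h3
        · exact ⟨φ / 2, by rw [show 2 * (φ / 2) = φ by ring], h3⟩
        · refine ⟨φ / 2 + Real.pi, ?_, by rw [Real.cos_add_pi]; linarith⟩
          rw [show 2 * (φ / 2 + Real.pi) = φ + 2 * Real.pi by ring]
          exact Circle.periodic_exp φ
      obtain ⟨hn, hmod⟩ := modelMap_polar (lam := lam) (θ := θ) hr0
      obtain ⟨z, hz, hzw⟩ := P.surj _ (by rw [hn]; exact hr1) (by rw [hn]; linarith)
      rw [hmod, ← hyr] at hzw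
      have hzw' : F.ext z = w := by
        rw [hzw, ← hφw, pol_eq_ray, pol_eq_ray, hθ]
      refine ⟨z, hdisc z _ hn hz, ?_, hzw'⟩
      have hre0 : ((r : ℂ) * Complex.exp (θ * Complex.I)).re ≤ 0 := by
        rw [Complex.re_ofReal_mul, Complex.exp_ofReal_mul_I_re]
        nlinarith
      have hre : z.re ≤ 1 / 100 := by
        have h3 := (Complex.re_le_norm (z - r * Complex.exp (θ * Complex.I))).trans hz
        rw [Complex.sub_re] at h3
        linarith
      have h4 : 99 / 100 ≤ ‖z - 1‖ := by
        have h5 := Complex.abs_re_le_norm (z - 1)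
        rw [Complex.sub_re, Complex.one_re] at h5
        linarith [neg_abs_le (z.re - 1)]
      have h6 : ‖z - 1‖ ≤ r + 2 := by
        have h7 := norm_add_le (z - r * Complex.exp (θ * Complex.I)) (r * Complex.exp (θ * Complex.I) - 1)
        have h8 := norm_sub_le ((r : ℂ) * Complex.exp (θ * Complex.I)) 1
        rw [hn, norm_one] at h8
        rw [sub_add_sub_cancel] at h7
        linarith
      have hr3 : r ≤ R / 2 + 12 := by
        by_contra! h0
        nlinarith
      exact P.mem_starAnnulus_of (by linarith) (by linarith [(P.H_bounds (dir z)).1])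

lemma starAnnulus_subset_act (P : Picture lam R η c σ F a11 a12 a21 a22 h s v q b m H) :
    starAnnulus m H ⊆ F.act (starAnnulus m H) := by
  intro w hw
  obtain ⟨z, hz, hzK, hzw⟩ := P.starAnnulus_subset hw
  exact ⟨⟨z, hz⟩, hzK, by rw [← F.ext_of_mem hz, hzw]⟩

lemma starAnnulus_subset_disc (P : Picture lam R η c σ F a11 a12 a21 a22 h s v q b m H) :
    starAnnulus m H ⊆ disc lam := by
  intro w hw
  have h1 := (P.H_bounds (dir w)).2
  have h2 := hw.2
  have hR := P.M.hR
  have h3 := norm_add_le (w - 1) 1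
  rw [sub_add_cancel, norm_one] at h3
  change ‖w‖ ≤ 2 * (1 - lam)⁻¹
  rw [← P.hR]
  linarith

lemma act_mono (F : SpaceF lam) : Monotone F.act := fun _ _ hST _ ⟨z, hz, hw⟩ => ⟨z, hST hz, hw⟩

/-- After one step the distance to `1` is below `2 R`, which serves as the initial excess. Being an
image is carried along, since `norm_image_le` is needed at each step. -/
lemma excess_iterate (P : Picture lam R η c σ F a11 a12 a21 a22 h s v q b m H) (n : ℕ) :
    ∀ w ∈ F.act^[n + 1] (disc lam),
      (∃ z ∈ discStar lam, F.ext z = w) ∧ ‖w - 1‖ ≤ H (dir w) + (c + 2 * σ) ^ n * (2 * R) := by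
  have hR := P.M.hR
  have hθ : 0 ≤ c + 2 * σ := by linarith [P.M.hc, P.M.sigma_nonneg]
  induction n with
  | zero =>
    rintro w ⟨z, -, hzw⟩
    rw [← F.ext_of_mem z.2] at hzw
    refine ⟨⟨z, z.2, hzw⟩, ?_⟩
    have h1 := P.norm_image_le z.2
    rw [hzw] at h1
    have h2 := (P.H_bounds (dir w)).1
    linarith
  | succ n ih =>
    rw [Function.iterate_succ']
    rintro w ⟨z, hz, hzw⟩
    rw [← F.ext_of_mem z.2] at hzw
    refine ⟨⟨z, z.2, hzw⟩, ?_⟩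
    obtain ⟨⟨z', hz', hzz'⟩, hle⟩ := ih _ hz
    have h1 := P.norm_image_le hz'
    rw [hzz'] at h1
    have h2 := P.excess z.2 h1 (by positivity) hle
    rw [hzw] at h2
    calc _ ≤ _ := h2
      _ = _ := by ring

/-- The maximal invariant set is the annulus between the hole and the invariant curve. -/
theorem omega_eq (P : Picture lam R η c σ F a11 a12 a21 a22 h s v q b m H) :
    F.omega = starAnnulus m H := by
  have hθ : 0 ≤ c + 2 * σ := by linarith [P.M.hc, P.M.sigma_nonneg]
  apply Subset.antisymm
  · intro w hw
    have hall : ∀ n : ℕ, w ∈ F.act^[n + 1] (disc lam) := fun n => by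
      simp only [SpaceF.omega, mem_iInter] at hw
      exact hw (n + 1) (by omega)
    refine ⟨?_, ?_⟩
    · obtain ⟨⟨z, hz, hzw⟩, -⟩ := P.excess_iterate 0 w (hall 0)
      rw [← hzw]
      exact P.lt_of_image hz
    · have hlim : Tendsto (fun n : ℕ => H (dir w) + (c + 2 * σ) ^ n * (2 * R)) atTop
          (𝓝 (H (dir w))) := by
        have := ((tendsto_pow_atTop_nhds_zero_of_lt_one hθ P.M.hcσ).mul_const (2 * R)).const_add
          (H (dir w))
        simpa using this
      exact ge_of_tendsto' hlim fun n => (P.excess_iterate n w (hall n)).2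
  -- The annulus is contained in its image, hence in all its forward images.
  · have hK : ∀ n : ℕ, starAnnulus m H ⊆ F.act^[n] (starAnnulus m H) := by
      intro n
      induction n with
      | zero => exact Subset.rfl
      | succ n ih =>
        rw [Function.iterate_succ']
        exact P.starAnnulus_subset_act.trans (act_mono F ih)
    intro w hw
    simp only [SpaceF.omega, mem_iInter]
    exact fun n _ => (act_mono F).iterate n P.starAnnulus_subset_disc (hK n hw)

end Picture

lemma contDiff_pol : ContDiff ℝ 1 pol := by
  have h1 : ContDiff ℝ 1 (fun x : ℝ × ℝ => (x.1 : ℂ)) := Complex.ofRealCLM.contDiff.comp contDiff_fst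
  have h2 : ContDiff ℝ 1 (fun x : ℝ × ℝ => (x.2 : ℂ)) := Complex.ofRealCLM.contDiff.comp contDiff_snd
  exact contDiff_const.add (h2.mul (h1.mul contDiff_const).cexp)

/-! ### The outer loop on the unstable manifold. -/

namespace Picture

variable {lam R η c σ : ℝ} {F : SpaceF lam} {a11 a12 a21 a22 : ℝ × ℝ → ℝ} {h s v : ℝ → ℝ} {q b : ℝ}
  {m H : Circle → ℝ}

lemma iterate_mem (P : Picture lam R η c σ F a11 a12 a21 a22 h s v q b m H) (n : ℕ) {φ : ℝ}
    (hφ : φ ∈ Ioo (-7 : ℝ) 7) : v^[n] φ ∈ Ioo (-7 : ℝ) 7 := by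
  induction n with
  | zero => exact hφ
  | succ n ih =>
    rw [Function.iterate_succ_apply']
    exact P.G.v_mem' ih

lemma graph_mem_disc (P : Picture lam R η c σ F a11 a12 a21 a22 h s v q b m H) {x : ℝ}
    (hx : x ∈ Ioo (-7 : ℝ) 7) : pol (x, h x) ∈ discStar lam := by
  have h1 := P.h_bounds hx
  have hR := P.M.hR
  have h2 := abs_le.1 (abs_norm_pol_sub (x, h x) (by simp only; linarith))
  rw [P.mem_disc_iff]
  simp only at h2
  exact ⟨by linarith [h2.2], norm_pos_iff.1 (by linarith [h2.1])⟩

lemma orbit_step (P : Picture lam R η c σ F a11 a12 a21 a22 h s v q b m H) (n : ℕ) {φ : ℝ}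
    (hφ : φ ∈ Ioo (-7 : ℝ) 7) :
    pol (v^[n + 1] φ, h (v^[n + 1] φ)) ∈ discStar lam ∧
      F.ext (pol (v^[n + 1] φ, h (v^[n + 1] φ))) = pol (v^[n] φ, h (v^[n] φ)) := by
  have h1 := P.iterate_mem n hφ
  refine ⟨P.graph_mem_disc (P.iterate_mem (n + 1) hφ), ?_⟩
  rw [Function.iterate_succ_apply', ← pol_lift F.ext, P.G.f_v _ h1, P.G.g_v _ h1]

lemma tendsto_orbit (P : Picture lam R η c σ F a11 a12 a21 a22 h s v q b m H) {x₀ : ℝ}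
    (hx₀ : |x₀| ≤ 1 / 100000) {φ : ℝ} (hv : Tendsto (fun n => v^[n] φ) atTop (𝓝 x₀)) :
    Tendsto (fun n => pol (v^[n] φ, h (v^[n] φ))) atTop (𝓝 (pol (x₀, h x₀))) := by
  have hx₀' := abs_le.1 hx₀
  have h1 : x₀ ∈ Ioo (-7 : ℝ) 7 := ⟨by linarith [hx₀'.1], by linarith [hx₀'.2]⟩
  have h2 : ContinuousAt h x₀ := (P.G.adm.continuousOn).continuousAt (isOpen_Ioo.mem_nhds h1)
  exact (contDiff_pol.continuous.tendsto _).comp (hv.prodMk_nhds (h2.tendsto.comp hv))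

/-- The outer boundary lies on the unstable manifold. -/
lemma range_subset_unstableManifold (P : Picture lam R η c σ F a11 a12 a21 a22 h s v q b m H)
    {x₀ : ℝ} (hx₀ : |x₀| ≤ 1 / 100000)
    (hv : ∀ φ ∈ Ioo (-7 : ℝ) 7, Tendsto (fun n => v^[n] φ) atTop (𝓝 x₀)) :
    (range fun u => ray u (H u)) ⊆ F.unstableManifold (pol (x₀, h x₀)) := by
  rintro _ ⟨u, rfl⟩
  obtain ⟨x, hx, -, hd⟩ := exists_pol_eq q (ray u 1)
  rw [dir_ray u one_pos] at hd
  have hx7 := P.mem_Ioo hx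
  refine ⟨fun n => pol (v^[n] x, h (v^[n] x)), ?_, fun n => P.orbit_step n hx7,
    P.tendsto_orbit hx₀ (hv x hx7)⟩
  simp only [Function.iterate_zero, id, pol_eq_ray, hd, P.hHh x hx]

lemma hasDerivAt_graph (P : Picture lam R η c σ F a11 a12 a21 a22 h s v q b m H) {x : ℝ}
    (hx : x ∈ Ioo (-7 : ℝ) 7) : HasDerivAt (fun x => pol (x, h x))
      (((s x : ℝ) + (h x : ℝ) * Complex.I) * Complex.exp (x * Complex.I)) x := by
  have h1 := P.G.hasDerivAt P.M hx
  have h2 := HasFDerivAt.comp_hasDerivAt (l := pol) (f := fun x => (x, h x)) x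
    (hasFDerivAt_pol (x, h x)) ((hasDerivAt_id x).prodMk h1)
  refine h2.congr_deriv ?_
  simp
  ring

/-- The outer boundary is a loop of the unstable manifold with one corner. -/
theorem isUnstableLoop (P : Picture lam R η c σ F a11 a12 a21 a22 h s v q b m H) {x₀ : ℝ}
    (hx₀ : |x₀| ≤ 1 / 100000)
    (hv : ∀ φ ∈ Ioo (-7 : ℝ) 7, Tendsto (fun n => v^[n] φ) atTop (𝓝 x₀)) :
    F.IsUnstableLoop (pol (x₀, h x₀)) (range fun u => ray u (H u)) (pol (q, h q)) := by
  have hpi := Real.pi_pos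
  have hpi2 := Real.pi_lt_d2
  have hpi3 := Real.pi_gt_three
  obtain ⟨q1, q2, q3, q4⟩ := P.q_bounds
  have hR := P.M.hR
  -- `[0, 1]` is sent affinely onto `[q - 2π, q]`; an excess of `1 / 100` of a turn at each end
  -- stays inside `(-7, 7)`.
  set a : ℝ → ℝ := fun t => q - 2 * Real.pi + 2 * Real.pi * t with ha
  have hmem : ∀ t ∈ Ioo (-(1 / 100) : ℝ) (1 + 1 / 100), a t ∈ Ioo (-7 : ℝ) 7 := by
    intro t ht
    have h1 : 2 * Real.pi * (-(1 / 100)) ≤ 2 * Real.pi * t :=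
      mul_le_mul_of_nonneg_left ht.1.le (by positivity)
    have h2 : 2 * Real.pi * t ≤ 2 * Real.pi * (1 + 1 / 100) :=
      mul_le_mul_of_nonneg_left ht.2.le (by positivity)
    constructor <;> simp only [ha] <;> linarith
  have hmem' : ∀ t ∈ Icc (0 : ℝ) 1, a t ∈ Icc (q - 2 * Real.pi) q := by
    intro t ht
    have h1 : 0 ≤ 2 * Real.pi * t := mul_nonneg (by positivity) ht.1
    have h2 : 2 * Real.pi * t ≤ 2 * Real.pi * 1 := mul_le_mul_of_nonneg_left ht.2 (by positivity)
    constructor <;> simp only [ha] <;> linarith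
  have hda : ∀ t, HasDerivAt a (2 * Real.pi) t := fun t => by
    have := ((hasDerivAt_id t).const_mul (2 * Real.pi)).const_add (q - 2 * Real.pi)
    rwa [mul_one] at this
  set Γ : ℝ → ℂ := fun t => pol (a t, h (a t)) with hΓ
  have hdΓ : ∀ t ∈ Ioo (-(1 / 100) : ℝ) (1 + 1 / 100), HasDerivAt Γ ((2 * Real.pi : ℝ) •
      (((s (a t) : ℝ) + (h (a t) : ℝ) * Complex.I) * Complex.exp (a t * Complex.I))) t := fun t ht =>
    HasDerivAt.scomp (h := a) (g₁ := fun x => pol (x, h x)) t (P.hasDerivAt_graph (hmem t ht)) (hda t)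
  have hac : ContDiff ℝ 1 a := by fun_prop
  have hh : ContDiffOn ℝ 1 h (Ioo (-7) 7) := by
    have hd := fun x (hx : x ∈ Ioo (-7 : ℝ) 7) => P.G.hasDerivAt P.M hx
    have h1 := contDiffOn_succ_iff_deriv_of_isOpen (𝕜 := ℝ) (f := h) (n := 0)
      (isOpen_Ioo (a := (-7 : ℝ)) (b := 7))
    rw [zero_add] at h1
    rw [h1]
    refine ⟨fun x hx => (hd x hx).differentiableAt.differentiableWithinAt, by simp, ?_⟩
    rw [contDiffOn_zero]
    exact P.G.s_cont.congr fun x hx => (hd x hx).deriv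
  have e0 : (0 : ℝ) ∈ Ioo (-(1 / 100) : ℝ) (1 + 1 / 100) := by norm_num
  have e1 : (1 : ℝ) ∈ Ioo (-(1 / 100) : ℝ) (1 + 1 / 100) := by norm_num
  have ha0 : a 0 = q - 2 * Real.pi := by simp [ha]
  have ha1 : a 1 = q := by simp [ha]
  have hexp : Complex.exp (((q - 2 * Real.pi : ℝ) : ℂ) * Complex.I) = Complex.exp (q * Complex.I) := by
    rw [Complex.exp_eq_exp_iff_exists_int]
    exact ⟨-1, by push_cast; ring⟩
  have hpos : ∀ t ∈ Ioo (-(1 / 100) : ℝ) (1 + 1 / 100), 0 < h (a t) := fun t ht => by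
    linarith [(P.h_bounds (hmem t ht)).1]
  refine ⟨1 / 100, Γ, by norm_num, ?_, fun t ht => ?_, ?_, ?_, ?_, ?_, ?_, ?_⟩
  · exact contDiff_pol.comp_contDiffOn (hac.contDiffOn.prodMk (hh.comp hac.contDiffOn hmem))
  · rw [(hdΓ t ht).deriv]
    have h1 : ((s (a t) : ℝ) + (h (a t) : ℝ) * Complex.I : ℂ) ≠ 0 := fun h0 => by
      have := congrArg Complex.im h0
      simp at this
      linarith [hpos t ht]
    have h2 : (2 * Real.pi : ℝ) ≠ 0 := by positivity
    exact smul_ne_zero h2 (mul_ne_zero h1 (Complex.exp_ne_zero _))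
  · refine ⟨fun n t => pol (v^[n] (a t), h (v^[n] (a t))), fun t _ => rfl, fun n => ?_,
      fun n t ht => P.orbit_step n (hmem t ht), fun t ht => P.tendsto_orbit hx₀ (hv _ (hmem t ht))⟩
    have hvc : ∀ n, ContinuousOn (v^[n]) (Ioo (-7 : ℝ) 7) := by
      intro n
      induction n with
      | zero => exact continuousOn_id
      | succ n ih =>
        rw [Function.iterate_succ']
        exact (StripMap.continuousOn_v P.M P.G.adm P.G.v_mem P.G.f_v).comp ih
          fun x hx => P.iterate_mem n hx
    have h1 : ContinuousOn (fun t => v^[n] (a t)) (Ioo (-(1 / 100)) (1 + 1 / 100)) :=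
      (hvc n).comp hac.continuous.continuousOn hmem
    exact contDiff_pol.continuous.comp_continuousOn (h1.prodMk (P.G.adm.continuousOn.comp h1
      fun t ht => P.iterate_mem n (hmem t ht)))
  · intro t ht t' ht' hEq
    have hI : ∀ t ∈ Ico (0 : ℝ) 1, t ∈ Ioo (-(1 / 100) : ℝ) (1 + 1 / 100) := fun t ht =>
      ⟨by linarith [ht.1], by linarith [ht.2]⟩
    have h1 := congrArg dir hEq
    simp only [hΓ] at h1
    rw [dir_pol (hpos t (hI t ht)), dir_pol (hpos t' (hI t' ht'))] at h1
    have h2 : |a t - a t'| < 2 * Real.pi := by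
      have h3 : a t - a t' = 2 * Real.pi * (t - t') := by simp only [ha]; ring
      rw [h3, abs_mul, abs_of_pos (by positivity : 0 < 2 * Real.pi)]
      have h4 : |t - t'| < 1 := abs_lt.2 ⟨by linarith [ht.1, ht'.2], by linarith [ht.2, ht'.1]⟩
      nlinarith
    have h5 := circle_exp_eq_exp_iff h1 h2
    simp only [ha] at h5
    have h6 : 2 * Real.pi * (t - t') = 0 := by linarith
    linarith [(mul_eq_zero.1 h6).resolve_left (by positivity)]
  · ext w
    constructor
    · rintro ⟨t, ht, rfl⟩
      refine ⟨Circle.exp (a t), ?_⟩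
      simp only [hΓ, pol_eq_ray, P.hHh _ (hmem' t ht)]
    · rintro ⟨u, rfl⟩
      obtain ⟨x, hx, -, hd⟩ := exists_pol_eq q (ray u 1)
      rw [dir_ray u one_pos] at hd
      refine ⟨(x - (q - 2 * Real.pi)) / (2 * Real.pi), ⟨?_, ?_⟩, ?_⟩
      · exact div_nonneg (by linarith [hx.1]) (by positivity)
      · rw [div_le_one (by positivity)]
        linarith [hx.2]
      · have hax : a ((x - (q - 2 * Real.pi)) / (2 * Real.pi)) = x := by
          simp only [ha]
          field_simp
          ring
        simp only [hΓ, hax, pol_eq_ray, hd, P.hHh x hx]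
  · simp only [hΓ, ha0, pol, P.h_q, hexp]
  · simp only [hΓ, ha1]
  -- Up to the common factor `2π e^{iq}` the two velocities are `s (q - 2π) + i h q` and `s q + i h
  -- q`: equal nonzero imaginary parts, different real parts.
  · rw [(hdΓ 0 e0).deriv, (hdΓ 1 e1).deriv, ha0, ha1, hexp, ← P.h_q, LinearIndependent.pair_iff]
    intro α β hαβ
    have hE : Complex.exp (q * Complex.I) ≠ 0 := Complex.exp_ne_zero _
    have hp : ((2 * Real.pi : ℝ) : ℂ) ≠ 0 := by
      have : (2 * Real.pi : ℝ) ≠ 0 := by positivity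
      exact_mod_cast this
    have h1 : ((α : ℂ) * ((s (q - 2 * Real.pi) : ℝ) + (h q : ℝ) * Complex.I) +
        β * ((s q : ℝ) + (h q : ℝ) * Complex.I)) * (((2 * Real.pi : ℝ) : ℂ) * Complex.exp (q * Complex.I)) = 0 := by
      rw [← hαβ]
      simp only [Complex.real_smul]
      ring
    have h2 := (mul_eq_zero.1 h1).resolve_right (mul_ne_zero hp hE)
    have hre := congrArg Complex.re h2
    have him := congrArg Complex.im h2
    simp at hre him
    have hq0 : 0 < h q := by have := hpos 1 e1; rwa [ha1] at this
    have h3 : α + β = 0 := by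
      have : (α + β) * h q = 0 := by linarith
      exact (mul_eq_zero.1 this).resolve_right hq0.ne'
    have h4 : β * (s q - s (q - 2 * Real.pi)) = 0 := by
      have : α = -β := by linarith
      rw [this] at hre
      linarith
    have h5 : β = 0 := (mul_eq_zero.1 h4).resolve_right (sub_ne_zero.2 P.s_q)
    exact ⟨by linarith, h5⟩

end Picture

/-! ### The saddle fixed point -/

namespace StripMap

variable {lam R η c σ : ℝ} {f g a11 a12 a21 a22 : ℝ × ℝ → ℝ}

/-- Almost fixed points are close to fixed points. -/
lemma almost_fixed (M : StripMap lam R η c σ f g a11 a12 a21 a22) {x y x' y' ε : ℝ}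
    (h : (x, y) ∈ strip R) (h' : (x', y') ∈ strip R) (hf : f (x, y) = x) (hg : g (x, y) = y)
    (hf' : |f (x', y') - x'| ≤ ε) (hg' : |g (x', y') - y'| ≤ ε) :
    (1 - c - 3 / 2 * σ) * |y - y'| ≤ 3 * ε ∧ |x - x'| ≤ 2 * ε + |y - y'| := by
  have hσ := M.hσ
  have hσ0 := M.sigma_nonneg
  have hY := abs_nonneg (y - y')
  have hX := abs_nonneg (x - x')
  have h1 : 199 / 100 * |x - x'| ≤ |f (x, y) - f (x', y)| := by
    rcases le_total x' x with hx | hx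
    · have := (M.horiz_f (x₁ := x') (x₂ := x) h hx).1
      rw [abs_of_nonneg (sub_nonneg.2 hx)]
      exact le_trans (by linarith [sub_nonneg.2 hx]) (this.trans (le_abs_self _))
    · have := (M.horiz_f (x₁ := x) (x₂ := x') h hx).1
      rw [abs_sub_comm, abs_of_nonneg (sub_nonneg.2 hx), abs_sub_comm]
      exact le_trans (by linarith [sub_nonneg.2 hx]) (this.trans (le_abs_self _))
  have h2 : |f (x', y) - f (x', y')| ≤ σ * |y - y'| := M.vert_f (x := x') h' h
  have h3 : |f (x, y) - f (x', y)| ≤ |x - x'| + |f (x', y') - x'| + |f (x', y) - f (x', y')| := by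
    have e : f (x, y) - f (x', y) = (x - x') - (f (x', y') - x') - (f (x', y) - f (x', y')) := by
      rw [hf]; ring
    rw [e]
    exact (abs_sub _ _).trans (add_le_add_left (abs_sub _ _) _)
  have h4 : |g (x, y) - g (x', y)| ≤ (1 + 1 / 100000) * |x - x'| := M.horiz_g h
  have h5 : |g (x', y) - g (x', y')| ≤ c * |y - y'| := M.vert_g_abs (x := x') h' h
  have h6 : |y - y'| ≤ |g (x, y) - g (x', y)| + |g (x', y) - g (x', y')| + |g (x', y') - y'| := by
    have e : y - y' = (g (x, y) - g (x', y)) + (g (x', y) - g (x', y')) + (g (x', y') - y') := by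
      rw [hg]; ring
    conv_lhs => rw [e]
    exact (abs_add_le _ _).trans (add_le_add_left (abs_add_le _ _) _)
  have h7 : 99 / 100 * |x - x'| ≤ ε + σ * |y - y'| := by linarith
  have h8 : σ * |y - y'| ≤ 1 / 100000 * |y - y'| := mul_le_mul_of_nonneg_right hσ hY
  have h9 := mul_nonneg hσ0 hY
  have hε : 0 ≤ ε := (abs_nonneg _).trans hf'
  constructor
  · have e : (1 - c - 3 / 2 * σ) * |y - y'| = |y - y'| - c * |y - y'| - 3 / 2 * (σ * |y - y'|) := by ring
    rw [e]
    linarith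
  · linarith

/-- The two real eigenvalues of the derivative at a fixed point of the strip map. -/
lemma exists_eigenvalues (M : StripMap lam R η c σ f g a11 a12 a21 a22) {p : ℝ × ℝ}
    (hp : p ∈ strip R) : ∃ a b : ℝ, |a| < 1 ∧ 1 < |b| ∧
      (a11 p - a) * (a22 p - a) = a12 p * a21 p ∧ (a11 p - b) * (a22 p - b) = a12 p * a21 p ∧
      a - a11 p ≠ 0 ∧ b - a22 p ≠ 0 := by
  have h11 := abs_le.1 (M.b11 p hp)
  have h22 := abs_le.1 (M.b22 p hp)
  have h22' := M.b22' p hp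
  have hσ := M.hσ
  have hσ0 := M.sigma_nonneg
  have hcσ := M.hcσ
  have h21 : |a21 p| ≤ 101 / 100 := by
    have h1 := M.b21 p hp
    have h2 := abs_sub_abs_le_abs_sub (a21 p) (-Real.sin p.1)
    rw [sub_neg_eq_add, abs_neg] at h2
    have h3 := Real.abs_sin_le_one p.1
    linarith
  have hprod : |a12 p * a21 p| ≤ 101 / 100 * σ := by
    rw [abs_mul]
    calc _ ≤ σ * (101 / 100) := mul_le_mul (M.b12 p hp) h21 (abs_nonneg _) hσ0
      _ = _ := by ring
  have hprod' := abs_le.1 hprod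
  -- The characteristic polynomial is positive at `-1` and `3`. At `1` it is negative: `1 - a22`
  -- exceeds `2 σ`, while the off-diagonal product is at most about `σ`.
  set χ : ℝ → ℝ := fun t => (a11 p - t) * (a22 p - t) - a12 p * a21 p with hχ
  have hχc : Continuous χ := by fun_prop
  have h1 : χ 1 < 0 := by
    simp only [hχ]
    nlinarith
  have h2 : 0 < χ (-1) := by
    simp only [hχ]
    nlinarith
  have h3 : 0 < χ 3 := by
    simp only [hχ]
    nlinarith
  obtain ⟨a, ha, ha0⟩ := intermediate_value_Ioo' (by norm_num : (-1 : ℝ) ≤ 1) hχc.continuousOn ⟨h1, h2⟩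
  obtain ⟨b, hb, hb0⟩ := intermediate_value_Ioo (by norm_num : (1 : ℝ) ≤ 3) hχc.continuousOn ⟨h1, h3⟩
  refine ⟨a, b, abs_lt.2 ha, hb.1.trans_le (le_abs_self b), sub_eq_zero.1 ha0, sub_eq_zero.1 hb0, ?_, ?_⟩
  · have : a - a11 p < 0 := by linarith [ha.2]
    exact this.ne
  · have : 0 < b - a22 p := by linarith [hb.1]
    exact this.ne'

end StripMap

/-- The neighbourhood of the saddle in which it is the only fixed point. -/
def fixNhd (R : ℝ) : Set ℂ :=
  {w | Real.cos 1 * ‖w - 1‖ < (w - 1).re ∧ R / 2 < ‖w - 1‖ ∧ ‖w - 1‖ < 2 * R - 3 / 2}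

lemma isOpen_fixNhd (R : ℝ) : IsOpen (fixNhd R) :=
  have h1 : Continuous fun w : ℂ => w - 1 := continuous_id.sub continuous_const
  (isOpen_lt (continuous_const.mul h1.norm) (Complex.continuous_re.comp h1)).inter
    ((isOpen_lt continuous_const h1.norm).inter (isOpen_lt h1.norm continuous_const))

lemma exists_of_mem_fixNhd {R : ℝ} {w : ℂ} (hw : w ∈ fixNhd R) :
    |Complex.arg (w - 1)| < 1 ∧ (Complex.arg (w - 1), ‖w - 1‖) ∈ strip R ∧
      pol (Complex.arg (w - 1), ‖w - 1‖) = w := by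
  obtain ⟨h1, h2, h3⟩ := hw
  have h0 : 0 < ‖w - 1‖ := by linarith
  refine ⟨?_, ⟨h2, h3⟩, ?_⟩
  · have h4 : Real.cos 1 < Real.cos |Complex.arg (w - 1)| := by
      rw [Real.cos_abs, Complex.cos_arg (norm_pos_iff.1 h0), lt_div_iff₀ h0]
      exact h1
    by_contra! h5
    have h6 := Real.cos_le_cos_of_nonneg_of_le_pi (by norm_num : (0 : ℝ) ≤ 1)
      (Complex.abs_arg_le_pi (w - 1)) h5
    linarith
  · rw [pol, Complex.norm_mul_exp_arg_mul_I]
    ring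

lemma pol_mem_fixNhd {R x y : ℝ} (hx : |x| < 1) (hxy : (x, y) ∈ strip R) :
    pol (x, y) ∈ fixNhd R := by
  obtain ⟨h1, h2⟩ := hxy
  simp only at h1 h2
  have h0 : 0 < y := by linarith
  have hn : ‖pol (x, y) - 1‖ = y := pol_norm_sub_one h0.le
  refine ⟨?_, by rw [hn]; exact h1, by rw [hn]; exact h2⟩
  rw [hn, pol_sub_one, Complex.re_ofReal_mul, Complex.exp_ofReal_mul_I_re, mul_comm]
  refine mul_lt_mul_of_pos_left ?_ h0
  rw [← Real.cos_abs x]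
  exact Real.cos_lt_cos_of_nonneg_of_le_pi (abs_nonneg x) (by linarith [Real.pi_gt_three]) hx

/-! ### Uniqueness, hyperbolicity and continuity of the fixed point. -/

section Saddle

variable {lam R η c σ : ℝ} {F : SpaceF lam} {a11 a12 a21 a22 : ℝ × ℝ → ℝ}

/-- A fixed point determines the lifted angle only modulo `2π`; for `|x| < 1` the near doubling of
the angle excludes a nonzero multiple. -/
lemma lift_eq_of_fixed {f : ℂ → ℂ}
    (M : StripMap lam R η c σ (liftF f) (liftG f) a11 a12 a21 a22) {x y : ℝ} (hx : |x| < 1)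
    (hs : (x, y) ∈ strip R) (hfix : f (pol (x, y)) = pol (x, y)) :
    liftF f (x, y) = x ∧ liftG f (x, y) = y := by
  have hR := M.hR
  have hy : 0 < y := by linarith [hs.1]
  have h1 := pol_lift f (x, y)
  rw [hfix] at h1
  have h2 : liftG f (x, y) = y := by
    rw [liftG, hfix]
    exact pol_norm_sub_one hy.le
  refine ⟨?_, h2⟩
  have h3 := congrArg dir h1
  rw [dir_pol (by simp only; rw [h2]; exact hy), dir_pol hy] at h3
  refine circle_exp_eq_exp_iff h3 ?_
  have h4 := abs_le.1 (M.f_near _ hs)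
  have h5 := abs_lt.1 hx
  have := Real.pi_gt_three
  simp only at h4
  rw [abs_lt]
  constructor <;> linarith

lemma eq_of_fixed (M : StripMap lam R η c σ (liftF F.ext) (liftG F.ext) a11 a12 a21 a22) {z w : ℂ}
    (hz : z ∈ fixNhd R) (hw : w ∈ fixNhd R) (hzF : F.ext z = z) (hwF : F.ext w = w) : z = w := by
  obtain ⟨z1, z2, z3⟩ := exists_of_mem_fixNhd hz
  obtain ⟨w1, w2, w3⟩ := exists_of_mem_fixNhd hw
  obtain ⟨e1, e2⟩ := lift_eq_of_fixed M z1 z2 (by rw [z3, hzF])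
  obtain ⟨e3, e4⟩ := lift_eq_of_fixed M w1 w2 (by rw [w3, hwF])
  -- Uniqueness is the case `ε = 0` of the estimate.
  have h := M.almost_fixed (ε := 0) z2 w2 e1 e2 (by rw [e3]; simp) (by rw [e4]; simp)
  have h1 : 0 < 1 - c - 3 / 2 * σ := by linarith [M.hcσ, M.sigma_nonneg]
  have h2 : |‖z - 1‖ - ‖w - 1‖| = 0 := le_antisymm (by nlinarith [h.1]) (abs_nonneg _)
  have h3 : |Complex.arg (z - 1) - Complex.arg (w - 1)| = 0 :=
    le_antisymm (by linarith [h.2]) (abs_nonneg _)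
  rw [← z3, ← w3, sub_eq_zero.1 (abs_eq_zero.1 h2), sub_eq_zero.1 (abs_eq_zero.1 h3)]

/-- The fixed point is a saddle. -/
lemma isSaddle_of_fixed (hl : lam ∈ Ioo (0 : ℝ) 1) (hR : R = (1 - lam)⁻¹)
    (M : StripMap lam R η c σ (liftF F.ext) (liftG F.ext) a11 a12 a21 a22) {z : ℂ}
    (hz : z ∈ fixNhd R) (hzF : F.ext z = z) : F.IsSaddle z := by
  have hR1 := M.hR
  have hpol : HasFDerivAt pol _ (Complex.arg (z - 1), ‖z - 1‖) := hasFDerivAt_pol _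
  obtain ⟨z1, z2, z3⟩ := exists_of_mem_fixNhd hz
  obtain ⟨e1, e2⟩ := lift_eq_of_fixed M z1 z2 (by rw [z3, hzF])
  obtain ⟨-, hz2, hz4⟩ := hz
  set p : ℝ × ℝ := (Complex.arg (z - 1), ‖z - 1‖) with hp
  have hn1 : ‖z‖ < 2 * (1 - lam)⁻¹ := by
    have := norm_add_le (z - 1) 1
    rw [sub_add_cancel, norm_one] at this
    rw [← hR]
    linarith
  have hn0 : 0 < ‖z‖ := by
    have := norm_sub_le z 1
    rw [norm_one] at this
    linarith
  have hmem : z ∈ discStar lam := ⟨hn1.le, norm_pos_iff.1 hn0⟩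
  refine ⟨⟨hmem, hzF⟩, ?_⟩
  obtain ⟨a, b, ha, hb, ha0, hb0, ha1, hb1⟩ := M.exists_eigenvalues z2
  set D := ((ContinuousLinearMap.fst ℝ ℝ ℝ).smulRight
        ((p.2 : ℂ) * Complex.exp (p.1 * Complex.I) * Complex.I)) +
      (ContinuousLinearMap.snd ℝ ℝ ℝ).smulRight (Complex.exp (p.1 * Complex.I)) with hD
  have hDinj : ∀ ξ : ℝ × ℝ, D ξ = 0 → ξ = 0 := by
    intro ξ hξ
    have h1 : Complex.exp (p.1 * Complex.I) * ((ξ.2 : ℂ) + (ξ.1 * p.2 : ℝ) * Complex.I) = 0 := by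
      rw [← hξ, hD]
      simp
      ring
    have h2 := (mul_eq_zero.1 h1).resolve_left (Complex.exp_ne_zero _)
    have hre := congrArg Complex.re h2
    have him := congrArg Complex.im h2
    have hp2 : p.2 ≠ 0 := by
      have : 0 < p.2 := by linarith [z2.1]
      exact this.ne'
    simp at hre him
    exact Prod.ext (him.resolve_right hp2) hre
  have hL : HasFDerivAt (fun p => (liftF F.ext p, liftG F.ext p))
      ((lin (a11 p) (a12 p)).prod (lin (a21 p) (a22 p))) p := (M.f_deriv p z2).prodMk (M.g_deriv p z2)
  have hLp : (liftF F.ext p, liftG F.ext p) = p := Prod.ext e1 e2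
  have hc1 : HasFDerivAt (fun p => pol (liftF F.ext p, liftG F.ext p))
      (D.comp ((lin (a11 p) (a12 p)).prod (lin (a21 p) (a22 p)))) p :=
    HasFDerivAt.comp (g := pol) p (by rw [hLp]; exact hpol) hL
  have hFz : HasFDerivAt F.ext (F.dext z) (pol p) := by
    rw [z3]
    exact F.hasFDerivAt hl hn0 hn1
  have hc2 : HasFDerivAt (fun p => pol (liftF F.ext p, liftG F.ext p)) ((F.dext z).comp D) p := by
    have : (fun p => pol (liftF F.ext p, liftG F.ext p)) = F.ext ∘ pol :=
      funext fun p => pol_lift F.ext p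
    rw [this]
    exact HasFDerivAt.comp p hFz hpol
  -- Polar coordinates conjugate the derivative of `F` to the `2 × 2` Jacobian of the lift, so
  -- eigenvalues can be computed there.
  have hconj : ∀ ξ, F.dext z (D ξ) = D (lin (a11 p) (a12 p) ξ, lin (a21 p) (a22 p) ξ) := fun ξ =>
    congrArg (fun A : ℝ × ℝ →L[ℝ] ℂ => A ξ) (hc2.unique hc1)
  have heig : ∀ (t : ℝ) (ξ : ℝ × ℝ), ξ ≠ 0 → lin (a11 p) (a12 p) ξ = t * ξ.1 →
      lin (a21 p) (a22 p) ξ = t * ξ.2 →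
      Module.End.HasEigenvalue (fderivWithin ℝ F.ext (discStar lam) z : ℂ →ₗ[ℝ] ℂ) t := by
    intro t ξ hξ h1 h2
    refine Module.End.hasEigenvalue_of_hasEigenvector (x := D ξ) ⟨?_, fun h0 => hξ (hDinj ξ h0)⟩
    rw [Module.End.mem_eigenspace_iff]
    change F.dext z (D ξ) = t • D ξ
    rw [hconj, h1, h2, ← map_smul]
    rfl
  -- Eigenvectors of the Jacobian; each is written so that the entry known to be nonzero is `a -
  -- a11` or `b - a22`.
  refine ⟨a, b, ha, hb, heig a (a12 p, a - a11 p) ?_ ?_ ?_, heig b (b - a22 p, a21 p) ?_ ?_ ?_⟩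
  · exact fun h0 => ha1 (congrArg Prod.snd h0)
  · rw [lin_apply]; ring
  · rw [lin_apply]; linear_combination -ha0
  · exact fun h0 => hb1 (congrArg Prod.fst h0)
  · rw [lin_apply]; linear_combination -hb0
  · rw [lin_apply]; ring

/-- The fixed point depends continuously on the map. -/
lemma continuousOn_fixed (hl : lam ∈ Ioo (0 : ℝ) 1) (hR : R = (1 - lam)⁻¹) {N : Set (SpaceF lam)}
    {p : SpaceF lam → ℂ}
    (hM : ∀ F ∈ N, ∃ a11 a12 a21 a22, StripMap lam R η c σ (liftF F.ext) (liftG F.ext) a11 a12 a21 a22)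
    (hp : ∀ F ∈ N, p F ∈ fixNhd R ∧ F.ext (p F) = p F) : ContinuousOn p N := by
  intro F₀ hF₀
  obtain ⟨b11, b12, b21, b22, M₀⟩ := hM F₀ hF₀
  have hR1 := M₀.hR
  obtain ⟨hV, hfix⟩ := hp F₀ hF₀
  obtain ⟨z1, z2, z3⟩ := exists_of_mem_fixNhd hV
  obtain ⟨e1, e2⟩ := lift_eq_of_fixed M₀ z1 z2 (by rw [z3, hfix])
  set x₀ := Complex.arg (p F₀ - 1) with hx₀
  set y₀ := ‖p F₀ - 1‖ with hy₀
  have hy0 : 0 < y₀ := by linarith [z2.1]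
  have hmem : pol (x₀, y₀) ∈ discStar lam := by
    have h1 := abs_le.1 (abs_norm_pol_sub (x₀, y₀) hy0.le)
    have h2 := z2.2
    have h3 := z2.1
    simp only at h1 h2 h3
    refine ⟨?_, norm_pos_iff.1 (by linarith)⟩
    change ‖_‖ ≤ _
    rw [← hR]
    linarith
  have hcont := (continuous_ext_apply hl hmem).continuousAt (x := F₀)
  have hG : Tendsto (fun F : SpaceF lam => liftG F.ext (x₀, y₀)) (𝓝 F₀) (𝓝 y₀) := by
    have : ContinuousAt (fun F : SpaceF lam => liftG F.ext (x₀, y₀)) F₀ :=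
      (hcont.sub continuousAt_const).norm
    rw [ContinuousAt, e2] at this
    exact this
  have hrot : ContinuousAt (fun F : SpaceF lam => rot F.ext (x₀, y₀)) F₀ :=
    (hcont.sub continuousAt_const).mul continuousAt_const
  have hslit : rot F₀.ext (x₀, y₀) ∈ Complex.slitPlane := by
    rw [Complex.mem_slitPlane_iff_arg]
    refine ⟨?_, norm_pos_iff.1 ?_⟩
    · have h1 : Complex.arg (rot F₀.ext (x₀, y₀)) = -x₀ := by
        have := e1
        rw [liftF] at this
        simp only at this
        linarith
      rw [h1]
      have := abs_lt.1 z1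
      intro h0
      linarith [Real.pi_gt_three]
    · rw [norm_rot, e2]
      exact hy0
  have hF : Tendsto (fun F : SpaceF lam => liftF F.ext (x₀, y₀)) (𝓝 F₀) (𝓝 x₀) := by
    have h1 : ContinuousAt (fun F : SpaceF lam => Complex.arg (rot F.ext (x₀, y₀))) F₀ :=
      ContinuousAt.comp (f := fun F : SpaceF lam => rot F.ext (x₀, y₀)) (g := Complex.arg)
        (Complex.continuousAt_arg hslit) hrot
    have h2 : ContinuousAt (fun F : SpaceF lam => liftF F.ext (x₀, y₀)) F₀ :=
      continuousAt_const.add h1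
    rw [ContinuousAt, e1] at h2
    exact h2
  set κ := 1 - c - 3 / 2 * σ with hκ
  have hκ0 : 0 < κ := by
    rw [hκ]
    linarith [M₀.hcσ, M₀.sigma_nonneg]
  have hclose : ∀ ε > 0, ∀ᶠ F in 𝓝[N] F₀, |‖p F - 1‖ - y₀| < ε ∧ |Complex.arg (p F - 1) - x₀| < ε := by
    intro ε hε
    -- The fixed point of `F₀` is almost fixed under nearby `F`. The bound on heights divides by `κ
    -- = 1 - c - 3 σ / 2`, whence the second term.
    have hε' : 0 < min (ε / 4) (κ * ε / 8) := lt_min (by linarith) (by positivity)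
    filter_upwards [nhdsWithin_le_nhds ((Metric.tendsto_nhds.1 hF) _ hε'),
      nhdsWithin_le_nhds ((Metric.tendsto_nhds.1 hG) _ hε'), self_mem_nhdsWithin] with F h1 h2 hFN
    obtain ⟨a11, a12, a21, a22, M⟩ := hM F hFN
    obtain ⟨w1, w2, w3⟩ := exists_of_mem_fixNhd (hp F hFN).1
    obtain ⟨e3, e4⟩ := lift_eq_of_fixed M w1 w2 (by rw [w3, (hp F hFN).2])
    rw [Real.dist_eq] at h1 h2
    have h3 := M.almost_fixed w2 z2 e3 e4 h1.le h2.le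
    have h4 : κ * |‖p F - 1‖ - y₀| ≤ κ * (3 * ε / 8) := by
      refine h3.1.trans ?_
      have := min_le_right (ε / 4) (κ * ε / 8)
      linarith
    have h5 := le_of_mul_le_mul_left h4 hκ0
    have h6 := min_le_left (ε / 4) (κ * ε / 8)
    exact ⟨by linarith, by linarith [h3.2]⟩
  have hy : Tendsto (fun F => ‖p F - 1‖) (𝓝[N] F₀) (𝓝 y₀) :=
    Metric.tendsto_nhds.2 fun ε hε => (hclose ε hε).mono fun F h => by rw [Real.dist_eq]; exact h.1
  have hx : Tendsto (fun F => Complex.arg (p F - 1)) (𝓝[N] F₀) (𝓝 x₀) :=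
    Metric.tendsto_nhds.2 fun ε hε => (hclose ε hε).mono fun F h => by rw [Real.dist_eq]; exact h.2
  have hfin := (contDiff_pol.continuous.tendsto (x₀, y₀)).comp (hx.prodMk_nhds hy)
  rw [z3] at hfin
  refine hfin.congr' ?_
  filter_upwards [self_mem_nhdsWithin] with F hFN
  exact (exists_of_mem_fixNhd (hp F hFN).1).2.2

end Saddle

/-! ### Assembling the data of a nearby map. -/

section Main

variable {lam : ℝ}

/-- The picture of a map close to the model map. -/
theorem exists_picture (hl : lam ∈ Ioo (0 : ℝ) 1) (hR : 10 ^ 7 ≤ (1 - lam)⁻¹) {η η₀ : ℝ}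
    (hη : 10 * (1 - lam)⁻¹ ^ 2 * η ≤ 1 / (1 - lam)⁻¹ ^ 2) (hη₀ : η ≤ η₀)
    (hsurj : ∀ F ∈ modelNhd lam η₀, ∀ z₀ : ℂ, 14 / 100 ≤ ‖z₀‖ → ‖z₀‖ ≤ 2 * (1 - lam)⁻¹ - 1 / 2 →
      ∃ z, ‖z - z₀‖ ≤ 1 / 100 ∧ F.ext z = modelMap lam z₀)
    {F : SpaceF lam} (hF : F ∈ modelNhd lam η) :
    ∃ a11 a12 a21 a22 h s v q b m H, Picture lam (1 - lam)⁻¹ (1 / (1 - lam)⁻¹ ^ 2)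
      (lam + 1 / (1 - lam)⁻¹ ^ 2) (10 / (1 - lam)⁻¹ ^ 2) F a11 a12 a21 a22 h s v q b m H := by
  have hM := (modelClose_of_mem hl hF).stripMap hl.1 hl.2 hR (by norm_num) hη
  obtain ⟨h, s, v, G⟩ := hM.exists_invGraph
  obtain ⟨q, hq, hqh, hqs, hright, hleft⟩ := G.exists_corner hM
  have hη1 : η ≤ 1 / 1000 := by
    have h1 : (1 : ℝ) ≤ (1 - lam)⁻¹ ^ 2 := one_le_pow₀ (le_trans (by norm_num) hR)
    have h2 : 1 / (1 - lam)⁻¹ ^ 2 ≤ 1 / 1000 := by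
      have : (1000 : ℝ) ≤ (1 - lam)⁻¹ ^ 2 := le_trans (by norm_num) (pow_le_pow_left₀ (by norm_num) hR 2)
      exact one_div_le_one_div_of_le (by norm_num) this
    by_contra! h3
    nlinarith
  have hlam : 1 - lam ≤ 1 / 1000 := by
    have h1 : (1000 : ℝ) ≤ (1 - lam)⁻¹ := le_trans (by norm_num) hR
    have h2 : 0 < 1 - lam := by linarith [hl.2]
    rw [le_inv_comm₀ (by norm_num) h2] at h1
    exact h1.trans (by norm_num)
  have hR1 : 1 ≤ (1 - lam)⁻¹ := le_trans (by norm_num) hR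
  clear hR hη
  have hsurjF := hsurj F ⟨fun z hz h1 => (hF.1 z hz h1).trans_le hη₀,
    fun z hz h1 h2 => (hF.2.1 z hz h1 h2).trans_le hη₀, hF.2.2⟩
  have houter : ∀ z ∈ discStar lam, 1 / 10 ≤ ‖z‖ →
      |‖F.ext z - 1‖ - (1 - lam + lam * ‖z‖)| ≤ 1 / 100 := by
    intro z hz hz1
    rw [← norm_modelMap_sub_one hl.1 hl.2 hz.2]
    refine (abs_norm_sub_norm_le _ _).trans ?_
    rw [sub_sub_sub_cancel_right]
    linarith [hF.1 z hz hz1]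
  obtain ⟨τ, g, hFg⟩ := F.exists_compMap
  have hg := hF.2.2 τ g hFg
  have hinner : ∀ z ∈ discStar lam, ‖z‖ ≤ 1 / 10 → ‖F.ext z - 1‖ ≤ 15 / 100 := by
    intro z hz hz1
    rw [hFg]
    refine norm_sub_one_le_of_good hl hg (δ := 1 / 10) (by linarith) (fun w hw0 hw => ?_)
      (norm_pos_iff.2 hz.2) hz1
    rw [← hFg]
    have h1 := (abs_le.1 (houter w ⟨(by linarith : ‖w‖ ≤ 2 * (1 - lam)⁻¹), norm_pos_iff.1 hw0⟩ hw.ge)).2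
    rw [hw] at h1
    linarith [hl.2]
  obtain ⟨m, b, hm, hb, hbm, hm1, hhole⟩ := SpaceF.exists_hole hl hFg hg (ρ₁ := 15 / 100) (by norm_num)
    (fun z hz hz1 => by
      by_contra! h1
      have h2 := (abs_le.1 (houter z hz (by linarith))).1
      nlinarith [hl.1])
    (fun u => by
      -- The radius of the circle that the model map sends to the circle of radius `15 / 100` around
      -- `1`.
      set r := (15 / 100 - (1 - lam)) / lam with hr
      have hyr : 1 - lam + lam * r = 15 / 100 := by
        rw [hr]
        have := hl.1.ne'
        field_simp
        ring
      have hr1 : 14 / 100 ≤ r := by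
        by_contra! h0
        nlinarith [hl.1, hl.2]
      have hr2 : r ≤ 1 := by
        by_contra! h0
        nlinarith [hl.1, hl.2]
      obtain ⟨hn, hmod⟩ := modelMap_polar (lam := lam) (r := r) (θ := Complex.arg u / 2) (by linarith)
      obtain ⟨z, hz, hzw⟩ := hsurjF _ (by rw [hn]; exact hr1) (by rw [hn]; linarith)
      refine ⟨z, ?_, ?_⟩
      · have h1 := abs_le.1 ((abs_norm_sub_norm_le _ _).trans hz)
        rw [hn] at h1
        exact ⟨(by linarith [h1.2] : ‖z‖ ≤ 2 * (1 - lam)⁻¹), norm_pos_iff.1 (by linarith [h1.1])⟩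
      · rw [hzw, hmod, hyr, pol_eq_ray]
        simp only
        rw [show 2 * (Complex.arg u / 2) = Complex.arg u by ring, Circle.exp_arg])
  have hpi := Real.pi_gt_d2
  have hpi' := Real.pi_lt_d2
  have hq' := abs_le.1 hq
  obtain ⟨H, hH, hHh⟩ := exists_circle_function (h := h) (q := q)
    (G.adm.continuousOn.mono fun x hx => ⟨by linarith [hx.1, hq'.1], by linarith [hx.2, hq'.2]⟩) hqh
  exact ⟨_, _, _, _, h, s, v, q, b, m, H, ⟨hl, rfl, hM, G, hq, hqh, hqs, hright, hleft, hsurjF, houter,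
    hinner, hm, hb, hbm, hm1, hhole, hH, hHh⟩⟩

lemma pModel_eq_pol (lam : ℝ) : pModel lam = pol (0, (1 - lam)⁻¹) := by
  simp [pModel, pol]

lemma modelF_pModel (hl : lam ∈ Ioo (0 : ℝ) 1) (hR : 1 ≤ (1 - lam)⁻¹) :
    (modelF lam hl).ext (pModel lam) = pModel lam := by
  have h0 : (0 : ℝ) < 1 + (1 - lam)⁻¹ := by linarith
  have hn : ‖pModel lam‖ = 1 + (1 - lam)⁻¹ := by
    rw [pModel, Complex.norm_real, Real.norm_of_nonneg h0.le]
  have hne : ((1 + (1 - lam)⁻¹ : ℝ) : ℂ) ≠ 0 := by exact_mod_cast h0.ne'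
  have hmem : pModel lam ∈ discStar lam :=
    ⟨(by rw [hn]; linarith : ‖pModel lam‖ ≤ 2 * (1 - lam)⁻¹), hne⟩
  rw [modelF_ext hl hmem, modelMap, hn]
  have h1 : pModel lam / ((1 + (1 - lam)⁻¹ : ℝ) : ℂ) = 1 := div_self hne
  have h2 : (1 - lam) * (1 - lam)⁻¹ = 1 := mul_inv_cancel₀ (by linarith [hl.2])
  rw [h1, one_pow, mul_one, pModel, ← Complex.ofReal_one, ← Complex.ofReal_add]
  congr 1
  linear_combination -h2

end Main

section Conclusion

variable {lam R η c σ : ℝ} {F : SpaceF lam} {a11 a12 a21 a22 : ℝ × ℝ → ℝ} {h s v : ℝ → ℝ} {q b : ℝ}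
  {m H : Circle → ℝ}

namespace Picture

/-- The saddle of the picture, with the backward convergence along the invariant graph. -/
lemma exists_saddle (P : Picture lam R η c σ F a11 a12 a21 a22 h s v q b m H) :
    ∃ x₀ : ℝ, |x₀| ≤ 1 / 100000 ∧ pol (x₀, h x₀) ∈ fixNhd R ∧
      F.ext (pol (x₀, h x₀)) = pol (x₀, h x₀) ∧
      ∀ φ ∈ Ioo (-7 : ℝ) 7, Tendsto (fun n => v^[n] φ) atTop (𝓝 x₀) := by
  obtain ⟨x₀, hx₀, hf, hg, hv⟩ := P.G.exists_fixed P.M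
  have hx := abs_le.1 hx₀
  have hx7 : x₀ ∈ Ioo (-7 : ℝ) 7 := ⟨by linarith [hx.1], by linarith [hx.2]⟩
  refine ⟨x₀, hx₀, pol_mem_fixNhd (by linarith) (P.G.mem_strip P.M x₀ hx7), ?_, hv⟩
  have h1 := pol_lift F.ext (x₀, h x₀)
  rw [hf, hg] at h1
  exact h1.symm

/-- Uniqueness in `fixNhd R` identifies `p` with the fixed point on the graph. The point `0` is
interior because it is at distance `1` from `1`, and `m < 1 < H`. -/
theorem properties (P : Picture lam R η c σ F a11 a12 a21 a22 h s v q b m H) {p : ℂ}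
    (hp : p ∈ fixNhd R) (hpF : F.ext p = p) :
    IsHalfOpenAnnulus F.omega ∧ (0 : ℂ) ∈ interior F.omega ∧
      IsJordanCurve (externalBoundary F.omega) ∧ externalBoundary F.omega ⊆ F.omega ∧
      externalBoundary F.omega ⊆ F.unstableManifold p ∧
      (∃ q, F.IsUnstableLoop p (externalBoundary F.omega) q) ∧
      IsJordanCurve (internalBoundary F.omega) ∧
      Disjoint (internalBoundary F.omega) F.omega := by
  obtain ⟨x₀, hx₀, hmem, hfix, hv⟩ := P.exists_saddle
  obtain rfl : p = pol (x₀, h x₀) := eq_of_fixed P.M hp hmem hpF hfix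
  have hR : 100 ≤ R := le_trans (by norm_num) P.M.hR
  have hH1 : ∀ u, 1 < H u := fun u => by linarith [(P.H_bounds u).1]
  have hm1 : ∀ u, m u < 1 := fun u => (P.hm1 u).trans (by norm_num)
  have h0 : ‖(0 : ℂ) - 1‖ = 1 := by simp
  rw [P.omega_eq]
  refine ⟨isHalfOpenAnnulus_starAnnulus P.hm P.hH P.hb P.hbm hm1 hH1,
    mem_interior_starAnnulus P.hm P.hH P.hb P.hbm hH1 (by rw [h0]; exact hm1 _)
      (by rw [h0]; exact hH1 _), ?_, externalBoundary_subset_starAnnulus P.hH hm1 hH1, ?_, ?_, ?_,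
    disjoint_internalBoundary_starAnnulus P.hm P.hb P.hbm hm1 hH1⟩
  · rw [externalBoundary_starAnnulus P.hH hm1 hH1]
    exact isJordanCurve_range_ray P.hH one_pos fun u => (hH1 u).le
  · rw [externalBoundary_starAnnulus P.hH hm1 hH1]
    exact P.range_subset_unstableManifold hx₀ hv
  · rw [externalBoundary_starAnnulus P.hH hm1 hH1]
    exact ⟨_, P.isUnstableLoop hx₀ hv⟩
  · rw [internalBoundary_starAnnulus P.hm P.hb P.hbm hm1 hH1]
    exact isJordanCurve_range_ray P.hm P.hb P.hbm

end Picture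

end Conclusion

/-- For `lam` close to `1`, the maximal invariant set of every map in a neighbourhood of the model map
is an annulus bounded by a loop of the unstable manifold of the continued saddle. -/
theorem exists_modelNhd :
    ∃ lam₀ ∈ Set.Ioo (0 : ℝ) 1, ∀ (lam : ℝ) (hl : lam ∈ Set.Ioo (0 : ℝ) 1), lam₀ < lam →
      ∃ (N : Set (SpaceF lam)) (p : SpaceF lam → ℂ),
        IsOpen N ∧ modelF lam hl ∈ N ∧ IsContinuation hl N p ∧
        ∀ F ∈ N,
          IsHalfOpenAnnulus F.omega ∧
          (0 : ℂ) ∈ interior F.omega ∧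
          IsJordanCurve (externalBoundary F.omega) ∧
          externalBoundary F.omega ⊆ F.omega ∧
          externalBoundary F.omega ⊆ F.unstableManifold (p F) ∧
          (∃ q, F.IsUnstableLoop (p F) (externalBoundary F.omega) q) ∧
          IsJordanCurve (internalBoundary F.omega) ∧
          Disjoint (internalBoundary F.omega) F.omega := by
  refine ⟨1 - 1 / 10 ^ 7, ⟨by norm_num, by norm_num⟩, fun lam hl hlam => ?_⟩
  have h1 : (0 : ℝ) < 1 - lam := by linarith [hl.2]
  have hR : 10 ^ 7 ≤ (1 - lam)⁻¹ := by
    rw [le_inv_comm₀ (by norm_num) h1]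
    norm_num at hlam ⊢
    linarith
  have hR2 : (2 : ℝ) ≤ (1 - lam)⁻¹ := le_trans (by norm_num) hR
  obtain ⟨η₀, hη₀, hsurj⟩ := exists_forall_exists_eq_modelMap hl
  set R := (1 - lam)⁻¹ with hRdef
  have hR0 : 0 < R := by linarith
  -- The first bound guarantees preimages near those of the model; the second is the order `R⁻⁴`
  -- demanded by `ModelClose.stripMap`.
  set η := min η₀ (1 / (10 * R ^ 4)) with hη
  have hηpos : 0 < η := lt_min hη₀ (by positivity)
  have hη4 : 10 * R ^ 2 * η ≤ 1 / R ^ 2 := by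
    refine (mul_le_mul_of_nonneg_left (min_le_right _ _) (by positivity)).trans (le_of_eq ?_)
    field_simp
  have hpic := fun F (hF : F ∈ modelNhd lam η) => exists_picture hl hR hη4 (min_le_left _ _) hsurj hF
  -- A fixed point in `fixNhd R` is merely chosen; its uniqueness there is what makes the choice
  -- continuous and correct at the model.
  set p : SpaceF lam → ℂ := fun F => Classical.epsilon fun z => z ∈ fixNhd R ∧ F.ext z = z with hp
  have hpF : ∀ F ∈ modelNhd lam η, p F ∈ fixNhd R ∧ F.ext (p F) = p F := by
    intro F hF
    obtain ⟨_, _, _, _, h, _, _, _, _, _, _, P⟩ := hpic F hF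
    obtain ⟨x₀, -, hmem, hfix, -⟩ := P.exists_saddle
    exact Classical.epsilon_spec (p := fun z => z ∈ fixNhd R ∧ F.ext z = z) ⟨_, hmem, hfix⟩
  have hmodel : modelF lam hl ∈ modelNhd lam η := modelF_mem_modelNhd hl hηpos
  have hV : pModel lam ∈ fixNhd R := by
    rw [pModel_eq_pol]
    exact pol_mem_fixNhd (by simp) ⟨by simp only; linarith, by simp only; linarith⟩
  have hfixmodel := modelF_pModel hl (by linarith)
  refine ⟨modelNhd lam η, p, isOpen_modelNhd hl η, hmodel, ⟨?_, ?_, fixNhd R, isOpen_fixNhd R, hV, ?_⟩,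
    ?_⟩
  · refine continuousOn_fixed (η := 1 / R ^ 2) (c := lam + 1 / R ^ 2) (σ := 10 / R ^ 2) hl hRdef
      (fun F hF => ?_) hpF
    obtain ⟨a11, a12, a21, a22, _, _, _, _, _, _, _, P⟩ := hpic F hF
    exact ⟨a11, a12, a21, a22, P.M⟩
  · obtain ⟨_, _, _, _, _, _, _, _, _, _, _, P⟩ := hpic _ hmodel
    exact eq_of_fixed P.M (hpF _ hmodel).1 hV (hpF _ hmodel).2 hfixmodel
  · intro F hF
    obtain ⟨_, _, _, _, _, _, _, _, _, _, _, P⟩ := hpic F hF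
    obtain ⟨hp1, hp2⟩ := hpF F hF
    exact ⟨hp1, isSaddle_of_fixed hl hRdef P.M hp1 hp2,
      fun z hz hzF => eq_of_fixed P.M hz hp1 hzF.2 hp2⟩
  · intro F hF
    obtain ⟨_, _, _, _, _, _, _, _, _, _, _, P⟩ := hpic F hF
    exact P.properties (hpF F hF).1 (hpF F hF).2

end WildLorenz

end

theorem mainTheorem6 :
    ∃ lam₀ ∈ Set.Ioo (0 : ℝ) 1, ∀ (lam : ℝ) (hl : lam ∈ Set.Ioo (0 : ℝ) 1), lam₀ < lam →
      ∃ (N : Set (WildLorenz.SpaceF lam)) (p : WildLorenz.SpaceF lam → ℂ),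
        IsOpen N ∧ WildLorenz.modelF lam hl ∈ N ∧ WildLorenz.IsContinuation hl N p ∧
        ∀ F ∈ N,
          WildLorenz.IsHalfOpenAnnulus F.omega ∧
          (0 : ℂ) ∈ interior F.omega ∧
          WildLorenz.IsJordanCurve (WildLorenz.externalBoundary F.omega) ∧
          WildLorenz.externalBoundary F.omega ⊆ F.omega ∧
          WildLorenz.externalBoundary F.omega ⊆ F.unstableManifold (p F) ∧
          (∃ q, F.IsUnstableLoop (p F) (WildLorenz.externalBoundary F.omega) q) ∧
          WildLorenz.IsJordanCurve (WildLorenz.internalBoundary F.omega) ∧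
          Disjoint (WildLorenz.internalBoundary F.omega) F.omega :=
  WildLorenz.exists_modelNhd
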